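/- For $x\in\mathbb R^2$ write $x=r_1(\cos\theta_1,\sin\theta_1)$ and for $y\in\mathbb R^2$ write $y=r_2(\cos\theta_2,\sin\theta_2)$, with $r_1,r_2\ge 0$ and $\theta_1,\theta_2\in[0,2\pi)$. For $1\le p\le\infty$ let $\delta_c(p,2)=\max\{0,\,2|\tfrac12-\tfrac1p|-\tfrac12\}$ (with $\tfrac1\infty=0$). Let $\delta\ge 0$, and let $a_\pm\in C^\infty((0,\infty);\mathbb C)$ be functions such that for every $N\ge 0$ there is a constant $C_N$ with $|a_\pm^{(N)}(r)|\le C_N r^{-N}$ for all $r>0$. Let $\beta\in C_c^\infty([\tfrac38,\tfrac43])$ be real-valued and such that $\beta_0(r)=1-\sum_{j\ge1}\beta(2^{-j}r)$, $r\ge 0$, is supported in $[0,1]$. Define $$K^{0}_{\pm}(x,y)=\beta_0(|x-y|)\,K_\pm(x,y),\qquad K^{j}_{\pm}(x,y)=\beta(2^{-j}|x-y|)\,K_\pm(x,y)\quad (j\ge1),$$ $$K_\pm(x,y)=e^{\pm i|x-y|}\,(1+|x-y|)^{-\frac32-\delta}\,a_\pm(|x-y|)\,\mathbf 1_{[0,\pi]}(|\theta_1-\theta_2|),$$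 and let $T^j_\pm f(x)=\int_{\mathbb R^2}K^j_\pm(x,y)f(y)\,dy$. Proposition 3.1. Let $4<p\le\infty$. Then there is a constant $C$, independent of $j$, such that for both signs and for all integers $j\ge 0$, $$\|T^j_\pm\|_{L^p(\mathbb R^2)\to L^p(\mathbb R^2)}\le C\,2^{j(\delta_c(p,2)-\delta)},\qquad \|T^j_\pm\|_{L^2(\mathbb R^2)\to L^2(\mathbb R^2)}\le C\,2^{-j\delta}.$$ -/

import Mathlib

open MeasureTheory
open scoped ENNReal NNReal ContDiff

noncomputable section

namespace BochnerRiesz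

/-- The Euclidean plane `ℝ²`. -/
abbrev Plane : Type := EuclideanSpace ℝ (Fin 2)

/-- The polar angle `θ ∈ [0, 2π)` of a point of the plane (with value `0` at the origin). -/
def polarAngle (x : Plane) : ℝ :=
  toIcoMod Real.two_pi_pos 0 (Complex.arg ⟨x 0, x 1⟩)

theorem polarAngle_mem (x : Plane) : polarAngle x ∈ Set.Ico 0 (2 * Real.pi) := by
  simpa [polarAngle] using toIcoMod_mem_Ico Real.two_pi_pos 0 (Complex.arg ⟨x 0, x 1⟩)

/-- `x = r (cos θ, sin θ)` with `r = |x|` and `θ = polarAngle x`. -/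
theorem polar_decomposition (x : Plane) :
    x = !₂[‖x‖ * Real.cos (polarAngle x), ‖x‖ * Real.sin (polarAngle x)] := by
  set z : ℂ := ⟨x 0, x 1⟩ with hz
  have hn : ‖x‖ = ‖z‖ := by
    rw [EuclideanSpace.norm_eq, Complex.norm_def, Complex.normSq_apply, Fin.sum_univ_two]
    simp only [hz, Real.norm_eq_abs, sq_abs]
    ring_nf
  have ha : polarAngle x = z.arg - toIcoDiv Real.two_pi_pos 0 z.arg * (2 * Real.pi) := by
    rw [polarAngle, toIcoMod, zsmul_eq_mul]
  rw [ha, Real.cos_sub_int_mul_two_pi, Real.sin_sub_int_mul_two_pi, hn,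
    Complex.norm_mul_cos_arg, Complex.norm_mul_sin_arg]
  ext i
  fin_cases i <;> simp [hz]

/-- The critical index `δ_c(p, n) = max {0, n |1/2 - 1/p| - 1/2}` (with `1/∞ = 0`). -/
def criticalIndex (p : ℝ≥0∞) (n : ℕ) : ℝ :=
  max 0 (n * |1 / 2 - (p⁻¹).toReal| - 1 / 2)

/-- Symbols of order zero on the half-line: `a ∈ C^∞((0, ∞); ℂ)` and, for every `N`,
`|a⁽ᴺ⁾(r)| ≤ C_N r⁻ᴺ` for all `r > 0`. -/
def IsSymbol (a : ℝ → ℂ) : Prop :=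
  ContDiffOn ℝ ∞ a (Set.Ioi 0) ∧
    ∀ N : ℕ, ∃ C : ℝ, ∀ r : ℝ, 0 < r → ‖iteratedDeriv N a r‖ ≤ C / r ^ N

/-- The low-frequency cutoff `β₀(r) = 1 - ∑_{j ≥ 1} β(2⁻ʲ r)` (a finite sum at each `r` if `β` is
compactly supported in `(0, ∞)`). -/
def betaZero (β : ℝ → ℝ) (r : ℝ) : ℝ :=
  1 - ∑' j : ℕ, β (r / 2 ^ (j + 1))

/-- `β ∈ C_c^∞([3/8, 4/3])` generates a dyadic partition of unity on `[0, ∞)`: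
`β₀ = 1 - ∑_{j ≥ 1} β(2⁻ʲ ·)` is supported in `[0, 1]`. -/
structure IsDyadicPartition (β : ℝ → ℝ) : Prop where
  smooth : ContDiff ℝ ∞ β
  support_subset : Function.support β ⊆ Set.Icc (3 / 8) (4 / 3)
  betaZero_eq_zero : ∀ r : ℝ, 1 < r → betaZero β r = 0

/-- The cutoffs of the decomposition: `β₀(r)` for `j = 0` and `β(2⁻ʲ r)` for `j ≥ 1`. -/
def dyadicCutoff (β : ℝ → ℝ) (j : ℕ) (r : ℝ) : ℝ :=
  if j = 0 then betaZero β r else β (r / 2 ^ j)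

/-- The geometric kernel
`e^{σ i |x-y|} (1 + |x-y|)^{-3/2-δ} a(|x-y|) 1_{[0,π]}(|θ₁ - θ₂|)`, where `σ = ±1` and `θ₁, θ₂` are
the polar angles in `[0, 2π)` of `x` and `y`. -/
def geometricKernel (σ δ : ℝ) (a : ℝ → ℂ) (x y : Plane) : ℂ :=
  Complex.exp (σ * Complex.I * ‖x - y‖) * ((1 + ‖x - y‖) ^ (-(3 / 2) - δ) : ℝ) * a ‖x - y‖ *
    (Set.Icc 0 Real.pi).indicator (fun _ => (1 : ℂ)) |polarAngle x - polarAngle y|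

/-- The `j`-th dyadic piece of the geometric kernel, localized to `|x - y| ∼ 2ʲ` for `j ≥ 1`. -/
def geometricPiece (σ δ : ℝ) (a : ℝ → ℂ) (β : ℝ → ℝ) (j : ℕ) (x y : Plane) : ℂ :=
  dyadicCutoff β j ‖x - y‖ * geometricKernel σ δ a x y

/-- The operator `T_K f(x) = ∫_{ℝ²} K(x, y) f(y) dy` with kernel `K`. -/
def kernelOperator (K : Plane → Plane → ℂ) (f : Plane → ℂ) (x : Plane) : ℂ :=
  ∫ y, K x y * f y

/-- `‖T_K‖_{L^p → L^p} ≤ B`: for each `f ∈ L^p(ℝ²)` the integral defining `T_K f(x)` converges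
absolutely at every `x`, and `T_K f ∈ L^p(ℝ²)` with `‖T_K f‖_p ≤ B ‖f‖_p`. -/
def OperatorNormLE (K : Plane → Plane → ℂ) (p B : ℝ≥0∞) : Prop :=
  ∀ f : Plane → ℂ, MemLp f p volume →
    (∀ x, Integrable (fun y => K x y * f y) volume) ∧
      MemLp (kernelOperator K f) p volume ∧
        eLpNorm (kernelOperator K f) p volume ≤ B * eLpNorm f p volume

end BochnerRiesz

end

/-! Rescaling the piece with `j ≥ 1` by `2^j` gives a kernel `b(|x - y|) e^{iμ|x - y|}` with `|x -
y|` of size one and `μ = σ 2^j`, still cut off to `|θ₁ - θ₂| ≤ π`. Symbol bounds are invariant under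
dilation, so the amplitude `b` is bounded in `C²` uniformly in `j` (`exists_amplitude_scaledAmp`).
The prefactor `2^{j(-3/2-δ)}` and the Jacobian `2^{2j}` together give `2^{j(1/2-δ)}`. It remains to
gain `(1 + |μ|)^{-s}` at unit scale, with `s = 2/p` on `L^p` for finite `p > 4` and `s = 1/2` on
`L²`. The piece `j = 0` and the exponent `p = ∞` follow from Schur's test. Fourier inversion writes
`b` as a superposition of exponentials that only shift `μ` (`exists_kerBound_ampKer`), and a grid of
tiny squares reduces matters to pairs of tiny balls at distance of order one (`KerBound.gridKer`).

Without the angular cutoff the `L^p` bound is the Carleson-Sjölin argument. Freezing one coordinate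
of `y` leaves an operator from functions on a line to functions on the plane. Its square is bilinear
in `(t, s)` and is split into bands `|t - s| ~ 2^{-k}`. The `T T*` kernel of a band has as phase a
second difference of the distance function. Its gradient is comparable to `gap`, which measures `t +
s - t' - s'` and `(t - s)² - (t' - s')²`, so nonstationary phase gives rapid decay in `μ · gap`
(`exists_norm_integral_exp_quad_le`). The width of the band pays for the Jacobian `|t' - s'|` of
these two coordinates. Interpolation with the trivial supremum bound gains `2^{-k(1-4/q)}`, which
sums because `q > 4`, and gives `L⁴ → L^q` with decay `μ^{-2/q}` (`exists_eLpNorm_lineOp_le`).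

For `L²`, reflecting `y` through the midpoint of the two balls turns `|x - y|` into `|x + y|` on a
narrow sector. In polar coordinates and for fixed radii this is a convolution in the angle, whose
Fourier coefficients are bounded by van der Corput's lemma (`KerBound.sector`). A sharp one-sided
cut in the angle difference costs nothing there.

The cutoff removes from the full kernel two wrapped parts, where one angle exceeds the other by more
than `π`; they are exchanged by complex conjugation. Far from the origin a wrapped part is a product
condition (`wrap_iff_of_far`). Near the origin it is an ordering of angles. On `L^q` the ordering is
resolved by a Whitney decomposition in the manner of Christ and Kiselev, summed with the gain from
`L⁴ → L^q` (`KerBound.ordered_of_gain`). On `L²`, where there is no gain, five generations are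
peeled off and the remainder is an instance of the one-sided sector estimate, now for the reflection
through the origin (`exists_kerBound_wrap_two`). -/

noncomputable section

namespace BochnerRiesz

open Set Function

/-! ### Minkowski's integral inequality. -/

section Minkowski

variable {X Y : Type*} [MeasurableSpace X] [MeasurableSpace Y]

/-- Testing against `h^(q-1)`, Fubini and Hölder bound `I = ∫ h^q` by `A · I^(1/q')`, and dividing
by the power of `I` gives the claim. The division needs `I` finite, which is why minorants `h` of
the inner integral are treated first. -/
theorem lintegral_truncated_rpow_le (μ : Measure X) (ν : Measure Y) [SFinite μ] [SFinite ν]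
    {F : X → Y → ℝ≥0∞} (hF : Measurable (uncurry F)) {q : ℝ} (hq : 1 < q) {h : X → ℝ≥0∞}
    (hh : Measurable h) (hle : ∀ x, h x ≤ ∫⁻ y, F x y ∂ν) (hfin : ∫⁻ x, h x ^ q ∂μ ≠ ⊤) :
    (∫⁻ x, h x ^ q ∂μ) ^ (1 / q) ≤ ∫⁻ y, (∫⁻ x, F x y ^ q ∂μ) ^ (1 / q) ∂ν := by
  set A := ∫⁻ y, (∫⁻ x, F x y ^ q ∂μ) ^ (1 / q) ∂ν
  set I := ∫⁻ x, h x ^ q ∂μ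
  have hq0 : 0 < q := by linarith
  have hconj : q.HolderConjugate (q / (q - 1)) := Real.HolderConjugate.conjExponent hq
  have hstep : I ≤ A * I ^ (1 / (q / (q - 1))) := by
    calc I ≤ ∫⁻ x, (∫⁻ y, F x y * h x ^ (q - 1) ∂ν) ∂μ := by
          refine lintegral_mono fun x => ?_
          have hFx : Measurable (F x) := hF.comp measurable_prodMk_left
          rw [lintegral_mul_const _ hFx]
          calc h x ^ q = h x * h x ^ (q - 1) := by
                conv_rhs => rw [← ENNReal.rpow_one (h x), ← ENNReal.rpow_mul, one_mul]
                rw [← ENNReal.rpow_add_of_nonneg _ _ zero_le_one (by linarith)]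
                ring_nf
            _ ≤ _ := by gcongr; exact hle x
      _ = ∫⁻ y, (∫⁻ x, F x y * h x ^ (q - 1) ∂μ) ∂ν := by
          refine lintegral_lintegral_swap (Measurable.aemeasurable ?_)
          exact hF.mul ((hh.comp measurable_fst).pow_const _)
      _ ≤ ∫⁻ y, (∫⁻ x, F x y ^ q ∂μ) ^ (1 / q) * I ^ (1 / (q / (q - 1))) ∂ν := by
          refine lintegral_mono fun y => ?_
          have hFy : Measurable (fun x => F x y) := hF.comp measurable_prodMk_right
          refine (ENNReal.lintegral_mul_le_Lp_mul_Lq μ hconj hFy.aemeasurable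
            (hh.pow_const _).aemeasurable).trans_eq ?_
          congr 3
          ext x
          rw [← ENNReal.rpow_mul]
          congr 1
          have : q - 1 ≠ 0 := by linarith
          field_simp
      _ = A * I ^ (1 / (q / (q - 1))) := by
          rw [lintegral_mul_const]
          refine Measurable.pow_const (Measurable.lintegral_prod_right ?_) _
          exact (hF.comp measurable_swap).pow_const _
  rcases eq_or_ne I 0 with h0 | h0
  · rw [h0, ENNReal.zero_rpow_of_pos (by positivity)]; exact zero_le
  have hsplit : I = I ^ (1 / q) * I ^ (1 / (q / (q - 1))) := by
    rw [← ENNReal.rpow_add _ _ h0 hfin]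
    have : 1 / q + 1 / (q / (q - 1)) = 1 := by
      have : q - 1 ≠ 0 := by linarith
      field_simp; ring
    rw [this, ENNReal.rpow_one]
  have hpow0 : I ^ (1 / (q / (q - 1))) ≠ 0 := by
    simp [h0, hfin]
  have hpowt : I ^ (1 / (q / (q - 1))) ≠ ⊤ := by
    simp [ENNReal.rpow_eq_top_iff, h0, hfin]
  exact (ENNReal.mul_le_mul_iff_left hpow0 hpowt).1 (hsplit.symm.trans_le hstep)

/-- Minkowski's integral inequality. -/
theorem lintegral_minkowski (μ : Measure X) (ν : Measure Y) [SigmaFinite μ] [SFinite ν]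
    {F : X → Y → ℝ≥0∞} (hF : Measurable (uncurry F)) {q : ℝ} (hq : 1 ≤ q) :
    (∫⁻ x, (∫⁻ y, F x y ∂ν) ^ q ∂μ) ^ (1 / q) ≤ ∫⁻ y, (∫⁻ x, F x y ^ q ∂μ) ^ (1 / q) ∂ν := by
  rcases hq.eq_or_lt with rfl | hq
  · simp only [ENNReal.rpow_one, div_one]
    exact (lintegral_lintegral_swap hF.aemeasurable).le
  have hq0 : 0 < q := by linarith
  set G : X → ℝ≥0∞ := fun x => ∫⁻ y, F x y ∂ν with hG
  have hGm : Measurable G := Measurable.lintegral_prod_right hF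
  -- Cutting off in space and in height makes the `q`-th power integrable, while the supremum over
  -- `n` still recovers `G`.
  set h : ℕ → X → ℝ≥0∞ := fun n => (spanningSets μ n).indicator (fun x => min (G x) n) with hh
  have hhm : ∀ n, Measurable (h n) := fun n =>
    (hGm.min measurable_const).indicator (measurableSet_spanningSets μ n)
  have hmono : Monotone h := by
    intro m n hmn x
    simp only [hh, indicator]
    split_ifs with h1 h2 h2
    · exact min_le_min_left _ (by exact_mod_cast hmn)
    · exact absurd (monotone_spanningSets μ hmn h1) h2
    · exact zero_le
    · exact le_rfl
  have hsup : ∀ x, ⨆ n, h n x = G x := by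
    intro x
    apply le_antisymm
    · refine iSup_le fun n => ?_
      simp only [hh, indicator]
      split_ifs
      · exact min_le_left _ _
      · exact zero_le
    · refine le_of_forall_lt fun c hc => ?_
      obtain ⟨n, hn⟩ := ENNReal.exists_nat_gt (ne_top_of_lt hc)
      obtain ⟨m, hm⟩ : ∃ m, x ∈ spanningSets μ m := by
        have := iUnion_spanningSets μ ▸ mem_univ x
        exact mem_iUnion.1 this
      refine lt_of_lt_of_le ?_ (le_iSup _ (max m n))
      have hx : x ∈ spanningSets μ (max m n) := monotone_spanningSets μ (le_max_left _ _) hm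
      simp only [hh, indicator_of_mem hx]
      refine lt_min hc (hn.trans_le ?_)
      exact_mod_cast le_max_right m n
  have hbd : ∀ n, ∫⁻ x, h n x ^ q ∂μ ≤
      (∫⁻ y, (∫⁻ x, F x y ^ q ∂μ) ^ (1 / q) ∂ν) ^ q := by
    intro n
    rw [← ENNReal.rpow_inv_le_iff hq0, ← one_div]
    refine lintegral_truncated_rpow_le μ ν hF hq (hhm n) (fun x => ?_) ?_
    · exact (le_iSup (fun n => h n x) n).trans (hsup x).le
    · refine ne_top_of_le_ne_top (b := ∫⁻ x in spanningSets μ n, (n : ℝ≥0∞) ^ q ∂μ) ?_ ?_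
      · rw [setLIntegral_const]
        exact ENNReal.mul_ne_top (ENNReal.rpow_ne_top_of_nonneg hq0.le (by simp))
          (measure_spanningSets_lt_top μ n).ne
      · rw [← lintegral_indicator (measurableSet_spanningSets μ n)]
        refine lintegral_mono fun x => ?_
        simp only [hh, indicator]
        split_ifs
        · gcongr; exact min_le_right _ _
        · simp [hq0]
  rw [one_div, ENNReal.rpow_inv_le_iff hq0, ← one_div]
  calc ∫⁻ x, G x ^ q ∂μ = ∫⁻ x, ⨆ n, h n x ^ q ∂μ := by
        refine lintegral_congr fun x => ?_
        rw [← hsup x]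
        exact (ENNReal.orderIsoRpow q hq0).map_iSup _
    _ = ⨆ n, ∫⁻ x, h n x ^ q ∂μ :=
        lintegral_iSup (fun n => (hhm n).pow_const _)
          (fun m n hmn x => ENNReal.rpow_le_rpow (hmono hmn x) hq0.le)
    _ ≤ _ := iSup_le hbd

/-- Only pointwise domination of `G` is asked, so the same statement serves integrals over a
parameter and, with counting measure, infinite sums of operators. -/
theorem eLpNorm_le_lintegral_eLpNorm (μ : Measure X) (ν : Measure Y) [SigmaFinite μ] [SFinite ν]
    {E E' : Type*} [NormedAddCommGroup E] [NormedAddCommGroup E'] [MeasurableSpace E']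
    [OpensMeasurableSpace E']
    {G : X → E} {H : Y → X → E'} (hH : Measurable (uncurry H))
    (hG : ∀ x, ‖G x‖ₑ ≤ ∫⁻ t, ‖H t x‖ₑ ∂ν) {q : ℝ≥0∞} (hq : 1 ≤ q) (hqt : q ≠ ⊤) :
    eLpNorm G q μ ≤ ∫⁻ t, eLpNorm (H t) q μ ∂ν := by
  have hq0 : q ≠ 0 := (zero_lt_one.trans_le hq).ne'
  have hqr : 1 ≤ q.toReal := by
    rw [← ENNReal.toReal_one]; exact ENNReal.toReal_mono hqt hq
  simp only [eLpNorm_eq_lintegral_rpow_enorm_toReal hq0 hqt]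
  refine le_trans ?_ (lintegral_minkowski μ ν (F := fun x t => ‖H t x‖ₑ) ?_ hqr)
  · gcongr with x; exact hG x
  · exact (hH.comp measurable_swap).enorm

end Minkowski

/-! ### Restricting kernels to sets of pairs. -/

section Cut

variable {X Y : Type*}

open Classical in
/-- The restriction of the kernel `k` to the pairs satisfying `P`. -/
def cut (P : X → Y → Prop) (k : X → Y → ℂ) (x : X) (y : Y) : ℂ := if P x y then k x y else 0

theorem cut_of_pos {P : X → Y → Prop} {k : X → Y → ℂ} {x : X} {y : Y} (h : P x y) :
    cut P k x y = k x y := if_pos h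

theorem cut_of_neg {P : X → Y → Prop} {k : X → Y → ℂ} {x : X} {y : Y} (h : ¬ P x y) :
    cut P k x y = 0 := if_neg h

theorem cut_cut (P Q : X → Y → Prop) (k : X → Y → ℂ) :
    cut P (cut Q k) = cut (fun x y => P x y ∧ Q x y) k := by
  ext x y
  by_cases h1 : P x y <;> by_cases h2 : Q x y <;> simp [cut, h1, h2]

theorem cut_congr {P Q : X → Y → Prop} {k k' : X → Y → ℂ} (h : ∀ x y, P x y ↔ Q x y)
    (hk : ∀ x y, P x y → k x y = k' x y) : cut P k = cut Q k' := by
  ext x y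
  by_cases h1 : P x y
  · rw [cut_of_pos h1, cut_of_pos ((h x y).1 h1), hk x y h1]
  · rw [cut_of_neg h1, cut_of_neg (fun h2 => h1 ((h x y).2 h2))]

theorem norm_cut_le (P : X → Y → Prop) (k : X → Y → ℂ) (x : X) (y : Y) :
    ‖cut P k x y‖ ≤ ‖k x y‖ := by
  by_cases h : P x y
  · rw [cut_of_pos h]
  · rw [cut_of_neg h]; simp

end Cut

/-! ### Calculus of integral operators and their norm bounds. -/

section KernelOperators

variable {X Y : Type*} [MeasureSpace X] [MeasureSpace Y]

/-- The integral operator with kernel `k`. -/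
def kop (k : X → Y → ℂ) (f : Y → ℂ) (x : X) : ℂ := ∫ y, k x y * f y

/-- The operator with kernel `k` is bounded from `L^p` to `L^q` with norm at most `B`. -/
def KerBound (k : X → Y → ℂ) (p q B : ℝ≥0∞) : Prop :=
  ∀ f : Y → ℂ, MemLp f p volume → eLpNorm (kop k f) q volume ≤ B * eLpNorm f p volume

/-- Bounded measurable kernels whose sections are supported in sets of finite measure. -/
structure Adm (k : X → Y → ℂ) : Prop where
  meas : Measurable (uncurry k)
  bdd : ∃ M : ℝ, ∀ x y, ‖k x y‖ ≤ M
  supp : ∀ x, volume (support (k x)) < ⊤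

theorem measurable_cut {P : X → Y → Prop} (hP : MeasurableSet {z : X × Y | P z.1 z.2})
    {k : X → Y → ℂ} (hk : Measurable (uncurry k)) : Measurable (uncurry (cut P k)) := by
  classical
  have : uncurry (cut P k) = fun z => if z ∈ {z : X × Y | P z.1 z.2} then uncurry k z else 0 := by
    ext ⟨x, y⟩
    by_cases h : P x y <;> simp [uncurry, cut, h]
  rw [this]
  exact Measurable.ite hP hk measurable_const

theorem Adm.cut {P : X → Y → Prop} (hP : MeasurableSet {z : X × Y | P z.1 z.2})
    {k : X → Y → ℂ} (hk : Adm k) : Adm (cut P k) where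
  meas := measurable_cut hP hk.meas
  bdd := by
    obtain ⟨M, hM⟩ := hk.bdd
    exact ⟨M, fun x y => (norm_cut_le P k x y).trans (hM x y)⟩
  supp := fun x => lt_of_le_of_lt (measure_mono fun y hy => by
    simp only [mem_support] at hy ⊢
    intro h
    apply hy
    have := norm_cut_le P k x y
    rw [h] at this
    simpa using this) (hk.supp x)

theorem Adm.add {k k' : X → Y → ℂ} (hk : Adm k) (hk' : Adm k') : Adm (fun x y => k x y + k' x y) where
  meas := hk.meas.add hk'.meas
  bdd := by
    obtain ⟨M, hM⟩ := hk.bdd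
    obtain ⟨M', hM'⟩ := hk'.bdd
    exact ⟨M + M', fun x y => (norm_add_le _ _).trans (add_le_add (hM x y) (hM' x y))⟩
  supp := fun x => lt_of_le_of_lt (measure_mono (support_add (k x) (k' x)))
    ((measure_union_le _ _).trans_lt (ENNReal.add_lt_top.2 ⟨hk.supp x, hk'.supp x⟩))

theorem Adm.zero : Adm (fun (_ : X) (_ : Y) => (0 : ℂ)) where
  meas := measurable_const
  bdd := ⟨0, by simp⟩
  supp := by simp

theorem Adm.sum {ι : Type*} (s : Finset ι) {k : ι → X → Y → ℂ} (hk : ∀ i ∈ s, Adm (k i)) :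
    Adm (fun x y => ∑ i ∈ s, k i x y) := by
  classical
  induction s using Finset.induction_on with
  | empty => simpa using Adm.zero
  | insert a s ha ih =>
    simp only [Finset.sum_insert ha]
    exact (hk a (Finset.mem_insert_self _ _)).add
      (ih fun i hi => hk i (Finset.mem_insert_of_mem hi))

theorem Adm.mul {k k' : X → Y → ℂ} (hk : Adm k) (hk' : Measurable (uncurry k')) {M' : ℝ}
    (hM' : ∀ x y, ‖k' x y‖ ≤ M') : Adm (fun x y => k' x y * k x y) where
  meas := hk'.mul hk.meas
  bdd := by
    obtain ⟨M, hM⟩ := hk.bdd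
    refine ⟨M' * M, fun x y => ?_⟩
    rw [norm_mul]
    exact mul_le_mul (hM' x y) (hM x y) (norm_nonneg _) ((norm_nonneg _).trans (hM' x y))
  supp := fun x => lt_of_le_of_lt (measure_mono fun y hy => by
    simp only [mem_support] at hy ⊢
    exact right_ne_zero_of_mul hy) (hk.supp x)

theorem Adm.integrable {k : X → Y → ℂ} (hk : Adm k) {p : ℝ≥0∞} (hp : 1 ≤ p) {f : Y → ℂ}
    (hf : MemLp f p volume) (x : X) : Integrable (fun y => k x y * f y) volume := by
  obtain ⟨M, hM⟩ := hk.bdd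
  have hkx : Measurable (k x) := hk.meas.comp measurable_prodMk_left
  set S := support (k x)
  have hS : MeasurableSet S := measurableSet_support hkx
  have : IsFiniteMeasure (volume.restrict S) := ⟨by simpa using hk.supp x⟩
  have h1 : Integrable f (volume.restrict S) := (hf.restrict S).integrable hp
  have h2 : IntegrableOn (fun y => k x y * f y) S volume :=
    h1.bdd_mul (c := M) hkx.aestronglyMeasurable (Filter.Eventually.of_forall (hM x))
  refine (integrableOn_iff_integrable_of_support_subset ?_).1 h2
  exact fun y hy => left_ne_zero_of_mul hy

theorem kop_congr_ae {X : Type*} (k : X → Y → ℂ) {f g : Y → ℂ} (h : f =ᵐ[volume] g) : kop k f = kop k g := by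
  ext x
  refine integral_congr_ae ?_
  filter_upwards [h] with y hy
  rw [hy]

theorem Adm.aestronglyMeasurable [SFinite (volume : Measure X)] [SFinite (volume : Measure Y)]
    {k : X → Y → ℂ} (hk : Adm k) {f : Y → ℂ} (hf : AEStronglyMeasurable f volume) :
    AEStronglyMeasurable (kop k f) volume := by
  rw [kop_congr_ae k hf.ae_eq_mk]
  have hm : Measurable (uncurry fun x y => k x y * hf.mk f y) :=
    hk.meas.mul (hf.stronglyMeasurable_mk.measurable.comp measurable_snd)
  exact (hm.stronglyMeasurable.integral_prod_right).aestronglyMeasurable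

/-- The operator sees `f` only up to null sets, so a measurable representative may be chosen; this
supplies the joint measurability that Fubini arguments need. -/
theorem KerBound.of_measurable {k : X → Y → ℂ} {p q B : ℝ≥0∞}
    (h : ∀ f : Y → ℂ, Measurable f → MemLp f p volume →
      eLpNorm (kop k f) q volume ≤ B * eLpNorm f p volume) : KerBound k p q B := by
  intro f hf
  obtain ⟨g, hg, hfg⟩ := hf.1
  rw [kop_congr_ae k hfg, eLpNorm_congr_ae hfg]
  exact h g hg.measurable (hf.ae_eq hfg)

theorem KerBound.mono {k : X → Y → ℂ} {p q B B' : ℝ≥0∞} (h : KerBound k p q B) (hB : B ≤ B') :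
    KerBound k p q B' := fun f hf => (h f hf).trans (by gcongr)

theorem KerBound.zero (p q : ℝ≥0∞) : KerBound (fun (_ : X) (_ : Y) => (0 : ℂ)) p q 0 := by
  intro f _
  have : kop (fun (_ : X) (_ : Y) => (0 : ℂ)) f = 0 := by ext x; simp [kop]
  rw [this]; simp

theorem KerBound.congr {k k' : X → Y → ℂ} {p q B : ℝ≥0∞} (h : KerBound k p q B)
    (hk : ∀ x, k x =ᵐ[volume] k' x) : KerBound k' p q B := by
  intro f hf
  have : kop k' f = kop k f := by
    ext x
    refine integral_congr_ae ?_
    filter_upwards [hk x] with y hy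
    rw [hy]
  rw [this]; exact h f hf

theorem KerBound.const_mul {k : X → Y → ℂ} {p q B : ℝ≥0∞} (h : KerBound k p q B) (c : ℂ) :
    KerBound (fun x y => c * k x y) p q (‖c‖ₑ * B) := by
  intro f hf
  have : kop (fun x y => c * k x y) f = c • kop k f := by
    ext x
    simp only [kop, Pi.smul_apply, smul_eq_mul, mul_assoc]
    exact integral_const_mul _ _
  rw [this, eLpNorm_const_smul, mul_assoc]
  gcongr
  exact h f hf

/-- On a product set, cutting the kernel amounts to multiplying input and output by indicators.
Integrability is asked of the truncated function only, so that `KerBound.cut_prod_of_le` can apply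
this to functions from another Lebesgue space. -/
theorem eLpNorm_kop_cut_le {k : X → Y → ℂ} {p q B : ℝ≥0∞} (h : KerBound k p q B) {E : Set X}
    {E' : Set Y} {f : Y → ℂ} (hf : MemLp (E'.indicator f) p volume) :
    eLpNorm (kop (cut (fun x y => x ∈ E ∧ y ∈ E') k) f) q volume ≤
      B * eLpNorm (E'.indicator f) p volume := by
  have : kop (cut (fun x y => x ∈ E ∧ y ∈ E') k) f = E.indicator (kop k (E'.indicator f)) := by
    ext x
    by_cases hx : x ∈ E
    · rw [indicator_of_mem hx]
      refine integral_congr_ae (Filter.Eventually.of_forall fun y => ?_)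
      by_cases hy : y ∈ E' <;> simp [cut, hx, hy]
    · rw [indicator_of_notMem hx]
      simp [kop, cut, hx]
  rw [this]
  exact (eLpNorm_indicator_le _).trans (h _ hf)

theorem KerBound.cut_prod {k : X → Y → ℂ} {p q B : ℝ≥0∞} (h : KerBound k p q B) {E : Set X}
    {E' : Set Y} (hE' : MeasurableSet E') :
    KerBound (cut (fun x y => x ∈ E ∧ y ∈ E') k) p q B := fun f hf =>
  (eLpNorm_kop_cut_le h (hf.indicator hE')).trans
    (by gcongr; exact eLpNorm_indicator_le _)

/-- On a set of finite measure an `L^p → L^q` bound gives an `L^r → L^q` bound, `p ≤ r`. -/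
theorem KerBound.cut_prod_of_le {k : X → Y → ℂ} {p q r B : ℝ≥0∞} (h : KerBound k p q B) {E : Set X}
    {E' : Set Y} (hE' : MeasurableSet E') (hfin : volume E' ≠ ⊤)
    (hpr : p ≤ r) :
    KerBound (cut (fun x y => x ∈ E ∧ y ∈ E') k) r q
      (B * volume E' ^ (1 / p.toReal - 1 / r.toReal)) := by
  intro f hf
  have : IsFiniteMeasure (volume.restrict E') := ⟨by simpa using hfin.lt_top⟩
  have h1 : MemLp f p (volume.restrict E') := (hf.restrict E').mono_exponent hpr
  refine (eLpNorm_kop_cut_le h ((memLp_indicator_iff_restrict hE').2 h1)).trans ?_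
  rw [mul_assoc]
  gcongr
  rw [eLpNorm_indicator_eq_eLpNorm_restrict hE']
  refine (eLpNorm_le_eLpNorm_mul_rpow_measure_univ hpr h1.1).trans ?_
  rw [mul_comm, Measure.restrict_apply_univ]
  gcongr
  exact Measure.restrict_le_self

theorem eLpNorm_rpow_toReal {Z E : Type*} [MeasurableSpace Z] [NormedAddCommGroup E]
    {μ : Measure Z} {q : ℝ≥0∞} (hq : q ≠ 0) (hqt : q ≠ ⊤) (g : Z → E) :
    eLpNorm g q μ ^ q.toReal = ∫⁻ z, ‖g z‖ₑ ^ q.toReal ∂μ := by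
  rw [eLpNorm_eq_lintegral_rpow_enorm_toReal hq hqt, ← ENNReal.rpow_mul,
    one_div_mul_cancel (ENNReal.toReal_pos hq hqt).ne', ENNReal.rpow_one]

theorem lintegral_eq_tsum_fiber {Z ι : Type*} [MeasurableSpace Z] [Countable ι]
    [MeasurableSpace ι] [MeasurableSingletonClass ι] (μ : Measure Z) {α : Z → ι}
    (hα : Measurable α) (g : Z → ℝ≥0∞) :
    ∫⁻ z, g z ∂μ = ∑' n, ∫⁻ z in α ⁻¹' {n}, g z ∂μ := by
  rw [← lintegral_iUnion (fun n => hα (measurableSet_singleton n))]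
  · rw [← preimage_iUnion, iUnion_of_singleton, preimage_univ, Measure.restrict_univ]
  · intro m n hmn
    exact Disjoint.preimage _ (by simpa using hmn)

/-- Block-diagonal operators are bounded on `L^q` if the blocks are uniformly bounded. -/
theorem KerBound.blocks {ι : Type*} [Countable ι] [MeasurableSpace ι]
    [MeasurableSingletonClass ι] {α : X → ι} {β : Y → ι} (hα : Measurable α) (hβ : Measurable β)
    {k : X → Y → ℂ} {q B : ℝ≥0∞} (hq : q ≠ 0) (hqt : q ≠ ⊤)
    (h : ∀ n, KerBound (cut (fun x y => α x = n ∧ β y = n) k) q q B) :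
    KerBound (cut (fun x y => α x = β y) k) q q B := by
  intro f hf
  have hqr := ENNReal.toReal_pos hq hqt
  rw [← ENNReal.rpow_le_rpow_iff hqr, ENNReal.mul_rpow_of_nonneg _ _ hqr.le,
    eLpNorm_rpow_toReal hq hqt, eLpNorm_rpow_toReal hq hqt, lintegral_eq_tsum_fiber _ hα,
    lintegral_eq_tsum_fiber volume hβ (fun y => ‖f y‖ₑ ^ q.toReal), ← ENNReal.tsum_mul_left]
  refine ENNReal.tsum_le_tsum fun n => ?_
  have hαn : MeasurableSet (α ⁻¹' {n}) := hα (measurableSet_singleton n)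
  have hβn : MeasurableSet (β ⁻¹' {n}) := hβ (measurableSet_singleton n)
  -- Testing block `n` on the part of `f` in fibre `n` makes both sides additive over the fibres.
  have key := h n ((β ⁻¹' {n}).indicator f) (hf.indicator hβn)
  rw [← ENNReal.rpow_le_rpow_iff hqr, ENNReal.mul_rpow_of_nonneg _ _ hqr.le,
    eLpNorm_indicator_eq_eLpNorm_restrict hβn,
    eLpNorm_rpow_toReal hq hqt, eLpNorm_rpow_toReal hq hqt] at key
  refine le_trans (le_trans ?_ (setLIntegral_le_lintegral (α ⁻¹' {n}) _)) key
  refine (setLIntegral_congr_fun hαn fun x hx => ?_).le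
  have : kop (BochnerRiesz.cut (fun x y => α x = β y) k) f x =
      kop (BochnerRiesz.cut (fun x y => α x = n ∧ β y = n) k) ((β ⁻¹' {n}).indicator f) x := by
    refine integral_congr_ae (Filter.Eventually.of_forall fun y => ?_)
    have hx' : α x = n := hx
    by_cases hy : β y = n
    · simp [BochnerRiesz.cut, hx', hy]
    · simp [BochnerRiesz.cut, hx', hy, Ne.symm hy]
  simp only [this]

/-- For kernels obtained by a symmetry that also acts on the input, such as complex conjugation. -/
theorem KerBound.of_enorm_le {k k' : X → Y → ℂ} {p q B : ℝ≥0∞} (h : KerBound k p q B)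
    (hk : ∀ f : Y → ℂ, MemLp f p volume → ∃ g : Y → ℂ, MemLp g p volume ∧
      eLpNorm g p volume ≤ eLpNorm f p volume ∧ ∀ x, ‖kop k' f x‖ ≤ ‖kop k g x‖) :
    KerBound k' p q B := by
  intro f hf
  obtain ⟨g, hg, hgf, hle⟩ := hk f hf
  exact (eLpNorm_mono hle).trans ((h g hg).trans (by gcongr))

theorem KerBound.conj {k : X → Y → ℂ} {p q B : ℝ≥0∞} (h : KerBound k p q B) :
    KerBound (fun x y => (starRingEnd ℂ) (k x y)) p q B := by
  refine h.of_enorm_le fun f hf => ⟨fun y => (starRingEnd ℂ) (f y), ?_, ?_, fun x => ?_⟩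
  · exact hf.star
  · exact (eLpNorm_congr_norm_ae (Filter.Eventually.of_forall fun y => by simp)).le
  · rw [← RCLike.norm_conj]
    refine le_of_eq (congrArg _ ?_)
    simp only [kop]
    rw [← integral_conj]
    simp

variable [SFinite (volume : Measure X)] [SFinite (volume : Measure Y)]

theorem KerBound.add {k k' : X → Y → ℂ} (hk : Adm k) (hk' : Adm k') {p q B B' : ℝ≥0∞}
    (hp : 1 ≤ p) (hq : 1 ≤ q) (h : KerBound k p q B) (h' : KerBound k' p q B') :
    KerBound (fun x y => k x y + k' x y) p q (B + B') := by
  intro f hf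
  have : kop (fun x y => k x y + k' x y) f = kop k f + kop k' f := by
    ext x
    simp only [kop, Pi.add_apply, add_mul]
    exact integral_add (hk.integrable hp hf x) (hk'.integrable hp hf x)
  rw [this, add_mul]
  exact (eLpNorm_add_le (hk.aestronglyMeasurable hf.1) (hk'.aestronglyMeasurable hf.1) hq).trans
    (add_le_add (h f hf) (h' f hf))

theorem KerBound.sum {ι : Type*} (s : Finset ι) {k : ι → X → Y → ℂ} {p q : ℝ≥0∞}
    {B : ι → ℝ≥0∞} (hk : ∀ i ∈ s, Adm (k i)) (hp : 1 ≤ p) (hq : 1 ≤ q)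
    (h : ∀ i ∈ s, KerBound (k i) p q (B i)) :
    KerBound (fun x y => ∑ i ∈ s, k i x y) p q (∑ i ∈ s, B i) := by
  classical
  induction s using Finset.induction_on with
  | empty => simpa using KerBound.zero p q
  | insert a s ha ih =>
    simp only [Finset.sum_insert ha]
    exact KerBound.add (hk a (Finset.mem_insert_self _ _))
      (Adm.sum s fun i hi => hk i (Finset.mem_insert_of_mem hi)) hp hq
      (h a (Finset.mem_insert_self _ _))
      (ih (fun i hi => hk i (Finset.mem_insert_of_mem hi))
        (fun i hi => h i (Finset.mem_insert_of_mem hi)))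

/-- Change of variables by measure preserving equivalences. -/
theorem KerBound.comp {X' Y' : Type*} [MeasureSpace X'] [MeasureSpace Y'] {k : X → Y → ℂ}
    (hk : Adm k) {p q B : ℝ≥0∞} (h : KerBound k p q B) {e : X' → X} (he : MeasurePreserving e)
    (e' : Y' ≃ᵐ Y) (he' : MeasurePreserving e') :
    KerBound (fun x y => k (e x) (e' y)) p q B := by
  intro f hf
  have hf' : MemLp (f ∘ e'.symm) p volume := hf.comp_measurePreserving he'.symm
  have : kop (fun x y => k (e x) (e' y)) f = kop k (f ∘ e'.symm) ∘ e := by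
    ext x
    simp only [kop, Function.comp]
    rw [← he'.integral_comp e'.measurableEmbedding]
    simp
  rw [this, eLpNorm_comp_measurePreserving (hk.aestronglyMeasurable hf'.1) he]
  refine (h _ hf').trans_eq ?_
  rw [eLpNorm_comp_measurePreserving hf.1 he'.symm]

end KernelOperators

/-! ### Superposition, freezing of variables and Schur's test. -/

section Superposition

variable {X Y : Type*} [MeasureSpace X] [MeasureSpace Y]
  [SigmaFinite (volume : Measure X)] [SFinite (volume : Measure Y)]

/-- Fubini writes the operator as an average of the operators with kernels `κ t`, and Minkowski's
inequality moves the norm inside. Sections supported in sets of finite measure make `f` integrable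
where it matters, as Fubini requires. -/
theorem KerBound.superpose {T : Type*} [MeasurableSpace T]
    {ν : Measure T} [SFinite ν] {κ : T → X → Y → ℂ}
    (hκ : Measurable fun z : T × X × Y => κ z.1 z.2.1 z.2.2)
    {M : ℝ} (hM : ∀ t x y, ‖κ t x y‖ ≤ M) {S : X → Set Y} (hS : ∀ x, volume (S x) < ⊤)
    (hκS : ∀ t x y, κ t x y ≠ 0 → y ∈ S x) {c : T → ℂ} (hcm : Measurable c)
    (hc : Integrable c ν) {p q : ℝ≥0∞} {B : T → ℝ≥0∞} (hp : 1 ≤ p) (hq : 1 ≤ q) (hqt : q ≠ ⊤)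
    (h : ∀ t, KerBound (κ t) p q (B t)) :
    KerBound (fun x y => ∫ t, c t * κ t x y ∂ν) p q (∫⁻ t, ‖c t‖ₑ * B t ∂ν) := by
  refine KerBound.of_measurable fun f hfm hf => ?_
  have hjoint : Measurable (uncurry fun (t : T) (x : X) => c t * kop (κ t) f x) := by
    refine (hcm.comp measurable_fst).mul ?_
    have hm : Measurable (uncurry fun (z : T × X) (y : Y) => κ z.1 z.2 y * f y) := by
      refine Measurable.mul ?_ (hfm.comp measurable_snd)
      exact hκ.comp ((measurable_fst.comp measurable_fst).prodMk
        ((measurable_snd.comp measurable_fst).prodMk measurable_snd))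
    exact hm.stronglyMeasurable.integral_prod_right.measurable
  have hrep : ∀ x, kop (fun x y => ∫ t, c t * κ t x y ∂ν) f x =
      ∫ t, c t * kop (κ t) f x ∂ν := by
    intro x
    -- `S x` need not be measurable; its measurable hull has the same measure.
    set S' := toMeasurable volume (S x)
    have hS' : MeasurableSet S' := measurableSet_toMeasurable _ _
    have : IsFiniteMeasure (volume.restrict S') :=
      ⟨by simpa [S', measure_toMeasurable] using hS x⟩
    have h1 : Integrable (S'.indicator f) volume :=
      (integrable_indicator_iff hS').2 ((hf.restrict S').integrable hp)
    have h2 : Integrable (fun z : Y × T => κ z.2 x z.1 * (S'.indicator f z.1 * c z.2))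
        (volume.prod ν) := by
      refine (h1.mul_prod hc).bdd_mul (c := M) ?_ (Filter.Eventually.of_forall fun z => hM _ _ _)
      exact (hκ.comp (measurable_snd.prodMk
        (measurable_const.prodMk measurable_fst))).aestronglyMeasurable
    have h3 : ∀ y t, κ t x y * (S'.indicator f y * c t) = c t * κ t x y * f y := by
      intro y t
      by_cases hy : κ t x y = 0
      · simp [hy]
      · rw [indicator_of_mem (subset_toMeasurable _ _ (hκS t x y hy))]; ring
    simp only [h3] at h2
    calc kop (fun x y => ∫ t, c t * κ t x y ∂ν) f x = ∫ y, ∫ t, c t * κ t x y * f y ∂ν := by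
          refine integral_congr_ae (Filter.Eventually.of_forall fun y => ?_)
          exact (integral_mul_const _ _).symm
      _ = ∫ t, (∫ y, c t * κ t x y * f y) ∂ν := integral_integral_swap h2
      _ = _ := by
          refine integral_congr_ae (Filter.Eventually.of_forall fun t => ?_)
          simp only [mul_assoc, kop]
          exact integral_const_mul _ _
  calc eLpNorm (kop (fun x y => ∫ t, c t * κ t x y ∂ν) f) q volume
      ≤ ∫⁻ t, eLpNorm (fun x => c t * kop (κ t) f x) q volume ∂ν := by
        refine eLpNorm_le_lintegral_eLpNorm _ ν hjoint (fun x => ?_) hq hqt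
        rw [hrep]
        exact enorm_integral_le_lintegral_enorm _
    _ ≤ ∫⁻ t, (‖c t‖ₑ * B t) * eLpNorm f p volume ∂ν := by
        refine lintegral_mono fun t => ?_
        have : (fun x => c t * kop (κ t) f x) = c t • kop (κ t) f := rfl
        simp only [this, eLpNorm_const_smul, mul_assoc]
        gcongr
        exact h t f hf
    _ = _ := lintegral_mul_const' _ _ hf.2.ne

/-- Freezing one variable of a kernel on `X × (T × Y)`. -/
theorem KerBound.freeze {T : Type*} [MeasureSpace T]
    [SFinite (volume : Measure T)] {k : X → T × Y → ℂ} (hk : Adm k) {I : Set T}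
    (hI : MeasurableSet I)
    (hkI : ∀ x t y, k x (t, y) ≠ 0 → t ∈ I) {p q : ℝ≥0∞} {B : ℝ≥0∞} (hp : 1 < p) (hpt : p ≠ ⊤)
    (hq : 1 ≤ q) (hqt : q ≠ ⊤) (h : ∀ t ∈ I, KerBound (fun x y => k x (t, y)) p q B) :
    KerBound k p q (B * volume I ^ (1 - 1 / p.toReal)) := by
  refine KerBound.of_measurable fun f hfm hf => ?_
  have hp0 : p ≠ 0 := (zero_lt_one.trans hp).ne'
  have hpr : 1 < p.toReal := by
    rw [← ENNReal.toReal_one]; exact ENNReal.toReal_strict_mono hpt hp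
  have hpr0 : 0 < p.toReal := by linarith
  set ν : Measure T := volume.restrict I
  have hjoint : Measurable (uncurry fun (t : T) (x : X) =>
      kop (fun x y => k x (t, y)) (fun y => f (t, y)) x) := by
    have hm : Measurable (uncurry fun (z : T × X) (y : Y) => k z.2 (z.1, y) * f (z.1, y)) := by
      have h1 : Measurable fun w : (T × X) × Y => (w.1.1, w.2) :=
        (measurable_fst.comp measurable_fst).prodMk measurable_snd
      exact (hk.meas.comp ((measurable_snd.comp measurable_fst).prodMk h1)).mul (hfm.comp h1)
    exact hm.stronglyMeasurable.integral_prod_right.measurable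
  have hrep : ∀ x, kop k f x =
      ∫ t in I, kop (fun x y => k x (t, y)) (fun y => f (t, y)) x := by
    intro x
    have h1 := hk.integrable hp.le hf x
    rw [kop, Measure.volume_eq_prod, integral_prod _ (by rwa [Measure.volume_eq_prod] at h1)]
    symm
    refine setIntegral_eq_integral_of_forall_compl_eq_zero fun t ht => ?_
    have : ∀ y, k x (t, y) = 0 := fun y => by
      by_contra hne
      exact ht (hkI x t y hne)
    simp [kop, this]
  set N : T → ℝ≥0∞ := fun t => eLpNorm (fun y => f (t, y)) p volume
  have hNrpow : ∀ t, N t ^ p.toReal = ∫⁻ y, ‖f (t, y)‖ₑ ^ p.toReal :=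
    fun t => eLpNorm_rpow_toReal hp0 hpt _
  have hNeq : ∀ t, N t = (∫⁻ y, ‖f (t, y)‖ₑ ^ p.toReal) ^ (1 / p.toReal) := fun t =>
    eLpNorm_eq_lintegral_rpow_enorm_toReal hp0 hpt
  have hNm : Measurable N := by
    simp only [funext hNeq]
    exact (Measurable.lintegral_prod_right (f := fun (t : T) (y : Y) => ‖f (t, y)‖ₑ ^ p.toReal)
      (hfm.enorm.pow_const _)).pow_const _
  have hNint : ∫⁻ t, N t ^ p.toReal = eLpNorm f p volume ^ p.toReal := by
    rw [eLpNorm_rpow_toReal hp0 hpt, Measure.volume_eq_prod,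
      lintegral_prod _ (hfm.enorm.pow_const _).aemeasurable]
    exact lintegral_congr hNrpow
  -- By Fubini almost every slice of `f` lies in `L^p`, so the hypothesis applies for almost every
  -- frozen value.
  have hae : ∀ᵐ t ∂ν, MemLp (fun y => f (t, y)) p volume := by
    refine ae_restrict_of_ae ?_
    have : ∀ᵐ t, N t ^ p.toReal < ⊤ := by
      refine ae_lt_top (hNm.pow_const _) ?_
      rw [hNint]
      exact ENNReal.rpow_ne_top_of_nonneg hpr0.le hf.2.ne
    filter_upwards [this] with t ht
    refine ⟨(hfm.comp measurable_prodMk_left).aestronglyMeasurable, ?_⟩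
    by_contra hcon
    have h3 : N t = ⊤ := not_lt_top_iff.1 hcon
    rw [h3, ENNReal.top_rpow_of_pos hpr0] at ht
    exact lt_irrefl _ ht
  calc eLpNorm (kop k f) q volume
      ≤ ∫⁻ t in I, eLpNorm (kop (fun x y => k x (t, y)) (fun y => f (t, y))) q volume := by
        refine eLpNorm_le_lintegral_eLpNorm _ ν hjoint (fun x => ?_) hq hqt
        rw [hrep]
        exact enorm_integral_le_lintegral_enorm _
    _ ≤ ∫⁻ t in I, B * N t := by
        refine lintegral_mono_ae ?_
        filter_upwards [hae, ae_restrict_mem hI] with t ht htI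
        exact h t htI _ ht
    _ = B * ∫⁻ t in I, N t * 1 := by
        simp only [mul_one]
        exact lintegral_const_mul _ hNm
    _ ≤ B * (eLpNorm f p volume * volume I ^ (1 - 1 / p.toReal)) := by
        gcongr
        -- Hölder in the frozen variable, against the constant one on `I`, costs `|I|^(1 - 1/p)`.
        refine (ENNReal.lintegral_mul_le_Lp_mul_Lq ν (Real.HolderConjugate.conjExponent hpr)
          hNm.aemeasurable aemeasurable_const).trans ?_
        simp only [ENNReal.one_rpow, lintegral_const, one_mul]
        have h4 : 1 / (p.toReal / (p.toReal - 1)) = 1 - 1 / p.toReal := by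
          have : p.toReal - 1 ≠ 0 := by linarith
          field_simp
        have h5 : (∫⁻ t, N t ^ p.toReal ∂ν) ^ (1 / p.toReal) ≤ eLpNorm f p volume := by
          rw [one_div, ENNReal.rpow_inv_le_iff hpr0, ← hNint]
          exact setLIntegral_le_lintegral _ _
        rw [Measure.restrict_apply_univ]
        change _ * volume I ^ (1 / (p.toReal / (p.toReal - 1))) ≤ _
        rw [h4]
        gcongr
    _ = _ := by ring

/-- Bounded kernels with sections of bounded measure define bounded operators on every `L^q`. -/
theorem KerBound.of_bounded {k : X → Y → ℂ} {M A : ℝ≥0∞} {S : X → Y → Prop}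
    (hSm : MeasurableSet {z : X × Y | S z.1 z.2})
    (hM : ∀ x y, ‖k x y‖ₑ ≤ M) (hkS : ∀ x y, k x y ≠ 0 → S x y)
    (hY : ∀ x, volume {y | S x y} ≤ A) (hX : ∀ y, volume {x | S x y} ≤ A) {q : ℝ≥0∞}
    (hq : 1 ≤ q) (hA : A ≠ ⊤) (hMt : M ≠ ⊤) : KerBound k q q (M * A) := by
  refine KerBound.of_measurable fun f hfm hf => ?_
  have hSx : ∀ x, MeasurableSet {y | S x y} := fun x => measurable_prodMk_left hSm
  have hSy : ∀ y, MeasurableSet {x | S x y} := fun y => measurable_prodMk_right hSm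
  have hpt : ∀ x, ‖kop k f x‖ₑ ≤ M * ∫⁻ y in {y | S x y}, ‖f y‖ₑ := by
    intro x
    refine (enorm_integral_le_lintegral_enorm _).trans ?_
    rw [← lintegral_const_mul _ hfm.enorm, ← lintegral_indicator (hSx x)]
    refine lintegral_mono fun y => ?_
    by_cases hy : S x y
    · rw [indicator_of_mem (show y ∈ {y | S x y} from hy), enorm_mul]
      gcongr
      exact hM x y
    · have : k x y = 0 := by
        by_contra hne; exact hy (hkS x y hne)
      simp [this]
  rcases eq_or_ne q ⊤ with rfl | hqt
  · rw [eLpNorm_exponent_top, eLpNorm_exponent_top]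
    refine essSup_le_of_ae_le _ (Filter.Eventually.of_forall fun x => (hpt x).trans ?_)
    rw [mul_assoc]
    refine mul_le_mul' le_rfl ?_
    refine (lintegral_mono_ae (ae_restrict_of_ae (ae_le_eLpNormEssSup (f := f)))).trans ?_
    rw [lintegral_const, Measure.restrict_apply_univ, mul_comm]
    exact mul_le_mul' (hY x) le_rfl
  · have hq0 : q ≠ 0 := (zero_lt_one.trans_le hq).ne'
    have hqr : 1 ≤ q.toReal := by
      rw [← ENNReal.toReal_one]; exact ENNReal.toReal_mono hqt hq
    have hqr0 : 0 < q.toReal := by linarith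
    -- Hölder on each section in `y`, of measure at most `A`; the exchange of integrals below then
    -- uses the sections in `x`.
    have hpt2 : ∀ x, ‖kop k f x‖ₑ ^ q.toReal ≤
        M ^ q.toReal * (A ^ (q.toReal - 1) * ∫⁻ y in {y | S x y}, ‖f y‖ₑ ^ q.toReal) := by
      intro x
      refine (ENNReal.rpow_le_rpow (hpt x) hqr0.le).trans ?_
      rw [ENNReal.mul_rpow_of_nonneg _ _ hqr0.le]
      gcongr
      have h1 := eLpNorm_le_eLpNorm_mul_rpow_measure_univ (μ := volume.restrict {y | S x y}) hq
        hfm.aestronglyMeasurable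
      rw [← ENNReal.rpow_le_rpow_iff hqr0, ENNReal.mul_rpow_of_nonneg _ _ hqr0.le,
        eLpNorm_rpow_toReal hq0 hqt, eLpNorm_one_eq_lintegral_enorm, ← ENNReal.rpow_mul,
        Measure.restrict_apply_univ] at h1
      refine h1.trans ?_
      rw [mul_comm]
      have : (1 / (1 : ℝ≥0∞).toReal - 1 / q.toReal) * q.toReal = q.toReal - 1 := by
        simp; field_simp
      rw [this]
      have h2 : volume {y | S x y} ^ (q.toReal - 1) ≤ A ^ (q.toReal - 1) :=
        ENNReal.rpow_le_rpow (hY x) (by linarith)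
      exact mul_le_mul' h2 le_rfl
    rw [← ENNReal.rpow_le_rpow_iff hqr0, ENNReal.mul_rpow_of_nonneg _ _ hqr0.le,
      eLpNorm_rpow_toReal hq0 hqt, eLpNorm_rpow_toReal hq0 hqt,
      ENNReal.mul_rpow_of_nonneg _ _ hqr0.le]
    refine (lintegral_mono hpt2).trans ?_
    have hmeas : Measurable (uncurry fun x y => {y | S x y}.indicator
        (fun y => ‖f y‖ₑ ^ q.toReal) y) := by
      have : (uncurry fun x y => {y | S x y}.indicator (fun y => ‖f y‖ₑ ^ q.toReal) y) =
          {z : X × Y | S z.1 z.2}.indicator (fun z => ‖f z.2‖ₑ ^ q.toReal) := by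
        ext ⟨x, y⟩
        by_cases hxy : S x y <;> simp [indicator, hxy]
      rw [this]
      exact ((hfm.comp measurable_snd).enorm.pow_const _).indicator hSm
    rw [lintegral_const_mul' _ _ (ENNReal.rpow_ne_top_of_nonneg hqr0.le hMt), mul_assoc,
      lintegral_const_mul' _ _ (ENNReal.rpow_ne_top_of_nonneg (by linarith) hA)]
    refine mul_le_mul' le_rfl ?_
    have hAA : A ^ q.toReal = A ^ (q.toReal - 1) * A := by
      nth_rewrite 3 [← ENNReal.rpow_one A]
      rw [← ENNReal.rpow_add_of_nonneg _ _ (by linarith) zero_le_one]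
      ring_nf
    rw [hAA, mul_assoc]
    refine mul_le_mul' le_rfl ?_
    calc ∫⁻ x, ∫⁻ y in {y | S x y}, ‖f y‖ₑ ^ q.toReal
        = ∫⁻ x, ∫⁻ y, {y | S x y}.indicator (fun y => ‖f y‖ₑ ^ q.toReal) y :=
          lintegral_congr fun x => (lintegral_indicator (hSx x) _).symm
      _ = ∫⁻ y, ∫⁻ x, {y | S x y}.indicator (fun y => ‖f y‖ₑ ^ q.toReal) y :=
          lintegral_lintegral_swap hmeas.aemeasurable
      _ = ∫⁻ y, volume {x | S x y} * ‖f y‖ₑ ^ q.toReal := by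
          refine lintegral_congr fun y => ?_
          have : ∀ x, {y | S x y}.indicator (fun y => ‖f y‖ₑ ^ q.toReal) y =
              {x | S x y}.indicator (fun _ => ‖f y‖ₑ ^ q.toReal) x := fun x => by
            by_cases hxy : S x y <;> simp [indicator, hxy]
          simp only [this]
          rw [lintegral_indicator (hSy y), lintegral_const, Measure.restrict_apply_univ, mul_comm]
      _ ≤ ∫⁻ y, A * ‖f y‖ₑ ^ q.toReal := by
          gcongr with y
          exact hX y
      _ = A * ∫⁻ y, ‖f y‖ₑ ^ q.toReal := lintegral_const_mul' _ _ hA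

end Superposition

/-! ### Van der Corput's lemma. -/

section VanDerCorput

open Complex (I)

/-- First-derivative test for oscillatory integrals with monotone phase derivative. -/
theorem norm_integral_exp_le_of_le_abs_deriv {ψ ψ' ψ'' : ℝ → ℝ} {a b d : ℝ} (hab : a ≤ b)
    (h1 : ∀ x ∈ Icc a b, HasDerivAt ψ (ψ' x) x) (h2 : ∀ x ∈ Icc a b, HasDerivAt ψ' (ψ'' x) x)
    (hc : ContinuousOn ψ'' (Icc a b)) (hpos : ∀ x ∈ Icc a b, 0 ≤ ψ'' x) (hd : 0 < d)
    (hlow : ∀ x ∈ Icc a b, d ≤ |ψ' x|) :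
    ‖∫ x in a..b, Complex.exp (I * ψ x)‖ ≤ 4 / d := by
  have hne : ∀ x ∈ Icc a b, ψ' x ≠ 0 := fun x hx h0 => by
    have := hlow x hx
    rw [h0, abs_zero] at this
    linarith
  have hψ'c : ContinuousOn ψ' (Icc a b) := fun x hx => (h2 x hx).continuousAt.continuousWithinAt
  have hψc : ContinuousOn ψ (Icc a b) := fun x hx => (h1 x hx).continuousAt.continuousWithinAt
  have hec : ContinuousOn (fun x => Complex.exp (I * ψ x)) (Icc a b) := by fun_prop
  set r : ℝ → ℝ := fun x => ψ'' x / ψ' x ^ 2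
  have hrc : ContinuousOn r (Icc a b) :=
    hc.div (hψ'c.pow 2) fun x hx => pow_ne_zero 2 (hne x hx)
  have hu : uIcc a b = Icc a b := uIcc_of_le hab
  -- Integration by parts in disguise: `e^{iψ}` is a derivative up to the error `i e^{iψ} ψ''/ψ'²`.
  have hderiv : ∀ x ∈ uIcc a b, HasDerivAt (fun x => Complex.exp (I * ψ x) * (-I * ((ψ' x)⁻¹ : ℝ)))
      (Complex.exp (I * ψ x) + I * (Complex.exp (I * ψ x) * (r x : ℝ))) x := by
    intro x hx
    rw [hu] at hx
    have e1 : HasDerivAt (fun x => Complex.exp (I * ψ x))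
        (Complex.exp (I * ψ x) * (I * (ψ' x : ℝ))) x :=
      ((h1 x hx).ofReal_comp.const_mul I).cexp
    have e2 : HasDerivAt (fun x => (((ψ' x)⁻¹ : ℝ) : ℂ)) ((-ψ'' x / ψ' x ^ 2 : ℝ) : ℂ) x :=
      ((h2 x hx).inv (hne x hx)).ofReal_comp
    refine (e1.mul (e2.const_mul (-I))).congr_deriv ?_
    have : (ψ' x : ℂ) ≠ 0 := by exact_mod_cast hne x hx
    have hr : ((r x : ℝ) : ℂ) = ψ'' x / (ψ' x : ℂ) ^ 2 := by simp [r]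
    rw [hr]
    push_cast
    field_simp
    linear_combination (-ψ' x ^ 2 : ℂ) * Complex.I_sq
  have hint1 : IntervalIntegrable (fun x => Complex.exp (I * ψ x)) volume a b :=
    (hu ▸ hec).intervalIntegrable
  have hint2 : IntervalIntegrable (fun x => I * (Complex.exp (I * ψ x) * (r x : ℝ))) volume a b := by
    refine ContinuousOn.intervalIntegrable ?_
    rw [hu]
    exact continuousOn_const.mul (hec.mul (Complex.continuous_ofReal.comp_continuousOn hrc))
  have hftc := intervalIntegral.integral_eq_sub_of_hasDerivAt hderiv (hint1.add hint2)
  rw [intervalIntegral.integral_add hint1 hint2] at hftc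
  -- As `ψ'' ≥ 0`, the error density is nonnegative and its integral is a difference of boundary
  -- values of `1/ψ'`. Neither an upper bound on `ψ''` nor the length of the interval enters.
  have hrftc : ∫ x in a..b, r x = (ψ' a)⁻¹ - (ψ' b)⁻¹ := by
    have := intervalIntegral.integral_eq_sub_of_hasDerivAt (f := fun x => -(ψ' x)⁻¹) (f' := r)
      (a := a) (b := b) (fun x hx => by
        rw [hu] at hx
        have := ((h2 x hx).inv (hne x hx)).neg
        rwa [neg_div, neg_neg] at this) ((hu ▸ hrc).intervalIntegrable)
    rw [this]; ring
  have hinv : ∀ x ∈ Icc a b, |(ψ' x)⁻¹| ≤ 1 / d := fun x hx => by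
    rw [abs_inv, one_div]
    exact inv_anti₀ hd (hlow x hx)
  have hbdry : ∀ x ∈ Icc a b, ‖Complex.exp (I * ψ x) * (-I * ((ψ' x)⁻¹ : ℝ))‖ ≤ 1 / d :=
    fun x hx => by
      rw [norm_mul, mul_comm I, Complex.norm_exp_ofReal_mul_I, one_mul, norm_mul, norm_neg,
        Complex.norm_I, one_mul, Complex.norm_real]
      exact hinv x hx
  have ha : a ∈ Icc a b := left_mem_Icc.2 hab
  have hb : b ∈ Icc a b := right_mem_Icc.2 hab
  have hrest : ‖∫ x in a..b, I * (Complex.exp (I * ψ x) * (r x : ℝ))‖ ≤ 2 / d := by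
    calc _ ≤ ∫ x in a..b, r x := by
          refine intervalIntegral.norm_integral_le_of_norm_le hab
            (Filter.Eventually.of_forall fun x hx => ?_) ((hu ▸ hrc).intervalIntegrable)
          have hx' : x ∈ Icc a b := Ioc_subset_Icc_self hx
          rw [norm_mul, Complex.norm_I, one_mul, norm_mul, mul_comm I,
            Complex.norm_exp_ofReal_mul_I, one_mul, Complex.norm_real, Real.norm_eq_abs,
            abs_of_nonneg (div_nonneg (hpos x hx') (sq_nonneg _))]
      _ ≤ |(ψ' a)⁻¹| + |(ψ' b)⁻¹| := by
          rw [hrftc]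
          exact (le_abs_self _).trans (abs_sub _ _)
      _ ≤ 1 / d + 1 / d := add_le_add (hinv a ha) (hinv b hb)
      _ = 2 / d := by ring
  have heq : ∫ x in a..b, Complex.exp (I * ψ x) =
      Complex.exp (I * ψ b) * (-I * ((ψ' b)⁻¹ : ℝ)) - Complex.exp (I * ψ a) * (-I * ((ψ' a)⁻¹ : ℝ))
        - ∫ x in a..b, I * (Complex.exp (I * ψ x) * (r x : ℝ)) := by
    rw [← hftc]; ring
  rw [heq]
  calc _ ≤ 1 / d + 1 / d + 2 / d :=
        (norm_sub_le _ _).trans (add_le_add ((norm_sub_le _ _).trans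
          (add_le_add (hbdry b hb) (hbdry a ha))) hrest)
    _ = 4 / d := by ring

theorem norm_integral_exp_le_sub {ψ : ℝ → ℝ} {a b : ℝ} (hab : a ≤ b) :
    ‖∫ x in a..b, Complex.exp (I * ψ x)‖ ≤ b - a := by
  have := intervalIntegral.norm_integral_le_of_norm_le_const (a := a) (b := b) (C := 1)
    (f := fun x => Complex.exp (I * ψ x)) fun x _ => by
      rw [mul_comm I, Complex.norm_exp_ofReal_mul_I]
  rwa [one_mul, abs_of_nonneg (by linarith)] at this

/-- Van der Corput's lemma for phases with second derivative bounded below. -/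
theorem norm_integral_exp_le_of_le_second_deriv {ψ ψ' ψ'' : ℝ → ℝ} {a b m : ℝ} (hab : a ≤ b)
    (h1 : ∀ x ∈ Icc a b, HasDerivAt ψ (ψ' x) x) (h2 : ∀ x ∈ Icc a b, HasDerivAt ψ' (ψ'' x) x)
    (hc : ContinuousOn ψ'' (Icc a b)) (hm : 0 < m) (hlow : ∀ x ∈ Icc a b, m ≤ ψ'' x) :
    ‖∫ x in a..b, Complex.exp (I * ψ x)‖ ≤ 10 / √m := by
  have hψ'c : ContinuousOn ψ' (Icc a b) := fun x hx => (h2 x hx).continuousAt.continuousWithinAt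
  have hψc : ContinuousOn ψ (Icc a b) := fun x hx => (h1 x hx).continuousAt.continuousWithinAt
  have hec : ContinuousOn (fun x => Complex.exp (I * ψ x)) (Icc a b) := by fun_prop
  have hgrow : ∀ x ∈ Icc a b, ∀ y ∈ Icc a b, x ≤ y → m * (y - x) ≤ ψ' y - ψ' x := by
    refine (convex_Icc a b).mul_sub_le_image_sub_of_le_deriv hψ'c (fun x hx => ?_) (fun x hx => ?_)
    · exact (h2 x (interior_subset hx)).differentiableAt.differentiableWithinAt
    · rw [(h2 x (interior_subset hx)).deriv]
      exact hlow x (interior_subset hx)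
  -- `c` is a zero of the increasing function `ψ'`, or an endpoint when `ψ'` keeps its sign; away
  -- from `c` the derivative grows at rate at least `m`.
  obtain ⟨c, hcm, hcr, hcl⟩ : ∃ c ∈ Icc a b, (∀ x ∈ Ioc c b, m * (x - c) ≤ ψ' x) ∧
      ∀ x ∈ Ico a c, ψ' x ≤ -(m * (c - x)) := by
    have ha : a ∈ Icc a b := left_mem_Icc.2 hab
    have hb : b ∈ Icc a b := right_mem_Icc.2 hab
    rcases le_or_gt 0 (ψ' a) with h0 | h0
    · refine ⟨a, ha, fun x hx => ?_, fun x hx => absurd hx.2 (not_lt.2 hx.1)⟩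
      have := hgrow a ha x ⟨hx.1.le, hx.2⟩ hx.1.le; linarith
    · rcases le_or_gt (ψ' b) 0 with h0' | h0'
      · refine ⟨b, hb, fun x hx => absurd hx.1 (not_lt.2 hx.2), fun x hx => ?_⟩
        have := hgrow x ⟨hx.1, hx.2.le⟩ b hb hx.2.le; linarith
      · obtain ⟨c, hc, hc0⟩ := intermediate_value_Icc hab hψ'c ⟨h0.le, h0'.le⟩
        refine ⟨c, hc, fun x hx => ?_, fun x hx => ?_⟩
        · have := hgrow c hc x ⟨hc.1.trans hx.1.le, hx.2⟩ hx.1.le; linarith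
        · have := hgrow x ⟨hx.1, hx.2.le.trans hc.2⟩ c hc hx.2.le; linarith
  have hint : ∀ x ∈ Icc a b, ∀ y ∈ Icc a b,
      IntervalIntegrable (fun x => Complex.exp (I * ψ x)) volume x y := fun x hx y hy =>
    (hec.mono (uIcc_subset_Icc hx hy)).intervalIntegrable
  have hsm : 0 < √m := Real.sqrt_pos.2 hm
  -- This width balances the trivial bound `h` near `c` with the bound `4 / (m h)` of the
  -- first-derivative test beyond it, so each side of `c` costs `5 h`.
  set h := 1 / √m
  have hh : 0 < h := by positivity
  have hmh : 4 / (m * h) = 4 * h := by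
    have : m = √m * √m := (Real.mul_self_sqrt hm.le).symm
    simp only [h]
    rw [this, Real.sqrt_mul_self hsm.le]
    field_simp
  have hpiece : ∀ x ∈ Icc a b, ∀ y ∈ Icc a b, x ≤ y → (∀ t ∈ Icc x y, m * h ≤ |ψ' t|) →
      ‖∫ x in x..y, Complex.exp (I * ψ x)‖ ≤ 4 * h := by
    intro x hx y hy hxy hlow'
    have hsub : Icc x y ⊆ Icc a b := Icc_subset_Icc hx.1 hy.2
    rw [← hmh]
    exact norm_integral_exp_le_of_le_abs_deriv hxy (fun t ht => h1 t (hsub ht))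
      (fun t ht => h2 t (hsub ht)) (hc.mono hsub) (fun t ht => hm.le.trans (hlow t (hsub ht)))
      (by positivity) hlow'
  have hright : ‖∫ x in c..b, Complex.exp (I * ψ x)‖ ≤ 5 * h := by
    rcases le_or_gt b (c + h) with hb | hb
    · exact (norm_integral_exp_le_sub hcm.2).trans (by linarith)
    · have hd : c + h ∈ Icc a b := ⟨by linarith [hcm.1], hb.le⟩
      rw [← intervalIntegral.integral_add_adjacent_intervals (hint c hcm _ hd)
        (hint _ hd b ⟨hab, le_rfl⟩)]
      refine (norm_add_le _ _).trans ((add_le_add (norm_integral_exp_le_sub (by linarith))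
        (hpiece _ hd b ⟨hab, le_rfl⟩ hb.le fun t ht => ?_)).trans (by linarith))
      refine le_trans ?_ (le_abs_self _)
      refine le_trans ?_ (hcr t ⟨by linarith [ht.1], ht.2⟩)
      exact mul_le_mul_of_nonneg_left (by linarith [ht.1]) hm.le
  have hleft : ‖∫ x in a..c, Complex.exp (I * ψ x)‖ ≤ 5 * h := by
    rcases le_or_gt (c - h) a with hb | hb
    · exact (norm_integral_exp_le_sub hcm.1).trans (by linarith)
    · have hd : c - h ∈ Icc a b := ⟨hb.le, by linarith [hcm.2]⟩
      rw [← intervalIntegral.integral_add_adjacent_intervals (hint a ⟨le_rfl, hab⟩ _ hd)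
        (hint _ hd c hcm)]
      refine (norm_add_le _ _).trans ((add_le_add (hpiece a ⟨le_rfl, hab⟩ _ hd hb.le fun t ht => ?_)
        (norm_integral_exp_le_sub (by linarith))).trans (by linarith))
      refine le_trans ?_ (neg_le_abs _)
      have := hcl t ⟨ht.1, by linarith [ht.2]⟩
      have h3 : m * h ≤ m * (c - t) := mul_le_mul_of_nonneg_left (by linarith [ht.2]) hm.le
      linarith
  rw [← intervalIntegral.integral_add_adjacent_intervals (hint a ⟨le_rfl, hab⟩ c hcm)
    (hint c hcm b ⟨hab, le_rfl⟩)]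
  calc _ ≤ 5 * h + 5 * h := (norm_add_le _ _).trans (add_le_add hleft hright)
    _ = 10 / √m := by simp only [h]; ring

/-- Conjugating the integral reverses the sign of the phase. -/
theorem norm_integral_exp_le_of_second_deriv_le {ψ ψ' ψ'' : ℝ → ℝ} {a b m : ℝ} (hab : a ≤ b)
    (h1 : ∀ x ∈ Icc a b, HasDerivAt ψ (ψ' x) x) (h2 : ∀ x ∈ Icc a b, HasDerivAt ψ' (ψ'' x) x)
    (hc : ContinuousOn ψ'' (Icc a b)) (hm : 0 < m) (hlow : ∀ x ∈ Icc a b, ψ'' x ≤ -m) :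
    ‖∫ x in a..b, Complex.exp (I * ψ x)‖ ≤ 10 / √m := by
  have := norm_integral_exp_le_of_le_second_deriv (ψ := fun x => -ψ x) hab
    (fun x hx => (h1 x hx).neg) (fun x hx => (h2 x hx).neg) hc.neg hm
    (fun x hx => by have := hlow x hx; linarith)
  rw [← RCLike.norm_conj, intervalIntegral.integral_of_le hab, ← integral_conj] at this
  rw [intervalIntegral.integral_of_le hab]
  have he : ∀ x, (starRingEnd ℂ) (Complex.exp (I * ((-ψ x : ℝ) : ℂ))) = Complex.exp (I * ψ x) := by
    intro x
    rw [← Complex.exp_conj]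
    simp
  simpa only [he] using this

end VanDerCorput

/-! ### Convolution in the angle by Fourier series. -/

section Convolution

open Complex (I)

/-- The `L²` bound for a convolution with a compactly supported kernel acting on functions supported
in an interval, in terms of the Fourier coefficients of the kernel. -/
theorem lintegral_convolution_sq_le {k h : ℝ → ℂ} {M w w' c B : ℝ} (hk : Measurable k)
    (hkM : ∀ s, ‖k s‖ ≤ M) (hkw : ∀ s, k s ≠ 0 → |s| ≤ w) (hhm : Measurable h)
    (hh : MemLp h 2 volume) (hsupp : ∀ t, h t ≠ 0 → |t - c| ≤ w') (hww : w + w' ≤ Real.pi)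
    (hw : 0 ≤ w)
    (hB : ∀ n : ℤ, ‖∫ s : ℝ, Complex.exp (-(I * n * s)) * k s‖ ≤ B) :
    ∫⁻ θ, ‖∫ t : ℝ, k (θ - t) * h t‖ₑ ^ 2 ≤ ENNReal.ofReal (B ^ 2) * ∫⁻ t, ‖h t‖ₑ ^ 2 := by
  set G : ℝ → ℂ := fun θ => ∫ t : ℝ, k (θ - t) * h t with hG
  have hpi := Real.pi_pos
  have hab : c - Real.pi < c + Real.pi := by linarith
  have hhint : Integrable h volume := by
    have hS : IsFiniteMeasure (volume.restrict (Icc (c - w') (c + w'))) := ⟨by simp⟩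
    have h1 : IntegrableOn h (Icc (c - w') (c + w')) volume :=
      (hh.restrict (Icc (c - w') (c + w'))).integrable (by norm_num)
    refine (integrableOn_iff_integrable_of_support_subset fun t ht => ?_).1 h1
    have := abs_le.1 (hsupp t ht)
    exact ⟨by linarith [this.1], by linarith [this.2]⟩
  have hjoint : Measurable (uncurry fun θ t => k (θ - t) * h t) :=
    (hk.comp (measurable_fst.sub measurable_snd)).mul (hhm.comp measurable_snd)
  have hGm : Measurable G := hjoint.stronglyMeasurable.integral_prod_right.measurable
  -- Since `w + w' ≤ π`, the convolution on the line stays in one period, and Fourier series on that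
  -- period see all of it.
  have hGsupp : ∀ θ, G θ ≠ 0 → θ ∈ Icc (c - Real.pi) (c + Real.pi) := by
    intro θ hθ
    by_contra hcon
    refine hθ (integral_eq_zero_of_ae (Filter.Eventually.of_forall fun t => ?_))
    by_contra hne
    have e1 := abs_le.1 (hkw _ (left_ne_zero_of_mul hne))
    have e2 := abs_le.1 (hsupp _ (right_ne_zero_of_mul hne))
    exact hcon ⟨by linarith [e1.1, e2.1], by linarith [e1.2, e2.2]⟩
  have hhsupp : ∀ t, h t ≠ 0 → t ∈ Icc (c - Real.pi) (c + Real.pi) := fun t ht => by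
    have e2 := abs_le.1 (hsupp _ ht)
    exact ⟨by linarith [e2.1], by linarith [e2.2]⟩
  have hM0 : 0 ≤ M := (norm_nonneg _).trans (hkM 0)
  have hGbd : ∀ θ, ‖G θ‖ ≤ M * ∫ t : ℝ, ‖h t‖ := by
    intro θ
    rw [← integral_const_mul]
    refine norm_integral_le_of_norm_le (hhint.norm.const_mul _)
      (Filter.Eventually.of_forall fun t => ?_)
    rw [norm_mul]
    exact mul_le_mul_of_nonneg_right (hkM _) (norm_nonneg _)
  have hGL2 : MemLp G 2 (volume.restrict (Ioc (c - Real.pi) (c + Real.pi))) :=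
    MemLp.of_bound hGm.aestronglyMeasurable _ (Filter.Eventually.of_forall hGbd)
  have hfour : ∀ (n : ℤ) (x : ℝ),
      (fourier (-n) (x : AddCircle (c + Real.pi - (c - Real.pi))) : ℂ) =
        Complex.exp (-(I * n * x)) := by
    intro n x
    rw [fourier_coe_apply]
    congr 1
    have : (Real.pi : ℂ) ≠ 0 := by exact_mod_cast hpi.ne'
    push_cast
    field_simp
    ring
  have hexpn : ∀ (n : ℤ) (x : ℝ), ‖Complex.exp (-(I * n * x))‖ = 1 := by
    intro n x
    have : -(I * n * x) = ((-(n * x) : ℝ) : ℂ) * I := by push_cast; ring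
    rw [this, Complex.norm_exp_ofReal_mul_I]
  have hexpm : ∀ n : ℤ, Measurable fun x : ℝ => Complex.exp (-(I * n * x)) := by
    intro n; fun_prop
  have hext : ∀ f : ℝ → ℂ, (∀ t, f t ≠ 0 → t ∈ Icc (c - Real.pi) (c + Real.pi)) →
      ∫ t in (c - Real.pi)..(c + Real.pi), f t = ∫ t : ℝ, f t := by
    intro f hf
    rw [intervalIntegral.integral_of_le hab.le, ← integral_Icc_eq_integral_Ioc]
    exact setIntegral_eq_integral_of_forall_compl_eq_zero fun t ht => by
      by_contra hne; exact ht (hf t hne)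
  have hcoef : ∀ (f : ℝ → ℂ), (∀ t, f t ≠ 0 → t ∈ Icc (c - Real.pi) (c + Real.pi)) → ∀ n : ℤ,
      fourierCoeffOn hab f n = (1 / (c + Real.pi - (c - Real.pi))) •
        ∫ t : ℝ, Complex.exp (-(I * n * t)) * f t := by
    intro f hf n
    rw [fourierCoeffOn_eq_integral]
    congr 1
    simp only [hfour, smul_eq_mul]
    exact hext _ fun t ht => hf t (right_ne_zero_of_mul ht)
  have hkint : ∀ n : ℤ, Integrable (fun s : ℝ => Complex.exp (-(I * n * s)) * k s) volume := by
    intro n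
    have h1 : IntegrableOn (fun s : ℝ => Complex.exp (-(I * n * s)) * k s) (Icc (-w) w) volume := by
      refine Measure.integrableOn_of_bounded (M := M) (by simp)
        ((hexpm n).mul hk).aestronglyMeasurable (Filter.Eventually.of_forall fun s => ?_)
      rw [norm_mul, hexpn, one_mul]
      exact hkM s
    refine (integrableOn_iff_integrable_of_support_subset fun s hs => ?_).1 h1
    exact abs_le.1 (hkw s (right_ne_zero_of_mul hs))
  -- The convolution theorem at integer frequencies.
  have hmult : ∀ n : ℤ, ∫ θ : ℝ, Complex.exp (-(I * n * θ)) * G θ =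
      (∫ s : ℝ, Complex.exp (-(I * n * s)) * k s) * ∫ t : ℝ, Complex.exp (-(I * n * t)) * h t := by
    intro n
    have hhn : Integrable (fun t : ℝ => Complex.exp (-(I * n * t)) * h t) volume :=
      hhint.bdd_mul (c := 1) (hexpm n).aestronglyMeasurable
        (Filter.Eventually.of_forall fun t => (hexpn n t).le)
    have hprod := (hhn.convolution_integrand (ContinuousLinearMap.mul ℂ ℂ) (hkint n))
    have hEE : ∀ θ t : ℝ, Complex.exp (-(I * n * t)) * Complex.exp (-(I * n * ((θ - t : ℝ) : ℂ))) =
        Complex.exp (-(I * n * θ)) := by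
      intro θ t
      rw [← Complex.exp_add]
      congr 1
      push_cast
      ring
    calc ∫ θ : ℝ, Complex.exp (-(I * n * θ)) * G θ
        = ∫ θ : ℝ, ∫ t : ℝ, (Complex.exp (-(I * n * t)) * h t) *
            (Complex.exp (-(I * n * ((θ - t : ℝ) : ℂ))) * k (θ - t)) := by
          refine integral_congr_ae (Filter.Eventually.of_forall fun θ => ?_)
          simp only [hG]
          rw [← integral_const_mul]
          refine integral_congr_ae (Filter.Eventually.of_forall fun t => ?_)
          simp only
          rw [← hEE θ t]
          ring
      _ = ∫ t : ℝ, ∫ θ : ℝ, (Complex.exp (-(I * n * t)) * h t) *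
            (Complex.exp (-(I * n * ((θ - t : ℝ) : ℂ))) * k (θ - t)) :=
          integral_integral_swap hprod
      _ = ∫ t : ℝ, (Complex.exp (-(I * n * t)) * h t) *
            ∫ s : ℝ, Complex.exp (-(I * n * s)) * k s := by
          refine integral_congr_ae (Filter.Eventually.of_forall fun t => ?_)
          simp only
          rw [integral_const_mul]
          congr 1
          exact integral_sub_right_eq_self (fun s : ℝ => Complex.exp (-(I * n * s)) * k s) t
      _ = _ := by rw [integral_mul_const, mul_comm]
  -- Parseval on the period, compared frequency by frequency.
  have hle : ∫ t in (c - Real.pi)..(c + Real.pi), ‖G t‖ ^ 2 ≤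
      B ^ 2 * ∫ t in (c - Real.pi)..(c + Real.pi), ‖h t‖ ^ 2 := by
    have s1 := hasSum_sq_fourierCoeffOn hab hGL2
    have s2 := (hasSum_sq_fourierCoeffOn hab
      (hh.restrict (Ioc (c - Real.pi) (c + Real.pi)))).mul_left (B ^ 2)
    have := hasSum_le (fun n => ?_) s1 s2
    · simp only [smul_eq_mul] at this
      have h2p : 0 < (c + Real.pi - (c - Real.pi))⁻¹ := inv_pos.2 (by linarith)
      rw [mul_left_comm] at this
      exact le_of_mul_le_mul_left this h2p
    · rw [hcoef G hGsupp, hcoef h hhsupp, hmult, norm_smul, norm_smul, norm_mul, ← mul_pow]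
      have : ∀ x y z : ℝ, x * (y * z) = y * (x * z) := fun x y z => by ring
      rw [this]
      gcongr
      exact hB n
  have hconv : ∀ f : ℝ → ℂ, MemLp f 2 (volume.restrict (Ioc (c - Real.pi) (c + Real.pi))) →
      (∀ t, f t ≠ 0 → t ∈ Icc (c - Real.pi) (c + Real.pi)) →
      ∫⁻ t, ‖f t‖ₑ ^ 2 = ENNReal.ofReal (∫ t in (c - Real.pi)..(c + Real.pi), ‖f t‖ ^ 2) := by
    intro f hf hfs
    rw [intervalIntegral.integral_of_le hab.le,
      ofReal_integral_eq_lintegral_ofReal (hf.integrable_norm_pow (by norm_num))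
        (Filter.Eventually.of_forall fun t => sq_nonneg _)]
    have : ∀ t, ENNReal.ofReal (‖f t‖ ^ 2) = ‖f t‖ₑ ^ 2 := fun t => by
      rw [ENNReal.ofReal_pow (norm_nonneg _), ofReal_norm]
    simp only [this]
    rw [setLIntegral_congr Ioc_ae_eq_Icc, ← lintegral_indicator measurableSet_Icc]
    refine lintegral_congr fun t => ?_
    by_cases ht : t ∈ Icc (c - Real.pi) (c + Real.pi)
    · rw [indicator_of_mem ht]
    · rw [indicator_of_notMem ht]
      have : f t = 0 := by by_contra hne; exact ht (hfs t hne)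
      simp [this]
  rw [hconv G hGL2 hGsupp, hconv h (hh.restrict _) hhsupp, ← ENNReal.ofReal_mul (sq_nonneg _)]
  exact ENNReal.ofReal_le_ofReal hle

end Convolution

/-! ### The `L²` bound on sectors, in polar coordinates. -/

section Polar

open Complex (I)

theorem measurable_polarCoord_symm : Measurable (Complex.polarCoord.symm : ℝ × ℝ → ℂ) := by
  have : (Complex.polarCoord.symm : ℝ × ℝ → ℂ) =
      fun p => p.1 * (Real.cos p.2 + Real.sin p.2 * Complex.I) := by
    ext p; exact Complex.polarCoord_symm_apply p
  rw [this]
  fun_prop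

theorem measurableSet_polarCoord_target : MeasurableSet polarCoord.target :=
  polarCoord.open_target.measurableSet

/-- The factor `√r` absorbs the polar Jacobian, so the change of coordinates is an `L²` isometry. -/
theorem eLpNorm_polar (F : ℂ → ℂ) :
    eLpNorm (polarCoord.target.indicator
      fun p : ℝ × ℝ => (√p.1 : ℂ) * F (Complex.polarCoord.symm p)) 2 volume =
      eLpNorm F 2 volume := by
  rw [eLpNorm_eq_lintegral_rpow_enorm_toReal (by norm_num) (by norm_num),
    eLpNorm_eq_lintegral_rpow_enorm_toReal (by norm_num) (by norm_num),
    ← Complex.lintegral_comp_polarCoord_symm, ← lintegral_indicator measurableSet_polarCoord_target]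
  congr 2
  ext p
  by_cases hp : p ∈ polarCoord.target
  · rw [indicator_of_mem hp, indicator_of_mem hp]
    have hp1 : 0 < p.1 := hp.1
    simp only [ENNReal.toReal_ofNat, ENNReal.rpow_ofNat, enorm_mul, mul_pow, smul_eq_mul]
    congr 1
    rw [← ofReal_norm, Complex.norm_real, Real.norm_eq_abs, abs_of_nonneg (Real.sqrt_nonneg _),
      ← ENNReal.ofReal_pow (Real.sqrt_nonneg _), Real.sq_sqrt hp1.le]
  · rw [indicator_of_notMem hp, indicator_of_notMem hp]
    simp

/-- `L²` bounds in polar coordinates. -/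
theorem KerBound.of_polar {k : ℂ → ℂ → ℂ} {B : ℝ≥0∞}
    (h : KerBound (cut (fun p p' : ℝ × ℝ => p ∈ polarCoord.target ∧ p' ∈ polarCoord.target)
      (fun p p' => (√p.1 * √p'.1 : ℂ) *
        k (Complex.polarCoord.symm p) (Complex.polarCoord.symm p'))) 2 2 B) :
    KerBound k 2 2 B := by
  refine KerBound.of_measurable fun f hfm hf => ?_
  set g : ℝ × ℝ → ℂ := polarCoord.target.indicator
      fun p : ℝ × ℝ => (√p.1 : ℂ) * f (Complex.polarCoord.symm p) with hg
  have hgm : Measurable g := by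
    refine Measurable.indicator ?_ measurableSet_polarCoord_target
    exact (by fun_prop : Measurable fun p : ℝ × ℝ => (√p.1 : ℂ)).mul
      (hfm.comp measurable_polarCoord_symm)
  have hgL : MemLp g 2 volume := ⟨hgm.aestronglyMeasurable, by rw [hg, eLpNorm_polar]; exact hf.2⟩
  have key := h g hgL
  rw [hg, eLpNorm_polar, ← hg] at key
  rw [← eLpNorm_polar (kop k f)]
  refine (congrArg (fun F => eLpNorm F 2 volume) ?_).trans_le key
  ext p
  by_cases hp : p ∈ polarCoord.target
  · rw [indicator_of_mem hp]
    simp only [kop]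
    rw [← Complex.integral_comp_polarCoord_symm, ← integral_const_mul,
      ← integral_indicator measurableSet_polarCoord_target]
    refine integral_congr_ae (Filter.Eventually.of_forall fun p' => ?_)
    simp only
    by_cases hp' : p' ∈ polarCoord.target
    · have hp1 : 0 < p'.1 := hp'.1
      rw [cut_of_pos ⟨hp, hp'⟩, hg, indicator_of_mem hp', indicator_of_mem hp', Complex.real_smul]
      have : (p'.1 : ℂ) = (√p'.1 : ℂ) * (√p'.1 : ℂ) := by
        rw [← Complex.ofReal_mul, Real.mul_self_sqrt hp1.le]
      rw [this]
      ring
    · rw [indicator_of_notMem hp', cut_of_neg fun hc => hp' hc.2, zero_mul]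
  · rw [indicator_of_notMem hp]
    refine (integral_eq_zero_of_ae (Filter.Eventually.of_forall fun p' => ?_)).symm
    simp only [Pi.zero_apply]
    rw [cut_of_neg fun hc => hp hc.1, zero_mul]

/-- The law of cosines with a plus sign: for points of a common narrow sector `|x + y|` stays smooth
when the two points coincide away from the origin, unlike `|x - y|`. -/
theorem norm_polar_add (r₁ r₂ s t : ℝ) :
    ‖Complex.polarCoord.symm (r₁, s) + Complex.polarCoord.symm (r₂, t)‖ =
      √(r₁ ^ 2 + r₂ ^ 2 + 2 * (r₁ * r₂) * Real.cos (s - t)) := by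
  rw [Complex.norm_def, Complex.normSq_apply]
  congr 1
  simp only [Complex.polarCoord_symm_apply, Complex.add_re, Complex.mul_re, Complex.ofReal_re,
    Complex.ofReal_im, Complex.add_im, Complex.mul_im, Complex.I_re, Complex.I_im, Real.cos_sub]
  linear_combination r₁ ^ 2 * Real.sin_sq_add_cos_sq s + r₂ ^ 2 * Real.sin_sq_add_cos_sq t

theorem arg_polarCoord_symm {p : ℝ × ℝ} (hp : p ∈ polarCoord.target) :
    (Complex.polarCoord.symm p).arg = p.2 := by
  rw [Complex.polarCoord_symm_apply]
  have := Complex.arg_mul_cos_add_sin_mul_I (r := p.1) hp.1 (θ := p.2) ⟨hp.2.1, hp.2.2.le⟩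
  simpa using this

/-- The angular frequency `n` enters the phase linearly and drops out of the second derivative,
which is at most `-μ r₁ r₂ / (4 R)` for `|s| ≤ π/4`. Van der Corput's bound degenerates like `(r₁
r₂)^(-1/2)` as the radii shrink, and the factor `√(r₁ r₂)` from the Jacobian cancels this exactly.
The lower endpoint `a` is free, so a sharp one-sided angular cut costs nothing. -/
theorem norm_integral_polar_phase_le {R r₁ r₂ μ : ℝ} (h1 : 0 < r₁) (h1R : r₁ ≤ R) (h2 : 0 < r₂)
    (h2R : r₂ ≤ R) (hμ : 0 < μ) (n : ℤ) {a : ℝ} (ha : -(Real.pi / 4) ≤ a) :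
    ‖∫ s : ℝ, Complex.exp (-(I * n * s)) * (Ioc a (Real.pi / 4)).indicator (fun s : ℝ =>
      (√(r₁ * r₂) : ℂ) * Complex.exp (I * (μ * √(r₁ ^ 2 + r₂ ^ 2 + 2 * (r₁ * r₂) * Real.cos s) : ℝ)))
        s‖ ≤ 20 * √R / √μ := by
  have hR : 0 < R := h1.trans_le h1R
  have hpi := Real.pi_pos
  rcases le_or_gt (Real.pi / 4) a with hab | hab
  · have : Ioc a (Real.pi / 4) = ∅ := Ioc_eq_empty (not_lt.2 hab)
    simp only [this, indicator_empty, mul_zero, integral_zero, norm_zero]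
    positivity
  set b := r₁ * r₂
  have hb : 0 < b := mul_pos h1 h2
  set Q : ℝ → ℝ := fun s => r₁ ^ 2 + r₂ ^ 2 + 2 * b * Real.cos s
  set d : ℝ → ℝ := fun s => √(Q s)
  set ψ : ℝ → ℝ := fun s => μ * d s - n * s
  have hcos : ∀ s ∈ Icc a (Real.pi / 4), 1 / 2 ≤ Real.cos s := by
    intro s hs
    have : Real.cos (Real.pi / 3) ≤ Real.cos |s| := by
      refine Real.cos_le_cos_of_nonneg_of_le_pi (abs_nonneg _) (by linarith) ?_
      exact abs_le.2 ⟨by linarith [hs.1], by linarith [hs.2]⟩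
    rwa [Real.cos_pi_div_three, Real.cos_abs] at this
  have hQ : ∀ s ∈ Icc a (Real.pi / 4), 0 < Q s := by
    intro s hs
    have := hcos s hs
    have : 0 ≤ 2 * b * Real.cos s := by positivity
    simp only [Q]
    positivity
  have hQle : ∀ s, d s ≤ 2 * R := by
    intro s
    refine Real.sqrt_le_iff.2 ⟨by linarith, ?_⟩
    have hc := Real.cos_le_one s
    have : 2 * b * Real.cos s ≤ 2 * b := by nlinarith
    have e1 : r₁ ^ 2 ≤ R ^ 2 := by gcongr
    have e2 : r₂ ^ 2 ≤ R ^ 2 := by gcongr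
    have e3 : b ≤ R * R := mul_le_mul h1R h2R h2.le hR.le
    simp only [Q]
    nlinarith
  have hdpos : ∀ s ∈ Icc a (Real.pi / 4), 0 < d s := fun s hs => Real.sqrt_pos.2 (hQ s hs)
  have hQd : ∀ s, HasDerivAt Q (-(2 * b * Real.sin s)) s := by
    intro s
    have := ((Real.hasDerivAt_cos s).const_mul (2 * b)).const_add (r₁ ^ 2 + r₂ ^ 2)
    exact this.congr_deriv (by ring)
  have hdd : ∀ s ∈ Icc a (Real.pi / 4), HasDerivAt d (-(b * Real.sin s) / d s) s := by
    intro s hs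
    refine ((hQd s).sqrt (hQ s hs).ne').congr_deriv ?_
    have := hdpos s hs
    change -(2 * b * Real.sin s) / (2 * d s) = _
    field_simp
  set ψ'' : ℝ → ℝ := fun s => μ * (-(b * Real.cos s) / d s - (b * Real.sin s) ^ 2 / d s ^ 3)
  have hψ1 : ∀ s ∈ Icc a (Real.pi / 4), HasDerivAt ψ (μ * (-(b * Real.sin s) / d s) - n) s := by
    intro s hs
    exact (((hdd s hs).const_mul μ).sub ((hasDerivAt_id s).const_mul (n : ℝ))).congr_deriv
      (by ring)
  have hψ2 : ∀ s ∈ Icc a (Real.pi / 4),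
      HasDerivAt (fun s => μ * (-(b * Real.sin s) / d s) - n) (ψ'' s) s := by
    intro s hs
    have hne := (hdpos s hs).ne'
    have e1 := (((Real.hasDerivAt_sin s).const_mul b).neg.div (hdd s hs) hne).const_mul μ
    refine (e1.sub_const (n : ℝ)).congr_deriv ?_
    simp only [ψ'', Pi.neg_apply]
    field_simp
  have hdc : ContinuousOn d (Icc a (Real.pi / 4)) := fun s hs =>
    (hdd s hs).continuousAt.continuousWithinAt
  have hψc : ContinuousOn ψ'' (Icc a (Real.pi / 4)) := by
    refine continuousOn_const.mul (ContinuousOn.sub ?_ ?_)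
    · exact ContinuousOn.div (by fun_prop) hdc fun s hs => (hdpos s hs).ne'
    · exact ContinuousOn.div (by fun_prop) (hdc.pow 3) fun s hs => pow_ne_zero 3 (hdpos s hs).ne'
  have hm : 0 < μ * b / (4 * R) := by positivity
  have hlow : ∀ s ∈ Icc a (Real.pi / 4), ψ'' s ≤ -(μ * b / (4 * R)) := by
    intro s hs
    have hd := hdpos s hs
    have e1 : 0 ≤ (b * Real.sin s) ^ 2 / d s ^ 3 := by positivity
    have e2 : b / (4 * R) ≤ b * Real.cos s / d s := by
      rw [div_le_div_iff₀ (by positivity) hd]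
      have := hcos s hs
      have h3 := hQle s
      calc b * d s ≤ b * (2 * R) := by gcongr
        _ = b * (1 / 2) * (4 * R) := by ring
        _ ≤ b * Real.cos s * (4 * R) := by gcongr
    have : ψ'' s = -(μ * (b * Real.cos s / d s + (b * Real.sin s) ^ 2 / d s ^ 3)) := by
      simp only [ψ'']; ring
    rw [this, neg_le_neg_iff, show μ * b / (4 * R) = μ * (b / (4 * R)) from mul_div_assoc _ _ _]
    have e3 : b / (4 * R) ≤ b * Real.cos s / d s + (b * Real.sin s) ^ 2 / d s ^ 3 :=
      e2.trans (le_add_of_nonneg_right e1)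
    exact mul_le_mul_of_nonneg_left e3 hμ.le
  have hvdc := norm_integral_exp_le_of_second_deriv_le hab.le hψ1 hψ2 hψc hm hlow
  have heq : ∫ s : ℝ, Complex.exp (-(I * n * s)) * (Ioc a (Real.pi / 4)).indicator (fun s : ℝ =>
      (√b : ℂ) * Complex.exp (I * (μ * √(Q s) : ℝ))) s =
      (√b : ℂ) * ∫ s in a..(Real.pi / 4), Complex.exp (I * ψ s) := by
    rw [intervalIntegral.integral_of_le hab.le, ← integral_const_mul,
      ← integral_indicator measurableSet_Ioc]
    refine integral_congr_ae (Filter.Eventually.of_forall fun s => ?_)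
    by_cases hs : s ∈ Ioc a (Real.pi / 4)
    · simp only [indicator_of_mem hs]
      rw [mul_left_comm, ← Complex.exp_add]
      congr 2
      simp only [ψ, d]
      push_cast
      ring
    · simp only [indicator_of_notMem hs, mul_zero]
  change ‖∫ s : ℝ, Complex.exp (-(I * n * s)) * (Ioc a (Real.pi / 4)).indicator (fun s : ℝ =>
      (√b : ℂ) * Complex.exp (I * (μ * √(Q s) : ℝ))) s‖ ≤ _
  rw [heq, norm_mul, Complex.norm_real, Real.norm_eq_abs, abs_of_nonneg (Real.sqrt_nonneg _)]
  refine (mul_le_mul_of_nonneg_left hvdc (Real.sqrt_nonneg _)).trans_eq ?_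
  have halg : ∀ b : ℝ, 0 < b → √b * (10 / √(μ * b / (4 * R))) = 20 * √R / √μ := by
    intro b hb
    rw [Real.sqrt_div (by positivity), Real.sqrt_mul hμ.le, Real.sqrt_mul (by norm_num),
      show (4 : ℝ) = 2 ^ 2 by norm_num, Real.sqrt_sq (by norm_num)]
    have : 0 < √b := Real.sqrt_pos.2 hb
    have : 0 < √μ := Real.sqrt_pos.2 hμ
    have : 0 < √R := Real.sqrt_pos.2 hR
    field_simp
    norm_num
  exact halg b hb

/-- The condition describing pairs of points of a sector with a one-sided angular restriction. -/
def sectorPair (R c t : ℝ) (x y : ℂ) : Prop :=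
  ‖x‖ ≤ R ∧ ‖y‖ ≤ R ∧ |x.arg - c| < Real.pi / 8 ∧ |y.arg - c| < Real.pi / 8 ∧ t < x.arg - y.arg

theorem measurableSet_sectorPair (R c t : ℝ) :
    MeasurableSet {z : ℂ × ℂ | sectorPair R c t z.1 z.2} := by
  have m1 : Measurable fun z : ℂ × ℂ => z.1.arg := Complex.measurable_arg.comp measurable_fst
  have m2 : Measurable fun z : ℂ × ℂ => z.2.arg := Complex.measurable_arg.comp measurable_snd
  have h1 : Measurable fun z : ℂ × ℂ => |z.1.arg - c| := (m1.sub_const c).norm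
  have h2 : Measurable fun z : ℂ × ℂ => |z.2.arg - c| := (m2.sub_const c).norm
  have h3 : Measurable fun z : ℂ × ℂ => z.1.arg - z.2.arg := m1.sub m2
  exact (measurableSet_le measurable_fst.norm measurable_const).inter
    ((measurableSet_le measurable_snd.norm measurable_const).inter
    ((measurableSet_lt h1 measurable_const).inter
    ((measurableSet_lt h2 measurable_const).inter (measurableSet_lt measurable_const h3))))

/-- The angles of the sector of aperture `π / 4` around the direction `c`. -/
def sectorAngles (c : ℝ) : Set ℝ := {θ | |θ - c| < Real.pi / 8 ∧ θ ∈ Ioo (-Real.pi) Real.pi}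

theorem measurableSet_sectorAngles (c : ℝ) : MeasurableSet (sectorAngles c) :=
  (measurableSet_lt (measurable_id.sub_const c).norm measurable_const).inter measurableSet_Ioo

/-- The condition `sectorPair` in polar coordinates. -/
def polarPair (R c t : ℝ) (p p' : ℝ × ℝ) : Prop :=
  (p.1 ∈ Ioc 0 R ∧ p.2 ∈ sectorAngles c) ∧
    (p'.1 ∈ Ioc 0 R ∧ p'.2 ∈ sectorAngles c) ∧ t < p.2 - p'.2

/-- The oscillatory kernel of a sector in polar coordinates. -/
def polarKer (μ R c t : ℝ) : ℝ × ℝ → ℝ × ℝ → ℂ :=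
  cut (polarPair R c t)
    (fun p p' => (√(p.1 * p'.1) : ℂ) * Complex.exp (I * (μ *
      √(p.1 ^ 2 + p'.1 ^ 2 + 2 * (p.1 * p'.1) * Real.cos (p.2 - p'.2)) : ℝ)))

theorem adm_polarKer (μ R c t : ℝ) : Adm (polarKer μ R c t) where
  meas := by
    refine measurable_cut ?_ (by unfold uncurry; fun_prop)
    refine MeasurableSet.inter ?_ (MeasurableSet.inter ?_ ?_)
    · exact (measurable_fst.comp measurable_fst measurableSet_Ioc).inter
        (measurable_snd.comp measurable_fst (measurableSet_sectorAngles c))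
    · exact (measurable_fst.comp measurable_snd measurableSet_Ioc).inter
        (measurable_snd.comp measurable_snd (measurableSet_sectorAngles c))
    · have : Measurable fun z : (ℝ × ℝ) × (ℝ × ℝ) => z.1.2 - z.2.2 := by fun_prop
      exact measurableSet_lt measurable_const this
  bdd := by
    refine ⟨√(R * R), fun p p' => ?_⟩
    by_cases h : polarPair R c t p p'
    · rw [polarKer, cut_of_pos h, norm_mul, mul_comm I, Complex.norm_exp_ofReal_mul_I, mul_one,
        Complex.norm_real, Real.norm_eq_abs, abs_of_nonneg (Real.sqrt_nonneg _)]
      exact Real.sqrt_le_sqrt (mul_le_mul h.1.1.2 h.2.1.1.2 h.2.1.1.1.le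
        (h.1.1.1.le.trans h.1.1.2))
    · rw [polarKer, cut_of_neg h]
      simp
  supp := by
    intro p
    have hsub : support (polarKer μ R c t p) ⊆ Ioc 0 R ×ˢ Ioo (-Real.pi) Real.pi := by
      intro p' hp'
      by_contra hcon
      refine hp' (cut_of_neg fun h => hcon ⟨h.2.1.1, h.2.1.2.2⟩)
    refine (measure_mono hsub).trans_lt ?_
    rw [Measure.volume_eq_prod, Measure.prod_prod]
    simp [ENNReal.mul_lt_top_iff]

/-- For fixed radii the operator is a convolution in the angle with multiplier at most `20 √R / √μ`;
integrating the square over `r₁ ∈ (0, R]` supplies the other `√R`. -/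
theorem KerBound.polar_slice {R μ c t r₂ : ℝ} (hμ : 0 < μ) (h2 : 0 < r₂) (h2R : r₂ ≤ R) :
    KerBound (fun (p : ℝ × ℝ) (θ : ℝ) => polarKer μ R c t p (r₂, θ)) 2 2
      (ENNReal.ofReal (20 * R / √μ)) := by
  have hR : 0 < R := h2.trans_le h2R
  have hpi := Real.pi_pos
  refine KerBound.of_measurable fun f hfm hf => ?_
  have hS := measurableSet_sectorAngles c
  set h : ℝ → ℂ := (sectorAngles c).indicator f
  have hh : MemLp h 2 volume := hf.indicator hS
  have hhm : Measurable h := hfm.indicator hS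
  -- Angles within `π/8` of `c` differ by less than `π/4`, so the condition `t < θ - θ'` becomes
  -- membership in `Ioc a (π/4)`.
  set a := max t (-(Real.pi / 4))
  set k1 : ℝ → ℝ → ℂ := fun r₁ => (Ioc a (Real.pi / 4)).indicator fun s : ℝ =>
      (√(r₁ * r₂) : ℂ) * Complex.exp (I * (μ * √(r₁ ^ 2 + r₂ ^ 2 + 2 * (r₁ * r₂) * Real.cos s) : ℝ))
  have hk1m : ∀ r₁, Measurable (k1 r₁) := fun r₁ =>
    Measurable.indicator (by fun_prop) measurableSet_Ioc
  have hk1b : ∀ r₁ s, ‖k1 r₁ s‖ ≤ √(r₁ * r₂) := by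
    intro r₁ s
    refine (norm_indicator_le_norm_self _ _).trans ?_
    rw [norm_mul, mul_comm I, Complex.norm_exp_ofReal_mul_I, mul_one, Complex.norm_real,
      Real.norm_eq_abs, abs_of_nonneg (Real.sqrt_nonneg _)]
  have hconv : ∀ r₁, 0 < r₁ → r₁ ≤ R → ∫⁻ θ, ‖∫ θ', k1 r₁ (θ - θ') * h θ'‖ₑ ^ 2 ≤
      ENNReal.ofReal ((20 * √R / √μ) ^ 2) * ∫⁻ θ, ‖h θ‖ₑ ^ 2 := by
    intro r₁ h1 h1R
    refine lintegral_convolution_sq_le (M := √(r₁ * r₂)) (w := Real.pi / 4) (w' := Real.pi / 8)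
      (c := c) (hk1m r₁) (hk1b r₁) (fun s hs => ?_) hhm hh (fun s hs => ?_)
      (by linarith) (by linarith) fun n => ?_
    · have : s ∈ Ioc a (Real.pi / 4) := mem_of_indicator_ne_zero hs
      exact abs_le.2 ⟨(le_max_right _ _).trans this.1.le, this.2⟩
    · exact (mem_of_indicator_ne_zero hs : s ∈ sectorAngles c).1.le
    · exact norm_integral_polar_phase_le h1 h1R h2 h2R hμ n (le_max_right _ _)
  set T : ℝ × ℝ → ℂ := kop (fun (p : ℝ × ℝ) (θ : ℝ) => polarKer μ R c t p (r₂, θ)) f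
  have hT0 : ∀ p, ¬ (p.1 ∈ Ioc 0 R ∧ p.2 ∈ sectorAngles c) → T p = 0 := by
    intro p hr
    refine integral_eq_zero_of_ae (Filter.Eventually.of_forall fun θ' => ?_)
    simp only [Pi.zero_apply, polarKer]
    rw [cut_of_neg fun hc => hr hc.1, zero_mul]
  have hT1 : ∀ r₁ θ, r₁ ∈ Ioc 0 R → ‖T (r₁, θ)‖ₑ ≤ ‖∫ θ', k1 r₁ (θ - θ') * h θ'‖ₑ := by
    intro r₁ θ hr
    by_cases hθ : θ ∈ sectorAngles c
    · refine le_of_eq (congrArg _ ?_)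
      refine integral_congr_ae (Filter.Eventually.of_forall fun θ' => ?_)
      simp only [h, polarKer]
      by_cases hθ' : θ' ∈ sectorAngles c
      · rw [indicator_of_mem hθ']
        congr 1
        have e1 := abs_lt.1 hθ.1
        have e2 := abs_lt.1 hθ'.1
        by_cases hc : t < θ - θ'
        · have hm : θ - θ' ∈ Ioc a (Real.pi / 4) := ⟨max_lt hc (by linarith), by linarith⟩
          simp only [k1]
          rw [cut_of_pos ⟨⟨hr, hθ⟩, ⟨⟨h2, h2R⟩, hθ'⟩, hc⟩, indicator_of_mem hm]
        · have hm : θ - θ' ∉ Ioc a (Real.pi / 4) := fun h' => hc ((le_max_left _ _).trans_lt h'.1)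
          simp only [k1]
          rw [cut_of_neg fun h' => hc h'.2.2, indicator_of_notMem hm]
      · rw [indicator_of_notMem hθ', mul_zero, cut_of_neg fun h' => hθ' h'.2.1.2, zero_mul]
    · rw [hT0 (r₁, θ) fun h' => hθ h'.2]
      simp
  have hTm : Measurable T := by
    have hm : Measurable (uncurry fun (p : ℝ × ℝ) θ => polarKer μ R c t p (r₂, θ) * f θ) := by
      refine Measurable.mul ?_ (hfm.comp measurable_snd)
      exact (adm_polarKer μ R c t).meas.comp
        (measurable_fst.prodMk (measurable_const.prodMk measurable_snd))
    exact hm.stronglyMeasurable.integral_prod_right.measurable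
  have hsq : ∀ (Z : Type) [MeasureSpace Z] (g : Z → ℂ),
      eLpNorm g 2 volume ^ (2 : ℝ) = ∫⁻ z, ‖g z‖ₑ ^ 2 := by
    intro Z _ g
    have := eLpNorm_rpow_toReal (μ := (volume : Measure Z)) (q := 2) (by norm_num) (by norm_num) g
    simpa using this
  rw [← ENNReal.rpow_le_rpow_iff (z := 2) (by norm_num), ENNReal.mul_rpow_of_nonneg _ _ (by norm_num),
    hsq, hsq]
  calc ∫⁻ p, ‖T p‖ₑ ^ 2 = ∫⁻ r₁, ∫⁻ θ, ‖T (r₁, θ)‖ₑ ^ 2 := by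
        rw [Measure.volume_eq_prod, lintegral_prod _ (hTm.enorm.pow_const _).aemeasurable]
    _ ≤ ∫⁻ r₁, (Ioc 0 R).indicator (fun _ => ENNReal.ofReal ((20 * √R / √μ) ^ 2) *
          ∫⁻ θ, ‖f θ‖ₑ ^ 2) r₁ := by
        refine lintegral_mono fun r₁ => ?_
        by_cases hr : r₁ ∈ Ioc 0 R
        · rw [indicator_of_mem hr]
          calc _ ≤ ∫⁻ θ, ‖∫ θ', k1 r₁ (θ - θ') * h θ'‖ₑ ^ 2 := by
                gcongr with θ
                exact hT1 r₁ θ hr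
            _ ≤ _ := hconv r₁ hr.1 hr.2
            _ ≤ _ := by
                gcongr with θ
                exact enorm_indicator_le_enorm_self _ _
        · rw [indicator_of_notMem hr]
          simp [hT0 (r₁, _) fun h' => hr h'.1]
    _ = ENNReal.ofReal ((20 * √R / √μ) ^ 2) * (∫⁻ θ, ‖f θ‖ₑ ^ 2) * ENNReal.ofReal R := by
        rw [lintegral_indicator measurableSet_Ioc, lintegral_const, Measure.restrict_apply_univ,
          Real.volume_Ioc, sub_zero]
    _ = _ := by
        rw [mul_right_comm, ← ENNReal.ofReal_mul (sq_nonneg _),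
          ENNReal.ofReal_rpow_of_nonneg (by positivity) (by norm_num)]
        congr 2
        rw [div_pow, mul_pow, Real.sq_sqrt hR.le, Real.rpow_ofNat]
        ring

/-- The `L²` bound for the kernel `e^{iμ|x+y|}` on pairs of points of a sector, with a one-sided
restriction on the angle. -/
theorem KerBound.sector {R μ : ℝ} (hR : 0 < R) (hμ : 0 < μ) (c t : ℝ) :
    KerBound (cut (sectorPair R c t) fun x y => Complex.exp (I * (μ * ‖x + y‖ : ℝ))) 2 2
      (ENNReal.ofReal (20 * R / √μ * √R)) := by
  refine KerBound.of_polar ?_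
  -- Cauchy-Schwarz in the radius of the input, which runs over an interval of length `R`,
  -- contributes `√R`.
  have hfr := KerBound.freeze (adm_polarKer μ R c t) (I := Ioc 0 R) measurableSet_Ioc
    (fun x r y hne => by
      by_contra hcon
      exact hne (cut_of_neg fun h => hcon h.2.1.1)) (p := 2) (q := 2)
    (B := ENNReal.ofReal (20 * R / √μ)) (by norm_num) (by norm_num) (by norm_num) (by norm_num)
    (fun r hr => KerBound.polar_slice hμ hr.1 hr.2)
  have hB : ENNReal.ofReal (20 * R / √μ * √R) =
      ENNReal.ofReal (20 * R / √μ) * volume (Ioc 0 R) ^ (1 - 1 / (2 : ℝ≥0∞).toReal) := by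
    rw [ENNReal.ofReal_mul (by positivity), Real.volume_Ioc, sub_zero,
      ENNReal.ofReal_rpow_of_pos hR, Real.sqrt_eq_rpow R]
    norm_num
  rw [hB]
  refine hfr.congr fun p => Filter.Eventually.of_forall fun p' => ?_
  by_cases hT : p ∈ polarCoord.target ∧ p' ∈ polarCoord.target
  · have hp1 : 0 < p.1 := hT.1.1
    have hp2 : 0 < p'.1 := hT.2.1
    rw [cut_of_pos (P := fun p p' : ℝ × ℝ => p ∈ polarCoord.target ∧ p' ∈ polarCoord.target) hT]
    by_cases hc : polarPair R c t p p'
    · rw [polarKer, cut_of_pos hc, cut_of_pos, norm_polar_add, Real.sqrt_mul hp1.le]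
      · push_cast
        rfl
      · rw [sectorPair, arg_polarCoord_symm hT.1, arg_polarCoord_symm hT.2,
          Complex.norm_polarCoord_symm, Complex.norm_polarCoord_symm, abs_of_pos hp1,
          abs_of_pos hp2]
        exact ⟨hc.1.1.2, hc.2.1.1.2, hc.1.2.1, hc.2.1.2.1, hc.2.2⟩
    · rw [polarKer, cut_of_neg hc, cut_of_neg, mul_zero]
      rw [sectorPair, arg_polarCoord_symm hT.1, arg_polarCoord_symm hT.2,
        Complex.norm_polarCoord_symm, Complex.norm_polarCoord_symm, abs_of_pos hp1, abs_of_pos hp2]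
      rintro ⟨h1, h2, h3, h4, h5⟩
      exact hc ⟨⟨⟨hp1, h1⟩, h3, hT.1.2⟩, ⟨⟨hp2, h2⟩, h4, hT.2.2⟩, h5⟩
  · rw [cut_of_neg (P := fun p p' : ℝ × ℝ => p ∈ polarCoord.target ∧ p' ∈ polarCoord.target) hT,
      polarKer, cut_of_neg]
    rintro ⟨h1, h2, -⟩
    exact hT ⟨⟨h1.1.1, h1.2.2⟩, ⟨h2.1.1, h2.2.2⟩⟩

end Polar

/-! ### Quantitative derivative bounds and nonstationary phase. -/

section Jets

variable {F : Type*} [NormedRing F] [NormedAlgebra ℝ F]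

/-- On `s` the function `f` has `n` derivatives, all bounded by `M`, and the derivatives of order
less than `n` vanish on `Z`. -/
def JetBound (s Z : Set ℝ) : ℕ → ℝ → (ℝ → F) → Prop
  | 0, M, f => ContinuousOn f s ∧ ∀ x ∈ s, ‖f x‖ ≤ M
  | n + 1, M, f => (∀ x ∈ s, ‖f x‖ ≤ M) ∧ (∀ x ∈ Z, f x = 0) ∧
      ∃ f' : ℝ → F, (∀ x ∈ s, HasDerivAt f (f' x) x) ∧ JetBound s Z n M f'

variable {s Z : Set ℝ} {n : ℕ} {M M' : ℝ} {f g : ℝ → F}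

theorem JetBound.continuousOn (h : JetBound s Z n M f) : ContinuousOn f s := by
  cases n with
  | zero => exact h.1
  | succ n =>
    obtain ⟨-, -, f', hf', -⟩ := h
    exact fun x hx => (hf' x hx).continuousAt.continuousWithinAt

theorem JetBound.mono (h : JetBound s Z n M f) (hM : M ≤ M') : JetBound s Z n M' f := by
  induction n generalizing f with
  | zero => exact ⟨h.1, fun x hx => (h.2 x hx).trans hM⟩
  | succ n ih =>
    obtain ⟨h1, h2, f', hf', h3⟩ := h
    exact ⟨fun x hx => (h1 x hx).trans hM, h2, f', hf', ih h3⟩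

theorem JetBound.lower (h : JetBound s Z (n + 1) M f) : JetBound s Z n M f := by
  induction n generalizing f with
  | zero => exact ⟨h.continuousOn, h.1⟩
  | succ n ih =>
    obtain ⟨h1, h2, f', hf', h3⟩ := h
    exact ⟨h1, h2, f', hf', ih h3⟩

theorem JetBound.add (hf : JetBound s Z n M f) (hg : JetBound s Z n M' g) :
    JetBound s Z n (M + M') (fun x => f x + g x) := by
  induction n generalizing f g with
  | zero => exact ⟨hf.1.add hg.1, fun x hx => (norm_add_le _ _).trans
      (add_le_add (hf.2 x hx) (hg.2 x hx))⟩
  | succ n ih =>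
    obtain ⟨h1, h2, f', hf', h3⟩ := hf
    obtain ⟨k1, k2, g', hg', k3⟩ := hg
    exact ⟨fun x hx => (norm_add_le _ _).trans (add_le_add (h1 x hx) (k1 x hx)),
      fun x hx => by simp [h2 x hx, k2 x hx], _,
      fun x hx => (hf' x hx).add (hg' x hx), ih h3 k3⟩

theorem JetBound.neg (hf : JetBound s Z n M f) : JetBound s Z n M (fun x => -f x) := by
  induction n generalizing f with
  | zero => exact ⟨hf.1.neg, fun x hx => by rw [norm_neg]; exact hf.2 x hx⟩
  | succ n ih =>
    obtain ⟨h1, h2, f', hf', h3⟩ := hf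
    exact ⟨fun x hx => by rw [norm_neg]; exact h1 x hx, fun x hx => by simp [h2 x hx], _,
      fun x hx => (hf' x hx).neg, ih h3⟩

/-- Leibniz: each derivative splits into two products, whence `2 ^ n`. Zeros on `Z` are needed for
one factor only. -/
theorem JetBound.mul (hM : 0 ≤ M) (hM' : 0 ≤ M') (hf : JetBound s Z n M f)
    (hg : JetBound s ∅ n M' g) : JetBound s Z n (2 ^ n * M * M') (fun x => f x * g x) := by
  have hbd : ∀ n : ℕ, ∀ x ∈ s, ‖f x‖ ≤ M → ‖g x‖ ≤ M' → ‖f x * g x‖ ≤ 2 ^ n * M * M' := by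
    intro n x _ h1 h2
    calc ‖f x * g x‖ ≤ ‖f x‖ * ‖g x‖ := norm_mul_le _ _
      _ ≤ M * M' := mul_le_mul h1 h2 (norm_nonneg _) hM
      _ ≤ 2 ^ n * (M * M') := le_mul_of_one_le_left (by positivity) (one_le_pow₀ (by norm_num))
      _ = _ := by ring
  induction n generalizing f g with
  | zero => exact ⟨hf.1.mul hg.1, fun x hx => hbd 0 x hx (hf.2 x hx) (hg.2 x hx)⟩
  | succ n ih =>
    have hf0 := hf
    have hg0 := hg
    obtain ⟨h1, h2, f', hf', h3⟩ := hf
    obtain ⟨k1, k2, g', hg', k3⟩ := hg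
    refine ⟨fun x hx => hbd _ x hx (h1 x hx) (k1 x hx), fun x hx => by simp [h2 x hx], _,
      fun x hx => (hf' x hx).mul (hg' x hx), ?_⟩
    have e1 := ih h3 hg0.lower fun m x hx a b => by
      calc ‖f' x * g x‖ ≤ ‖f' x‖ * ‖g x‖ := norm_mul_le _ _
        _ ≤ M * M' := mul_le_mul a b (norm_nonneg _) hM
        _ ≤ 2 ^ m * (M * M') := le_mul_of_one_le_left (by positivity) (one_le_pow₀ (by norm_num))
        _ = _ := by ring
    have e2 := ih hf0.lower k3 fun m x hx a b => by
      calc ‖f x * g' x‖ ≤ ‖f x‖ * ‖g' x‖ := norm_mul_le _ _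
        _ ≤ M * M' := mul_le_mul a b (norm_nonneg _) hM
        _ ≤ 2 ^ m * (M * M') := le_mul_of_one_le_left (by positivity) (one_le_pow₀ (by norm_num))
        _ = _ := by ring
    have e3 := e1.add e2
    have : 2 ^ n * M * M' + 2 ^ n * M * M' = 2 ^ (n + 1) * M * M' := by ring
    rw [this] at e3
    exact e3

/-- Induction on `(1/f)' = -f' · (1/f)²`. The new bound depends on `n`, `M` and `c` alone, so it is
uniform over families of phases. -/
theorem JetBound.inv (n : ℕ) (M c : ℝ) (hM : 0 ≤ M) (hc : 0 < c) :
    ∃ M' : ℝ, 0 ≤ M' ∧ ∀ (s : Set ℝ) (f : ℝ → ℝ), JetBound s ∅ n M f → (∀ x ∈ s, c ≤ |f x|) →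
      JetBound s ∅ n M' (fun x => (f x)⁻¹) := by
  have hinv : ∀ (s : Set ℝ) (f : ℝ → ℝ), (∀ x ∈ s, c ≤ |f x|) → ∀ x ∈ s, ‖(f x)⁻¹‖ ≤ c⁻¹ := by
    intro s f hf x hx
    rw [norm_inv]
    exact inv_anti₀ hc (hf x hx)
  have hne : ∀ (s : Set ℝ) (f : ℝ → ℝ), (∀ x ∈ s, c ≤ |f x|) → ∀ x ∈ s, f x ≠ 0 := by
    intro s f hf x hx h0
    have := hf x hx
    rw [h0, abs_zero] at this
    linarith
  induction n with
  | zero => exact ⟨c⁻¹, by positivity, fun s f hf hlow =>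
      ⟨hf.1.inv₀ (hne s f hlow), hinv s f hlow⟩⟩
  | succ n ih =>
    obtain ⟨M', hM', h⟩ := ih
    refine ⟨max c⁻¹ (2 ^ n * M * (2 ^ n * M' * M')), le_max_of_le_left (by positivity),
      fun s f hf hlow => ?_⟩
    have hf0 := hf
    obtain ⟨h1, h2, f', hf', h3⟩ := hf
    have hg := h s f hf0.lower hlow
    refine ⟨fun x hx => (hinv s f hlow x hx).trans (le_max_left _ _), by simp, _,
      fun x hx => ((hf' x hx).inv (hne s f hlow x hx)), ?_⟩
    have e1 := ((h3.mul hM (by positivity) (hg.mul hM' hM' hg)).neg).mono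
      (le_max_right c⁻¹ (2 ^ n * M * (2 ^ n * M' * M')))
    convert e1 using 1
    ext x
    rw [← mul_inv, ← sq, neg_div, div_eq_mul_inv]

/-- The support lies in the open interval, so `f` and its derivatives vanish at the endpoints and
integration by parts produces no boundary terms. -/
theorem JetBound.of_contDiff (n : ℕ) {f : ℝ → ℝ} (hf : ContDiff ℝ ∞ f) {a b : ℝ}
    (hsupp : tsupport f ⊆ Ioo a b) : ∃ M : ℝ, 0 ≤ M ∧ JetBound (Icc a b) {a, b} n M f := by
  induction n generalizing f with
  | zero =>
    obtain ⟨M, hM⟩ := isCompact_Icc.exists_bound_of_continuousOn (hf.continuous.continuousOn (s := Icc a b))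
    exact ⟨max M 0, le_max_right _ _, hf.continuous.continuousOn,
      fun x hx => (hM x hx).trans (le_max_left _ _)⟩
  | succ n ih =>
    obtain ⟨M, hM⟩ := isCompact_Icc.exists_bound_of_continuousOn (hf.continuous.continuousOn (s := Icc a b))
    have hd : ContDiff ℝ ∞ (deriv f) := hf.deriv' 
    obtain ⟨M', hM', hJ⟩ := ih hd ((closure_minimal support_deriv_subset isClosed_closure).trans hsupp)
    refine ⟨max M M', le_max_of_le_right hM', fun x hx => (hM x hx).trans (le_max_left _ _), ?_,
      deriv f, fun x _ => (hf.differentiable (by simp)).differentiableAt.hasDerivAt,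
      hJ.mono (le_max_right _ _)⟩
    intro x hx
    by_contra hne
    have := hsupp (subset_tsupport f hne)
    rcases hx with rfl | hx
    · exact lt_irrefl _ this.1
    · rw [mem_singleton_iff.1 hx] at this
      exact lt_irrefl _ this.2

open Complex (I) in
/-- Nonstationary phase: `n` integrations by parts. -/
theorem exists_norm_integral_exp_mul_le (n : ℕ) (M M' L : ℝ) (hM : 0 ≤ M) (hM' : 0 ≤ M') :
    ∃ C : ℝ, 0 ≤ C ∧ ∀ (a b κ : ℝ) (ψ ψ' g A : ℝ → ℝ), a ≤ b → b - a ≤ L → 0 < κ →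
      (∀ x ∈ Icc a b, HasDerivAt ψ (κ * ψ' x) x) → ContinuousOn ψ' (Icc a b) →
      (∀ x ∈ Icc a b, ψ' x * g x = 1) →
      JetBound (Icc a b) ∅ n M' g → JetBound (Icc a b) {a, b} n M A →
      ‖∫ x in a..b, Complex.exp (I * ψ x) * (A x : ℂ)‖ ≤ C / κ ^ n := by
  induction n generalizing M with
  | zero =>
    refine ⟨M * |L|, by positivity, fun a b κ ψ ψ' g A hab hL hκ hψ _ _ _ hA => ?_⟩
    rw [pow_zero, div_one]
    refine (intervalIntegral.norm_integral_le_of_norm_le_const (C := M) fun x hx => ?_).trans ?_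
    · rw [uIoc_of_le hab] at hx
      rw [norm_mul, mul_comm I, Complex.norm_exp_ofReal_mul_I, one_mul, Complex.norm_real]
      exact hA.2 x (Ioc_subset_Icc_self hx)
    · rw [abs_of_nonneg (by linarith : 0 ≤ b - a)]
      exact mul_le_mul_of_nonneg_left (hL.trans (le_abs_self _)) hM
  | succ n ih =>
    -- One step trades `A` for `(A g)'`, and the jet bound of the latter is the one for the product.
    obtain ⟨C, hC, h⟩ := ih (2 ^ (n + 1) * M * M') (by positivity)
    refine ⟨C, hC, fun a b κ ψ ψ' g A hab hL hκ hψ hψc hg hgJ hAJ => ?_⟩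
    have hu : uIcc a b = Icc a b := uIcc_of_le hab
    obtain ⟨-, hz, B, hB, hBJ⟩ := hAJ.mul hM hM' hgJ
    have hψcont : ContinuousOn ψ (Icc a b) := fun x hx =>
      (hψ x hx).continuousAt.continuousWithinAt
    have hec : ContinuousOn (fun x => Complex.exp (I * ψ x)) (Icc a b) := by fun_prop
    have key := intervalIntegral.integral_mul_deriv_eq_deriv_mul (a := a) (b := b)
      (u := fun x => ((A x * g x : ℝ) : ℂ)) (u' := fun x => (B x : ℂ))
      (v := fun x => Complex.exp (I * ψ x))
      (v' := fun x => Complex.exp (I * ψ x) * (I * ((κ * ψ' x : ℝ) : ℂ)))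
      (fun x hx => (hB x (hu ▸ hx)).ofReal_comp)
      (fun x hx => ((hψ x (hu ▸ hx)).ofReal_comp.const_mul I).cexp)
      (ContinuousOn.intervalIntegrable (by
        rw [hu]; exact Complex.continuous_ofReal.comp_continuousOn hBJ.continuousOn))
      (ContinuousOn.intervalIntegrable (by
        rw [hu]
        exact hec.mul (continuousOn_const.mul (Complex.continuous_ofReal.comp_continuousOn
          (continuousOn_const.mul hψc)))))
    -- Because `ψ' g = 1`, this side is `iκ` times the original integral, so each step gains `1/κ`.
    have e1 : ∫ x in a..b, ((A x * g x : ℝ) : ℂ) *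
        (Complex.exp (I * ψ x) * (I * ((κ * ψ' x : ℝ) : ℂ))) =
        (I * κ) * ∫ x in a..b, Complex.exp (I * ψ x) * (A x : ℂ) := by
      rw [← intervalIntegral.integral_const_mul]
      refine intervalIntegral.integral_congr fun x hx => ?_
      have := hg x (hu ▸ hx)
      have h2 : (ψ' x : ℂ) * (g x : ℂ) = 1 := by exact_mod_cast this
      push_cast
      linear_combination (I * κ * Complex.exp (I * ψ x) * A x) * h2
    have hza : A a * g a = 0 := hz a (by simp)
    have hzb : A b * g b = 0 := hz b (by simp)
    rw [e1] at key
    simp only [hza, hzb, Complex.ofReal_zero, zero_mul, sub_zero, zero_sub] at key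
    have hres := h a b κ ψ ψ' g B hab hL hκ hψ hψc hg hgJ.lower hBJ
    have e2 : ∫ x in a..b, (B x : ℂ) * Complex.exp (I * ψ x) =
        ∫ x in a..b, Complex.exp (I * ψ x) * (B x : ℂ) := by
      simp only [mul_comm]
    rw [e2] at key
    have hnorm := congrArg norm key
    rw [norm_mul, norm_mul, Complex.norm_I, one_mul, norm_neg, Complex.norm_real, Real.norm_eq_abs,
      abs_of_pos hκ] at hnorm
    have h3 : κ * ‖∫ x in a..b, Complex.exp (I * ψ x) * (A x : ℂ)‖ ≤ C / κ ^ n :=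
      hnorm.trans_le hres
    rw [pow_succ, ← div_div, le_div_iff₀ hκ, mul_comm]
    exact h3

end Jets

/-! ### Second differences of symmetric sums. -/

section SecondDifference

theorem abs_sub_le_of_hasDerivAt {g g' : ℝ → ℝ} {r A : ℝ}
    (hg : ∀ x ∈ Icc (-r) r, HasDerivAt g (g' x) x) (hA : ∀ x ∈ Icc (-r) r, |g' x| ≤ A)
    {x y : ℝ} (hx : x ∈ Icc (-r) r) (hy : y ∈ Icc (-r) r) : |g x - g y| ≤ A * |x - y| :=
  (convex_Icc (-r) r).norm_image_sub_le_of_norm_hasDerivWithin_le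
    (fun z hz => (hg z hz).hasDerivWithinAt) hA hy hx

/-- Differences of symmetric sums `g t + g s` in terms of the symmetric functions of `t` and `s`. -/
theorem abs_symmetric_difference_le {g g' g'' : ℝ → ℝ} {e A B : ℝ}
    (h1 : ∀ x ∈ Icc (-(3 * e)) (3 * e), HasDerivAt g (g' x) x)
    (h2 : ∀ x ∈ Icc (-(3 * e)) (3 * e), HasDerivAt g' (g'' x) x)
    (hA : ∀ x ∈ Icc (-(3 * e)) (3 * e), |g' x| ≤ A)
    (hB : ∀ x ∈ Icc (-(3 * e)) (3 * e), |g'' x| ≤ B) {t s t' s' : ℝ} (ht : |t| ≤ e) (hs : |s| ≤ e)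
    (ht' : |t'| ≤ e) (hs' : |s'| ≤ e) :
    |g t + g s - g t' - g s'| ≤
      A * |t + s - t' - s'| + B * |(t - s) ^ 2 - (t' - s') ^ 2| := by
  rw [abs_le] at ht hs ht' hs'
  have he : 0 ≤ e := by linarith [ht.1, ht.2]
  have hB0 : 0 ≤ B := (abs_nonneg _).trans (hB 0 ⟨by linarith, by linarith⟩)
  have hA0 : 0 ≤ A := (abs_nonneg _).trans (hA 0 ⟨by linarith, by linarith⟩)
  set m := (t + s) / 2 with hm
  set m' := (t' + s') / 2 with hm'
  -- At a fixed midpoint, the derivative in the half-difference `u` is a difference of values of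
  -- `g'`, hence at most `2 B u`; integrating it produces a difference of squares.
  have step2 : ∀ d d' : ℝ, 0 ≤ d' → d' ≤ d → d ≤ e →
      |(g (m' + d) + g (m' - d)) - (g (m' + d') + g (m' - d'))| ≤ B * (d ^ 2 - d' ^ 2) := by
    intro d d' hd' hdd hde
    have hmem : ∀ u ∈ Icc d' d, m' + u ∈ Icc (-(3 * e)) (3 * e) ∧ m' - u ∈ Icc (-(3 * e)) (3 * e) := by
      intro u hu
      exact ⟨⟨by linarith [hu.1, ht'.1, hs'.1], by linarith [hu.2, ht'.2, hs'.2]⟩,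
        ⟨by linarith [hu.2, ht'.1, hs'.1], by linarith [hu.1, ht'.2, hs'.2]⟩⟩
    have hder : ∀ u ∈ Icc d' d, HasDerivAt (fun u => g (m' + u) + g (m' - u))
        (g' (m' + u) - g' (m' - u)) u := by
      intro u hu
      have e1 := (h1 _ (hmem u hu).1).comp_const_add m' u
      have e2 := (h1 _ (hmem u hu).2).comp_const_sub m' u
      exact (e1.add e2).congr_deriv (by ring)
    have hdb : ∀ u ∈ Icc d' d, |g' (m' + u) - g' (m' - u)| ≤ 2 * B * u := by
      intro u hu
      refine (abs_sub_le_of_hasDerivAt h2 hB (hmem u hu).1 (hmem u hu).2).trans_eq ?_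
      have : m' + u - (m' - u) = 2 * u := by ring
      rw [this, abs_of_nonneg (by linarith [hu.1])]
      ring
    have hmono : ∀ σ : ℝ, |σ| = 1 → MonotoneOn
        (fun u => B * u ^ 2 + σ * (g (m' + u) + g (m' - u))) (Icc d' d) := by
      intro σ hσ
      have hd2 : ∀ u ∈ Icc d' d, HasDerivAt (fun u => B * u ^ 2 + σ * (g (m' + u) + g (m' - u)))
          (2 * B * u + σ * (g' (m' + u) - g' (m' - u))) u := by
        intro u hu
        exact ((((hasDerivAt_id u).pow 2).const_mul B).add ((hder u hu).const_mul σ)).congr_deriv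
          (by simp; ring)
      refine monotoneOn_of_deriv_nonneg (convex_Icc _ _)
        (fun u hu => (hd2 u hu).continuousAt.continuousWithinAt)
        (fun u hu => (hd2 u (interior_subset hu)).differentiableAt.differentiableWithinAt)
        fun u hu => ?_
      rw [(hd2 u (interior_subset hu)).deriv]
      have e1 : |σ * (g' (m' + u) - g' (m' - u))| ≤ 2 * B * u := by
        rw [abs_mul, hσ, one_mul]; exact hdb u (interior_subset hu)
      linarith [neg_abs_le (σ * (g' (m' + u) - g' (m' - u)))]
    have p1 := hmono 1 (by simp) (left_mem_Icc.2 hdd) (right_mem_Icc.2 hdd) hdd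
    have p2 := hmono (-1) (by simp) (left_mem_Icc.2 hdd) (right_mem_Icc.2 hdd) hdd
    simp only at p1 p2
    rw [abs_le]
    constructor <;> linarith
  -- At a fixed half-difference, moving the midpoint is a first-order effect.
  have step1 : ∀ d : ℝ, |d| ≤ e → |(g (m + d) + g (m - d)) - (g (m' + d) + g (m' - d))| ≤
      2 * A * |m - m'| := by
    intro d hd
    rw [abs_le] at hd
    have e1 := abs_sub_le_of_hasDerivAt h1 hA (x := m + d) (y := m' + d)
      ⟨by linarith [ht.1, hs.1, hd.1], by linarith [ht.2, hs.2, hd.2]⟩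
      ⟨by linarith [ht'.1, hs'.1, hd.1], by linarith [ht'.2, hs'.2, hd.2]⟩
    have e2 := abs_sub_le_of_hasDerivAt h1 hA (x := m - d) (y := m' - d)
      ⟨by linarith [ht.1, hs.1, hd.2], by linarith [ht.2, hs.2, hd.1]⟩
      ⟨by linarith [ht'.1, hs'.1, hd.2], by linarith [ht'.2, hs'.2, hd.1]⟩
    rw [show m + d - (m' + d) = m - m' by ring] at e1
    rw [show m - d - (m' - d) = m - m' by ring] at e2
    calc _ = |(g (m + d) - g (m' + d)) + (g (m - d) - g (m' - d))| := by congr 1; ring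
      _ ≤ _ := (abs_add_le _ _).trans (by linarith)
  have hsym : ∀ t s : ℝ, g t + g s = g ((t + s) / 2 + |(t - s) / 2|) + g ((t + s) / 2 - |(t - s) / 2|) := by
    intro t s
    rcases abs_choice ((t - s) / 2) with h | h <;> rw [h] <;> ring_nf
  have hdle : ∀ t s : ℝ, (-e ≤ t ∧ t ≤ e) → (-e ≤ s ∧ s ≤ e) → |(t - s) / 2| ≤ e := by
    intro t s h h'
    exact abs_le.2 ⟨by linarith [h.1, h'.2], by linarith [h.2, h'.1]⟩
  have hd1 := hdle t s ht hs
  have hd2 := hdle t' s' ht' hs'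
  have s1 := step1 |(t - s) / 2| (by rwa [abs_abs])
  have s2 : |(g (m' + |(t - s) / 2|) + g (m' - |(t - s) / 2|)) -
      (g (m' + |(t' - s') / 2|) + g (m' - |(t' - s') / 2|))| ≤
      B * |((t - s) / 2) ^ 2 - ((t' - s') / 2) ^ 2| := by
    rcases le_total |(t' - s') / 2| |(t - s) / 2| with h | h
    · refine (step2 _ _ (abs_nonneg _) h hd1).trans ?_
      rw [sq_abs, sq_abs]
      exact mul_le_mul_of_nonneg_left (le_abs_self _) hB0
    · rw [abs_sub_comm]
      refine (step2 _ _ (abs_nonneg _) h hd2).trans ?_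
      rw [sq_abs, sq_abs, abs_sub_comm]
      exact mul_le_mul_of_nonneg_left (le_abs_self _) hB0
  have e1 : 2 * A * |m - m'| = A * |t + s - t' - s'| := by
    rw [show t + s - t' - s' = 2 * (m - m') by rw [hm, hm']; ring, abs_mul, abs_two]
    ring
  have e2 : B * |((t - s) / 2) ^ 2 - ((t' - s') / 2) ^ 2| ≤ B * |(t - s) ^ 2 - (t' - s') ^ 2| := by
    rw [show ((t - s) / 2) ^ 2 - ((t' - s') / 2) ^ 2 = (1 / 4) * ((t - s) ^ 2 - (t' - s') ^ 2) by ring,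
      abs_mul]
    refine mul_le_mul_of_nonneg_left ?_ hB0
    rw [abs_of_pos (by norm_num : (0 : ℝ) < 1 / 4)]
    linarith [abs_nonneg ((t - s) ^ 2 - (t' - s') ^ 2)]
  calc |g t + g s - g t' - g s'| = |(g (m + |(t - s) / 2|) + g (m - |(t - s) / 2|) -
        (g (m' + |(t - s) / 2|) + g (m' - |(t - s) / 2|))) +
        ((g (m' + |(t - s) / 2|) + g (m' - |(t - s) / 2|)) -
      (g (m' + |(t' - s') / 2|) + g (m' - |(t' - s') / 2|)))| := by
        rw [show g t + g s - g t' - g s' = (g t + g s) - (g t' + g s') by ring, hsym t s, hsym t' s']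
        congr 1
        ring
    _ ≤ _ := (abs_add_le _ _).trans (by linarith)

end SecondDifference

/-! ### The phase of the composed kernel and its nondegeneracy. -/

section Phase

/-- The open half plane on which the distance function is smooth. -/
def rightHalf : Set (ℝ × ℝ) := {p | 0 < p.1}

theorem isOpen_rightHalf : IsOpen rightHalf := isOpen_lt continuous_const continuous_fst

/-- The partial derivative in the first variable. -/
def pd₁ (h : ℝ × ℝ → ℝ) (p : ℝ × ℝ) : ℝ := fderiv ℝ h p (1, 0)

/-- The partial derivative in the second variable. -/
def pd₂ (h : ℝ × ℝ → ℝ) (p : ℝ × ℝ) : ℝ := fderiv ℝ h p (0, 1)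

variable {h : ℝ × ℝ → ℝ}

theorem contDiffOn_pd₁ (hh : ContDiffOn ℝ ∞ h rightHalf) : ContDiffOn ℝ ∞ (pd₁ h) rightHalf :=
  (hh.fderiv_of_isOpen isOpen_rightHalf (by simp)).clm_apply contDiffOn_const

theorem contDiffOn_pd₂ (hh : ContDiffOn ℝ ∞ h rightHalf) : ContDiffOn ℝ ∞ (pd₂ h) rightHalf :=
  (hh.fderiv_of_isOpen isOpen_rightHalf (by simp)).clm_apply contDiffOn_const

theorem hasDerivAt_pd₁ (hh : ContDiffOn ℝ ∞ h rightHalf) {w : ℝ} (hw : 0 < w) (z : ℝ) :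
    HasDerivAt (fun w => h (w, z)) (pd₁ h (w, z)) w := by
  have h1 : HasFDerivAt h (fderiv ℝ h (w, z)) (w, z) :=
    ((hh.differentiableOn (by simp)).differentiableAt
      (isOpen_rightHalf.mem_nhds hw)).hasFDerivAt
  exact h1.comp_hasDerivAt w ((hasDerivAt_id w).prodMk (hasDerivAt_const w z))

theorem hasDerivAt_pd₂ (hh : ContDiffOn ℝ ∞ h rightHalf) {w : ℝ} (hw : 0 < w) (z : ℝ) :
    HasDerivAt (fun z => h (w, z)) (pd₂ h (w, z)) z := by
  have h1 : HasFDerivAt h (fderiv ℝ h (w, z)) (w, z) :=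
    ((hh.differentiableOn (by simp)).differentiableAt
      (isOpen_rightHalf.mem_nhds hw)).hasFDerivAt
  exact h1.comp_hasDerivAt z ((hasDerivAt_const z w).prodMk (hasDerivAt_id z))

/-- The second difference `h(w, z - t) + h(w, z - s) - h(w, z - t') - h(w, z - s')`. -/
def quad (h : ℝ × ℝ → ℝ) (t s t' s' w z : ℝ) : ℝ :=
  h (w, z - t) + h (w, z - s) - h (w, z - t') - h (w, z - s')

/-- The size of the second differences. -/
def gap (t s t' s' : ℝ) : ℝ := |t + s - t' - s'| + |(t - s) ^ 2 - (t' - s') ^ 2|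

theorem gap_nonneg (t s t' s' : ℝ) : 0 ≤ gap t s t' s' := by unfold gap; positivity

theorem exists_abs_le_on_box (hh : ContDiffOn ℝ ∞ h rightHalf) :
    ∃ M : ℝ, 0 ≤ M ∧ ∀ w ∈ Icc (1 / 8 : ℝ) 3, ∀ z ∈ Icc (-1 : ℝ) 1, |h (w, z)| ≤ M := by
  obtain ⟨M, hM⟩ := ((isCompact_Icc (a := (1 / 8 : ℝ)) (b := 3)).prod
    (isCompact_Icc (a := (-1 : ℝ)) (b := 1))).exists_bound_of_continuousOn
    (hh.continuousOn.mono fun p hp => lt_of_lt_of_le (by norm_num) hp.1.1)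
  exact ⟨max M 0, le_max_right _ _, fun w hw z hz => (hM (w, z) ⟨hw, hz⟩).trans (le_max_left _ _)⟩

/-- The symmetric difference estimate bounds `quad` by a multiple of `gap`. Where the gap is zero,
the convention `0⁻¹ = 0` makes the product vanish, so no nondegeneracy is assumed. -/
theorem exists_abs_quad_le (hh : ContDiffOn ℝ ∞ h rightHalf) :
    ∃ M : ℝ, 0 ≤ M ∧ ∀ w ∈ Icc (1 / 8 : ℝ) 3, ∀ z ∈ Icc (-(1 / 2) : ℝ) (1 / 2), ∀ t s t' s' : ℝ,
      |t| ≤ 1 / 10 → |s| ≤ 1 / 10 → |t'| ≤ 1 / 10 → |s'| ≤ 1 / 10 →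
      |(gap t s t' s')⁻¹ * quad h t s t' s' w z| ≤ M := by
  obtain ⟨A, hA0, hA⟩ := exists_abs_le_on_box (contDiffOn_pd₂ hh)
  obtain ⟨B, hB0, hB⟩ := exists_abs_le_on_box (contDiffOn_pd₂ (contDiffOn_pd₂ hh))
  refine ⟨A + B, by positivity, fun w hw z hz t s t' s' ht hs ht' hs' => ?_⟩
  have hw0 : 0 < w := lt_of_lt_of_le (by norm_num) hw.1
  have hmem : ∀ x ∈ Icc (-(3 * (1 / 10)) : ℝ) (3 * (1 / 10)), z - x ∈ Icc (-1 : ℝ) 1 := fun x hx =>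
    ⟨by linarith [hz.1, hx.2], by linarith [hz.2, hx.1]⟩
  have key := abs_symmetric_difference_le (g := fun x => h (w, z - x))
    (g' := fun x => -pd₂ h (w, z - x)) (g'' := fun x => pd₂ (pd₂ h) (w, z - x)) (e := 1 / 10)
    (A := A) (B := B) (fun x _ => (hasDerivAt_pd₂ hh hw0 (z - x)).comp_const_sub z x)
    (fun x _ => ((hasDerivAt_pd₂ (contDiffOn_pd₂ hh) hw0 (z - x)).comp_const_sub z x).neg.congr_deriv
      (by ring))
    (fun x hx => by rw [abs_neg]; exact hA w hw _ (hmem x hx))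
    (fun x hx => hB w hw _ (hmem x hx)) ht hs ht' hs'
  rw [abs_mul, abs_inv, abs_of_nonneg (gap_nonneg _ _ _ _)]
  rcases (gap_nonneg t s t' s').eq_or_lt with h0 | h0
  · rw [← h0, inv_zero, zero_mul]; positivity
  · rw [inv_mul_le_iff₀ h0]
    refine key.trans ?_
    unfold gap
    nlinarith [abs_nonneg (t + s - t' - s'), abs_nonneg ((t - s) ^ 2 - (t' - s') ^ 2)]

theorem hasDerivAt_quad_fst (hh : ContDiffOn ℝ ∞ h rightHalf) (t s t' s' : ℝ) {w : ℝ} (hw : 0 < w)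
    (z : ℝ) : HasDerivAt (fun w => quad h t s t' s' w z) (quad (pd₁ h) t s t' s' w z) w :=
  (((hasDerivAt_pd₁ hh hw (z - t)).add (hasDerivAt_pd₁ hh hw (z - s))).sub
    (hasDerivAt_pd₁ hh hw (z - t'))).sub (hasDerivAt_pd₁ hh hw (z - s'))

theorem hasDerivAt_quad_snd (hh : ContDiffOn ℝ ∞ h rightHalf) (t s t' s' : ℝ) {w : ℝ} (hw : 0 < w)
    (z : ℝ) : HasDerivAt (fun z => quad h t s t' s' w z) (quad (pd₂ h) t s t' s' w z) z :=
  ((((hasDerivAt_pd₂ hh hw (z - t)).comp_sub_const z t).add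
    ((hasDerivAt_pd₂ hh hw (z - s)).comp_sub_const z s)).sub
    ((hasDerivAt_pd₂ hh hw (z - t')).comp_sub_const z t')).sub
    ((hasDerivAt_pd₂ hh hw (z - s')).comp_sub_const z s')

/-- Derivatives of a second difference are second differences of derivatives, so the preceding bound
applies at every order, uniformly in the four parameters. -/
theorem exists_jetBound_quad_fst (n : ℕ) (hh : ContDiffOn ℝ ∞ h rightHalf) :
    ∃ M : ℝ, 0 ≤ M ∧ ∀ I ⊆ Icc (1 / 8 : ℝ) 3, ∀ z ∈ Icc (-(1 / 2) : ℝ) (1 / 2), ∀ t s t' s' : ℝ,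
      |t| ≤ 1 / 10 → |s| ≤ 1 / 10 → |t'| ≤ 1 / 10 → |s'| ≤ 1 / 10 →
      JetBound I ∅ n M (fun w => (gap t s t' s')⁻¹ * quad h t s t' s' w z) := by
  induction n generalizing h with
  | zero =>
    obtain ⟨M, hM, H⟩ := exists_abs_quad_le hh
    refine ⟨M, hM, fun I hI z hz t s t' s' ht hs ht' hs' => ⟨fun w hw => ?_, fun w hw =>
      H w (hI hw) z hz t s t' s' ht hs ht' hs'⟩⟩
    exact ((hasDerivAt_quad_fst hh t s t' s' (lt_of_lt_of_le (by norm_num) (hI hw).1)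
      z).continuousAt.const_mul _).continuousWithinAt
  | succ n ih =>
    obtain ⟨M, hM, H⟩ := exists_abs_quad_le hh
    obtain ⟨M', hM', H'⟩ := ih (contDiffOn_pd₁ hh)
    refine ⟨max M M', le_max_of_le_left hM, fun I hI z hz t s t' s' ht hs ht' hs' =>
      ⟨fun w hw => (H w (hI hw) z hz t s t' s' ht hs ht' hs').trans (le_max_left _ _), by simp, _,
      fun w hw => (hasDerivAt_quad_fst hh t s t' s' (lt_of_lt_of_le (by norm_num) (hI hw).1)
      z).const_mul _, (H' I hI z hz t s t' s' ht hs ht' hs').mono (le_max_right _ _)⟩⟩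

theorem exists_jetBound_quad_snd (n : ℕ) (hh : ContDiffOn ℝ ∞ h rightHalf) :
    ∃ M : ℝ, 0 ≤ M ∧ ∀ w ∈ Icc (1 / 8 : ℝ) 3, ∀ I ⊆ Icc (-(1 / 2) : ℝ) (1 / 2), ∀ t s t' s' : ℝ,
      |t| ≤ 1 / 10 → |s| ≤ 1 / 10 → |t'| ≤ 1 / 10 → |s'| ≤ 1 / 10 →
      JetBound I ∅ n M (fun z => (gap t s t' s')⁻¹ * quad h t s t' s' w z) := by
  induction n generalizing h with
  | zero =>
    obtain ⟨M, hM, H⟩ := exists_abs_quad_le hh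
    refine ⟨M, hM, fun w hw I hI t s t' s' ht hs ht' hs' => ⟨fun z hz => ?_, fun z hz =>
      H w hw z (hI hz) t s t' s' ht hs ht' hs'⟩⟩
    exact ((hasDerivAt_quad_snd hh t s t' s' (lt_of_lt_of_le (by norm_num) hw.1)
      z).continuousAt.const_mul _).continuousWithinAt
  | succ n ih =>
    obtain ⟨M, hM, H⟩ := exists_abs_quad_le hh
    obtain ⟨M', hM', H'⟩ := ih (contDiffOn_pd₂ hh)
    refine ⟨max M M', le_max_of_le_left hM, fun w hw I hI t s t' s' ht hs ht' hs' =>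
      ⟨fun z hz => (H w hw z (hI hz) t s t' s' ht hs ht' hs').trans (le_max_left _ _), by simp, _,
      fun z hz => (hasDerivAt_quad_snd hh t s t' s' (lt_of_lt_of_le (by norm_num) hw.1)
      z).const_mul _, (H' w hw I hI t s t' s' ht hs ht' hs').mono (le_max_right _ _)⟩⟩

/-- The Euclidean norm on `ℝ × ℝ`. -/
def dist₂ (p : ℝ × ℝ) : ℝ := √(p.1 ^ 2 + p.2 ^ 2)

theorem sq_add_sq_pos {w : ℝ} (hw : 0 < w) (z : ℝ) : 0 < w ^ 2 + z ^ 2 := by positivity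

theorem dist₂_pos {w : ℝ} (hw : 0 < w) (z : ℝ) : 0 < dist₂ (w, z) :=
  Real.sqrt_pos.2 (sq_add_sq_pos hw z)

theorem dist₂_sq (w z : ℝ) : dist₂ (w, z) ^ 2 = w ^ 2 + z ^ 2 :=
  Real.sq_sqrt (by positivity)

theorem contDiffOn_dist₂ : ContDiffOn ℝ ∞ dist₂ rightHalf := by
  refine ContDiffOn.sqrt (by fun_prop) fun p hp => ?_
  exact (sq_add_sq_pos hp p.2).ne'

theorem hasDerivAt_dist₂_fst {w : ℝ} (hw : 0 < w) (z : ℝ) :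
    HasDerivAt (fun w => dist₂ (w, z)) (w / dist₂ (w, z)) w := by
  have h1 : HasDerivAt (fun w : ℝ => w ^ 2 + z ^ 2) (2 * w) w := by
    simpa using ((hasDerivAt_id w).pow 2).add_const (z ^ 2)
  refine (h1.sqrt (sq_add_sq_pos hw z).ne').congr_deriv ?_
  have := (dist₂_pos hw z).ne'
  change 2 * w / (2 * dist₂ (w, z)) = _
  field_simp

theorem hasDerivAt_dist₂_snd {w : ℝ} (hw : 0 < w) (z : ℝ) :
    HasDerivAt (fun z => dist₂ (w, z)) (z / dist₂ (w, z)) z := by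
  have h1 : HasDerivAt (fun z : ℝ => w ^ 2 + z ^ 2) (2 * z) z := by
    simpa using ((hasDerivAt_id z).pow 2).const_add (w ^ 2)
  refine (h1.sqrt (sq_add_sq_pos hw z).ne').congr_deriv ?_
  have := (dist₂_pos hw z).ne'
  change 2 * z / (2 * dist₂ (w, z)) = _
  field_simp

theorem pd₁_dist₂ {w : ℝ} (hw : 0 < w) (z : ℝ) : pd₁ dist₂ (w, z) = w / dist₂ (w, z) :=
  (hasDerivAt_pd₁ contDiffOn_dist₂ hw z).unique (hasDerivAt_dist₂_fst hw z)

theorem pd₂_dist₂ {w : ℝ} (hw : 0 < w) (z : ℝ) : pd₂ dist₂ (w, z) = z / dist₂ (w, z) :=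
  (hasDerivAt_pd₂ contDiffOn_dist₂ hw z).unique (hasDerivAt_dist₂_snd hw z)

theorem hasDerivAt_snd_div_dist₂ {w : ℝ} (hw : 0 < w) (z : ℝ) :
    HasDerivAt (fun z => z / dist₂ (w, z)) (w ^ 2 / dist₂ (w, z) ^ 3) z := by
  have h0 := (dist₂_pos hw z).ne'
  refine ((hasDerivAt_id z).div (hasDerivAt_dist₂_snd hw z) h0).congr_deriv ?_
  have := dist₂_sq w z
  simp only [id]
  field_simp
  linear_combination this

theorem hasDerivAt_const_div_dist₂_pow (n : ℕ) (c : ℝ) {w : ℝ} (hw : 0 < w) (z : ℝ) :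
    HasDerivAt (fun z => c / dist₂ (w, z) ^ n) (-(n * c * z) / dist₂ (w, z) ^ (n + 2)) z := by
  have h0 := (dist₂_pos hw z).ne'
  refine ((hasDerivAt_const z c).div ((hasDerivAt_dist₂_snd hw z).pow n) (pow_ne_zero n h0)).congr_deriv ?_
  rcases n with _ | n
  · simp
  · simp only [Nat.add_sub_cancel, Pi.pow_apply]
    field_simp
    ring

theorem le_dist₂_fst {w : ℝ} (hw : 0 < w) (z : ℝ) : w ≤ dist₂ (w, z) := by
  have h1 := dist₂_sq w z
  nlinarith [dist₂_pos hw z, sq_nonneg z]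

theorem abs_snd_le_dist₂ {w : ℝ} (hw : 0 < w) (z : ℝ) : |z| ≤ dist₂ (w, z) := by
  have h1 := dist₂_sq w z
  exact abs_le_of_sq_le_sq (by nlinarith [sq_nonneg w]) (dist₂_pos hw z).le

theorem dist₂_le {w : ℝ} (hw : 0 < w) (z : ℝ) : dist₂ (w, z) ≤ w + |z| := by
  have h1 := dist₂_sq w z
  have h2 := abs_nonneg z
  have h3 := sq_abs z
  nlinarith [dist₂_pos hw z, mul_nonneg hw.le h2]

theorem inv_dist₂_cube_le {w : ℝ} (hw : 1 / 8 ≤ w) (z : ℝ) : 1 / dist₂ (w, z) ^ 3 ≤ 512 := by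
  have hw0 : 0 < w := by linarith
  have h1 : (1 / 8 : ℝ) ^ 3 ≤ dist₂ (w, z) ^ 3 :=
    pow_le_pow_left₀ (by norm_num) (hw.trans (le_dist₂_fst hw0 z)) 3
  rw [div_le_iff₀ (pow_pos (dist₂_pos hw0 z) 3)]
  linarith

/-- With `ρ` the distance, `w²/ρ³` is the second derivative of `ρ` in `z`, equal to `1/w` at `z =
0`. The constant is `3 · 64`, from `ρ - w ≤ |z|`, `ρ² + ρ w + w² ≤ 3 ρ²` and `w ρ ≥ 1/64`. -/
theorem abs_curvature_le {w : ℝ} (hw : 1 / 8 ≤ w) (z : ℝ) :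
    |w ^ 2 / dist₂ (w, z) ^ 3 - 1 / w| ≤ 192 * |z| := by
  have hw0 : 0 < w := by linarith
  have hρ := dist₂_pos hw0 z
  have h1 := le_dist₂_fst hw0 z
  have h2 := dist₂_le hw0 z
  set ρ := dist₂ (w, z)
  have e1 : w ^ 2 / ρ ^ 3 - 1 / w = -((ρ ^ 3 - w ^ 3) / (w * ρ ^ 3)) := by field_simp; ring
  have e0 : 0 ≤ ρ ^ 3 - w ^ 3 := sub_nonneg.2 (pow_le_pow_left₀ hw0.le h1 3)
  rw [e1, abs_neg, abs_of_nonneg (by positivity), div_le_iff₀ (by positivity)]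
  have e2 : ρ ^ 3 - w ^ 3 ≤ |z| * (3 * ρ ^ 2) := by
    have : ρ ^ 3 - w ^ 3 = (ρ - w) * (ρ ^ 2 + ρ * w + w ^ 2) := by ring
    rw [this]
    exact mul_le_mul (by linarith) (by nlinarith) (by positivity) (abs_nonneg z)
  have e3 : 1 ≤ 64 * (w * ρ) := by nlinarith
  have e4 : 0 ≤ |z| * (3 * ρ ^ 2) := by positivity
  calc _ ≤ _ := e2
    _ ≤ |z| * (3 * ρ ^ 2) * (64 * (w * ρ)) := le_mul_of_one_le_right e4 e3
    _ = _ := by ring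

/-- To leading order the `z`-derivative of the distance is `z/w`, whose second difference is `-(t +
s - t' - s')/w`. Removing that linear part leaves a function with first and second derivatives at
most `1/50`, too small to cancel the main term when the linear part of the gap dominates. -/
theorem abs_quad_pd₂_ge {w z : ℝ} (hw : w ∈ Icc (1 / 8 : ℝ) 3) (hz : |z| ≤ 4 / 10 ^ 7)
    {t s t' s' : ℝ} (ht : |t| ≤ 1 / 10 ^ 7) (hs : |s| ≤ 1 / 10 ^ 7) (ht' : |t'| ≤ 1 / 10 ^ 7)
    (hs' : |s'| ≤ 1 / 10 ^ 7) (hle : |(t - s) ^ 2 - (t' - s') ^ 2| ≤ |t + s - t' - s'|) :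
    gap t s t' s' / 100 ≤ |quad (pd₂ dist₂) t s t' s' w z| := by
  have hw0 : 0 < w := lt_of_lt_of_le (by norm_num) hw.1
  have hζ : ∀ x ∈ Icc (-(3 * (1 / 10 ^ 7)) : ℝ) (3 * (1 / 10 ^ 7)), |z - x| ≤ 7 / 10 ^ 7 := by
    intro x hx
    have := abs_le.1 hz
    exact abs_le.2 ⟨by linarith [hx.2], by linarith [hx.1]⟩
  have key := abs_symmetric_difference_le
    (g := fun x => (z - x) / dist₂ (w, z - x) + x * (1 / w))
    (g' := fun x => -(w ^ 2 / dist₂ (w, z - x) ^ 3) + 1 * (1 / w))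
    (g'' := fun x => -(3 * w ^ 2 * (z - x)) / dist₂ (w, z - x) ^ 5) (e := 1 / 10 ^ 7)
    (A := 1 / 50) (B := 1 / 50)
    (fun x _ => ((hasDerivAt_snd_div_dist₂ hw0 (z - x)).comp_const_sub z x).add
      ((hasDerivAt_id x).mul_const _))
    (fun x _ => (((hasDerivAt_const_div_dist₂_pow 3 (w ^ 2) hw0 (z - x)).comp_const_sub
      z x).neg.add_const (1 * (1 / w))).congr_deriv (by push_cast; ring))
    (fun x hx => by
      have h1 := abs_curvature_le hw.1 (z - x)
      have h2 := hζ x hx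
      rw [show -(w ^ 2 / dist₂ (w, z - x) ^ 3) + 1 * (1 / w) =
        -(w ^ 2 / dist₂ (w, z - x) ^ 3 - 1 / w) by ring, abs_neg]
      linarith)
    (fun x hx => by
      have h2 := hζ x hx
      have h3 := inv_dist₂_cube_le hw.1 (z - x)
      have hρ := dist₂_pos hw0 (z - x)
      have h4 := le_dist₂_fst hw0 (z - x)
      rw [abs_div, abs_neg, abs_mul, abs_of_pos (by positivity : 0 < 3 * w ^ 2),
        abs_of_pos (pow_pos hρ 5)]
      set ρ := dist₂ (w, z - x)
      have h5 : w ^ 2 / ρ ^ 2 ≤ 1 := by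
        rw [div_le_one (by positivity)]; exact pow_le_pow_left₀ hw0.le h4 2
      calc 3 * w ^ 2 * |z - x| / ρ ^ 5 = 3 * (w ^ 2 / ρ ^ 2) * |z - x| * (1 / ρ ^ 3) := by
            field_simp
        _ ≤ 3 * 1 * (7 / 10 ^ 7) * 512 := by gcongr
        _ ≤ _ := by norm_num) ht hs ht' hs'
  have e1 : quad (pd₂ dist₂) t s t' s' w z = ((z - t) / dist₂ (w, z - t) + t * (1 / w) +
      ((z - s) / dist₂ (w, z - s) + s * (1 / w)) - ((z - t') / dist₂ (w, z - t') + t' * (1 / w)) -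
      ((z - s') / dist₂ (w, z - s') + s' * (1 / w))) - (t + s - t' - s') * (1 / w) := by
    unfold quad
    simp only [pd₂_dist₂ hw0]
    ring
  have e2 : |t + s - t' - s'| * (1 / 3) ≤ |(t + s - t' - s') * (1 / w)| := by
    rw [abs_mul, abs_of_pos (by positivity : 0 < 1 / w)]
    exact mul_le_mul_of_nonneg_left (one_div_le_one_div_of_le hw0 hw.2) (abs_nonneg _)
  rw [e1, abs_sub_comm]
  refine le_trans ?_ (abs_sub_abs_le_abs_sub _ _)
  unfold gap
  linarith [abs_nonneg (t + s - t' - s')]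

/-- To leading order the `w`-derivative of the distance is `1 - z²/(2w²)`, so the quadratic part of
the gap appears with coefficient `1/(4w²) ≥ 1/36`. The linear part enters with small coefficients
only, and by assumption it does not dominate. -/
theorem abs_quad_pd₁_ge {w z : ℝ} (hw : w ∈ Icc (1 / 8 : ℝ) 3) (hz : |z| ≤ 4 / 10 ^ 7)
    {t s t' s' : ℝ} (ht : |t| ≤ 1 / 10 ^ 7) (hs : |s| ≤ 1 / 10 ^ 7) (ht' : |t'| ≤ 1 / 10 ^ 7)
    (hs' : |s'| ≤ 1 / 10 ^ 7) (hle : |t + s - t' - s'| ≤ |(t - s) ^ 2 - (t' - s') ^ 2|) :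
    gap t s t' s' / 1000 ≤ |quad (pd₁ dist₂) t s t' s' w z| := by
  have hw0 : 0 < w := lt_of_lt_of_le (by norm_num) hw.1
  have hζ : ∀ x ∈ Icc (-(3 * (1 / 10 ^ 7)) : ℝ) (3 * (1 / 10 ^ 7)), |z - x| ≤ 7 / 10 ^ 7 := by
    intro x hx
    have := abs_le.1 hz
    exact abs_le.2 ⟨by linarith [hx.2], by linarith [hx.1]⟩
  have hwinv : 1 / w ≤ 8 := by
    rw [div_le_iff₀ hw0]; linarith [hw.1]
  have hwinv2 : 1 / w ^ 2 ≤ 64 := by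
    rw [div_le_iff₀ (by positivity)]; nlinarith [hw.1]
  have key := abs_symmetric_difference_le
    (g := fun x => w / dist₂ (w, z - x) ^ 1 + x ^ 2 * (1 / (2 * w ^ 2)))
    (g' := fun x => w * ((z - x) / dist₂ (w, z - x) ^ 3) + x * (1 / w ^ 2))
    (g'' := fun x => -(w / dist₂ (w, z - x) ^ 3) + 3 * w * (z - x) ^ 2 / dist₂ (w, z - x) ^ 5 +
      1 / w ^ 2) (e := 1 / 10 ^ 7)
    (A := 1 / 200) (B := 1 / 200)
    (fun x _ => (((hasDerivAt_const_div_dist₂_pow 1 w hw0 (z - x)).comp_const_sub z x).add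
      (((hasDerivAt_id x).pow 2).mul_const (1 / (2 * w ^ 2)))).congr_deriv (by
        simp; field_simp))
    (fun x _ => by
      have h1 := hasDerivAt_const_div_dist₂_pow 3 1 hw0 (z - x)
      have h2 := (((hasDerivAt_id (z - x)).mul h1).const_mul w).comp_const_sub z x
      have h3 := h2.add ((hasDerivAt_id x).mul_const (1 / w ^ 2))
      have hρ := dist₂_pos hw0 (z - x)
      refine (h3.congr_deriv ?_).congr_of_eventuallyEq (Filter.Eventually.of_forall fun u => ?_)
      · simp only [id]
        push_cast
        field_simp
        ring
      · simp only [id, Pi.add_apply, Pi.mul_apply]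
        ring)
    (fun x hx => by
      have h2 := hζ x hx
      have hρ := dist₂_pos hw0 (z - x)
      have h4 := le_dist₂_fst hw0 (z - x)
      have h3 := inv_dist₂_cube_le hw.1 (z - x)
      have hx' : |x| ≤ 3 * (1 / 10 ^ 7) := abs_le.2 hx
      refine (abs_add_le _ _).trans ?_
      rw [abs_mul, abs_mul, abs_div, abs_of_pos hw0, abs_of_pos (pow_pos hρ 3),
        abs_of_pos (by positivity : 0 < 1 / w ^ 2)]
      calc w * (|z - x| / dist₂ (w, z - x) ^ 3) + |x| * (1 / w ^ 2)
          = w * |z - x| * (1 / dist₂ (w, z - x) ^ 3) + |x| * (1 / w ^ 2) := by ring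
        _ ≤ 3 * (7 / 10 ^ 7) * 512 + 3 * (1 / 10 ^ 7) * 64 := by
            gcongr
            exact hw.2
        _ ≤ _ := by norm_num)
    (fun x hx => by
      have h2 := hζ x hx
      have h3 := inv_dist₂_cube_le hw.1 (z - x)
      have hρ := dist₂_pos hw0 (z - x)
      have h4 := le_dist₂_fst hw0 (z - x)
      have h5 := abs_snd_le_dist₂ hw0 (z - x)
      have h1 := abs_curvature_le hw.1 (z - x)
      have e1 : -(w / dist₂ (w, z - x) ^ 3) + 3 * w * (z - x) ^ 2 / dist₂ (w, z - x) ^ 5 +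
        1 / w ^ 2 = -(w ^ 2 / dist₂ (w, z - x) ^ 3 - 1 / w) * (1 / w) +
          3 * w * (z - x) ^ 2 / dist₂ (w, z - x) ^ 5 := by field_simp; ring
      rw [e1]
      refine (abs_add_le _ _).trans ?_
      rw [abs_mul, abs_neg, abs_of_pos (by positivity : 0 < 1 / w), ← sq_abs (z - x),
        abs_of_nonneg (by positivity : 0 ≤ 3 * w * |z - x| ^ 2 / dist₂ (w, z - x) ^ 5)]
      set ρ := dist₂ (w, z - x)
      have h6 : w * |z - x| / ρ ^ 2 ≤ 1 := by
        rw [div_le_one (by positivity), sq]; exact mul_le_mul h4 h5 (abs_nonneg _) hρ.le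
      calc |w ^ 2 / ρ ^ 3 - 1 / w| * (1 / w) + 3 * w * |z - x| ^ 2 / ρ ^ 5
          = |w ^ 2 / ρ ^ 3 - 1 / w| * (1 / w) + 3 * (w * |z - x| / ρ ^ 2) * |z - x| * (1 / ρ ^ 3) := by
            congr 1; field_simp
        _ ≤ (192 * (7 / 10 ^ 7)) * 8 + 3 * 1 * (7 / 10 ^ 7) * 512 := by
            gcongr
            linarith
        _ ≤ _ := by norm_num) ht hs ht' hs'
  have e1 : quad (pd₁ dist₂) t s t' s' w z = (w / dist₂ (w, z - t) ^ 1 + t ^ 2 * (1 / (2 * w ^ 2)) +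
      (w / dist₂ (w, z - s) ^ 1 + s ^ 2 * (1 / (2 * w ^ 2))) -
      (w / dist₂ (w, z - t') ^ 1 + t' ^ 2 * (1 / (2 * w ^ 2))) -
      (w / dist₂ (w, z - s') ^ 1 + s' ^ 2 * (1 / (2 * w ^ 2)))) -
      (((t - s) ^ 2 - (t' - s') ^ 2) * (1 / (4 * w ^ 2)) +
        (t + s - t' - s') * ((t + s + t' + s') * (1 / (4 * w ^ 2)))) := by
    unfold quad
    simp only [pd₁_dist₂ hw0, pow_one]
    field_simp
    ring
  have e2 : |(t - s) ^ 2 - (t' - s') ^ 2| * (1 / 36) ≤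
      |((t - s) ^ 2 - (t' - s') ^ 2) * (1 / (4 * w ^ 2))| := by
    rw [abs_mul, abs_of_pos (by positivity : 0 < 1 / (4 * w ^ 2))]
    refine mul_le_mul_of_nonneg_left (one_div_le_one_div_of_le (by positivity) ?_) (abs_nonneg _)
    nlinarith [hw.2]
  have e3 : |(t + s - t' - s') * ((t + s + t' + s') * (1 / (4 * w ^ 2)))| ≤
      |t + s - t' - s'| * (1 / 10000) := by
    rw [abs_mul, abs_mul, abs_of_pos (by positivity : 0 < 1 / (4 * w ^ 2))]
    refine mul_le_mul_of_nonneg_left ?_ (abs_nonneg _)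
    have e4 : |t + s + t' + s'| ≤ 4 / 10 ^ 7 := by
      rw [abs_le] at *
      constructor <;> linarith [ht.1, ht.2, hs.1, hs.2, ht'.1, ht'.2, hs'.1, hs'.2]
    calc |t + s + t' + s'| * (1 / (4 * w ^ 2)) = |t + s + t' + s'| * (1 / w ^ 2) / 4 := by
          field_simp
      _ ≤ 4 / 10 ^ 7 * 64 / 4 := by gcongr
      _ ≤ _ := by norm_num
  rw [e1, abs_sub_comm]
  refine le_trans ?_ (abs_sub_abs_le_abs_sub _ _)
  have e5 := abs_sub_abs_le_abs_sub (((t - s) ^ 2 - (t' - s') ^ 2) * (1 / (4 * w ^ 2)))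
    (-((t + s - t' - s') * ((t + s + t' + s') * (1 / (4 * w ^ 2)))))
  rw [abs_neg, sub_neg_eq_add] at e5
  unfold gap
  linarith [abs_nonneg (t + s - t' - s'), abs_nonneg ((t - s) ^ 2 - (t' - s') ^ 2)]

theorem JetBound.comp_const_add {I J : Set ℝ} {n : ℕ} {M : ℝ} {f : ℝ → ℝ} (hf : JetBound I ∅ n M f)
    (c : ℝ) (hJ : ∀ x ∈ J, c + x ∈ I) : JetBound J ∅ n M (fun x => f (c + x)) := by
  induction n generalizing f with
  | zero => exact ⟨hf.1.comp (by fun_prop) hJ, fun x hx => hf.2 _ (hJ x hx)⟩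
  | succ n ih =>
    obtain ⟨h1, -, f', hf', h3⟩ := hf
    exact ⟨fun x hx => h1 _ (hJ x hx), by simp, _,
      fun x hx => (hf' _ (hJ x hx)).comp_const_add c x, ih h3⟩

/-- A smooth cutoff equal to one near the origin. -/
def bump : ContDiffBump (0 : ℝ) := ⟨2 / 10 ^ 7, 3 / 10 ^ 7, by norm_num, by norm_num⟩

theorem tsupport_bump : tsupport bump ⊆ Ioo (-(4 / 10 ^ 7)) (4 / 10 ^ 7) := by
  rw [bump.tsupport_eq, Real.closedBall_eq_Icc]
  have : bump.rOut = 3 / 10 ^ 7 := rfl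
  rw [this]
  exact Icc_subset_Ioo (by norm_num) (by norm_num)

/-- The interval carrying the cutoff. -/
def box : Set ℝ := Icc (-(4 / 10 ^ 7)) (4 / 10 ^ 7)

theorem exists_jetBound_bump (n : ℕ) : ∃ M : ℝ, 0 ≤ M ∧
    JetBound box {-(4 / 10 ^ 7), 4 / 10 ^ 7} n M bump :=
  JetBound.of_contDiff n bump.contDiff tsupport_bump

theorem continuous_dist₂ : Continuous dist₂ := by unfold dist₂; fun_prop

-- Four integrations by parts in `x` with large parameter `μ · gap`: divided by the gap, the phase
-- derivative is bounded below and has uniformly bounded jets. This variable is the right one when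
-- the quadratic part of the gap dominates.
open Complex (I) in
theorem exists_norm_integral_exp_quad_fst_le : ∃ C : ℝ, 0 ≤ C ∧ ∀ R ∈ Icc (1 / 5 : ℝ) (5 / 2),
    ∀ μ > 0, ∀ t s t' s' : ℝ, |t| ≤ 1 / 10 ^ 7 → |s| ≤ 1 / 10 ^ 7 → |t'| ≤ 1 / 10 ^ 7 →
    |s'| ≤ 1 / 10 ^ 7 → 0 < gap t s t' s' →
    |t + s - t' - s'| ≤ |(t - s) ^ 2 - (t' - s') ^ 2| → ∀ z ∈ box,
    ‖∫ x in (-(4 / 10 ^ 7) : ℝ)..(4 / 10 ^ 7),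
      Complex.exp (I * (μ * quad dist₂ t s t' s' (R + x) z : ℝ)) * (bump x : ℂ)‖ ≤
      C / (μ * gap t s t' s') ^ 4 := by
  obtain ⟨M, hM, hb⟩ := exists_jetBound_bump 4
  obtain ⟨M₁, hM₁, hq⟩ := exists_jetBound_quad_fst 4 (contDiffOn_pd₁ contDiffOn_dist₂)
  obtain ⟨M₂, hM₂, hinv⟩ := JetBound.inv 4 M₁ (1 / 1000) hM₁ (by norm_num)
  obtain ⟨C, hC, H⟩ := exists_norm_integral_exp_mul_le 4 M M₂ (8 / 10 ^ 7) hM hM₂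
  refine ⟨C, hC, fun R hR μ hμ t s t' s' ht hs ht' hs' hgap hle z hz => ?_⟩
  have hw : ∀ x ∈ box, R + x ∈ Icc (1 / 8 : ℝ) 3 := fun x hx =>
    ⟨by linarith [hx.1, hR.1], by linarith [hx.2, hR.2]⟩
  have hjet := (hq (Icc (1 / 8) 3) subset_rfl z ⟨by linarith [hz.1], by linarith [hz.2]⟩ t s t' s'
    (by linarith) (by linarith) (by linarith) (by linarith)).comp_const_add R hw
  have hlow : ∀ x ∈ box, 1 / 1000 ≤ |(gap t s t' s')⁻¹ * quad (pd₁ dist₂) t s t' s' (R + x) z| := by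
    intro x hx
    have := abs_quad_pd₁_ge (hw x hx) (abs_le.2 hz) ht hs ht' hs' hle
    rw [abs_mul, abs_of_pos (inv_pos.2 hgap), le_inv_mul_iff₀ hgap]
    linarith
  refine H _ _ (μ * gap t s t' s') _
    (fun x => (gap t s t' s')⁻¹ * quad (pd₁ dist₂) t s t' s' (R + x) z) _ _ (by norm_num)
    (by norm_num) (by positivity) (fun x hx => ?_) hjet.continuousOn (fun x hx => ?_)
    (hinv _ _ hjet hlow) hb
  · have := (hasDerivAt_quad_fst contDiffOn_dist₂ t s t' s' (w := R + x)
      (lt_of_lt_of_le (by norm_num) (hw x hx).1) z).comp_const_add R x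
    exact (this.const_mul μ).congr_deriv (by field_simp)
  · refine mul_inv_cancel₀ fun h0 => ?_
    have := hlow x hx
    rw [h0, abs_zero] at this
    norm_num at this

-- The counterpart in the second variable, for a dominant linear part of the gap.
open Complex (I) in
theorem exists_norm_integral_exp_quad_snd_le : ∃ C : ℝ, 0 ≤ C ∧ ∀ R ∈ Icc (1 / 5 : ℝ) (5 / 2),
    ∀ μ > 0, ∀ t s t' s' : ℝ, |t| ≤ 1 / 10 ^ 7 → |s| ≤ 1 / 10 ^ 7 → |t'| ≤ 1 / 10 ^ 7 →
    |s'| ≤ 1 / 10 ^ 7 → 0 < gap t s t' s' →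
    |(t - s) ^ 2 - (t' - s') ^ 2| ≤ |t + s - t' - s'| → ∀ x ∈ box,
    ‖∫ z in (-(4 / 10 ^ 7) : ℝ)..(4 / 10 ^ 7),
      Complex.exp (I * (μ * quad dist₂ t s t' s' (R + x) z : ℝ)) * (bump z : ℂ)‖ ≤
      C / (μ * gap t s t' s') ^ 4 := by
  obtain ⟨M, hM, hb⟩ := exists_jetBound_bump 4
  obtain ⟨M₁, hM₁, hq⟩ := exists_jetBound_quad_snd 4 (contDiffOn_pd₂ contDiffOn_dist₂)
  obtain ⟨M₂, hM₂, hinv⟩ := JetBound.inv 4 M₁ (1 / 100) hM₁ (by norm_num)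
  obtain ⟨C, hC, H⟩ := exists_norm_integral_exp_mul_le 4 M M₂ (8 / 10 ^ 7) hM hM₂
  refine ⟨C, hC, fun R hR μ hμ t s t' s' ht hs ht' hs' hgap hle x hx => ?_⟩
  have hw : R + x ∈ Icc (1 / 8 : ℝ) 3 :=
    ⟨by linarith [hx.1, hR.1], by linarith [hx.2, hR.2]⟩
  have hjet := hq (R + x) hw box (Icc_subset_Icc (by norm_num) (by norm_num)) t s t' s'
    (by linarith) (by linarith) (by linarith) (by linarith)
  have hlow : ∀ z ∈ box, 1 / 100 ≤ |(gap t s t' s')⁻¹ * quad (pd₂ dist₂) t s t' s' (R + x) z| := by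
    intro z hz
    have := abs_quad_pd₂_ge hw (abs_le.2 hz) ht hs ht' hs' hle
    rw [abs_mul, abs_of_pos (inv_pos.2 hgap), le_inv_mul_iff₀ hgap]
    linarith
  refine H _ _ (μ * gap t s t' s') _
    (fun z => (gap t s t' s')⁻¹ * quad (pd₂ dist₂) t s t' s' (R + x) z) _ _ (by norm_num)
    (by norm_num) (by positivity) (fun z hz => ?_) hjet.continuousOn (fun z hz => ?_)
    (hinv _ _ hjet hlow) hb
  · have := hasDerivAt_quad_snd contDiffOn_dist₂ t s t' s' (w := R + x)
      (lt_of_lt_of_le (by norm_num) hw.1) z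
    exact (this.const_mul μ).congr_deriv (by field_simp)
  · refine mul_inv_cancel₀ fun h0 => ?_
    have := hlow z hz
    rw [h0, abs_zero] at this
    norm_num at this

/-- Lebesgue measure on the square carrying the cutoff. -/
def boxMeasure : Measure (ℝ × ℝ) := (volume.restrict box).prod (volume.restrict box)

instance : IsFiniteMeasure (volume.restrict box) := ⟨by
  rw [Measure.restrict_apply_univ, box]; exact measure_Icc_lt_top⟩

instance : IsFiniteMeasure boxMeasure := by unfold boxMeasure; infer_instance

theorem boxMeasure_real_univ_le : (volume.restrict box).real univ ≤ 1 := by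
  rw [measureReal_restrict_apply_univ, box, Real.volume_real_Icc_of_le (by norm_num)]
  norm_num

theorem setIntegral_box (f : ℝ → ℂ) :
    ∫ x in box, f x = ∫ x in (-(4 / 10 ^ 7) : ℝ)..(4 / 10 ^ 7), f x := by
  rw [box, integral_Icc_eq_integral_Ioc, intervalIntegral.integral_of_le (by norm_num)]

open Complex (I) in
/-- The kernel of the `T * T` operator decays rapidly in the gap. -/
theorem exists_norm_integral_exp_quad_le : ∃ C : ℝ, 0 ≤ C ∧ ∀ R ∈ Icc (1 / 5 : ℝ) (5 / 2),
    ∀ μ > 0, ∀ t s t' s' : ℝ, |t| ≤ 1 / 10 ^ 7 → |s| ≤ 1 / 10 ^ 7 → |t'| ≤ 1 / 10 ^ 7 →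
    |s'| ≤ 1 / 10 ^ 7 →
    ‖∫ x, Complex.exp (I * (μ * quad dist₂ t s t' s' (R + x.1) x.2 : ℝ)) *
      (bump x.1 * bump x.2 : ℝ) ∂boxMeasure‖ ≤ C / (1 + (μ * gap t s t' s') ^ 2) ^ 2 := by
  obtain ⟨C₁, hC₁, H₁⟩ := exists_norm_integral_exp_quad_fst_le
  obtain ⟨C₂, hC₂, H₂⟩ := exists_norm_integral_exp_quad_snd_le
  refine ⟨4 * (1 + C₁ + C₂), by positivity, fun R hR μ hμ t s t' s' ht hs ht' hs' => ?_⟩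
  set F : ℝ × ℝ → ℂ := fun x => Complex.exp (I * (μ * quad dist₂ t s t' s' (R + x.1) x.2 : ℝ)) *
      (bump x.1 * bump x.2 : ℝ) with hF
  have hFc : Continuous F := by
    have h1 := continuous_dist₂
    have h2 := bump.continuous
    unfold F quad
    fun_prop
  have hFb : ∀ x, ‖F x‖ ≤ 1 := by
    intro x
    rw [hF, norm_mul, mul_comm I, Complex.norm_exp_ofReal_mul_I, one_mul, Complex.norm_real,
      Real.norm_of_nonneg (mul_nonneg bump.nonneg bump.nonneg)]
    exact mul_le_one₀ bump.le_one bump.nonneg bump.le_one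
  have hFi : Integrable F boxMeasure :=
    Integrable.of_bound hFc.aestronglyMeasurable 1 (Filter.Eventually.of_forall hFb)
  have htriv : ‖∫ x, F x ∂boxMeasure‖ ≤ 1 := by
    refine (norm_integral_le_of_norm_le_const (C := 1) (Filter.Eventually.of_forall hFb)).trans ?_
    rw [one_mul, boxMeasure, ← univ_prod_univ, measureReal_prod_prod]
    exact mul_le_one₀ boxMeasure_real_univ_le measureReal_nonneg boxMeasure_real_univ_le
  have hav : ∀ (G : ℝ → ℂ) (B : ℝ), (∀ x ∈ box, ‖G x‖ ≤ B) → 0 ≤ B → ‖∫ x in box, G x‖ ≤ B := by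
    intro G B hG hB
    refine (norm_integral_le_of_norm_le_const (C := B)
      ((ae_restrict_iff' measurableSet_Icc).2 (Filter.Eventually.of_forall hG))).trans ?_
    exact mul_le_of_le_one_right hB boxMeasure_real_univ_le
  set y := μ * gap t s t' s' with hy
  have hy0 : 0 ≤ y := mul_nonneg hμ.le (gap_nonneg _ _ _ _)
  rw [le_div_iff₀ (by positivity)]
  -- For `y ≤ 1` the trivial bound suffices. The factor 4 bounds `(1 + y²)²` in this range and its
  -- quotient by `y⁴` in the other.
  rcases le_total y 1 with h1 | h1
  · have e1 : (1 + y ^ 2) ^ 2 ≤ 4 := by nlinarith [sq_nonneg y, pow_le_one₀ hy0 h1 (n := 2)]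
    calc ‖∫ x, F x ∂boxMeasure‖ * (1 + y ^ 2) ^ 2 ≤ 1 * 4 :=
          mul_le_mul htriv e1 (by positivity) zero_le_one
      _ ≤ _ := by linarith
  · have hgap : 0 < gap t s t' s' := pos_of_mul_pos_right (lt_of_lt_of_le one_pos h1) hμ.le
    have hbd : ‖∫ x, F x ∂boxMeasure‖ ≤ (C₁ + C₂) / y ^ 4 := by
      -- The larger part of the gap decides the variable of integration by parts; the other variable
      -- runs over a set of measure at most one.
      rcases le_total |(t - s) ^ 2 - (t' - s') ^ 2| |t + s - t' - s'| with hle | hle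
      · rw [boxMeasure, integral_prod _ hFi]
        refine hav _ _ (fun x hx => ?_) (by positivity)
        rw [setIntegral_box]
        have e1 : ∫ z in (-(4 / 10 ^ 7) : ℝ)..(4 / 10 ^ 7), F (x, z) = (bump x : ℂ) *
          ∫ z in (-(4 / 10 ^ 7) : ℝ)..(4 / 10 ^ 7),
            Complex.exp (I * (μ * quad dist₂ t s t' s' (R + x) z : ℝ)) * (bump z : ℂ) := by
          rw [← intervalIntegral.integral_const_mul]
          congr 1
          ext z
          simp only [hF]
          push_cast
          ring
        rw [e1, norm_mul, Complex.norm_real, Real.norm_of_nonneg bump.nonneg]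
        calc _ ≤ 1 * (C₂ / y ^ 4) := mul_le_mul bump.le_one
              (H₂ R hR μ hμ t s t' s' ht hs ht' hs' hgap hle x hx) (norm_nonneg _) zero_le_one
          _ ≤ _ := by rw [one_mul]; gcongr; linarith
      · rw [boxMeasure, integral_prod_symm _ hFi]
        refine hav _ _ (fun z hz => ?_) (by positivity)
        rw [setIntegral_box]
        have e1 : ∫ x in (-(4 / 10 ^ 7) : ℝ)..(4 / 10 ^ 7), F (x, z) = (bump z : ℂ) *
          ∫ x in (-(4 / 10 ^ 7) : ℝ)..(4 / 10 ^ 7),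
            Complex.exp (I * (μ * quad dist₂ t s t' s' (R + x) z : ℝ)) * (bump x : ℂ) := by
          rw [← intervalIntegral.integral_const_mul]
          congr 1
          ext x
          simp only [hF]
          push_cast
          ring
        rw [e1, norm_mul, Complex.norm_real, Real.norm_of_nonneg bump.nonneg]
        calc _ ≤ 1 * (C₁ / y ^ 4) := mul_le_mul bump.le_one
              (H₁ R hR μ hμ t s t' s' ht hs ht' hs' hgap hle z hz) (norm_nonneg _) zero_le_one
          _ ≤ _ := by rw [one_mul]; gcongr; linarith
    have e1 : (1 + y ^ 2) ^ 2 ≤ 4 * y ^ 4 := by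
      have : 1 ≤ y ^ 2 := one_le_pow₀ h1
      nlinarith
    calc ‖∫ x, F x ∂boxMeasure‖ * (1 + y ^ 2) ^ 2 ≤ (C₁ + C₂) / y ^ 4 * (4 * y ^ 4) :=
          mul_le_mul hbd e1 (by positivity) (by positivity)
      _ = 4 * (C₁ + C₂) := by field_simp
      _ ≤ _ := by linarith

end Phase

/-! ### The `T T*` method with Schur's test. -/

section Schur

variable {X Z : Type*} [MeasurableSpace X] [MeasurableSpace Z]

theorem enorm_mul_enorm_le {E : Type*} [NormedAddCommGroup E] (a b : E) :
    ‖a‖ₑ * ‖b‖ₑ ≤ 2⁻¹ * (‖a‖ₑ ^ 2 + ‖b‖ₑ ^ 2) := by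
  have h : ‖a‖₊ * ‖b‖₊ ≤ 2⁻¹ * (‖a‖₊ ^ 2 + ‖b‖₊ ^ 2) := by
    rw [← NNReal.coe_le_coe]
    push_cast
    nlinarith [sq_nonneg (‖a‖ - ‖b‖)]
  have h2 : (2⁻¹ : ℝ≥0∞) = ((2⁻¹ : ℝ≥0) : ℝ≥0∞) := by
    rw [ENNReal.coe_inv (by norm_num)]; norm_num
  rw [h2, enorm_eq_nnnorm, enorm_eq_nnnorm]
  exact_mod_cast h

/-- The `T * T` argument: an `L²` bound from Schur's test for the composed kernel. -/
theorem lintegral_sq_le_of_schur (ρ : Measure X) (ν : Measure Z) [IsFiniteMeasure ρ]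
    [IsFiniteMeasure ν] {E : X → Z → ℂ} (hE : Measurable (uncurry E)) (hE1 : ∀ x z, ‖E x z‖ ≤ 1)
    {F : Z → ℂ} (hFm : Measurable F) (hF : Integrable F ν) {A : ℝ≥0∞}
    (hA : ∀ᵐ z ∂ν, ∫⁻ z', ‖∫ x, E x z * (starRingEnd ℂ) (E x z') ∂ρ‖ₑ ∂ν ≤ A) :
    ∫⁻ x, ‖∫ z, E x z * F z ∂ν‖ₑ ^ 2 ∂ρ ≤ A * ∫⁻ z, ‖F z‖ₑ ^ 2 ∂ν := by
  set c := starRingEnd ℂ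
  have hcm : Measurable (fun w : ℂ => c w) := Complex.continuous_conj.measurable
  set S : X → ℂ := fun x => ∫ z, E x z * F z ∂ν with hS
  set H : Z → Z → ℂ := fun z z' => ∫ x, E x z * c (E x z') ∂ρ with hH
  have hSm : StronglyMeasurable S := by
    refine StronglyMeasurable.integral_prod_right (f := fun x z => E x z * F z) ?_
    exact (hE.mul (hFm.comp measurable_snd)).stronglyMeasurable
  have hSb : ∀ x, ‖S x‖ ≤ ∫ z, ‖F z‖ ∂ν := fun x =>
    norm_integral_le_of_norm_le hF.norm (Filter.Eventually.of_forall fun z => by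
      rw [norm_mul]; exact mul_le_of_le_one_left (norm_nonneg _) (hE1 x z))
  have hSi : Integrable (fun x => ‖S x‖ ^ 2) ρ := by
    refine Integrable.of_bound (hSm.norm.pow 2).aestronglyMeasurable ((∫ z, ‖F z‖ ∂ν) ^ 2)
      (Filter.Eventually.of_forall fun x => ?_)
    rw [Real.norm_of_nonneg (by positivity)]
    exact pow_le_pow_left₀ (norm_nonneg _) (hSb x) 2
  set G : X → Z × Z → ℂ := fun x w => (E x w.1 * F w.1) * c (E x w.2 * F w.2) with hG
  have hGm : Measurable (uncurry G) := by
    have h1 : Measurable fun p : X × Z × Z => E p.1 p.2.1 :=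
      hE.comp (measurable_fst.prodMk (measurable_fst.comp measurable_snd))
    have h2 : Measurable fun p : X × Z × Z => E p.1 p.2.2 :=
      hE.comp (measurable_fst.prodMk (measurable_snd.comp measurable_snd))
    have h3 : Measurable fun p : X × Z × Z => F p.2.1 :=
      hFm.comp (measurable_fst.comp measurable_snd)
    have h4 : Measurable fun p : X × Z × Z => F p.2.2 :=
      hFm.comp (measurable_snd.comp measurable_snd)
    exact (h1.mul h3).mul (hcm.comp (h2.mul h4))
  have hGi : Integrable (uncurry G) (ρ.prod (ν.prod ν)) := by
    have h1 : Integrable (fun p : X × Z × Z => (1 : ℝ) * (‖F p.2.1‖ * ‖F p.2.2‖))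
        (ρ.prod (ν.prod ν)) :=
      (integrable_const (1 : ℝ)).mul_prod (hF.norm.mul_prod hF.norm)
    refine h1.mono' hGm.aestronglyMeasurable (Filter.Eventually.of_forall fun p => ?_)
    simp only [uncurry, hG, c, norm_mul, Complex.norm_conj, one_mul]
    exact mul_le_mul (mul_le_of_le_one_left (norm_nonneg _) (hE1 _ _))
      (mul_le_of_le_one_left (norm_nonneg _) (hE1 _ _)) (by positivity) (norm_nonneg _)
  -- Expanding the square exposes the composed kernel `H`.
  have e1 : ((∫ x, ‖S x‖ ^ 2 ∂ρ : ℝ) : ℂ) = ∫ w : Z × Z, F w.1 * c (F w.2) * H w.1 w.2 ∂ν.prod ν := by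
    rw [← integral_complex_ofReal]
    have : ∀ x, ((‖S x‖ ^ 2 : ℝ) : ℂ) = ∫ w, G x w ∂ν.prod ν := by
      intro x
      rw [hG, integral_prod_mul (f := fun z => E x z * F z) (g := fun z => c (E x z * F z)),
        integral_conj, Complex.mul_conj, Complex.normSq_eq_norm_sq]
    simp only [this]
    rw [integral_integral_swap hGi]
    refine integral_congr_ae (Filter.Eventually.of_forall fun w => ?_)
    simp only [hG, hH, map_mul]
    rw [← integral_const_mul]
    congr 1
    ext x
    ring
  have hHm : Measurable fun w : Z × Z => ‖H w.1 w.2‖ₑ := by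
    have : StronglyMeasurable fun w : Z × Z => ∫ x, E x w.1 * c (E x w.2) ∂ρ := by
      refine StronglyMeasurable.integral_prod_right (f := fun (w : Z × Z) x => E x w.1 * c (E x w.2)) ?_
      have h1 : Measurable fun p : (Z × Z) × X => E p.2 p.1.1 :=
        hE.comp (measurable_snd.prodMk (measurable_fst.comp measurable_fst))
      have h2 : Measurable fun p : (Z × Z) × X => E p.2 p.1.2 :=
        hE.comp (measurable_snd.prodMk (measurable_snd.comp measurable_fst))
      exact (h1.mul (hcm.comp h2)).stronglyMeasurable
    exact this.enorm
  have hFe : Measurable fun z => ‖F z‖ₑ ^ 2 := hFm.enorm.pow_const 2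
  have hp1 : Measurable fun w : Z × Z => ‖F w.1‖ₑ ^ 2 * ‖H w.1 w.2‖ₑ :=
    (hFe.comp measurable_fst).mul hHm
  have hp2 : Measurable fun w : Z × Z => ‖F w.2‖ₑ ^ 2 * ‖H w.1 w.2‖ₑ :=
    (hFe.comp measurable_snd).mul hHm
  -- `H` is Hermitian, so the bound on its row integrals also bounds the column integrals.
  have hsym : ∀ z z', ‖H z z'‖ₑ = ‖H z' z‖ₑ := by
    intro z z'
    have : H z z' = c (H z' z) := by
      simp only [hH, c]
      rw [← integral_conj]
      congr 1
      ext x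
      simp [mul_comm]
    rw [this, RCLike.enorm_conj]
  have e2 : ∫⁻ x, ‖S x‖ₑ ^ 2 ∂ρ = ‖((∫ x, ‖S x‖ ^ 2 ∂ρ : ℝ) : ℂ)‖ₑ := by
    rw [← ofReal_norm, Complex.norm_real, Real.norm_of_nonneg (integral_nonneg fun x => by positivity),
      ofReal_integral_eq_lintegral_ofReal hSi (Filter.Eventually.of_forall fun x => by positivity)]
    refine lintegral_congr fun x => ?_
    rw [ENNReal.ofReal_pow (norm_nonneg _), ofReal_norm]
  have e3 : ∫⁻ w : Z × Z, ‖F w.1‖ₑ ^ 2 * ‖H w.1 w.2‖ₑ ∂ν.prod ν ≤ A * ∫⁻ z, ‖F z‖ₑ ^ 2 ∂ν := by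
    rw [lintegral_prod _ hp1.aemeasurable,
      ← lintegral_const_mul _ hFe]
    refine lintegral_mono_ae (hA.mono fun z hz => ?_)
    have hz2 : Measurable fun y => ‖H z y‖ₑ := hHm.comp measurable_prodMk_left
    simp only
    rw [lintegral_const_mul _ hz2, mul_comm]
    exact mul_le_mul' hz le_rfl
  have e4 : ∫⁻ w : Z × Z, ‖F w.2‖ₑ ^ 2 * ‖H w.1 w.2‖ₑ ∂ν.prod ν ≤ A * ∫⁻ z, ‖F z‖ₑ ^ 2 ∂ν := by
    rw [← lintegral_prod_swap]
    simp only [Prod.fst_swap, Prod.snd_swap]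
    refine le_trans (lintegral_mono fun w => ?_) e3
    rw [hsym]
  rw [e2, e1]
  calc _ ≤ ∫⁻ w : Z × Z, ‖F w.1 * c (F w.2) * H w.1 w.2‖ₑ ∂ν.prod ν := enorm_integral_le_lintegral_enorm _
    _ ≤ ∫⁻ w : Z × Z, 2⁻¹ * (‖F w.1‖ₑ ^ 2 * ‖H w.1 w.2‖ₑ + ‖F w.2‖ₑ ^ 2 * ‖H w.1 w.2‖ₑ) ∂ν.prod ν := by
        refine lintegral_mono fun w => ?_
        rw [enorm_mul, enorm_mul, RCLike.enorm_conj, ← add_mul, ← mul_assoc]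
        exact mul_le_mul' (enorm_mul_enorm_le _ _) le_rfl
    _ = 2⁻¹ * (∫⁻ w : Z × Z, ‖F w.1‖ₑ ^ 2 * ‖H w.1 w.2‖ₑ ∂ν.prod ν +
        ∫⁻ w : Z × Z, ‖F w.2‖ₑ ^ 2 * ‖H w.1 w.2‖ₑ ∂ν.prod ν) := by
        rw [lintegral_const_mul, lintegral_add_left hp1]
        exact hp1.add hp2
    _ ≤ 2⁻¹ * (A * ∫⁻ z, ‖F z‖ₑ ^ 2 ∂ν + A * ∫⁻ z, ‖F z‖ₑ ^ 2 ∂ν) := by gcongr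
    _ = _ := by
        rw [← two_mul, ← mul_assoc, ENNReal.inv_mul_cancel (by norm_num) (by norm_num), one_mul]

end Schur

/-! ### Integrating the decay in the gap. -/

section GapIntegral

/-- The Cauchy profile. -/
def profile (μ u : ℝ) : ℝ≥0∞ := ENNReal.ofReal ((1 + (μ * u) ^ 2)⁻¹)

theorem measurable_profile (μ : ℝ) : Measurable (profile μ) := by
  unfold profile; fun_prop

theorem lintegral_profile {μ : ℝ} (hμ : 0 < μ) (b : ℝ) :
    ∫⁻ u, profile μ (b - u) = ENNReal.ofReal (Real.pi / μ) := by
  rw [lintegral_sub_left_eq_self (fun u => profile μ u) b]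
  unfold profile
  rw [← ofReal_integral_eq_lintegral_ofReal (integrable_inv_one_add_sq.comp_mul_left' hμ.ne')
    (Filter.Eventually.of_forall fun x => by positivity),
    Measure.integral_comp_mul_left (fun y : ℝ => (1 + y ^ 2)⁻¹) μ, integral_univ_inv_one_add_sq,
    abs_of_pos (inv_pos.2 hμ), smul_eq_mul]
  congr 1
  ring

/-- `|v| dv` is half the differential of `v²`, and each half-line contributes at most one half of
the right side. -/
theorem lintegral_abs_mul_comp_sq_le (f : ℝ → ℝ≥0∞) :
    ∫⁻ v, ENNReal.ofReal |v| * f (v ^ 2) ≤ ∫⁻ u, f u := by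
  have key : ∀ s : Set ℝ, MeasurableSet s → InjOn (fun v : ℝ => v ^ 2) s →
      ∫⁻ v in s, ENNReal.ofReal |v| * f (v ^ 2) ≤ 2⁻¹ * ∫⁻ u, f u := by
    intro s hs hinj
    have h := lintegral_image_eq_lintegral_abs_deriv_mul hs
      (fun x _ => (by simpa using (hasDerivAt_pow 2 x).hasDerivWithinAt :
        HasDerivWithinAt (fun v : ℝ => v ^ 2) (2 * x) s x)) hinj f
    calc ∫⁻ v in s, ENNReal.ofReal |v| * f (v ^ 2)
        = ∫⁻ v in s, 2⁻¹ * (ENNReal.ofReal |2 * v| * f (v ^ 2)) := by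
          refine lintegral_congr fun v => ?_
          rw [abs_mul, ENNReal.ofReal_mul (by norm_num), ← mul_assoc, ← mul_assoc]
          congr 1
          rw [abs_two, ENNReal.ofReal_ofNat, ENNReal.inv_mul_cancel (by norm_num) (by norm_num), one_mul]
      _ = 2⁻¹ * ∫⁻ v in s, ENNReal.ofReal |2 * v| * f (v ^ 2) :=
          lintegral_const_mul' _ _ (by simp)
      _ ≤ _ := by
          rw [← h]
          exact mul_le_mul' le_rfl (setLIntegral_le_lintegral _ _)
  rw [← lintegral_add_compl _ (measurableSet_Ioi (a := (0 : ℝ)))]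
  have h1 := key (Ioi 0) measurableSet_Ioi fun x hx y hy h => by
    have := (sq_eq_sq₀ (le_of_lt hx) (le_of_lt hy)).1 h
    exact this
  have h2 := key (Ioi 0)ᶜ measurableSet_Ioi.compl fun x hx y hy h => by
    simp only [mem_compl_iff, mem_Ioi, not_lt] at hx hy
    have := (sq_eq_sq₀ (neg_nonneg.2 hx) (neg_nonneg.2 hy)).1 (by simpa using h)
    linarith
  refine (add_le_add h1 h2).trans_eq ?_
  rw [← add_mul, ENNReal.inv_two_add_inv_two, one_mul]

/-- Passing to sum and difference has Jacobian 2, which is discarded. -/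
theorem lintegral_add_mul_sub_le {f g : ℝ → ℝ≥0∞} (hf : Measurable f) (hg : Measurable g) :
    ∫⁻ z : ℝ × ℝ, f (z.1 + z.2) * g (z.1 - z.2) ≤ (∫⁻ u, f u) * ∫⁻ v, g v := by
  rw [Measure.volume_eq_prod, lintegral_prod_symm _ (by fun_prop)]
  calc ∫⁻ s, ∫⁻ t, f (t + s) * g (t - s) = ∫⁻ s, ∫⁻ v, f (v + 2 * s) * g v := by
        refine lintegral_congr fun s => ?_
        rw [← lintegral_add_right_eq_self _ s]
        refine lintegral_congr fun v => ?_
        rw [add_sub_cancel_right, two_mul, add_assoc]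
    _ = ∫⁻ v, ∫⁻ s, f (v + 2 * s) * g v := lintegral_lintegral_swap (by fun_prop)
    _ = ∫⁻ v, (∫⁻ s, f (2 * s)) * g v := by
        refine lintegral_congr fun v => ?_
        rw [lintegral_mul_const _ (by fun_prop)]
        congr 1
        rw [← lintegral_add_left_eq_self (fun s => f (2 * s)) (v / 2)]
        refine lintegral_congr fun s => ?_
        congr 1
        ring
    _ = (∫⁻ s, f (2 * s)) * ∫⁻ v, g v := lintegral_const_mul _ hg
    _ ≤ _ := by
        refine mul_le_mul' ?_ le_rfl
        have h := lintegral_image_eq_lintegral_abs_deriv_mul MeasurableSet.univ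
          (fun x _ => (by simpa using (hasDerivAt_id x).const_mul 2 :
            HasDerivAt (fun v : ℝ => 2 * v) 2 x).hasDerivWithinAt)
          (mul_right_injective₀ (two_ne_zero' ℝ)).injOn f
        rw [setLIntegral_univ] at h
        calc ∫⁻ s, f (2 * s) ≤ ∫⁻ s, ENNReal.ofReal |2| * f (2 * s) := by
              refine lintegral_mono fun s => le_mul_of_one_le_left' ?_
              rw [abs_two, ENNReal.ofReal_ofNat]
              norm_num
          _ = _ := h.symm
          _ ≤ _ := setLIntegral_le_lintegral _ _

/-- The weight `|t' - s'|` is, up to a constant, the Jacobian of `(t', s') ↦ (t' + s', (t' - s')²)`.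
The gap controls both coordinates, so the squared Cauchy profile is at most a product of two
profiles, each of integral `π/μ`. -/
theorem lintegral_gap_le {μ C : ℝ} (hμ : 0 < μ) (hC : 0 ≤ C) (t s : ℝ) :
    ∫⁻ z : ℝ × ℝ, ENNReal.ofReal (|z.1 - z.2| * (C / (1 + (μ * gap t s z.1 z.2) ^ 2) ^ 2)) ≤
      ENNReal.ofReal (C * (Real.pi / μ) ^ 2) := by
  have hp := measurable_profile μ
  calc _ ≤ ∫⁻ z : ℝ × ℝ, ENNReal.ofReal C * (profile μ ((t + s) - (z.1 + z.2)) *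
        (ENNReal.ofReal |z.1 - z.2| * profile μ ((t - s) ^ 2 - (z.1 - z.2) ^ 2))) := by
        refine lintegral_mono fun z => ?_
        unfold profile
        rw [← ENNReal.ofReal_mul (by positivity), ← ENNReal.ofReal_mul (by positivity),
          ← ENNReal.ofReal_mul hC]
        refine ENNReal.ofReal_le_ofReal ?_
        have hle : ∀ a : ℝ, |a| ≤ gap t s z.1 z.2 →
            (1 + (μ * gap t s z.1 z.2) ^ 2)⁻¹ ≤ (1 + (μ * a) ^ 2)⁻¹ := by
          intro a ha
          refine inv_anti₀ (by positivity) ?_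
          rw [mul_pow, mul_pow, ← sq_abs a]
          gcongr
        have h1 := hle ((t + s) - (z.1 + z.2)) (by
          unfold gap
          rw [← sub_sub]
          exact le_add_of_nonneg_right (abs_nonneg _))
        have h2 := hle ((t - s) ^ 2 - (z.1 - z.2) ^ 2) (le_add_of_nonneg_left (abs_nonneg _))
        calc |z.1 - z.2| * (C / (1 + (μ * gap t s z.1 z.2) ^ 2) ^ 2)
            = C * (|z.1 - z.2| * ((1 + (μ * gap t s z.1 z.2) ^ 2)⁻¹ *
              (1 + (μ * gap t s z.1 z.2) ^ 2)⁻¹)) := by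
              rw [div_eq_mul_inv, sq (1 + _), mul_inv]; ring
          _ ≤ C * (|z.1 - z.2| * ((1 + (μ * ((t + s) - (z.1 + z.2))) ^ 2)⁻¹ *
              (1 + (μ * ((t - s) ^ 2 - (z.1 - z.2) ^ 2)) ^ 2)⁻¹)) := by gcongr
          _ = _ := by ring
    _ = ENNReal.ofReal C * ∫⁻ z : ℝ × ℝ, (profile μ ((t + s) - (z.1 + z.2)) *
        (ENNReal.ofReal |z.1 - z.2| * profile μ ((t - s) ^ 2 - (z.1 - z.2) ^ 2))) :=
        lintegral_const_mul _ (by fun_prop)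
    _ ≤ ENNReal.ofReal C * (ENNReal.ofReal (Real.pi / μ) * ENNReal.ofReal (Real.pi / μ)) := by
        refine mul_le_mul' le_rfl ?_
        refine (lintegral_add_mul_sub_le (f := fun u => profile μ ((t + s) - u))
          (g := fun v => ENNReal.ofReal |v| * profile μ ((t - s) ^ 2 - v ^ 2))
          (by fun_prop) (by fun_prop)).trans ?_
        rw [lintegral_profile hμ]
        refine mul_le_mul' le_rfl ?_
        exact (lintegral_abs_mul_comp_sq_le fun u => profile μ ((t - s) ^ 2 - u)).trans_eq
          (lintegral_profile hμ _)
    _ = _ := by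
        rw [← ENNReal.ofReal_mul (by positivity), ← ENNReal.ofReal_mul hC, sq]

end GapIntegral

/-! ### The `L⁴ → L^q` bound for the line operator. -/

section Line

/-- The cutoff times Lebesgue measure on the plane. -/
def bumpMeasure : Measure (ℝ × ℝ) :=
  boxMeasure.withDensity fun x => ENNReal.ofReal (bump x.1 * bump x.2)

theorem measurable_bump_mul : Measurable fun x : ℝ × ℝ => ENNReal.ofReal (bump x.1 * bump x.2) := by
  have := bump.continuous
  exact (by fun_prop : Continuous fun x : ℝ × ℝ => bump x.1 * bump x.2).measurable.ennreal_ofReal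

theorem bump_mul_nonneg (x : ℝ × ℝ) : 0 ≤ bump x.1 * bump x.2 := mul_nonneg bump.nonneg bump.nonneg

theorem bump_mul_le_one (x : ℝ × ℝ) : bump x.1 * bump x.2 ≤ 1 :=
  mul_le_one₀ bump.le_one bump.nonneg bump.le_one

instance : IsFiniteMeasure bumpMeasure := ⟨by
  rw [bumpMeasure, withDensity_apply _ MeasurableSet.univ, setLIntegral_univ]
  calc ∫⁻ x, ENNReal.ofReal (bump x.1 * bump x.2) ∂boxMeasure ≤ ∫⁻ x, 1 ∂boxMeasure :=
        lintegral_mono fun x => by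
          simpa using ENNReal.ofReal_le_ofReal (bump_mul_le_one x)
    _ < ⊤ := by rw [lintegral_const, one_mul]; exact measure_lt_top _ _⟩

theorem integral_bumpMeasure (f : ℝ × ℝ → ℂ) :
    ∫ x, f x ∂bumpMeasure = ∫ x, f x * (bump x.1 * bump x.2 : ℝ) ∂boxMeasure := by
  rw [bumpMeasure, integral_withDensity_eq_integral_toReal_smul measurable_bump_mul
    (Filter.Eventually.of_forall fun x => ENNReal.ofReal_lt_top)]
  refine integral_congr_ae (Filter.Eventually.of_forall fun x => ?_)
  simp only
  rw [ENNReal.toReal_ofReal (bump_mul_nonneg x), Complex.real_smul, mul_comm]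

/-- The interval of unit weight. -/
def core : Set ℝ := Icc (-(1 / 10 ^ 7)) (1 / 10 ^ 7)

/-- The cutoffs equal one on the core, so estimates for the smoothly weighted measure pass to the
core square. -/
theorem restrict_core_le : volume.restrict (core ×ˢ core) ≤ bumpMeasure := by
  have hsub : core ⊆ box := Icc_subset_Icc (by norm_num) (by norm_num)
  refine Measure.le_intro fun s hs _ => ?_
  have e1 : boxMeasure = volume.restrict (box ×ˢ box) := by
    rw [boxMeasure, Measure.prod_restrict, Measure.volume_eq_prod]
  rw [Measure.restrict_apply hs, bumpMeasure, withDensity_apply _ hs]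
  have hcm : MeasurableSet (s ∩ core ×ˢ core) :=
    hs.inter (measurableSet_Icc.prod measurableSet_Icc)
  calc volume (s ∩ core ×ˢ core) = boxMeasure (s ∩ core ×ˢ core) := by
        rw [e1, Measure.restrict_apply hcm, inter_assoc]
        congr 2
        rw [inter_eq_left.2 (prod_mono hsub hsub)]
    _ = ∫⁻ x in s ∩ core ×ˢ core, 1 ∂boxMeasure := by rw [setLIntegral_one]
    _ ≤ ∫⁻ x in s ∩ core ×ˢ core, ENNReal.ofReal (bump x.1 * bump x.2) ∂boxMeasure := by
        refine setLIntegral_mono measurable_bump_mul fun x hx => ?_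
        have h1 : ∀ u ∈ core, bump u = 1 := fun u hu => by
          refine bump.one_of_mem_closedBall ?_
          rw [Real.closedBall_eq_Icc]
          have : bump.rIn = 2 / 10 ^ 7 := rfl
          rw [this]
          exact ⟨by linarith [hu.1], by linarith [hu.2]⟩
        rw [h1 _ hx.2.1, h1 _ hx.2.2]
        simp
    _ ≤ _ := lintegral_mono_set inter_subset_left

open Complex (I) in
/-- The kernel `e^{iμ|(R + x₁, x₂ - t)|}`. -/
def lineKer (μ R : ℝ) (x : ℝ × ℝ) (t : ℝ) : ℂ :=
  Complex.exp (I * (μ * dist₂ (R + x.1, x.2 - t) : ℝ))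

theorem continuous_lineKer (μ R : ℝ) : Continuous (uncurry (lineKer μ R)) := by
  have := continuous_dist₂
  unfold lineKer uncurry
  fun_prop

theorem norm_lineKer (μ R : ℝ) (x : ℝ × ℝ) (t : ℝ) : ‖lineKer μ R x t‖ = 1 := by
  rw [lineKer, mul_comm, Complex.norm_exp_ofReal_mul_I]

theorem lineKer_mul_conj (μ R : ℝ) (x : ℝ × ℝ) (t s t' s' : ℝ) :
    lineKer μ R x t * lineKer μ R x s *
      (starRingEnd ℂ) (lineKer μ R x t' * lineKer μ R x s') =
      Complex.exp (Complex.I * (μ * quad dist₂ t s t' s' (R + x.1) x.2 : ℝ)) := by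
  unfold lineKer quad
  rw [map_mul, ← Complex.exp_conj, ← Complex.exp_conj, ← Complex.exp_add, ← Complex.exp_add,
    ← Complex.exp_add]
  congr 1
  simp only [map_mul, Complex.conj_I, Complex.conj_ofReal]
  push_cast
  ring

/-- The dyadic bands around the diagonal. -/
def band (k : ℕ) : Set (ℝ × ℝ) := {z | |z.1 - z.2| ∈ Ioc ((2 : ℝ) ^ (-(k + 1 : ℤ))) ((2 : ℝ) ^ (-(k : ℤ)))}

theorem measurableSet_band (k : ℕ) : MeasurableSet (band k) :=
  (by fun_prop : Measurable fun z : ℝ × ℝ => |z.1 - z.2|) measurableSet_Ioc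

/-- Lebesgue measure on the part of a band in the core square. -/
def bandMeasure (k : ℕ) : Measure (ℝ × ℝ) := volume.restrict (core ×ˢ core ∩ band k)

theorem measurableSet_core : MeasurableSet core := measurableSet_Icc

theorem volume_core_le_one : volume core ≤ 1 := by
  rw [core, Real.volume_Icc]
  exact ENNReal.ofReal_le_one.2 (by norm_num)

instance : IsFiniteMeasure (volume.restrict core) := ⟨by
  rw [Measure.restrict_apply_univ]; exact volume_core_le_one.trans_lt ENNReal.one_lt_top⟩

instance (k : ℕ) : IsFiniteMeasure (bandMeasure k) := ⟨by
  rw [bandMeasure, Measure.restrict_apply_univ]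
  refine (measure_mono inter_subset_left).trans_lt ?_
  rw [Measure.volume_eq_prod, Measure.prod_prod]
  exact (mul_le_one' volume_core_le_one volume_core_le_one).trans_lt ENNReal.one_lt_top⟩

/-- Schur's test for the strip `|t - s| ≤ 2^(-k)`, whose sections have length at most `2 · 2^(-k)`.
The arithmetic-geometric inequality is a hypothesis because both `‖g‖ₑ` and its square are used as
`f`. -/
theorem lintegral_bandMeasure_le (k : ℕ) {f : ℝ → ℝ≥0∞} (hf : Measurable f)
    (hle : ∀ a b, f a * f b ≤ 2⁻¹ * (f a ^ 2 + f b ^ 2)) :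
    ∫⁻ z, f z.1 * f z.2 ∂bandMeasure k ≤
      ENNReal.ofReal (2 * (2 : ℝ) ^ (-(k : ℤ))) * ∫⁻ t in core, f t ^ 2 := by
  set h : ℝ := (2 : ℝ) ^ (-(k : ℤ)) with hh
  have hh0 : 0 < h := by positivity
  set P : Set (ℝ × ℝ) := {z | |z.1 - z.2| ≤ h} with hP
  have hPm : MeasurableSet P := (by fun_prop : Measurable fun z : ℝ × ℝ => |z.1 - z.2|) measurableSet_Iic
  have hind : ∀ (t : ℝ) (Q : Set ℝ), Q ⊆ Icc (t - h) (t + h) →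
      ∫⁻ s in core, Q.indicator (fun _ => (1 : ℝ≥0∞)) s ≤ ENNReal.ofReal (2 * h) := by
    intro t Q hQ
    calc ∫⁻ s in core, Q.indicator (fun _ => (1 : ℝ≥0∞)) s
        ≤ ∫⁻ s, (Icc (t - h) (t + h)).indicator (fun _ => (1 : ℝ≥0∞)) s :=
          (setLIntegral_le_lintegral _ _).trans (lintegral_mono fun s =>
            indicator_le_indicator_of_subset hQ (fun _ => zero_le) s)
      _ = _ := by
          rw [lintegral_indicator measurableSet_Icc, setLIntegral_one, Real.volume_Icc]
          congr 1; ring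
  set φ : ℝ × ℝ → ℝ≥0∞ := P.indicator fun _ => 1 with hφ
  have hφm : Measurable φ := measurable_const.indicator hPm
  set ν : Measure (ℝ × ℝ) := (volume.restrict core).prod (volume.restrict core) with hν
  have hν' : ν = volume.restrict (core ×ˢ core) := by
    rw [hν, Measure.prod_restrict, Measure.volume_eq_prod]
  have b1 : ∫⁻ z, φ z * f z.1 ^ 2 ∂ν ≤ ENNReal.ofReal (2 * h) * ∫⁻ t in core, f t ^ 2 := by
    rw [hν, lintegral_prod _ (by fun_prop), ← lintegral_const_mul _ (by fun_prop)]
    refine lintegral_mono fun t => ?_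
    have : Measurable fun s => φ (t, s) := hφm.comp measurable_prodMk_left
    simp only
    rw [lintegral_mul_const _ this]
    refine mul_le_mul' ?_ le_rfl
    refine hind t {s | (t, s) ∈ P} fun s hs => ?_
    have := abs_le.1 (show |t - s| ≤ h from hs)
    exact ⟨by linarith [this.2], by linarith [this.1]⟩
  have b2 : ∫⁻ z, φ z * f z.2 ^ 2 ∂ν ≤ ENNReal.ofReal (2 * h) * ∫⁻ t in core, f t ^ 2 := by
    rw [hν, lintegral_prod_symm _ (by fun_prop), ← lintegral_const_mul _ (by fun_prop)]
    refine lintegral_mono fun s => ?_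
    have : Measurable fun t => φ (t, s) := hφm.comp measurable_prodMk_right
    simp only
    rw [lintegral_mul_const _ this]
    refine mul_le_mul' ?_ le_rfl
    refine hind s {t | (t, s) ∈ P} fun t hs => ?_
    have := abs_le.1 (show |t - s| ≤ h from hs)
    exact ⟨by linarith [this.1], by linarith [this.2]⟩
  calc ∫⁻ z, f z.1 * f z.2 ∂bandMeasure k
      ≤ ∫⁻ z in core ×ˢ core ∩ P, f z.1 * f z.2 :=
        lintegral_mono_set (inter_subset_inter_right _ fun z hz => hz.2)
    _ = ∫⁻ z, P.indicator (fun z => f z.1 * f z.2) z ∂ν := by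
        rw [lintegral_indicator hPm, hν', Measure.restrict_restrict hPm, inter_comm]
    _ ≤ ∫⁻ z, 2⁻¹ * (φ z * f z.1 ^ 2 + φ z * f z.2 ^ 2) ∂ν := by
        refine lintegral_mono fun z => ?_
        by_cases hz : z ∈ P
        · simp only [hφ, indicator_of_mem hz, one_mul]
          exact hle _ _
        · simp [indicator_of_notMem hz]
    _ = 2⁻¹ * ((∫⁻ z, φ z * f z.1 ^ 2 ∂ν) + ∫⁻ z, φ z * f z.2 ^ 2 ∂ν) := by
        rw [lintegral_const_mul _ (by fun_prop), lintegral_add_left (by fun_prop)]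
    _ ≤ 2⁻¹ * (ENNReal.ofReal (2 * h) * (∫⁻ t in core, f t ^ 2) +
        ENNReal.ofReal (2 * h) * (∫⁻ t in core, f t ^ 2)) := by gcongr
    _ = _ := by
        rw [← two_mul, ← mul_assoc, ENNReal.inv_mul_cancel (by norm_num) (by norm_num), one_mul]

/-- The `L²` bound for the part of the squared line operator in one band. -/
theorem exists_lintegral_band_sq_le : ∃ C : ℝ, 0 ≤ C ∧ ∀ R ∈ Icc (1 / 5 : ℝ) (5 / 2), ∀ μ > 0,
    ∀ (k : ℕ) (F : ℝ × ℝ → ℂ), Measurable F → Integrable F (bandMeasure k) →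
    ∫⁻ x, ‖∫ z, (lineKer μ R x z.1 * lineKer μ R x z.2) * F z ∂bandMeasure k‖ₑ ^ 2 ∂bumpMeasure ≤
      ENNReal.ofReal ((2 : ℝ) ^ (k + 1) * (C / μ ^ 2)) * ∫⁻ z, ‖F z‖ₑ ^ 2 ∂bandMeasure k := by
  obtain ⟨C, hC, H⟩ := exists_norm_integral_exp_quad_le
  refine ⟨C * Real.pi ^ 2, by positivity, fun R hR μ hμ k F hFm hF => ?_⟩
  have hcont := continuous_lineKer μ R
  have hm : Measurable (uncurry fun (x : ℝ × ℝ) (z : ℝ × ℝ) => lineKer μ R x z.1 * lineKer μ R x z.2) := by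
    have h1 : Measurable fun p : (ℝ × ℝ) × (ℝ × ℝ) => lineKer μ R p.1 p.2.1 :=
      (hcont.comp (by fun_prop : Continuous fun p : (ℝ × ℝ) × (ℝ × ℝ) => (p.1, p.2.1))).measurable
    have h2 : Measurable fun p : (ℝ × ℝ) × (ℝ × ℝ) => lineKer μ R p.1 p.2.2 :=
      (hcont.comp (by fun_prop : Continuous fun p : (ℝ × ℝ) × (ℝ × ℝ) => (p.1, p.2.2))).measurable
    exact h1.mul h2
  have hmem : ∀ᵐ z ∂bandMeasure k, z ∈ core ×ˢ core ∩ band k :=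
    ae_restrict_mem ((measurableSet_core.prod measurableSet_core).inter (measurableSet_band k))
  refine lintegral_sq_le_of_schur bumpMeasure (bandMeasure k) hm
    (fun x z => by rw [norm_mul, norm_lineKer, norm_lineKer, one_mul]) hFm hF ?_
  filter_upwards [hmem] with z hz
  have h2k : (2 : ℝ) ^ (-(k + 1 : ℤ)) = ((2 : ℝ) ^ (k + 1))⁻¹ := by
    rw [zpow_neg]; norm_cast
  -- On the band `|z'.1 - z'.2|` exceeds `2^(-(k+1))`, so the Jacobian weight can be inserted at the
  -- price `2^(k+1)`.
  calc _ ≤ ∫⁻ z', ENNReal.ofReal ((2 : ℝ) ^ (k + 1)) * ENNReal.ofReal (|z'.1 - z'.2| *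
        (C / (1 + (μ * gap z.1 z.2 z'.1 z'.2) ^ 2) ^ 2)) ∂bandMeasure k := by
        refine lintegral_mono_ae ?_
        filter_upwards [hmem] with z' hz'
        simp only [lineKer_mul_conj]
        rw [integral_bumpMeasure, ← ofReal_norm, ← ENNReal.ofReal_mul (by positivity)]
        refine ENNReal.ofReal_le_ofReal ?_
        refine (H R hR μ hμ z.1 z.2 z'.1 z'.2 (abs_le.2 hz.1.1) (abs_le.2 hz.1.2)
          (abs_le.2 hz'.1.1) (abs_le.2 hz'.1.2)).trans ?_
        rw [← mul_assoc]
        refine le_mul_of_one_le_left (by positivity) ?_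
        have := hz'.2.1
        rw [h2k, inv_eq_one_div, div_lt_iff₀ (by positivity)] at this
        linarith
    _ ≤ ENNReal.ofReal ((2 : ℝ) ^ (k + 1)) * ENNReal.ofReal (C * (Real.pi / μ) ^ 2) := by
        rw [lintegral_const_mul' _ _ ENNReal.ofReal_ne_top]
        exact mul_le_mul' le_rfl ((setLIntegral_le_lintegral _ _).trans (lintegral_gap_le hμ hC _ _))
    _ = _ := by
        rw [← ENNReal.ofReal_mul (by positivity)]
        congr 2
        ring

/-- The part of the squared line operator in one band. -/
def bandOp (μ R : ℝ) (g : ℝ → ℂ) (k : ℕ) (x : ℝ × ℝ) : ℂ :=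
  ∫ z, (lineKer μ R x z.1 * lineKer μ R x z.2) * (g z.1 * g z.2) ∂bandMeasure k

/-- The line operator. -/
def lineOp (μ R : ℝ) (g : ℝ → ℂ) (x : ℝ × ℝ) : ℂ := ∫ t in core, lineKer μ R x t * g t

theorem integrable_mul_band {g : ℝ → ℂ} (hg : Integrable g (volume.restrict core)) :
    Integrable (fun z : ℝ × ℝ => g z.1 * g z.2) (volume.restrict (core ×ˢ core)) := by
  have := hg.mul_prod hg
  rwa [Measure.prod_restrict, ← Measure.volume_eq_prod] at this

/-- The square of the line operator is an integral over pairs `(t, s)`. The diagonal is null and `|t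
- s| ≤ 1` on the core, so the bands of index `k ≥ 0` exhaust the rest. -/
theorem enorm_lineOp_sq_le (μ R : ℝ) {g : ℝ → ℂ} (hg : Integrable g (volume.restrict core))
    (x : ℝ × ℝ) : ‖lineOp μ R g x ^ 2‖ₑ ≤ ∑' k, ‖bandOp μ R g k x‖ₑ := by
  have hcont := continuous_lineKer μ R
  have hk : Continuous fun t => lineKer μ R x t := hcont.comp (by fun_prop : Continuous fun t => (x, t))
  have hgi : Integrable (fun t => lineKer μ R x t * g t) (volume.restrict core) :=
    hg.bdd_mul hk.aestronglyMeasurable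
      (Filter.Eventually.of_forall fun t => (norm_lineKer μ R x t).le)
  have e0 : lineOp μ R g x ^ 2 = ∫ z in core ×ˢ core,
      (lineKer μ R x z.1 * lineKer μ R x z.2) * (g z.1 * g z.2) := by
    rw [sq, lineOp, ← integral_prod_mul, Measure.prod_restrict, Measure.volume_eq_prod]
    congr 1
    ext z
    ring
  have hi : IntegrableOn (fun z : ℝ × ℝ => (lineKer μ R x z.1 * lineKer μ R x z.2) * (g z.1 * g z.2))
      (core ×ˢ core) := by
    have := integrable_mul_band hgi
    refine this.congr (Filter.Eventually.of_forall fun z => ?_)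
    simp only
    ring
  have hdiag : volume {z : ℝ × ℝ | z.1 = z.2} = 0 := by
    rw [Measure.volume_eq_prod, Measure.measure_prod_null (measurableSet_eq_fun measurable_fst measurable_snd)]
    refine Filter.Eventually.of_forall fun t => ?_
    have : Prod.mk t ⁻¹' {z : ℝ × ℝ | z.1 = z.2} = {t} := by
      ext s; simp [eq_comm]
    change volume (Prod.mk t ⁻¹' {z : ℝ × ℝ | z.1 = z.2}) = 0
    rw [this]
    exact Real.volume_singleton
  have hcover : core ×ˢ core =ᵐ[volume] ⋃ k, (core ×ˢ core ∩ band k) := by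
    have h0 : ∀ᵐ z : ℝ × ℝ, z.1 ≠ z.2 := by
      rw [ae_iff]
      simpa using hdiag
    filter_upwards [h0] with z hz
    refine propext ⟨fun hm => ?_, fun hm => ?_⟩
    · have h1 : 0 < |z.1 - z.2| := abs_pos.2 (sub_ne_zero.2 hz)
      have h2 : |z.1 - z.2| ≤ 1 := by
        obtain ⟨a, b⟩ := hm
        exact abs_le.2 ⟨by linarith [a.1, b.2], by linarith [a.2, b.1]⟩
      obtain ⟨n, hn⟩ := exists_mem_Ioc_zpow (y := (2 : ℝ)) h1 (by norm_num)
      have hn0 : n + 1 ≤ 0 := by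
        by_contra hcon
        have : (1 : ℝ) ≤ 2 ^ n := one_le_zpow₀ (by norm_num) (by omega)
        linarith [hn.1]
      refine mem_iUnion.2 ⟨(-(n + 1)).toNat, hm, ?_⟩
      have hcast : (((-(n + 1)).toNat : ℕ) : ℤ) = -(n + 1) := Int.toNat_of_nonneg (by omega)
      change |z.1 - z.2| ∈ Ioc _ _
      rw [hcast]
      rwa [show -(-(n + 1) + 1) = n by ring, neg_neg]
    · obtain ⟨k, hk⟩ := mem_iUnion.1 hm
      exact hk.1
  have hdisj : Pairwise (Disjoint on fun k => (core ×ˢ core ∩ band k)) := by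
    intro i j hij
    wlog hlt : i < j generalizing i j
    · exact (this hij.symm (lt_of_le_of_ne (not_lt.1 hlt) hij.symm)).symm
    refine disjoint_left.2 fun z hz hz' => ?_
    have h1 := hz.2.1
    have h2 := hz'.2.2
    have : (2 : ℝ) ^ (-(j : ℤ)) ≤ 2 ^ (-(i + 1 : ℤ)) := zpow_le_zpow_right₀ (by norm_num) (by omega)
    linarith
  have hms : ∀ k, MeasurableSet (core ×ˢ core ∩ band k) := fun k =>
    (measurableSet_core.prod measurableSet_core).inter (measurableSet_band k)
  rw [e0, setIntegral_congr_set hcover,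
    integral_iUnion hms hdisj (hi.mono_set (iUnion_subset fun k => inter_subset_left))]
  exact enorm_tsum_le_tsum_enorm

theorem measurable_bandOp (μ R : ℝ) {g : ℝ → ℂ} (hg : Measurable g) (k : ℕ) :
    Measurable (bandOp μ R g k) := by
  have hcont := continuous_lineKer μ R
  refine (StronglyMeasurable.integral_prod_right (f := fun (x : ℝ × ℝ) (z : ℝ × ℝ) =>
    (lineKer μ R x z.1 * lineKer μ R x z.2) * (g z.1 * g z.2)) ?_).measurable
  have h1 : Measurable fun p : (ℝ × ℝ) × (ℝ × ℝ) => lineKer μ R p.1 p.2.1 :=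
    (hcont.comp (by fun_prop : Continuous fun p : (ℝ × ℝ) × (ℝ × ℝ) => (p.1, p.2.1))).measurable
  have h2 : Measurable fun p : (ℝ × ℝ) × (ℝ × ℝ) => lineKer μ R p.1 p.2.2 :=
    (hcont.comp (by fun_prop : Continuous fun p : (ℝ × ℝ) × (ℝ × ℝ) => (p.1, p.2.2))).measurable
  exact ((h1.mul h2).mul (by fun_prop)).stronglyMeasurable

theorem lintegral_core_sq_le {g : ℝ → ℂ} (hg : Measurable g) :
    ∫⁻ t in core, ‖g t‖ₑ ^ 2 ≤ (∫⁻ t in core, ‖g t‖ₑ ^ 4) ^ (1 / 2 : ℝ) := by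
  have h := ENNReal.lintegral_mul_le_Lp_mul_Lq (volume.restrict core) Real.HolderConjugate.two_two
    (f := fun t => ‖g t‖ₑ ^ 2) (g := fun _ => 1) (by fun_prop) (by fun_prop)
  simp only [Pi.mul_apply, mul_one, ENNReal.one_rpow, lintegral_const, Measure.restrict_apply_univ,
    one_mul] at h
  refine h.trans ?_
  calc _ ≤ (∫⁻ t in core, (‖g t‖ₑ ^ 2) ^ (2 : ℝ)) ^ (1 / 2 : ℝ) * 1 := by
        gcongr
        exact ENNReal.rpow_le_one volume_core_le_one (by norm_num)
    _ = _ := by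
        rw [mul_one]
        congr 1
        refine lintegral_congr fun t => ?_
        rw [show (2 : ℝ) = ((2 : ℕ) : ℝ) by norm_num, ENNReal.rpow_natCast, ← pow_mul]

theorem tsum_dyadic_ne_top {θ : ℝ} (hθ : 0 < θ) :
    ∑' k : ℕ, ENNReal.ofReal (2 * (2 : ℝ) ^ (-(k : ℤ))) ^ θ ≠ ⊤ := by
  have h1 : ∀ k : ℕ, ENNReal.ofReal (2 * (2 : ℝ) ^ (-(k : ℤ))) ^ θ =
      ENNReal.ofReal (2 ^ θ * ((2 : ℝ)⁻¹ ^ θ) ^ k) := by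
    intro k
    rw [ENNReal.ofReal_rpow_of_nonneg (by positivity) hθ.le,
      Real.mul_rpow (by norm_num) (by positivity), zpow_neg, zpow_natCast, ← inv_pow,
      ← Real.rpow_natCast, ← Real.rpow_natCast, ← Real.rpow_mul (by norm_num),
      ← Real.rpow_mul (by norm_num), mul_comm θ]
  simp only [h1]
  rw [← ENNReal.ofReal_tsum_of_nonneg (fun k => by positivity)]
  · exact ENNReal.ofReal_ne_top
  · exact (summable_geometric_of_lt_one (by positivity)
      (Real.rpow_lt_one (by norm_num) (by norm_num) hθ)).mul_left _

/-- The `L⁴ → L^q` bound for the line operator. -/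
theorem exists_eLpNorm_lineOp_le {q : ℝ≥0∞} (hq : 4 < q) (hqt : q ≠ ⊤) : ∃ C : ℝ≥0,
    ∀ R ∈ Icc (1 / 5 : ℝ) (5 / 2), ∀ μ > 0, ∀ g : ℝ → ℂ, Measurable g →
      MemLp g 4 (volume.restrict core) →
      eLpNorm (lineOp μ R g) q bumpMeasure ≤
        C * ENNReal.ofReal (μ ^ (-(2 / q.toReal))) * eLpNorm g 4 (volume.restrict core) := by
  obtain ⟨C₀, hC₀, H⟩ := exists_lintegral_band_sq_le
  have hq4 : 4 < q.toReal := by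
    have := (ENNReal.toReal_lt_toReal (by norm_num) hqt).2 hq
    simpa using this
  set Q := q.toReal with hQ
  set r := Q / 2 with hr
  have hr2 : 2 < r := by rw [hr]; linarith
  have hr0 : 0 < r := by linarith
  -- The square of the operator is measured in `L^r` with `r = q/2`. This exponent is positive
  -- because `q > 4`, and it is what sums the bands.
  set θ := 1 - 2 / r with hθ
  have hθ0 : 0 < θ := by
    have : 2 / r < 1 := (div_lt_one hr0).2 hr2
    rw [hθ]; linarith
  set G : ℝ≥0∞ := ∑' k : ℕ, ENNReal.ofReal (2 * (2 : ℝ) ^ (-(k : ℤ))) ^ θ with hG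
  have hGt : G ≠ ⊤ := tsum_dyadic_ne_top hθ0
  have hCt : G ^ (1 / 2 : ℝ) * ENNReal.ofReal (4 * C₀) ^ (1 / Q) ≠ ⊤ :=
    ENNReal.mul_ne_top (ENNReal.rpow_ne_top_of_nonneg (by norm_num) hGt)
      (ENNReal.rpow_ne_top_of_nonneg (by positivity) ENNReal.ofReal_ne_top)
  refine ⟨(G ^ (1 / 2 : ℝ) * ENNReal.ofReal (4 * C₀) ^ (1 / Q)).toNNReal,
    fun R hR μ hμ g hgm hg => ?_⟩
  rw [ENNReal.coe_toNNReal hCt]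
  set N := ∫⁻ t in core, ‖g t‖ₑ ^ 4 with hN
  have hgN : eLpNorm g 4 (volume.restrict core) = N ^ (1 / 4 : ℝ) := by
    have := eLpNorm_rpow_toReal (μ := volume.restrict core) (q := 4) (by norm_num) (by norm_num) g
    have e4 : (4 : ℝ≥0∞).toReal = 4 := by norm_num
    rw [e4] at this
    have e2 : N = eLpNorm g 4 (volume.restrict core) ^ (4 : ℝ) := by
      rw [this, hN]
      refine lintegral_congr fun t => ?_
      norm_cast
    rw [e2, ← ENNReal.rpow_mul]
    norm_num
  have hNt : N ≠ ⊤ := by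
    intro h
    have := hg.2
    rw [hgN, h, ENNReal.top_rpow_of_pos (by norm_num)] at this
    exact lt_irrefl _ this
  have hgi : Integrable g (volume.restrict core) := hg.integrable (by norm_num)
  set D := ENNReal.ofReal (4 * C₀ / μ ^ 2) with hD
  -- The trivial bound: the kernel has modulus one and the band has width comparable to `2^(-k)`.
  have hSsup : ∀ k x, ‖bandOp μ R g k x‖ₑ ≤
      ENNReal.ofReal (2 * (2 : ℝ) ^ (-(k : ℤ))) * N ^ (1 / 2 : ℝ) := by
    intro k x
    calc ‖bandOp μ R g k x‖ₑ ≤ ∫⁻ z, ‖g z.1‖ₑ * ‖g z.2‖ₑ ∂bandMeasure k := by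
          refine (enorm_integral_le_lintegral_enorm _).trans (lintegral_mono fun z => ?_)
          have h1 : ∀ t, ‖lineKer μ R x t‖ₑ = 1 := fun t => by
            rw [← ofReal_norm, norm_lineKer, ENNReal.ofReal_one]
          rw [enorm_mul, enorm_mul, enorm_mul, h1, h1, one_mul, one_mul]
      _ ≤ _ := lintegral_bandMeasure_le k (f := fun t => ‖g t‖ₑ) (by fun_prop)
          fun a b => enorm_mul_enorm_le _ _
      _ ≤ _ := mul_le_mul' le_rfl (lintegral_core_sq_le hgm)
  -- The loss `2^(k+1)` of the `T T*` bound and the width `2 · 2^(-k)` of the band cancel, leaving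
  -- `4 C₀ / μ²` for every `k`.
  have hSsq : ∀ k, ∫⁻ x, ‖bandOp μ R g k x‖ₑ ^ 2 ∂bumpMeasure ≤ D * N := by
    intro k
    have hi : Integrable (fun z : ℝ × ℝ => g z.1 * g z.2) (bandMeasure k) :=
      (integrable_mul_band hgi).mono_measure
        (Measure.restrict_mono inter_subset_left le_rfl)
    refine (H R hR μ hμ k (fun z => g z.1 * g z.2) (by fun_prop) hi).trans ?_
    have e1 : ∫⁻ z, ‖g z.1 * g z.2‖ₑ ^ 2 ∂bandMeasure k ≤
        ENNReal.ofReal (2 * (2 : ℝ) ^ (-(k : ℤ))) * N := by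
      have := lintegral_bandMeasure_le k (f := fun t => ‖g t‖ₑ ^ 2) (by fun_prop)
        fun a b => by
          have := enorm_mul_enorm_le (g a ^ 2) (g b ^ 2)
          simpa only [enorm_pow] using this
      calc _ = ∫⁻ z, ‖g z.1‖ₑ ^ 2 * ‖g z.2‖ₑ ^ 2 ∂bandMeasure k := by
            simp only [enorm_mul, mul_pow]
        _ ≤ _ := this
        _ = _ := by simp only [← pow_mul]; rfl
    refine (mul_le_mul' le_rfl e1).trans_eq ?_
    rw [← mul_assoc, ← ENNReal.ofReal_mul (by positivity), hD]
    congr 2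
    rw [zpow_neg, zpow_natCast]
    field_simp
    ring
  set r' := ENNReal.ofReal r with hr'
  have hr't : r'.toReal = r := ENNReal.toReal_ofReal hr0.le
  have hr'1 : 1 ≤ r' := by
    rw [hr', ← ENNReal.ofReal_one]; exact ENNReal.ofReal_le_ofReal (by linarith)
  have hr'0 : r' ≠ 0 := (lt_of_lt_of_le one_pos hr'1).ne'
  -- Interpolation: bounding the power `r - 2` by the supremum leaves an `L²` integral and a gain
  -- comparable to `2^(-kθ)`.
  have hSr : ∀ k, eLpNorm (bandOp μ R g k) r' bumpMeasure ≤
      ENNReal.ofReal (2 * (2 : ℝ) ^ (-(k : ℤ))) ^ θ * (D ^ (1 / r) * N ^ (1 / 2 : ℝ)) := by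
    intro k
    rw [← ENNReal.rpow_le_rpow_iff hr0, ← hr't, eLpNorm_rpow_toReal hr'0 ENNReal.ofReal_ne_top, hr't]
    set a := ENNReal.ofReal (2 * (2 : ℝ) ^ (-(k : ℤ))) with ha
    calc ∫⁻ x, ‖bandOp μ R g k x‖ₑ ^ r ∂bumpMeasure
        ≤ ∫⁻ x, (a * N ^ (1 / 2 : ℝ)) ^ (r - 2) * ‖bandOp μ R g k x‖ₑ ^ 2 ∂bumpMeasure := by
          refine lintegral_mono fun x => ?_
          have e1 : ‖bandOp μ R g k x‖ₑ ^ r =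
              ‖bandOp μ R g k x‖ₑ ^ (r - 2) * ‖bandOp μ R g k x‖ₑ ^ 2 := by
            rw [← ENNReal.rpow_natCast, ← ENNReal.rpow_add_of_nonneg _ _ (by linarith) (by norm_num)]
            congr 1
            push_cast
            ring
          rw [e1]
          exact mul_le_mul' (ENNReal.rpow_le_rpow (hSsup k x) (by linarith)) le_rfl
      _ = (a * N ^ (1 / 2 : ℝ)) ^ (r - 2) * ∫⁻ x, ‖bandOp μ R g k x‖ₑ ^ 2 ∂bumpMeasure := by
          refine lintegral_const_mul' _ _ (ENNReal.rpow_ne_top_of_nonneg (by linarith) ?_)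
          exact ENNReal.mul_ne_top ENNReal.ofReal_ne_top
            (ENNReal.rpow_ne_top_of_nonneg (by norm_num) hNt)
      _ ≤ (a * N ^ (1 / 2 : ℝ)) ^ (r - 2) * (D * N) := mul_le_mul' le_rfl (hSsq k)
      _ = _ := by
          rw [ENNReal.mul_rpow_of_nonneg _ _ (by linarith), ENNReal.mul_rpow_of_nonneg _ _ hr0.le,
            ENNReal.mul_rpow_of_nonneg _ _ hr0.le, ← ENNReal.rpow_mul, ← ENNReal.rpow_mul,
            ← ENNReal.rpow_mul, ← ENNReal.rpow_mul]
          have e1 : θ * r = r - 2 := by rw [hθ]; field_simp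
          have e2 : 1 / r * r = 1 := by field_simp
          have e3 : N ^ (1 / 2 * r) = N ^ (1 / 2 * (r - 2)) * N := by
            conv_rhs => rw [← ENNReal.rpow_one N, ← ENNReal.rpow_mul, one_mul]
            rw [← ENNReal.rpow_add_of_nonneg _ _ (by linarith) (by norm_num)]
            congr 1
            ring
          rw [e1, e2, ENNReal.rpow_one, e3]
          ring
  have hsum : eLpNorm (fun x => lineOp μ R g x ^ 2) r' bumpMeasure ≤
      G * (D ^ (1 / r) * N ^ (1 / 2 : ℝ)) := by
    have hmeas : Measurable (uncurry (bandOp μ R g)) :=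
      measurable_from_prod_countable_right fun k => measurable_bandOp μ R hgm k
    have := eLpNorm_le_lintegral_eLpNorm bumpMeasure (Measure.count : Measure ℕ) hmeas
      (G := fun x => lineOp μ R g x ^ 2) (q := r')
      (fun x => by rw [lintegral_count]; exact enorm_lineOp_sq_le μ R hgi x) hr'1 ENNReal.ofReal_ne_top
    rw [lintegral_count] at this
    refine this.trans ?_
    rw [hG, ← ENNReal.tsum_mul_right]
    exact ENNReal.tsum_le_tsum hSr
  have hq0 : q ≠ 0 := (lt_trans (by norm_num) hq).ne'
  have hQ0 : 0 < Q := by linarith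
  have hfin : eLpNorm (lineOp μ R g) q bumpMeasure =
      eLpNorm (fun x => lineOp μ R g x ^ 2) r' bumpMeasure ^ (1 / 2 : ℝ) := by
    refine ENNReal.rpow_left_injective hQ0.ne' ?_
    beta_reduce
    rw [hQ, eLpNorm_rpow_toReal hq0 hqt, ← ENNReal.rpow_mul,
      show 1 / 2 * Q = r'.toReal by rw [hr't, hr]; ring, eLpNorm_rpow_toReal hr'0 ENNReal.ofReal_ne_top]
    refine lintegral_congr fun x => ?_
    rw [enorm_pow, ← ENNReal.rpow_natCast, ← ENNReal.rpow_mul, hr't, hr]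
    congr 1
    push_cast
    ring
  rw [hfin]
  -- Undoing the square halves the exponents: `D^(1/(2r)) = D^(1/q)` is a constant times `μ^(-2/q)`.
  refine (ENNReal.rpow_le_rpow hsum (by norm_num)).trans_eq ?_
  rw [ENNReal.mul_rpow_of_nonneg _ _ (by norm_num), ENNReal.mul_rpow_of_nonneg _ _ (by norm_num),
    ← ENNReal.rpow_mul, ← ENNReal.rpow_mul, hgN]
  have e1 : 1 / r * (1 / 2) = 1 / Q := by rw [hr]; field_simp
  have e2 : D ^ (1 / Q) = ENNReal.ofReal (4 * C₀) ^ (1 / Q) * ENNReal.ofReal (μ ^ (-(2 / Q))) := by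
    rw [hD, div_eq_mul_inv, ENNReal.ofReal_mul (by positivity),
      ENNReal.mul_rpow_of_nonneg _ _ (by positivity),
      ENNReal.ofReal_rpow_of_nonneg (inv_nonneg.2 (sq_nonneg μ)) (by positivity)]
    congr 2
    rw [← Real.rpow_natCast, ← Real.rpow_neg hμ.le, ← Real.rpow_mul hμ.le]
    congr 1
    push_cast
    ring
  rw [e1, e2]
  norm_num
  ring

/-- The kernel of the line operator, localized to the core. -/
def coreKer (μ R : ℝ) : ℝ × ℝ → ℝ → ℂ := cut (fun x t => x ∈ core ×ˢ core ∧ t ∈ core) (lineKer μ R)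

theorem exists_kerBound_coreKer {q : ℝ≥0∞} (hq : 4 < q) (hqt : q ≠ ⊤) : ∃ C : ℝ≥0,
    ∀ R ∈ Icc (1 / 5 : ℝ) (5 / 2), ∀ μ > 0,
      KerBound (coreKer μ R) 4 q (C * ENNReal.ofReal (μ ^ (-(2 / q.toReal)))) := by
  obtain ⟨C, H⟩ := exists_eLpNorm_lineOp_le hq hqt
  refine ⟨C, fun R hR μ hμ => KerBound.of_measurable fun g hgm hg => ?_⟩
  have e1 : kop (coreKer μ R) g = (core ×ˢ core).indicator (lineOp μ R g) := by
    ext x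
    by_cases hx : x ∈ core ×ˢ core
    · rw [indicator_of_mem hx, lineOp, ← integral_indicator measurableSet_core, kop]
      congr 1
      ext t
      by_cases ht : t ∈ core
      · rw [indicator_of_mem ht, coreKer, cut_of_pos (⟨hx, ht⟩)]
      · rw [indicator_of_notMem ht, coreKer, cut_of_neg (fun h => ht h.2), zero_mul]
    · rw [indicator_of_notMem hx, kop]
      refine integral_eq_zero_of_ae (Filter.Eventually.of_forall fun t => ?_)
      simp only [coreKer]
      rw [cut_of_neg (fun h => hx h.1), zero_mul]
      rfl
  rw [e1, eLpNorm_indicator_eq_eLpNorm_restrict (measurableSet_core.prod measurableSet_core)]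
  refine (eLpNorm_mono_measure _ restrict_core_le).trans ?_
  refine (H R hR μ hμ g hgm (hg.mono_measure Measure.restrict_le_self)).trans ?_
  exact mul_le_mul' le_rfl (eLpNorm_mono_measure _ Measure.restrict_le_self)

end Line

/-! ### Oscillatory kernels on a pair of small balls. -/

section Pair

open Complex (I) in
/-- The kernel `e^{iμ|x - y|}`. -/
def osc (μ : ℝ) (x y : ℂ) : ℂ := Complex.exp (I * (μ * ‖x - y‖ : ℝ))

theorem continuous_osc (μ : ℝ) : Continuous (uncurry (osc μ)) := by
  unfold osc uncurry
  fun_prop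

theorem norm_osc (μ : ℝ) (x y : ℂ) : ‖osc μ x y‖ = 1 := by
  rw [osc, mul_comm, Complex.norm_exp_ofReal_mul_I]

/-- Complex coordinates centred at `x₀` with first axis along `u`. -/
def rigid (u : Circle) (x₀ : ℂ) : ℂ ≃ᵐ ℂ :=
  (MeasurableEquiv.addRight (-x₀)).trans (rotation u).symm.toHomeomorph.toMeasurableEquiv

theorem rigid_apply (u : Circle) (x₀ x : ℂ) : rigid u x₀ x = (u : ℂ)⁻¹ * (x - x₀) := by
  have : (rotation u).symm (x - x₀) = (u : ℂ)⁻¹ * (x - x₀) := by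
    rw [rotation_symm, rotation_apply, Circle.coe_inv]
  rw [← this]
  rfl

theorem measurePreserving_rigid (u : Circle) (x₀ : ℂ) : MeasurePreserving (rigid u x₀) := by
  have h1 : MeasurePreserving (fun x : ℂ => x + -x₀) volume volume :=
    measurePreserving_add_right volume (-x₀)
  have h2 : MeasurePreserving (rotation u).symm volume volume :=
    (rotation u).symm.measurePreserving
  exact h2.comp h1

/-- Real coordinates centred at `x₀` with first axis along `u`. -/
def frame (u : Circle) (x₀ : ℂ) : ℂ ≃ᵐ ℝ × ℝ :=
  (rigid u x₀).trans Complex.measurableEquivRealProd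

theorem frame_apply (u : Circle) (x₀ x : ℂ) :
    frame u x₀ x = (((u : ℂ)⁻¹ * (x - x₀)).re, ((u : ℂ)⁻¹ * (x - x₀)).im) := by
  rw [← rigid_apply]
  rfl

theorem measurePreserving_frame (u : Circle) (x₀ : ℂ) : MeasurePreserving (frame u x₀) :=
  Complex.volume_preserving_equiv_real_prod.comp (measurePreserving_rigid u x₀)

/-- Both frames share the axis along `x₀ - y₀`, so the separation of the centres only shifts the
first coordinate. -/
theorem norm_sub_frame (u : Circle) {x₀ y₀ : ℂ} {R : ℝ} (h : x₀ - y₀ = u * R) (x y : ℂ) :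
    ‖x - y‖ = dist₂ (R + (frame u x₀ x).1 - (frame u y₀ y).1, (frame u x₀ x).2 - (frame u y₀ y).2) := by
  have e1 : ‖x - y‖ = ‖(u : ℂ)⁻¹ * (x - y)‖ := by
    rw [norm_mul, norm_inv, Circle.norm_coe, inv_one, one_mul]
  have e2 : (u : ℂ)⁻¹ * (x - y) = R + (u : ℂ)⁻¹ * (x - x₀) - (u : ℂ)⁻¹ * (y - y₀) := by
    have : (u : ℂ) ≠ 0 := Circle.coe_ne_zero u
    field_simp
    linear_combination h
  rw [e1, e2, frame_apply, frame_apply, dist₂, Complex.norm_def, Complex.normSq_apply]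
  simp [sq]

theorem frame_mem_core (u : Circle) {x₀ x : ℂ} (h : ‖x - x₀‖ ≤ 1 / 10 ^ 7) :
    frame u x₀ x ∈ core ×ˢ core := by
  have e1 : ‖(u : ℂ)⁻¹ * (x - x₀)‖ ≤ 1 / 10 ^ 7 := by
    rwa [norm_mul, norm_inv, Circle.norm_coe, inv_one, one_mul]
  rw [frame_apply]
  exact ⟨abs_le.1 ((Complex.abs_re_le_norm _).trans e1), abs_le.1 ((Complex.abs_im_le_norm _).trans e1)⟩

/-- The kernel of the oscillatory operator on a product of squares. -/
def squareKer (μ R : ℝ) : ℝ × ℝ → ℝ × ℝ → ℂ :=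
  cut (fun x y => x ∈ core ×ˢ core ∧ y ∈ core ×ˢ core)
    fun x y => Complex.exp (Complex.I * (μ * dist₂ (R + x.1 - y.1, x.2 - y.2) : ℝ))

theorem measurableSet_core_sq : MeasurableSet (core ×ˢ core) := measurableSet_core.prod measurableSet_core

theorem Adm.of_cut {X Y : Type*} [MeasureSpace X] [MeasureSpace Y] {P : X → Y → Prop}
    (hP : MeasurableSet {z : X × Y | P z.1 z.2}) {k : X → Y → ℂ} (hk : Measurable (uncurry k)) {M : ℝ}
    (hM : ∀ x y, ‖k x y‖ ≤ M) {S : Set Y} (hS : volume S < ⊤) (hPS : ∀ x y, P x y → y ∈ S) :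
    Adm (BochnerRiesz.cut P k) where
  meas := measurable_cut hP hk
  bdd := ⟨M, fun x y => (norm_cut_le P k x y).trans (hM x y)⟩
  supp := fun x => (measure_mono fun y hy => hPS x y (by
    by_contra h
    exact hy (cut_of_neg h))).trans_lt hS

theorem continuous_squareKer_aux (μ R : ℝ) : Continuous (uncurry fun x y : ℝ × ℝ =>
    Complex.exp (Complex.I * (μ * dist₂ (R + x.1 - y.1, x.2 - y.2) : ℝ))) := by
  have := continuous_dist₂
  unfold uncurry
  fun_prop

theorem measurableSet_mem_and_mem {X Y : Type*} [MeasurableSpace X] [MeasurableSpace Y] {E : Set X}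
    {E' : Set Y} (hE : MeasurableSet E) (hE' : MeasurableSet E') :
    MeasurableSet {z : X × Y | z.1 ∈ E ∧ z.2 ∈ E'} :=
  (measurable_fst hE).inter (measurable_snd hE')

theorem volume_core_sq_lt_top : volume (core ×ˢ core) < ⊤ := by
  rw [Measure.volume_eq_prod, Measure.prod_prod]
  exact (mul_le_one' volume_core_le_one volume_core_le_one).trans_lt ENNReal.one_lt_top

theorem adm_squareKer (μ R : ℝ) : Adm (squareKer μ R) :=
  Adm.of_cut (measurableSet_mem_and_mem measurableSet_core_sq measurableSet_core_sq)
    (continuous_squareKer_aux μ R).measurable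
    (fun x y => by rw [mul_comm, Complex.norm_exp_ofReal_mul_I]) volume_core_sq_lt_top
    fun x y h => h.2

/-- Freezing the first coordinate `t` of `y` leaves the line operator with separation `R - t`. The
range `[1/5, 5/2]` of the line estimate has room for these shifts of `[1/4, 2]`. -/
theorem exists_kerBound_squareKer {q : ℝ≥0∞} (hq : 4 < q) (hqt : q ≠ ⊤) : ∃ C : ℝ≥0,
    ∀ R ∈ Icc (1 / 4 : ℝ) 2, ∀ μ > 0,
      KerBound (squareKer μ R) 4 q (C * ENNReal.ofReal (μ ^ (-(2 / q.toReal)))) := by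
  obtain ⟨C, H⟩ := exists_kerBound_coreKer hq hqt
  refine ⟨C, fun R hR μ hμ => ?_⟩
  have h := KerBound.freeze (adm_squareKer μ R) measurableSet_core
    (fun x t y hne => by
      by_contra ht
      exact hne (cut_of_neg fun h => ht h.2.1)) (p := 4) (q := q) (by norm_num) (by norm_num)
    (le_trans (by norm_num) hq.le) hqt (B := C * ENNReal.ofReal (μ ^ (-(2 / q.toReal))))
    fun t ht => by
      refine (H (R - t) ⟨by linarith [hR.1, ht.2], by linarith [hR.2, ht.1]⟩ μ hμ).congr
        fun x => Filter.Eventually.of_forall fun y => ?_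
      have e : R - t + x.1 = R + x.1 - t := by ring
      change coreKer μ (R - t) x y = squareKer μ R x (t, y)
      by_cases hxy : x ∈ core ×ˢ core ∧ y ∈ core
      · rw [coreKer, cut_of_pos (P := fun x t => x ∈ core ×ˢ core ∧ t ∈ core) hxy, squareKer,
          cut_of_pos (P := fun x y => x ∈ core ×ˢ core ∧ y ∈ core ×ˢ core) ⟨hxy.1, ht, hxy.2⟩, lineKer, e]
      · rw [coreKer, cut_of_neg (P := fun x t => x ∈ core ×ˢ core ∧ t ∈ core) hxy, squareKer, cut_of_neg]
        exact fun h => hxy ⟨h.1, h.2.2⟩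
  refine h.mono (mul_le_of_le_one_right' ?_)
  exact ENNReal.rpow_le_one volume_core_le_one (by norm_num)

theorem exists_circle_mul (z : ℂ) : ∃ u : Circle, z = u * (‖z‖ : ℂ) := by
  refine ⟨Circle.exp z.arg, ?_⟩
  rw [Circle.coe_exp, mul_comm, Complex.norm_mul_exp_arg_mul_I]

/-- The radius of the balls used to localize. -/
def tiny : ℝ := 1 / 10 ^ 7

/-- Both points lie near the given centres. -/
def nearPair (x₀ y₀ x y : ℂ) : Prop := x ∈ Metric.closedBall x₀ tiny ∧ y ∈ Metric.closedBall y₀ tiny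

theorem exists_kerBound_pair {q : ℝ≥0∞} (hq : 4 < q) (hqt : q ≠ ⊤) : ∃ C : ℝ≥0,
    ∀ x₀ y₀ : ℂ, ‖x₀ - y₀‖ ∈ Icc (1 / 4 : ℝ) 2 → ∀ μ > 0,
      KerBound (cut (nearPair x₀ y₀) (osc μ)) 4 q (C * ENNReal.ofReal (μ ^ (-(2 / q.toReal)))) := by
  obtain ⟨C, H⟩ := exists_kerBound_squareKer hq hqt
  refine ⟨C, fun x₀ y₀ hR μ hμ => ?_⟩
  obtain ⟨u, hu⟩ := exists_circle_mul (x₀ - y₀)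
  have h := ((H _ hR μ hμ).comp (adm_squareKer μ _) (measurePreserving_frame u x₀) (frame u y₀)
    (measurePreserving_frame u y₀)).cut_prod (E := Metric.closedBall x₀ tiny)
    (E' := Metric.closedBall y₀ tiny) Metric.isClosed_closedBall.measurableSet
  refine h.congr fun x => Filter.Eventually.of_forall fun y => ?_
  by_cases hxy : nearPair x₀ y₀ x y
  · have hx := frame_mem_core u (mem_closedBall_iff_norm.1 hxy.1)
    have hy := frame_mem_core u (mem_closedBall_iff_norm.1 hxy.2)
    rw [cut_of_pos (P := nearPair x₀ y₀) hxy,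
      cut_of_pos (P := fun x y => x ∈ Metric.closedBall x₀ tiny ∧ y ∈ Metric.closedBall y₀ tiny) hxy,
      squareKer, cut_of_pos (P := fun x y => x ∈ core ×ˢ core ∧ y ∈ core ×ˢ core) ⟨hx, hy⟩, osc,
      norm_sub_frame u hu x y]
  · rw [cut_of_neg (P := nearPair x₀ y₀) hxy, cut_of_neg]
    exact hxy

theorem abs_arg_lt_of_near {z : ℂ} {r : ℝ} (hr : 1 / 8 ≤ r) (hz : ‖z - r‖ ≤ tiny) :
    |z.arg| < Real.pi / 8 := by
  have e1 := (Complex.abs_re_le_norm _).trans hz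
  have e2 := (Complex.abs_im_le_norm _).trans hz
  simp only [Complex.sub_re, Complex.ofReal_re, Complex.sub_im, Complex.ofReal_im, sub_zero, tiny] at e1 e2
  have hre : 1 / 16 ≤ z.re := by linarith [(abs_le.1 e1).1]
  have hn : 1 / 16 ≤ ‖z‖ := hre.trans (Complex.re_le_norm z)
  have h1 := Real.mul_abs_le_abs_sin (Complex.abs_arg_le_pi_div_two_iff.2 (by linarith : 0 ≤ z.re))
  rw [Complex.sin_arg, abs_div, abs_norm] at h1
  have h2 : |z.im| / ‖z‖ ≤ 1 / 100 := by
    rw [div_le_iff₀ (by linarith)]; linarith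
  have hπ := Real.pi_pos
  have h3 : |z.arg| ≤ Real.pi / 2 * (1 / 100) := by
    calc |z.arg| = Real.pi / 2 * (2 / Real.pi * |z.arg|) := by field_simp
      _ ≤ Real.pi / 2 * (1 / 100) := by gcongr; linarith
  linarith

open Complex (I) in
theorem adm_sector (R c t μ : ℝ) :
    Adm (cut (sectorPair R c t) fun x y : ℂ => Complex.exp (I * (μ * ‖x + y‖ : ℝ))) :=
  Adm.of_cut (measurableSet_sectorPair R c t)
    (by unfold uncurry; exact Continuous.measurable (by fun_prop))
    (fun x y => by rw [mul_comm, Complex.norm_exp_ofReal_mul_I])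
    (S := Metric.closedBall 0 R) measure_closedBall_lt_top
    fun x y h => mem_closedBall_zero_iff.2 h.2.1

/-- Measuring `x` from the midpoint along `u` and `y` from the midpoint along `-u` turns `|x - y|`
into `|x' + y'|`, with `x'` and `y'` both near the positive number `|x₀ - y₀|/2`, hence in one
sector. The threshold `-π` makes the one-sided restriction void. -/
theorem kerBound_pair_two {x₀ y₀ : ℂ} (hR : ‖x₀ - y₀‖ ∈ Icc (1 / 4 : ℝ) 2) {μ : ℝ} (hμ : 0 < μ) :
    KerBound (cut (nearPair x₀ y₀) (osc μ)) 2 2 (ENNReal.ofReal (20 * 2 / √μ * √2)) := by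
  obtain ⟨u, hu⟩ := exists_circle_mul (x₀ - y₀)
  set m := (x₀ + y₀) / 2 with hm
  have h := ((KerBound.sector (by norm_num : (0 : ℝ) < 2) hμ 0 (-Real.pi)).comp (adm_sector _ _ _ _)
    (measurePreserving_rigid u m) (rigid (-u) m) (measurePreserving_rigid (-u) m)).cut_prod
    (E := Metric.closedBall x₀ tiny)
    (E' := Metric.closedBall y₀ tiny) Metric.isClosed_closedBall.measurableSet
  refine h.congr fun x => Filter.Eventually.of_forall fun y => ?_
  have hu0 : (u : ℂ) ≠ 0 := Circle.coe_ne_zero u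
  have hun : ‖(u : ℂ)⁻¹‖ = 1 := by rw [norm_inv, Circle.norm_coe, inv_one]
  by_cases hxy : nearPair x₀ y₀ x y
  · have hneg : ((-u : Circle) : ℂ)⁻¹ = -(u : ℂ)⁻¹ := by
      rw [show ((-u : Circle) : ℂ) = -(u : ℂ) from rfl, inv_neg]
    have hx : ‖rigid u m x - ((‖x₀ - y₀‖ / 2 : ℝ) : ℂ)‖ ≤ tiny := by
      have e : rigid u m x - ((‖x₀ - y₀‖ / 2 : ℝ) : ℂ) = (u : ℂ)⁻¹ * (x - x₀) := by
        rw [rigid_apply, hm]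
        push_cast
        field_simp
        linear_combination hu
      rw [e, norm_mul, hun, one_mul]
      exact mem_closedBall_iff_norm.1 hxy.1
    have hy : ‖rigid (-u) m y - ((‖x₀ - y₀‖ / 2 : ℝ) : ℂ)‖ ≤ tiny := by
      have e : rigid (-u) m y - ((‖x₀ - y₀‖ / 2 : ℝ) : ℂ) = -((u : ℂ)⁻¹ * (y - y₀)) := by
        rw [rigid_apply, hneg, hm]
        push_cast
        field_simp
        linear_combination hu
      rw [e, norm_neg, norm_mul, hun, one_mul]
      exact mem_closedBall_iff_norm.1 hxy.2
    have hr : 1 / 8 ≤ ‖x₀ - y₀‖ / 2 := by linarith [hR.1]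
    have hnorm : ∀ z : ℂ, ‖z - ((‖x₀ - y₀‖ / 2 : ℝ) : ℂ)‖ ≤ tiny → ‖z‖ ≤ 2 := by
      intro z hz
      have := norm_le_norm_add_norm_sub ((‖x₀ - y₀‖ / 2 : ℝ) : ℂ) z
      rw [norm_sub_rev _ z, Complex.norm_real, Real.norm_of_nonneg (by positivity)] at this
      unfold tiny at hz
      linarith [hR.2]
    have hax := abs_arg_lt_of_near hr hx
    have hay := abs_arg_lt_of_near hr hy
    have hsec : sectorPair 2 0 (-Real.pi) (rigid u m x) (rigid (-u) m y) := by
      refine ⟨hnorm _ hx, hnorm _ hy, by rwa [sub_zero], by rwa [sub_zero], ?_⟩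
      linarith [(abs_lt.1 hax).1, (abs_lt.1 hay).2, Real.pi_pos]
    have hsum : ‖rigid u m x + rigid (-u) m y‖ = ‖x - y‖ := by
      rw [rigid_apply, rigid_apply, hneg]
      have : (u : ℂ)⁻¹ * (x - m) + -(u : ℂ)⁻¹ * (y - m) = (u : ℂ)⁻¹ * (x - y) := by ring
      rw [this, norm_mul, hun, one_mul]
    rw [cut_of_pos (P := nearPair x₀ y₀) hxy,
      cut_of_pos (P := fun x y => x ∈ Metric.closedBall x₀ tiny ∧ y ∈ Metric.closedBall y₀ tiny) hxy,
      cut_of_pos hsec, osc, hsum]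
  · rw [cut_of_neg (P := nearPair x₀ y₀) hxy, cut_of_neg]
    exact hxy

end Pair

/-! ### Whitney decomposition of an ordering. -/

section Whitney

variable {X Y : Type*} [MeasureSpace X] [MeasureSpace Y]

theorem KerBound.congr_ae {k k' : X → Y → ℂ} {p q B : ℝ≥0∞} (h : KerBound k p q B)
    (hk : ∀ᵐ x, k x =ᵐ[volume] k' x) : KerBound k' p q B := by
  intro f hf
  rw [← eLpNorm_congr_ae (f := kop k f)]
  · exact h f hf
  · filter_upwards [hk] with x hx
    exact integral_congr_ae (hx.mono fun y hy => by simp only [hy])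

/-- The condition has to be a product only where the kernel does not vanish. -/
theorem KerBound.cut_prod' {k : X → Y → ℂ} {p q B : ℝ≥0∞} (h : KerBound k p q B) {P : X → Y → Prop}
    {E : Set X} {E' : Set Y} (hE' : MeasurableSet E')
    (hP : ∀ x y, k x y ≠ 0 → (P x y ↔ x ∈ E ∧ y ∈ E')) : KerBound (cut P k) p q B := by
  refine (h.cut_prod (E := E) hE').congr fun x => Filter.Eventually.of_forall fun y => ?_
  by_cases h0 : k x y = 0
  · simp [cut, h0]
  · by_cases hp : P x y
    · rw [cut_of_pos hp, cut_of_pos (P := fun x y => x ∈ E ∧ y ∈ E') ((hP x y h0).1 hp)]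
    · rw [cut_of_neg hp, cut_of_neg (P := fun x y => x ∈ E ∧ y ∈ E') fun h => hp ((hP x y h0).2 h)]

/-- The dyadic cell of generation `k` containing the value of `U`. -/
def cell {Z : Type*} (U : Z → ℝ) (k : ℕ) (z : Z) : ℤ := ⌊(2 : ℝ) ^ k * U z⌋

theorem cell_div_two {Z : Type*} (U : Z → ℝ) (k : ℕ) (z : Z) : cell U (k + 1) z / 2 = cell U k z := by
  have := Int.cast_mul_floor_div_cancel_of_pos (R := ℝ) (n := 2) (by norm_num) ((2 : ℝ) ^ k * U z)
  unfold cell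
  rw [← this]
  congr 2
  push_cast
  ring

theorem measurable_cell {Z : Type*} [MeasurableSpace Z] {U : Z → ℝ} (hU : Measurable U) (k : ℕ) :
    Measurable (cell U k) := Int.measurable_floor.comp (hU.const_mul _)

variable {U : X → ℝ} {V : Y → ℝ}

/-- The pairs of cells of generation `k + 1` with a common parent, in increasing order. -/
def siblings {X Y : Type*} (U : X → ℝ) (V : Y → ℝ) (k : ℕ) (x : X) (y : Y) : Prop :=
  cell U k x = cell V k y ∧ x ∈ {x | cell U (k + 1) x % 2 = 1} ∧ y ∈ {y | cell V (k + 1) y % 2 = 0}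

/-- The pairs in a common cell of generation `k`, in increasing order. -/
def ordered {X Y : Type*} (U : X → ℝ) (V : Y → ℝ) (k : ℕ) (x : X) (y : Y) : Prop :=
  cell U k x = cell V k y ∧ V y < U x

/-- Two ordered points in a common cell either separate in the next generation, and then occupy the
two halves of their parent in increasing order, or stay together. Parity of the cell numbers tells
the halves apart. -/
theorem cut_ordered_succ {X Y : Type*} {U : X → ℝ} {V : Y → ℝ} (k : ℕ) (K : X → Y → ℂ) (x : X) (y : Y) :
    cut (ordered U V k) K x y = cut (siblings U V k) K x y + cut (ordered U V (k + 1)) K x y := by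
  have hx := cell_div_two U k x
  have hy := cell_div_two V k y
  have hmono : V y < U x → cell V (k + 1) y ≤ cell U (k + 1) x := fun h =>
    Int.floor_le_floor (mul_le_mul_of_nonneg_left h.le (by positivity))
  have hmono' : ¬ V y < U x → cell U (k + 1) x ≤ cell V (k + 1) y := fun h =>
    Int.floor_le_floor (mul_le_mul_of_nonneg_left (not_lt.1 h) (by positivity))
  have e1 : ordered U V k x y ↔ (cell U (k + 1) x / 2 = cell V (k + 1) y / 2 ∧ V y < U x) := by
    rw [hx, hy]; exact Iff.rfl
  have e2 : siblings U V k x y ↔ (cell U (k + 1) x / 2 = cell V (k + 1) y / 2 ∧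
      cell U (k + 1) x % 2 = 1 ∧ cell V (k + 1) y % 2 = 0) := by
    rw [hx, hy]; exact Iff.rfl
  have e3 : ordered U V (k + 1) x y ↔ (cell U (k + 1) x = cell V (k + 1) y ∧ V y < U x) := Iff.rfl
  simp only [cut, e1, e2, e3]
  generalize cell U (k + 1) x = a at *
  generalize cell V (k + 1) y = b at *
  by_cases h : V y < U x
  · have := hmono h
    by_cases e1 : a / 2 = b / 2
    · by_cases e2 : a = b
      · have : ¬ (a % 2 = 1 ∧ b % 2 = 0) := by omega
        simp [h, e2]
      · have : a % 2 = 1 ∧ b % 2 = 0 := by omega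
        simp [h, e1, e2, this]
    · have : a ≠ b := by rintro rfl; exact e1 rfl
      simp [e1, this]
  · have := hmono' h
    have h2 : ¬ (a / 2 = b / 2 ∧ a % 2 = 1 ∧ b % 2 = 0) := by omega
    simp only [h, and_false, if_false, h2, add_zero]

theorem cut_ordered_eq_sum {X Y : Type*} {U : X → ℝ} {V : Y → ℝ} (N : ℕ) (K : X → Y → ℂ) (x : X) (y : Y) :
    cut (ordered U V 0) K x y =
      (∑ k ∈ Finset.range N, cut (siblings U V k) K x y) + cut (ordered U V N) K x y := by
  induction N with
  | zero => simp
  | succ N ih => rw [ih, Finset.sum_range_succ, cut_ordered_succ N, add_assoc]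

theorem measurableSet_cell_eq (hU : Measurable U) (hV : Measurable V) (k : ℕ) :
    MeasurableSet {z : X × Y | cell U k z.1 = cell V k z.2} :=
  measurableSet_eq_fun ((measurable_cell hU k).comp measurable_fst)
    ((measurable_cell hV k).comp measurable_snd)

theorem measurableSet_ordered (hU : Measurable U) (hV : Measurable V) (k : ℕ) :
    MeasurableSet {z : X × Y | ordered U V k z.1 z.2} :=
  (measurableSet_cell_eq hU hV k).inter
    (measurableSet_lt (hV.comp measurable_snd) (hU.comp measurable_fst))

theorem measurableSet_siblings (hU : Measurable U) (hV : Measurable V) (k : ℕ) :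
    MeasurableSet {z : X × Y | siblings U V k z.1 z.2} :=
  (measurableSet_cell_eq hU hV k).inter (measurableSet_mem_and_mem
    ((measurable_cell hU (k + 1)) (MeasurableSet.of_discrete (s := {n : ℤ | n % 2 = 1})))
    ((measurable_cell hV (k + 1)) (MeasurableSet.of_discrete (s := {n : ℤ | n % 2 = 0}))))

/-- Inside each cell of generation `k` the sibling condition is a product, so the unrestricted bound
survives. Hölder on the cell turns `L^p → L^q` into `L^q → L^q` with the gain `b`, and distinct
cells combine as diagonal blocks. -/
theorem KerBound.siblings (hU : Measurable U) (hV : Measurable V) {K : X → Y → ℂ} {p q B b : ℝ≥0∞}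
    (h : KerBound K p q B) (hpq : p ≤ q) (hq : q ≠ 0) (hqt : q ≠ ⊤) {F : Set Y}
    (hF : MeasurableSet F) (hKF : ∀ x y, K x y ≠ 0 → y ∈ F) (k : ℕ)
    (hfin : ∀ n, volume ({y | cell V k y = n} ∩ F) ≠ ⊤)
    (hb : ∀ n, volume ({y | cell V k y = n} ∩ F) ^ (1 / p.toReal - 1 / q.toReal) ≤ b) :
    KerBound (cut (siblings U V k) K) q q (B * b) := by
  have h1 := h.cut_prod (E := {x | cell U (k + 1) x % 2 = 1}) (E' := {y | cell V (k + 1) y % 2 = 0})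
    ((measurable_cell hV (k + 1)) (MeasurableSet.of_discrete (s := {n : ℤ | n % 2 = 0})))
  have h2 : KerBound (cut (fun x y => cell U k x = cell V k y) (cut (fun x y =>
      x ∈ {x | cell U (k + 1) x % 2 = 1} ∧ y ∈ {y | cell V (k + 1) y % 2 = 0}) K)) q q (B * b) := by
    refine KerBound.blocks (measurable_cell hU k) (measurable_cell hV k) hq hqt fun n => ?_
    have h3 := (h1.cut_prod_of_le (E := {x | cell U k x = n}) (E' := {y | cell V k y = n} ∩ F)
      (((measurable_cell hV k) (measurableSet_singleton n)).inter hF) (hfin n) hpq).mono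
      (mul_le_mul' le_rfl (hb n))
    refine h3.congr fun x => Filter.Eventually.of_forall fun y => ?_
    by_cases h0 : K x y = 0
    · simp [cut, h0]
    · have := hKF x y h0
      simp [cut, this]
  rwa [cut_cut] at h2

variable [SigmaFinite (volume : Measure X)] [SigmaFinite (volume : Measure Y)]

/-- With equal exponents no generation gains anything, so only finitely many are peeled off and the
remainder needs a bound of its own. This is the version for `L²`. -/
theorem KerBound.ordered_of_finite (hU : Measurable U) (hV : Measurable V) {K : X → Y → ℂ}
    (hK : Adm K) {q B : ℝ≥0∞} (h : KerBound K q q B) (hq : 1 ≤ q) (hqt : q ≠ ⊤) {N : ℕ} {B' : ℝ≥0∞}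
    (hN : KerBound (cut (ordered U V N) K) q q B') :
    KerBound (cut (ordered U V 0) K) q q (N * B + B') := by
  have hq0 : q ≠ 0 := (lt_of_lt_of_le one_pos hq).ne'
  have h1 : ∀ k ∈ Finset.range N, KerBound (cut (BochnerRiesz.siblings U V k) K) q q B := by
    intro k _
    have h1 := h.cut_prod (E := {x | cell U (k + 1) x % 2 = 1}) (E' := {y | cell V (k + 1) y % 2 = 0})
      ((measurable_cell hV (k + 1)) (MeasurableSet.of_discrete (s := {n : ℤ | n % 2 = 0})))
    have h2 : KerBound (cut (fun x y => cell U k x = cell V k y) (cut (fun x y =>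
        x ∈ {x | cell U (k + 1) x % 2 = 1} ∧ y ∈ {y | cell V (k + 1) y % 2 = 0}) K)) q q B := by
      refine KerBound.blocks (measurable_cell hU k) (measurable_cell hV k) hq0 hqt fun n => ?_
      exact h1.cut_prod (E := {x | cell U k x = n}) (E' := {y | cell V k y = n})
        ((measurable_cell hV k) (measurableSet_singleton n))
    rwa [cut_cut] at h2
  have ha : ∀ k ∈ Finset.range N, Adm (cut (BochnerRiesz.siblings U V k) K) := fun k _ =>
    hK.cut (measurableSet_siblings hU hV k)
  have h2 := (KerBound.sum (Finset.range N) ha hq hq h1).add (Adm.sum _ ha)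
    (hK.cut (measurableSet_ordered hU hV N)) hq hq hN
  simp only [Finset.sum_const, Finset.card_range, nsmul_eq_mul] at h2
  exact h2.congr fun x => Filter.Eventually.of_forall fun y => (cut_ordered_eq_sum N K x y).symm

/-- The ordering is exhausted by sibling pairs of all generations, whose gains are added up; the
part left after `N` generations tends to zero by the trivial bound. -/
theorem KerBound.ordered_of_gain (hU : Measurable U) (hV : Measurable V) {K : X → Y → ℂ}
    (hK : Adm K) {p q B : ℝ≥0∞} (h : KerBound K p q B) (hpq : p ≤ q) (hq : 1 ≤ q) (hqt : q ≠ ⊤)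
    {E : Set X} {F : Set Y} (hE : MeasurableSet E) (hF : MeasurableSet F)
    (hKE : ∀ x y, K x y ≠ 0 → x ∈ E) (hKF : ∀ x y, K x y ≠ 0 → y ∈ F) {M : ℝ} 
    (hVF : ∀ k n, volume ({y | cell V k y = n} ∩ F) ≤ ENNReal.ofReal (M * (2 : ℝ) ^ (-(k : ℤ))))
    (hUE : ∀ k n, volume ({x | cell U k x = n} ∩ E) ≤ ENNReal.ofReal (M * (2 : ℝ) ^ (-(k : ℤ))))
    (hθ : 0 ≤ 1 / p.toReal - 1 / q.toReal) :
    KerBound (cut (ordered U V 0) K) q q (B * ∑' k : ℕ,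
      ENNReal.ofReal (M * (2 : ℝ) ^ (-(k : ℤ))) ^ (1 / p.toReal - 1 / q.toReal)) := by
  set θ := 1 / p.toReal - 1 / q.toReal with hθd
  have hq0 : q ≠ 0 := (lt_of_lt_of_le one_pos hq).ne'
  obtain ⟨M₀, hM₀⟩ := hK.bdd
  have h1 : ∀ N, ∀ k ∈ Finset.range N, KerBound (cut (BochnerRiesz.siblings U V k) K) q q
      (B * ENNReal.ofReal (M * (2 : ℝ) ^ (-(k : ℤ))) ^ θ) := fun N k _ =>
    h.siblings hU hV hpq hq0 hqt hF hKF k (fun n => ne_top_of_le_ne_top ENNReal.ofReal_ne_top (hVF k n))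
      fun n => ENNReal.rpow_le_rpow (hVF k n) hθ
  have ha : ∀ N, ∀ k ∈ Finset.range N, Adm (cut (BochnerRiesz.siblings U V k) K) := fun N k _ =>
    hK.cut (measurableSet_siblings hU hV k)
  -- What remains lies near the diagonal: every section is contained in a single cell of generation
  -- `N`.
  have hrem : ∀ N, KerBound (cut (BochnerRiesz.ordered U V N) K) q q
      (ENNReal.ofReal M₀ * ENNReal.ofReal (M * (2 : ℝ) ^ (-(N : ℤ)))) := by
    intro N
    refine KerBound.of_bounded (S := fun x y => cell U N x = cell V N y ∧ x ∈ E ∧ y ∈ F)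
      ((measurableSet_cell_eq hU hV N).inter (measurableSet_mem_and_mem hE hF)) (fun x y => ?_)
      (fun x y hne => ?_) (fun x => ?_) (fun y => ?_) hq ENNReal.ofReal_ne_top ENNReal.ofReal_ne_top
    · rw [← ofReal_norm]
      exact ENNReal.ofReal_le_ofReal ((norm_cut_le _ _ _ _).trans (hM₀ x y))
    · by_cases ho : BochnerRiesz.ordered U V N x y
      · rw [cut_of_pos ho] at hne
        exact ⟨ho.1, hKE x y hne, hKF x y hne⟩
      · exact absurd (cut_of_neg ho) hne
    · exact (measure_mono (t := {y | cell V N y = cell U N x} ∩ F) fun y hy => ⟨hy.1.symm, hy.2.2⟩).trans (hVF N (cell U N x))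
    · exact (measure_mono (t := {x | cell U N x = cell V N y} ∩ E) fun x hx => ⟨hx.1, hx.2.1⟩).trans (hUE N (cell V N y))
  have h2 : ∀ N : ℕ, KerBound (cut (BochnerRiesz.ordered U V 0) K) q q
      (B * (∑' k : ℕ, ENNReal.ofReal (M * (2 : ℝ) ^ (-(k : ℤ))) ^ θ) +
        ENNReal.ofReal M₀ * ENNReal.ofReal (M * (2 : ℝ) ^ (-(N : ℤ)))) := by
    intro N
    have h2 := (KerBound.sum (Finset.range N) (ha N) hq hq (h1 N)).add (Adm.sum _ (ha N))
      (hK.cut (measurableSet_ordered hU hV N)) hq hq (hrem N)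
    refine (h2.congr fun x => Filter.Eventually.of_forall fun y =>
      (cut_ordered_eq_sum N K x y).symm).mono ?_
    rw [← Finset.mul_sum]
    gcongr
    exact ENNReal.sum_le_tsum _
  -- The crude kernel bound `M₀` enters only through a term that disappears as `N` grows.
  intro f hf
  have ht : Filter.Tendsto (fun N : ℕ => (B * (∑' k : ℕ, ENNReal.ofReal (M * (2 : ℝ) ^ (-(k : ℤ))) ^ θ) +
        ENNReal.ofReal M₀ * ENNReal.ofReal (M * (2 : ℝ) ^ (-(N : ℤ)))) * eLpNorm f q volume)
      Filter.atTop (nhds ((B * (∑' k : ℕ, ENNReal.ofReal (M * (2 : ℝ) ^ (-(k : ℤ))) ^ θ) +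
        ENNReal.ofReal M₀ * 0) * eLpNorm f q volume)) := by
    refine ENNReal.Tendsto.mul_const (tendsto_const_nhds.add
      (ENNReal.Tendsto.const_mul ?_ (Or.inr ENNReal.ofReal_ne_top))) (Or.inr hf.2.ne)
    rw [← ENNReal.ofReal_zero]
    refine ENNReal.tendsto_ofReal ?_
    have : Filter.Tendsto (fun N : ℕ => M * (2 : ℝ)⁻¹ ^ N) Filter.atTop (nhds (M * 0)) :=
      (tendsto_pow_atTop_nhds_zero_of_lt_one (by norm_num) (by norm_num)).const_mul M
    rw [mul_zero] at this
    refine this.congr fun N => ?_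
    rw [zpow_neg, zpow_natCast, inv_pow]
  rw [mul_zero, add_zero] at ht
  exact ge_of_tendsto' ht fun N => h2 N f hf

end Whitney

/-! ### Pairs whose angles wrap around. -/

section Wrap

/-- The pairs whose polar angles in `[0, 2π)` satisfy `θ(x) - θ(y) > π`. -/
def wrap (x y : ℂ) : Prop := x.arg < 0 ∧ 0 ≤ y.arg ∧ y.arg < x.arg + Real.pi

theorem measurableSet_wrap : MeasurableSet {z : ℂ × ℂ | wrap z.1 z.2} := by
  have h1 : Measurable fun z : ℂ × ℂ => z.1.arg := Complex.measurable_arg.comp measurable_fst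
  have h2 : Measurable fun z : ℂ × ℂ => z.2.arg := Complex.measurable_arg.comp measurable_snd
  exact (measurableSet_lt h1 measurable_const).inter ((measurableSet_le measurable_const h2).inter
    (measurableSet_lt h2 (h1.add_const _)))

/-- A positive inner product keeps the angle between the points below `π/2`, so wrapping can occur
only across the positive real axis, and there the inequality coupling the two arguments is
automatic. A product condition remains. -/
theorem wrap_iff_of_far {x y : ℂ} (h : 0 < x.re * y.re + x.im * y.im) :
    wrap x y ↔ (x.arg < 0 ∧ 0 < x.re) ∧ 0 ≤ y.arg := by
  unfold wrap
  constructor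
  · rintro ⟨h1, h2, h3⟩
    refine ⟨⟨h1, ?_⟩, h2⟩
    by_contra hx
    have him := Complex.arg_neg_iff.1 h1
    have him2 := Complex.arg_nonneg_iff.1 h2
    have hxy : 0 < x.re * y.re := by nlinarith
    have hx0 : x.re < 0 := lt_of_le_of_ne (not_lt.1 hx) fun h0 => by rw [h0, zero_mul] at hxy; exact lt_irrefl _ hxy
    have hy0 : y.re < 0 := by by_contra hc; nlinarith
    have a1 : ¬ (-(Real.pi / 2) < x.arg) := by
      rw [Complex.neg_pi_div_two_lt_arg_iff]
      rintro (h | h) <;> linarith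
    have a2 : ¬ (y.arg ≤ Real.pi / 2) := by
      rw [Complex.arg_le_pi_div_two_iff]
      rintro (h | h) <;> linarith
    linarith
  · rintro ⟨⟨h1, h2⟩, h3⟩
    refine ⟨h1, h3, ?_⟩
    have him := Complex.arg_neg_iff.1 h1
    have him2 := Complex.arg_nonneg_iff.1 h3
    have hxy : 0 < x.re * y.re := by nlinarith
    have hy0 : 0 < y.re := by by_contra hc; nlinarith
    have a1 := Complex.neg_pi_div_two_lt_arg_iff.2 (Or.inl h2)
    have a2 := Complex.arg_le_pi_div_two_iff.2 (Or.inl hy0.le)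
    linarith

/-- The inner product is `|x|²` minus that of `x` with `x - y`, hence positive once `|x| > |x - y|`;
here `|x| > 3 ≥ |x - y|`. -/
theorem far_of_near {x₀ y₀ x y : ℂ} (h : ‖x₀ - y₀‖ ∈ Icc (1 / 4 : ℝ) 2) (h4 : 4 ≤ ‖x₀‖)
    (hxy : nearPair x₀ y₀ x y) : 0 < x.re * y.re + x.im * y.im := by
  have h1 := mem_closedBall_iff_norm.1 hxy.1
  have h2 := mem_closedBall_iff_norm.1 hxy.2
  unfold tiny at h1 h2
  have h3 : ‖x - y‖ ≤ 3 := by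
    calc ‖x - y‖ = ‖(x - x₀) + (x₀ - y₀) - (y - y₀)‖ := by congr 1; ring
      _ ≤ ‖x - x₀‖ + ‖x₀ - y₀‖ + ‖y - y₀‖ := (norm_sub_le _ _).trans (by gcongr; exact norm_add_le _ _)
      _ ≤ 3 := by linarith [h.2]
  have h5 : 3 < ‖x‖ := by
    have := norm_sub_norm_le x₀ x
    rw [norm_sub_rev] at this
    linarith
  have h6 := (Complex.abs_re_le_norm _).trans_eq (norm_mul x ((starRingEnd ℂ) (x - y)))
  rw [Complex.norm_conj] at h6
  have h7 : (x * (starRingEnd ℂ) (x - y)).re = ‖x‖ ^ 2 - (x.re * y.re + x.im * y.im) := by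
    rw [← Complex.normSq_eq_norm_sq, Complex.normSq_apply]
    simp
    ring
  rw [h7] at h6
  have := (abs_le.1 h6).2
  nlinarith [norm_nonneg x]

theorem volume_closedBall_tiny_le (y : ℂ) : volume (Metric.closedBall y tiny) ≤ 1 := by
  rw [Complex.volume_closedBall, ← ENNReal.ofReal_pow (by norm_num [tiny])]
  calc ENNReal.ofReal (tiny ^ 2) * (NNReal.pi : ℝ≥0∞) ≤ ENNReal.ofReal (tiny ^ 2) * ENNReal.ofReal 4 := by
        gcongr
        rw [← ENNReal.ofReal_coe_nnreal, NNReal.coe_real_pi]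
        exact ENNReal.ofReal_le_ofReal Real.pi_le_four
    _ ≤ 1 := by
        rw [← ENNReal.ofReal_mul (by positivity)]
        exact ENNReal.ofReal_le_one.2 (by norm_num [tiny])

/-- Crude polar integration: the range of radii and the Jacobian are both at most 8. -/
theorem volume_sector_le (a w : ℝ) :
    volume ({z : ℂ | z.arg ∈ Ico a (a + w)} ∩ Metric.closedBall 0 8) ≤ ENNReal.ofReal (64 * w) := by
  have hm : MeasurableSet ({z : ℂ | z.arg ∈ Ico a (a + w)} ∩ Metric.closedBall 0 8) :=
    (Complex.measurable_arg measurableSet_Ico).inter Metric.isClosed_closedBall.measurableSet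
  rw [← lintegral_indicator_one hm, ← Complex.lintegral_comp_polarCoord_symm]
  calc _ ≤ ∫⁻ p : ℝ × ℝ, (Icc (0 : ℝ) 8 ×ˢ Ico a (a + w)).indicator (fun _ => ENNReal.ofReal 8) p := by
        rw [← lintegral_indicator measurableSet_polarCoord_target]
        refine lintegral_mono fun p => ?_
        by_cases hp : p ∈ polarCoord.target
        · rw [indicator_of_mem hp]
          have hp0 : 0 < p.1 := hp.1
          by_cases hz : Complex.polarCoord.symm p ∈
            ({z : ℂ | z.arg ∈ Ico a (a + w)} ∩ Metric.closedBall 0 8)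
          · have h1 : p.2 ∈ Ico a (a + w) := by
              have := hz.1
              change (Complex.polarCoord.symm p).arg ∈ Ico a (a + w) at this
              rwa [arg_polarCoord_symm hp] at this
            have h2 : p.1 ≤ 8 := by
              have := mem_closedBall_zero_iff.1 hz.2
              rw [Complex.norm_polarCoord_symm, abs_of_pos hp0] at this
              exact this
            rw [indicator_of_mem (show p ∈ Icc (0 : ℝ) 8 ×ˢ Ico a (a + w) from ⟨⟨hp0.le, h2⟩, h1⟩),
              indicator_of_mem hz, Pi.one_apply, smul_eq_mul, mul_one]
            exact ENNReal.ofReal_le_ofReal h2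
          · rw [indicator_of_notMem hz, smul_zero]
            exact zero_le
        · rw [indicator_of_notMem hp]
          exact zero_le
    _ = _ := by
        rw [lintegral_indicator (measurableSet_Icc.prod measurableSet_Ico), setLIntegral_const,
          Measure.volume_eq_prod, Measure.prod_prod, Real.volume_Icc, Real.volume_Ico,
          ← ENNReal.ofReal_mul (by norm_num), ← ENNReal.ofReal_mul (by norm_num)]
        congr 1
        ring

/-- Normalized angle of `-x` for `x` in the lower half plane. -/
def lowerAngle (x : ℂ) : ℝ := (x.arg + Real.pi) / (4 * Real.pi)

/-- Normalized angle of `y` in the upper half plane. -/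
def upperAngle (y : ℂ) : ℝ := y.arg / (4 * Real.pi)

theorem measurable_lowerAngle : Measurable lowerAngle :=
  (Complex.measurable_arg.add_const _).div_const _

theorem measurable_upperAngle : Measurable upperAngle := Complex.measurable_arg.div_const _

theorem mem_Ico_of_floor_eq {k : ℕ} {n : ℤ} {t : ℝ} (h : ⌊(2 : ℝ) ^ k * (t / (4 * Real.pi))⌋ = n) :
    t ∈ Ico (4 * Real.pi * n * (2 : ℝ) ^ (-(k : ℤ)))
      (4 * Real.pi * n * (2 : ℝ) ^ (-(k : ℤ)) + 4 * Real.pi * (2 : ℝ) ^ (-(k : ℤ))) := by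
  rw [Int.floor_eq_iff] at h
  have hπ := Real.pi_pos
  have h2 : (0 : ℝ) < 2 ^ k := by positivity
  have e : t = 4 * Real.pi * ((2 : ℝ) ^ k * (t / (4 * Real.pi))) * (2 : ℝ) ^ (-(k : ℤ)) := by
    rw [zpow_neg, zpow_natCast]; field_simp
  have h3 : (0 : ℝ) < 2 ^ (-(k : ℤ)) := by positivity
  set v := (2 : ℝ) ^ k * (t / (4 * Real.pi))
  constructor
  · rw [e]
    have := h.1
    gcongr
  · calc t = 4 * Real.pi * v * (2 : ℝ) ^ (-(k : ℤ)) := e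
      _ < 4 * Real.pi * (n + 1) * (2 : ℝ) ^ (-(k : ℤ)) := by
          have := h.2
          gcongr
      _ = _ := by ring

theorem volume_lower_cell_le (k : ℕ) (n : ℤ) :
    volume ({x | cell lowerAngle k x = n} ∩ Metric.closedBall (0 : ℂ) 8) ≤
      ENNReal.ofReal (256 * Real.pi * (2 : ℝ) ^ (-(k : ℤ))) := by
  refine (measure_mono (t := {z : ℂ | z.arg ∈ Ico (4 * Real.pi * n * (2 : ℝ) ^ (-(k : ℤ)) - Real.pi)
    (4 * Real.pi * n * (2 : ℝ) ^ (-(k : ℤ)) - Real.pi + 4 * Real.pi * (2 : ℝ) ^ (-(k : ℤ)))} ∩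
    Metric.closedBall (0 : ℂ) 8) ?_).trans ((volume_sector_le _ _).trans_eq ?_)
  · refine inter_subset_inter_left _ fun x hx => ?_
    have := mem_Ico_of_floor_eq (show ⌊(2 : ℝ) ^ k * ((x.arg + Real.pi) / (4 * Real.pi))⌋ = n from hx)
    exact ⟨by linarith [this.1], by linarith [this.2]⟩
  · congr 1; ring

theorem volume_upper_cell_le (k : ℕ) (n : ℤ) :
    volume ({x | cell upperAngle k x = n} ∩ Metric.closedBall (0 : ℂ) 8) ≤
      ENNReal.ofReal (256 * Real.pi * (2 : ℝ) ^ (-(k : ℤ))) := by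
  refine (measure_mono (t := {z : ℂ | z.arg ∈ Ico (4 * Real.pi * n * (2 : ℝ) ^ (-(k : ℤ)))
    (4 * Real.pi * n * (2 : ℝ) ^ (-(k : ℤ)) + 4 * Real.pi * (2 : ℝ) ^ (-(k : ℤ)))} ∩
    Metric.closedBall (0 : ℂ) 8) ?_).trans ((volume_sector_le _ _).trans_eq ?_)
  · exact inter_subset_inter_left _ fun x hx => mem_Ico_of_floor_eq hx
  · congr 1; ring

theorem measurableSet_nearPair (x₀ y₀ : ℂ) : MeasurableSet {z : ℂ × ℂ | nearPair x₀ y₀ z.1 z.2} :=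
  measurableSet_mem_and_mem Metric.isClosed_closedBall.measurableSet
    Metric.isClosed_closedBall.measurableSet

theorem adm_pair (x₀ y₀ : ℂ) (μ : ℝ) : Adm (cut (nearPair x₀ y₀) (osc μ)) :=
  Adm.of_cut (measurableSet_nearPair x₀ y₀) (continuous_osc μ).measurable
    (fun x y => (norm_osc μ x y).le) (S := Metric.closedBall y₀ tiny) measure_closedBall_lt_top
    fun _ _ h => h.2

/-- The oscillatory kernel on pairs in the lower and upper half planes. -/
def halfKer (x₀ y₀ : ℂ) (μ : ℝ) : ℂ → ℂ → ℂ :=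
  cut (fun x y => x ∈ {x : ℂ | x.arg < 0} ∧ y ∈ {y : ℂ | 0 ≤ y.arg}) (cut (nearPair x₀ y₀) (osc μ))

theorem measurableSet_upper : MeasurableSet {y : ℂ | 0 ≤ y.arg} :=
  measurableSet_le measurable_const Complex.measurable_arg

theorem measurableSet_lower : MeasurableSet {y : ℂ | y.arg < 0} :=
  measurableSet_lt Complex.measurable_arg measurable_const

theorem adm_halfKer (x₀ y₀ : ℂ) (μ : ℝ) : Adm (halfKer x₀ y₀ μ) :=
  (adm_pair x₀ y₀ μ).cut (measurableSet_mem_and_mem measurableSet_lower measurableSet_upper)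

theorem near_of_halfKer_ne_zero {x₀ y₀ x y : ℂ} {μ : ℝ} (h : halfKer x₀ y₀ μ x y ≠ 0) :
    nearPair x₀ y₀ x y := by
  by_contra hc
  refine h ?_
  unfold halfKer
  rw [cut_cut]
  exact cut_of_neg fun h => hc h.2

/-- For `x` in the lower and `y` in the upper half plane, wrapping is an ordering of the normalized
angles. Division by `4π` puts both in `[0, 1)`, a single cell of generation zero. -/
theorem cut_wrap_eq (x₀ y₀ : ℂ) (μ : ℝ) : cut wrap (cut (nearPair x₀ y₀) (osc μ)) =
    cut (ordered lowerAngle upperAngle 0) (halfKer x₀ y₀ μ) := by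
  unfold halfKer
  rw [cut_cut (ordered lowerAngle upperAngle 0)]
  refine cut_congr (fun _ _ => ?_) fun _ _ _ => rfl
  rename_i x y
  have hπ := Real.pi_pos
  have hlt : upperAngle y < lowerAngle x ↔ y.arg < x.arg + Real.pi :=
    div_lt_div_iff_of_pos_right (by positivity)
  have hcell : x.arg < 0 → 0 ≤ y.arg → cell lowerAngle 0 x = cell upperAngle 0 y := by
    intro h1 h2
    have e1 : cell lowerAngle 0 x = 0 := by
      unfold cell lowerAngle
      rw [Int.floor_eq_zero_iff, pow_zero, one_mul]
      exact ⟨div_nonneg (by linarith [Complex.neg_pi_lt_arg x]) (by positivity),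
        (div_lt_one (by positivity)).2 (by linarith)⟩
    have e2 : cell upperAngle 0 y = 0 := by
      unfold cell upperAngle
      rw [Int.floor_eq_zero_iff, pow_zero, one_mul]
      exact ⟨div_nonneg h2 (by positivity),
        (div_lt_one (by positivity)).2 (by linarith [Complex.arg_le_pi y])⟩
    rw [e1, e2]
  constructor
  · rintro ⟨h1, h2, h3⟩
    exact ⟨⟨hcell h1 h2, hlt.2 h3⟩, h1, h2⟩
  · rintro ⟨⟨-, h3⟩, h1, h2⟩
    exact ⟨h1, h2, hlt.1 h3⟩

theorem norm_le_of_near {x₀ y₀ x y : ℂ} (h : ‖x₀ - y₀‖ ∈ Icc (1 / 4 : ℝ) 2) (h4 : ‖x₀‖ < 4)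
    (hxy : nearPair x₀ y₀ x y) : ‖x‖ ≤ 8 ∧ ‖y‖ ≤ 8 := by
  have h1 := mem_closedBall_iff_norm.1 hxy.1
  have h2 := mem_closedBall_iff_norm.1 hxy.2
  unfold tiny at h1 h2
  have e1 := norm_sub_norm_le x x₀
  have e2 := norm_sub_norm_le y y₀
  have e3 := norm_sub_norm_le y₀ x₀
  rw [norm_sub_rev] at e3
  constructor <;> linarith [h.2]

/-- Away from the origin wrapping is a product condition and the `L⁴ → L^q` bound suffices. Near the
origin it is a genuine ordering; angular cells of generation `k` meet the ball of radius 8 in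
measure `O(2^(-k))`, and `1/4 - 1/q > 0` makes the sum over generations converge. -/
theorem exists_kerBound_wrap {q : ℝ≥0∞} (hq : 4 < q) (hqt : q ≠ ⊤) : ∃ C : ℝ≥0,
    ∀ x₀ y₀ : ℂ, ‖x₀ - y₀‖ ∈ Icc (1 / 4 : ℝ) 2 → ∀ μ > 0,
      KerBound (cut wrap (cut (nearPair x₀ y₀) (osc μ))) q q
        (C * ENNReal.ofReal (μ ^ (-(2 / q.toReal)))) := by
  obtain ⟨C, H⟩ := exists_kerBound_pair hq hqt
  have hq4 : 4 < q.toReal := by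
    have := (ENNReal.toReal_lt_toReal (by norm_num) hqt).2 hq
    simpa using this
  have e4 : (4 : ℝ≥0∞).toReal = 4 := by norm_num
  have hθ : 0 < 1 / (4 : ℝ≥0∞).toReal - 1 / q.toReal := by
    rw [e4, sub_pos]
    exact one_div_lt_one_div_of_lt (by norm_num) hq4
  set θ := 1 / (4 : ℝ≥0∞).toReal - 1 / q.toReal with hθd
  have hq1 : 1 ≤ q := le_trans (by norm_num) hq.le
  set G : ℝ≥0∞ := ∑' k : ℕ, ENNReal.ofReal (256 * Real.pi * (2 : ℝ) ^ (-(k : ℤ))) ^ θ with hG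
  have hGt : G ≠ ⊤ := by
    have e1 : ∀ k : ℕ, ENNReal.ofReal (256 * Real.pi * (2 : ℝ) ^ (-(k : ℤ))) ^ θ =
        ENNReal.ofReal (128 * Real.pi) ^ θ * ENNReal.ofReal (2 * (2 : ℝ) ^ (-(k : ℤ))) ^ θ := by
      intro k
      rw [← ENNReal.mul_rpow_of_nonneg _ _ hθ.le, ← ENNReal.ofReal_mul (by positivity)]
      congr 2
      ring
    rw [hG]
    simp only [e1]
    rw [ENNReal.tsum_mul_left]
    exact ENNReal.mul_ne_top (ENNReal.rpow_ne_top_of_nonneg hθ.le ENNReal.ofReal_ne_top)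
      (tsum_dyadic_ne_top hθ)
  refine ⟨C * (G.toNNReal + 1), fun x₀ y₀ hR μ hμ => ?_⟩
  have hP := H x₀ y₀ hR μ hμ
  rw [ENNReal.coe_mul, ENNReal.coe_add, ENNReal.coe_toNNReal hGt, ENNReal.coe_one]
  by_cases h4 : 4 ≤ ‖x₀‖
  · have h1 := hP.cut_prod_of_le (E := {x : ℂ | x.arg < 0 ∧ 0 < x.re})
      (E' := {y : ℂ | 0 ≤ y.arg} ∩ Metric.closedBall y₀ tiny)
      (measurableSet_upper.inter Metric.isClosed_closedBall.measurableSet)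
      (ne_top_of_le_ne_top ENNReal.one_ne_top ((measure_mono inter_subset_right).trans
        (volume_closedBall_tiny_le y₀))) hq.le
    refine (h1.congr fun x => Filter.Eventually.of_forall fun y => ?_).mono
      (B' := C * (G + 1) * ENNReal.ofReal (μ ^ (-(2 / q.toReal)))) ?_
    · by_cases hn : nearPair x₀ y₀ x y
      · have := wrap_iff_of_far (far_of_near hR h4 hn)
        by_cases hw : wrap x y
        · rw [cut_of_pos hw]
          have hw2 := this.1 hw
          exact cut_of_pos (P := fun x y => x ∈ {x : ℂ | x.arg < 0 ∧ 0 < x.re} ∧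
            y ∈ {y : ℂ | 0 ≤ y.arg} ∩ Metric.closedBall y₀ tiny) ⟨hw2.1, hw2.2, hn.2⟩
        · rw [cut_of_neg hw]
          exact cut_of_neg fun h => hw (this.2 ⟨h.1, h.2.1⟩)
      · simp [cut, hn]
    · calc _ ≤ (C : ℝ≥0∞) * ENNReal.ofReal (μ ^ (-(2 / q.toReal))) * 1 := by
            gcongr
            exact ENNReal.rpow_le_one ((measure_mono inter_subset_right).trans
              (volume_closedBall_tiny_le y₀)) hθ.le
        _ = C * 1 * ENNReal.ofReal (μ ^ (-(2 / q.toReal))) := by ring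
        _ ≤ _ := by gcongr; exact le_add_self
  · rw [cut_wrap_eq]
    have h1 : KerBound (halfKer x₀ y₀ μ) 4 q _ := hP.cut_prod measurableSet_upper
    have hE : MeasurableSet (Metric.closedBall (0 : ℂ) 8) := Metric.isClosed_closedBall.measurableSet
    have h2 := KerBound.ordered_of_gain measurable_lowerAngle measurable_upperAngle
      (adm_halfKer x₀ y₀ μ) h1 hq.le hq1 hqt hE hE
      (fun x y h => mem_closedBall_zero_iff.2 (norm_le_of_near hR (not_le.1 h4) (near_of_halfKer_ne_zero h)).1)
      (fun x y h => mem_closedBall_zero_iff.2 (norm_le_of_near hR (not_le.1 h4) (near_of_halfKer_ne_zero h)).2)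
      volume_upper_cell_le volume_lower_cell_le hθ.le
    refine h2.mono ?_
    rw [← hθd, ← hG]
    calc (C : ℝ≥0∞) * ENNReal.ofReal (μ ^ (-(2 / q.toReal))) * G
        = C * G * ENNReal.ofReal (μ ^ (-(2 / q.toReal))) := by ring
      _ ≤ _ := by gcongr; exact le_self_add

/-- On `L²` there is no gain to sum. After five generations the angular cells have width `π/8`, and
within one cell `x ↦ -x` brings both points into a sector, where wrapping is the one-sided
restriction that `KerBound.sector` allows. -/
theorem exists_kerBound_wrap_two : ∃ C : ℝ≥0,
    ∀ x₀ y₀ : ℂ, ‖x₀ - y₀‖ ∈ Icc (1 / 4 : ℝ) 2 → ∀ μ > 0,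
      KerBound (cut wrap (cut (nearPair x₀ y₀) (osc μ))) 2 2
        (C * ENNReal.ofReal (μ ^ (-(1 / 2 : ℝ)))) := by
  -- Generous: the case near the origin needs only `5 · 80 + 480`.
  refine ⟨10000, fun x₀ y₀ hR μ hμ => ?_⟩
  have hP := kerBound_pair_two hR hμ
  have hsq : ∀ c : ℝ, 0 ≤ c → ENNReal.ofReal (c / √μ) = ENNReal.ofReal c * ENNReal.ofReal (μ ^ (-(1 / 2 : ℝ))) := by
    intro c hc
    rw [← ENNReal.ofReal_mul hc, Real.rpow_neg hμ.le, ← Real.sqrt_eq_rpow]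
    rfl
  have hs2 : √2 ≤ 2 := by rw [Real.sqrt_le_left (by norm_num)]; norm_num
  have hs8 : √8 ≤ 3 := by rw [Real.sqrt_le_left (by norm_num)]; norm_num
  have hb : ENNReal.ofReal (20 * 2 / √μ * √2) ≤ ENNReal.ofReal 80 * ENNReal.ofReal (μ ^ (-(1 / 2 : ℝ))) := by
    rw [← hsq _ (by norm_num)]
    refine ENNReal.ofReal_le_ofReal ?_
    rw [div_mul_eq_mul_div]
    gcongr
    linarith
  have hb8 : ENNReal.ofReal (20 * 8 / √μ * √8) ≤ ENNReal.ofReal 480 * ENNReal.ofReal (μ ^ (-(1 / 2 : ℝ))) := by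
    rw [← hsq _ (by norm_num)]
    refine ENNReal.ofReal_le_ofReal ?_
    rw [div_mul_eq_mul_div]
    gcongr
    linarith
  by_cases h4 : 4 ≤ ‖x₀‖
  · refine (hP.cut_prod' (E := {x : ℂ | x.arg < 0 ∧ 0 < x.re}) (E' := {y : ℂ | 0 ≤ y.arg})
      measurableSet_upper fun x y hne => ?_).mono (hb.trans ?_)
    · have hn : nearPair x₀ y₀ x y := by
        by_contra hc
        exact hne (cut_of_neg hc)
      exact wrap_iff_of_far (far_of_near hR h4 hn)
    · gcongr
      norm_num
  · rw [cut_wrap_eq]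
    have h1 : KerBound (halfKer x₀ y₀ μ) 2 2 _ := hP.cut_prod measurableSet_upper
    have hrem : KerBound (cut (ordered lowerAngle upperAngle 5) (halfKer x₀ y₀ μ)) 2 2
        (ENNReal.ofReal (20 * 8 / √μ * √8)) := by
      have h2 : KerBound (cut (fun x y => cell lowerAngle 5 x = cell upperAngle 5 y)
          (cut (fun x y => upperAngle y < lowerAngle x) (halfKer x₀ y₀ μ))) 2 2
          (ENNReal.ofReal (20 * 8 / √μ * √8)) := by
        refine KerBound.blocks (measurable_cell measurable_lowerAngle 5)
          (measurable_cell measurable_upperAngle 5) (by norm_num) (by norm_num) fun n => ?_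
        -- The cell has width `4π/32 = π/8`, and `c` is its centre.
        set c : ℝ := 4 * Real.pi * n * (2 : ℝ) ^ (-(5 : ℤ)) + Real.pi / 16 with hc
        have h3 := ((KerBound.sector (by norm_num : (0 : ℝ) < 8) hμ c 0).comp (adm_sector 8 c 0 μ)
          (Measure.measurePreserving_neg (volume : Measure ℂ)) (MeasurableEquiv.refl ℂ)
          (MeasurePreserving.id volume)).cut_prod
          (E := {x : ℂ | (cell lowerAngle 5 x = n ∧ x.arg < 0) ∧ x ∈ Metric.closedBall x₀ tiny})
          (E' := {y : ℂ | (cell upperAngle 5 y = n ∧ 0 ≤ y.arg) ∧ y ∈ Metric.closedBall y₀ tiny})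
          ((((measurable_cell measurable_upperAngle 5) (measurableSet_singleton n)).inter
            measurableSet_upper).inter Metric.isClosed_closedBall.measurableSet)
        refine h3.congr fun x => Filter.Eventually.of_forall fun y => ?_
        rw [halfKer, cut_cut, cut_cut, cut_cut]
        by_cases hxy : x ∈ {x : ℂ | (cell lowerAngle 5 x = n ∧ x.arg < 0) ∧ x ∈ Metric.closedBall x₀ tiny} ∧
            y ∈ {y : ℂ | (cell upperAngle 5 y = n ∧ 0 ≤ y.arg) ∧ y ∈ Metric.closedBall y₀ tiny}
        · rw [cut_of_pos (P := fun x y => x ∈ {x : ℂ | (cell lowerAngle 5 x = n ∧ x.arg < 0) ∧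
            x ∈ Metric.closedBall x₀ tiny} ∧ y ∈ {y : ℂ | (cell upperAngle 5 y = n ∧ 0 ≤ y.arg) ∧
            y ∈ Metric.closedBall y₀ tiny}) hxy]
          obtain ⟨⟨⟨hx1, hx2⟩, hx3⟩, ⟨hy1, hy2⟩, hy3⟩ := hxy
          have hnorm := norm_le_of_near hR (not_le.1 h4) ⟨hx3, hy3⟩
          have harg : (-x).arg = x.arg + Real.pi :=
            Complex.arg_neg_eq_arg_add_pi_of_im_neg (Complex.arg_neg_iff.1 hx2)
          have hmx := mem_Ico_of_floor_eq (k := 5) (n := n) (t := x.arg + Real.pi) hx1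
          have hmy := mem_Ico_of_floor_eq (k := 5) (n := n) (t := y.arg) hy1
          have h25 : (2 : ℝ) ^ (-((5 : ℕ) : ℤ)) = 1 / 32 := by norm_num
          have h25' : (2 : ℝ) ^ (-(5 : ℤ)) = 1 / 32 := by norm_num
          rw [h25] at hmx hmy
          rw [h25'] at hc
          have hπ := Real.pi_pos
          have hsec : ∀ t, t ∈ Ico (4 * Real.pi * n * (1 / 32))
              (4 * Real.pi * n * (1 / 32) + 4 * Real.pi * (1 / 32)) → |t - c| < Real.pi / 8 := by
            intro t ht
            rw [hc, abs_lt]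
            constructor <;> linarith [ht.1, ht.2]
          have hlt : upperAngle y < lowerAngle x ↔ y.arg < x.arg + Real.pi :=
            div_lt_div_iff_of_pos_right (by positivity)
          change cut (sectorPair 8 c 0) (fun x y : ℂ => Complex.exp (Complex.I * (μ * ‖x + y‖ : ℝ))) (-x) y = _
          by_cases hw : y.arg < x.arg + Real.pi
          · have hs : sectorPair 8 c 0 (-x) y := by
              refine ⟨by rw [norm_neg]; exact hnorm.1, hnorm.2, ?_, hsec _ hmy, ?_⟩
              · rw [harg]; exact hsec _ hmx
              · rw [harg]; linarith
            rw [cut_of_pos hs]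
            symm
            have e : ‖-x + y‖ = ‖x - y‖ := by rw [← norm_neg, neg_add, neg_neg, sub_eq_add_neg]
            rw [e]
            refine cut_of_pos ?_
            exact ⟨⟨⟨⟨hx1, hy1⟩, hlt.2 hw⟩, hx2, hy2⟩, hx3, hy3⟩
          · have hs : ¬ sectorPair 8 c 0 (-x) y := by
              rintro ⟨-, -, -, -, h⟩
              rw [harg] at h
              exact hw (by linarith)
            rw [cut_of_neg hs]
            symm
            refine cut_of_neg fun h => hw (hlt.1 h.1.1.2)
        · rw [cut_of_neg (P := fun x y => x ∈ {x : ℂ | (cell lowerAngle 5 x = n ∧ x.arg < 0) ∧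
            x ∈ Metric.closedBall x₀ tiny} ∧ y ∈ {y : ℂ | (cell upperAngle 5 y = n ∧ 0 ≤ y.arg) ∧
            y ∈ Metric.closedBall y₀ tiny}) hxy]
          symm
          refine cut_of_neg fun h => hxy ?_
          exact ⟨⟨⟨h.1.1.1.1, h.1.2.1⟩, h.2.1⟩, ⟨h.1.1.1.2, h.1.2.2⟩, h.2.2⟩
      rwa [cut_cut] at h2
    refine (KerBound.ordered_of_finite measurable_lowerAngle measurable_upperAngle
      (adm_halfKer x₀ y₀ μ) h1 (by norm_num) (by norm_num) hrem).mono ?_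
    calc _ ≤ ((5 : ℕ) : ℝ≥0∞) * (ENNReal.ofReal 80 * ENNReal.ofReal (μ ^ (-(1 / 2 : ℝ)))) +
          ENNReal.ofReal 480 * ENNReal.ofReal (μ ^ (-(1 / 2 : ℝ))) := by gcongr
      _ = (5 * ENNReal.ofReal 80 + ENNReal.ofReal 480) * ENNReal.ofReal (μ ^ (-(1 / 2 : ℝ))) := by
          push_cast; ring
      _ ≤ _ := by
          gcongr
          norm_num

end Wrap

/-! ### The angular cutoff in terms of wrapped pairs. -/

section Truncation

/-- The polar angle in `[0, 2π)` of a complex number. -/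
def angle (x : ℂ) : ℝ := toIcoMod Real.two_pi_pos 0 x.arg

theorem angle_of_nonneg {x : ℂ} (h : 0 ≤ x.arg) : angle x = x.arg := by
  have h2 := Complex.arg_le_pi x
  have := Real.pi_pos
  exact (toIcoMod_eq_self Real.two_pi_pos).2 ⟨h, by linarith⟩

theorem angle_of_neg {x : ℂ} (h : x.arg < 0) : angle x = x.arg + 2 * Real.pi := by
  have h2 := Complex.neg_pi_lt_arg x
  have := Real.pi_pos
  rw [angle, ← toIcoMod_add_right Real.two_pi_pos]
  exact (toIcoMod_eq_self Real.two_pi_pos).2 ⟨by linarith, by linarith⟩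

/-- Angles in `[0, 2π)` exceed arguments in `(-π, π]` by `2π` exactly when the argument is negative,
so a difference above `π` requires a negative argument for `x` and a nonnegative one for `y`. -/
theorem lt_angle_sub_iff (x y : ℂ) : Real.pi < angle x - angle y ↔ wrap x y := by
  have hx1 := Complex.neg_pi_lt_arg x
  have hx2 := Complex.arg_le_pi x
  have hy1 := Complex.neg_pi_lt_arg y
  have hy2 := Complex.arg_le_pi y
  unfold wrap
  rcases lt_or_ge x.arg 0 with hx | hx <;> rcases lt_or_ge y.arg 0 with hy | hy
  · rw [angle_of_neg hx, angle_of_neg hy]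
    exact ⟨fun h => by linarith, fun h => by linarith [h.2.1]⟩
  · rw [angle_of_neg hx, angle_of_nonneg hy]
    exact ⟨fun h => ⟨hx, hy, by linarith⟩, fun h => by linarith [h.2.2]⟩
  · rw [angle_of_nonneg hx, angle_of_neg hy]
    exact ⟨fun h => by linarith, fun h => by linarith [h.1]⟩
  · rw [angle_of_nonneg hx, angle_of_nonneg hy]
    exact ⟨fun h => by linarith, fun h => by linarith [h.1]⟩

/-- The truncation of the geometric kernel. -/
def trunc (x y : ℂ) : Prop := |angle x - angle y| ≤ Real.pi

theorem trunc_iff (x y : ℂ) : trunc x y ↔ ¬ wrap x y ∧ ¬ wrap y x := by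
  rw [← lt_angle_sub_iff, ← lt_angle_sub_iff, not_lt, not_lt, trunc, abs_le]
  constructor <;> rintro ⟨h1, h2⟩ <;> constructor <;> linarith

theorem measurableSet_wrap_swap : MeasurableSet {z : ℂ × ℂ | wrap z.2 z.1} :=
  measurable_swap measurableSet_wrap

theorem measurableSet_trunc : MeasurableSet {z : ℂ × ℂ | trunc z.1 z.2} := by
  simp only [trunc_iff]
  exact measurableSet_wrap.compl.inter measurableSet_wrap_swap.compl

theorem not_wrap_and_wrap (x y : ℂ) : ¬ (wrap x y ∧ wrap y x) := by
  rintro ⟨h1, h2⟩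
  exact absurd h1.1 (not_lt.2 h2.2.1)

/-- The two ways of wrapping exclude each other and together form the complement of the truncation.
-/
theorem cut_trunc_eq (k : ℂ → ℂ → ℂ) (x y : ℂ) : cut trunc k x y =
    k x y + (-1 : ℂ) * (cut wrap k x y + cut (fun x y => wrap y x) k x y) := by
  have h0 := not_wrap_and_wrap x y
  have h1 := trunc_iff x y
  by_cases hw : wrap x y
  · have hw2 : ¬ wrap y x := fun h => h0 ⟨hw, h⟩
    have ht : ¬ trunc x y := fun h => (h1.1 h).1 hw
    simp [cut, hw, hw2, ht]
  · by_cases hw2 : wrap y x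
    · have ht : ¬ trunc x y := fun h => (h1.1 h).2 hw2
      simp [cut, hw, hw2, ht]
    · have ht : trunc x y := h1.2 ⟨hw, hw2⟩
      simp [cut, hw, hw2, ht]

theorem ae_im_ne_zero : ∀ᵐ x : ℂ, x.im ≠ 0 := by
  have h : volume ((LinearMap.ker Complex.imLm : Submodule ℝ ℂ) : Set ℂ) = 0 := by
    refine Measure.addHaar_submodule volume _ fun htop => ?_
    have : Complex.I ∈ (LinearMap.ker Complex.imLm : Submodule ℝ ℂ) := by rw [htop]; trivial
    simp at this
  rw [ae_iff]
  convert h using 2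
  ext x
  simp

/-- Complex conjugation as a measurable equivalence. -/
def conjEquiv : ℂ ≃ᵐ ℂ := Complex.conjLIE.toHomeomorph.toMeasurableEquiv

theorem conjEquiv_apply (x : ℂ) : conjEquiv x = (starRingEnd ℂ) x := rfl

theorem measurePreserving_conjEquiv : MeasurePreserving conjEquiv :=
  Complex.conjLIE.measurePreserving

/-- Conjugation negates arguments off the real axis and so exchanges the two half planes. On the
axis the boundary conventions differ, but it is a null set; hence one orientation of wrapping
suffices for estimates. -/
theorem wrap_conj {x y : ℂ} (hx : x.im ≠ 0) (hy : y.im ≠ 0) :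
    wrap (conjEquiv x) (conjEquiv y) ↔ wrap y x := by
  have e : ∀ z : ℂ, z.im ≠ 0 → (conjEquiv z).arg = -z.arg := by
    intro z hz
    rw [conjEquiv_apply, Complex.arg_conj, if_neg]
    intro h
    exact hz (Complex.arg_eq_pi_iff.1 h).2
  have e0 : ∀ z : ℂ, z.im ≠ 0 → z.arg ≠ 0 := by
    intro z hz h
    exact hz (Complex.arg_eq_zero_iff.1 h).2
  have hx0 := e0 x hx
  have hy0 := e0 y hy
  unfold wrap
  rw [e x hx, e y hy]
  constructor
  · rintro ⟨h1, h2, h3⟩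
    exact ⟨lt_of_le_of_ne (by linarith) hy0, by linarith, by linarith⟩
  · rintro ⟨h1, h2, h3⟩
    exact ⟨by linarith [lt_of_le_of_ne h2 hx0.symm], by linarith, by linarith⟩

theorem KerBound.wrap_swap {x₀ y₀ : ℂ} {μ : ℝ} {q B : ℝ≥0∞}
    (h : KerBound (cut wrap (cut (nearPair (conjEquiv x₀) (conjEquiv y₀)) (osc μ))) q q B) :
    KerBound (cut (fun x y => wrap y x) (cut (nearPair x₀ y₀) (osc μ))) q q B := by
  refine (h.comp ((adm_pair _ _ μ).cut measurableSet_wrap) measurePreserving_conjEquiv conjEquiv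
    measurePreserving_conjEquiv).congr_ae ?_
  filter_upwards [ae_im_ne_zero] with x hx
  filter_upwards [ae_im_ne_zero] with y hy
  have e : ∀ x y : ℂ, ‖conjEquiv x - conjEquiv y‖ = ‖x - y‖ := by
    intro x y
    rw [conjEquiv_apply, conjEquiv_apply, ← map_sub, Complex.norm_conj]
  have hw := wrap_conj hx hy
  have hn : nearPair (conjEquiv x₀) (conjEquiv y₀) (conjEquiv x) (conjEquiv y) ↔ nearPair x₀ y₀ x y := by
    unfold nearPair
    rw [mem_closedBall_iff_norm, mem_closedBall_iff_norm, mem_closedBall_iff_norm,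
      mem_closedBall_iff_norm, e, e]
  by_cases h1 : wrap y x <;> by_cases h2 : nearPair x₀ y₀ x y
  · simp [cut, hw, hn, osc, e, h1, h2]
  · simp [cut, hw, hn, h1, h2]
  · simp [cut, hw, h1]
  · simp [cut, hw, h1]

theorem KerBound.trunc_pair {q : ℝ≥0∞} (hq : 1 ≤ q) {s : ℝ} {C C' : ℝ≥0}
    (h : ∀ x₀ y₀ : ℂ, ‖x₀ - y₀‖ ∈ Icc (1 / 4 : ℝ) 2 → ∀ μ > 0,
      KerBound (cut (nearPair x₀ y₀) (osc μ)) q q (C * ENNReal.ofReal (μ ^ (-s))))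
    (h' : ∀ x₀ y₀ : ℂ, ‖x₀ - y₀‖ ∈ Icc (1 / 4 : ℝ) 2 → ∀ μ > 0,
      KerBound (cut wrap (cut (nearPair x₀ y₀) (osc μ))) q q (C' * ENNReal.ofReal (μ ^ (-s))))
    {x₀ y₀ : ℂ} (hR : ‖x₀ - y₀‖ ∈ Icc (1 / 4 : ℝ) 2) {μ : ℝ} (hμ : 0 < μ) :
    KerBound (cut trunc (cut (nearPair x₀ y₀) (osc μ))) q q
      ((C + 2 * C' : ℝ≥0) * ENNReal.ofReal (μ ^ (-s))) := by
  have hR' : ‖conjEquiv x₀ - conjEquiv y₀‖ ∈ Icc (1 / 4 : ℝ) 2 := by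
    rwa [conjEquiv_apply, conjEquiv_apply, ← map_sub, Complex.norm_conj]
  have a := adm_pair x₀ y₀ μ
  have a1 := a.cut measurableSet_wrap
  have a2 := a.cut (P := fun x y => wrap y x) measurableSet_wrap_swap
  have h1 := (h' x₀ y₀ hR μ hμ).add a1 a2 hq hq (KerBound.wrap_swap (h' _ _ hR' μ hμ))
  have h2 := (h x₀ y₀ hR μ hμ).add a ((a1.add a2).mul (k' := fun _ _ => (-1 : ℂ)) measurable_const
    (M' := 1) (fun _ _ => by simp)) hq hq (h1.const_mul (-1))
  refine (h2.congr fun x => Filter.Eventually.of_forall fun y => (cut_trunc_eq _ x y).symm).mono ?_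
  rw [enorm_neg, enorm_one]
  push_cast
  refine le_of_eq ?_
  ring

theorem osc_neg (μ : ℝ) (x y : ℂ) : osc (-μ) x y = (starRingEnd ℂ) (osc μ x y) := by
  unfold osc
  rw [← Complex.exp_conj]
  congr 1
  simp

/-- Decay of the truncated pair operators for all real frequencies. -/
theorem KerBound.trunc_pair_all {q : ℝ≥0∞} (hq : 1 ≤ q) {s : ℝ} (hs : 0 ≤ s) {C : ℝ≥0}
    (h : ∀ x₀ y₀ : ℂ, ‖x₀ - y₀‖ ∈ Icc (1 / 4 : ℝ) 2 → ∀ μ > 0,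
      KerBound (cut trunc (cut (nearPair x₀ y₀) (osc μ))) q q (C * ENNReal.ofReal (μ ^ (-s)))) :
    ∃ C' : ℝ≥0, ∀ x₀ y₀ : ℂ, ‖x₀ - y₀‖ ∈ Icc (1 / 4 : ℝ) 2 → ∀ μ : ℝ,
      KerBound (cut trunc (cut (nearPair x₀ y₀) (osc μ))) q q
        (C' * ENNReal.ofReal ((1 + |μ|) ^ (-s))) := by
  refine ⟨(C + 1) * (2 ^ s : ℝ).toNNReal, fun x₀ y₀ hR μ => ?_⟩
  have h2 : ∀ a b : ℝ, 0 < a → 0 < b → a ≤ 2 * b → b ^ (-s) ≤ 2 ^ s * a ^ (-s) := by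
    intro a b ha hb hab
    calc b ^ (-s) = 2 ^ s * (2 * b) ^ (-s) := by
          rw [Real.mul_rpow (by norm_num) hb.le, ← mul_assoc, ← Real.rpow_add (by norm_num)]
          simp
      _ ≤ 2 ^ s * a ^ (-s) := by
          refine mul_le_mul_of_nonneg_left ?_ (by positivity)
          exact Real.rpow_le_rpow_of_nonpos ha hab (by linarith)
  have h3 : ∀ b : ℝ, 0 < b → 1 + |μ| ≤ 2 * b → ∀ D : ℝ≥0, D ≤ C + 1 →
      (D : ℝ≥0∞) * ENNReal.ofReal (b ^ (-s)) ≤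
      ((C + 1) * (2 ^ s : ℝ).toNNReal : ℝ≥0) * ENNReal.ofReal ((1 + |μ|) ^ (-s)) := by
    intro b hb hab D hD
    have hp : (0 : ℝ) ≤ 2 ^ s := by positivity
    calc (D : ℝ≥0∞) * ENNReal.ofReal (b ^ (-s))
        ≤ ((C + 1 : ℝ≥0) : ℝ≥0∞) * ENNReal.ofReal (2 ^ s * (1 + |μ|) ^ (-s)) := by
          gcongr
          exact h2 _ _ (by positivity) hb hab
      _ = _ := by
          rw [ENNReal.ofReal_mul hp, ENNReal.coe_mul, mul_assoc]
          rfl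
  have hpos : ∀ ν : ℝ, 1 ≤ ν → |ν| = |μ| → KerBound (cut trunc (cut (nearPair x₀ y₀) (osc ν))) q q
        (((C + 1) * (2 ^ s : ℝ).toNNReal : ℝ≥0) * ENNReal.ofReal ((1 + |μ|) ^ (-s))) := by
    intro ν hν hνμ
    refine (h x₀ y₀ hR ν (by linarith)).mono (h3 ν (by linarith) ?_ C le_self_add)
    rw [← hνμ, abs_of_pos (by linarith)]
    linarith
  rcases le_or_gt 1 μ with h1 | h1
  · exact hpos μ h1 rfl
  rcases le_or_gt μ (-1) with h1' | h1'
  -- Negative frequencies are conjugates of positive ones, and the truncation is real.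
  · refine (hpos (-μ) (by linarith) (abs_neg μ)).conj.congr fun x =>
      Filter.Eventually.of_forall fun y => ?_
    simp only [cut, apply_ite (starRingEnd ℂ), map_zero, ← osc_neg, neg_neg]
  -- For `|μ| < 1` no decay is asked: the kernel is at most one, on balls of area at most one.
  · have hb : KerBound (cut trunc (cut (nearPair x₀ y₀) (osc μ))) q q (1 * 1) := by
      refine KerBound.of_bounded (S := nearPair x₀ y₀) (measurableSet_nearPair x₀ y₀) (fun x y => ?_)
        (fun x y hne => ?_) (fun x => ?_) (fun y => ?_) hq ENNReal.one_ne_top ENNReal.one_ne_top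
      · rw [← ofReal_norm]
        refine ENNReal.ofReal_le_one.2 ?_
        exact (norm_cut_le _ _ _ _).trans ((norm_cut_le _ _ _ _).trans (norm_osc μ x y).le)
      · by_contra hc
        refine hne ?_
        rw [cut_cut]
        exact cut_of_neg fun h => hc h.2
      · exact (measure_mono fun y hy => hy.2).trans (volume_closedBall_tiny_le y₀)
      · exact (measure_mono fun x hx => hx.1).trans (volume_closedBall_tiny_le x₀)
    refine hb.mono ?_
    have := h3 1 one_pos (by have := abs_lt.2 ⟨h1', h1⟩; linarith) 1 le_add_self
    simpa using this

end Truncation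

/-! ### Localization to a grid of small squares. -/

section Cells

/-- The index of the grid square containing a point. -/
def gridIndex (x : ℂ) : ℤ × ℤ := (⌊x.re / (tiny / 2)⌋, ⌊x.im / (tiny / 2)⌋)

/-- The corner of a grid square. -/
def gridPoint (m : ℤ × ℤ) : ℂ := ⟨m.1 * (tiny / 2), m.2 * (tiny / 2)⟩

theorem gridPoint_sub (m n : ℤ × ℤ) : gridPoint m - gridPoint n = gridPoint (m - n) := by
  apply Complex.ext <;> simp [gridPoint] <;> ring

theorem measurable_gridIndex : Measurable gridIndex := by
  unfold gridIndex
  exact (Int.measurable_floor.comp (Complex.measurable_re.div_const _)).prodMk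
    (Int.measurable_floor.comp (Complex.measurable_im.div_const _))

theorem norm_sub_gridPoint_le (x : ℂ) : ‖x - gridPoint (gridIndex x)‖ ≤ tiny := by
  have ht : 0 < tiny / 2 := by norm_num [tiny]
  have key : ∀ t : ℝ, |t - ⌊t / (tiny / 2)⌋ * (tiny / 2)| ≤ tiny / 2 := by
    intro t
    have h1 := Int.floor_le (t / (tiny / 2))
    have h2 := Int.lt_floor_add_one (t / (tiny / 2))
    rw [le_div_iff₀ ht] at h1
    rw [div_lt_iff₀ ht] at h2
    rw [abs_le]
    constructor <;> linarith
  refine (Complex.norm_le_abs_re_add_abs_im _).trans ?_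
  have h1 := key x.re
  have h2 := key x.im
  simp only [gridPoint, gridIndex, Complex.sub_re, Complex.sub_im]
  linarith

theorem finite_offsets : {d : ℤ × ℤ | ‖gridPoint d‖ ∈ Icc (1 / 4 : ℝ) 2}.Finite := by
  refine (Set.finite_Icc ((-(4 * 10 ^ 7), -(4 * 10 ^ 7)) : ℤ × ℤ) (4 * 10 ^ 7, 4 * 10 ^ 7)).subset ?_
  intro d hd
  have key : ∀ n : ℤ, |(n : ℝ) * (tiny / 2)| ≤ 2 → -(4 * 10 ^ 7) ≤ n ∧ n ≤ 4 * 10 ^ 7 := by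
    intro n hn
    rw [abs_le] at hn
    unfold tiny at hn
    constructor
    · have : (-(4 * 10 ^ 7) : ℝ) ≤ n := by linarith [hn.1]
      exact_mod_cast this
    · have : (n : ℝ) ≤ 4 * 10 ^ 7 := by linarith [hn.2]
      exact_mod_cast this
  have h1 := key d.1 ((Complex.abs_re_le_norm (gridPoint d)).trans hd.2)
  have h2 := key d.2 ((Complex.abs_im_le_norm (gridPoint d)).trans hd.2)
  exact ⟨⟨h1.1, h2.1⟩, ⟨h1.2, h2.2⟩⟩

/-- The offsets between grid squares at distance comparable to one. -/
def offsets : Finset (ℤ × ℤ) := finite_offsets.toFinset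

theorem mem_offsets {d : ℤ × ℤ} : d ∈ offsets ↔ ‖gridPoint d‖ ∈ Icc (1 / 4 : ℝ) 2 :=
  finite_offsets.mem_toFinset

/-- Each point is within `tiny` of its grid corner, and the margins between `[3/8, 4/3]` and `[1/4,
2]` absorb the two displacements. -/
theorem mem_offsets_of_norm {x y : ℂ} (h : ‖x - y‖ ∈ Icc (3 / 8 : ℝ) (4 / 3)) :
    gridIndex x - gridIndex y ∈ offsets := by
  have h1 := norm_sub_gridPoint_le x
  have h2 := norm_sub_gridPoint_le y
  unfold tiny at h1 h2
  rw [mem_offsets, ← gridPoint_sub]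
  have e : gridPoint (gridIndex x) - gridPoint (gridIndex y) =
      (x - y) + ((y - gridPoint (gridIndex y)) - (x - gridPoint (gridIndex x))) := by ring
  have h3 := norm_sub_le (y - gridPoint (gridIndex y)) (x - gridPoint (gridIndex x))
  rw [e]
  constructor
  · have := norm_sub_le_norm_add (x - y) ((y - gridPoint (gridIndex y)) - (x - gridPoint (gridIndex x)))
    linarith [h.1]
  · have := norm_add_le (x - y) ((y - gridPoint (gridIndex y)) - (x - gridPoint (gridIndex x)))
    linarith [h.2]

/-- The grid squares of the two points are at distance comparable to one. -/
def gridSep (x y : ℂ) : Prop := gridIndex x - gridIndex y ∈ offsets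

theorem measurableSet_gridSep : MeasurableSet {z : ℂ × ℂ | gridSep z.1 z.2} := by
  have : Measurable fun z : ℂ × ℂ => gridIndex z.1 - gridIndex z.2 :=
    (measurable_gridIndex.comp measurable_fst).sub (measurable_gridIndex.comp measurable_snd)
  exact this (MeasurableSet.of_discrete (s := (offsets : Set (ℤ × ℤ))))

theorem norm_sub_le_of_gridSep {x y : ℂ} (h : gridSep x y) : ‖x - y‖ ≤ 3 := by
  have h1 := norm_sub_gridPoint_le x
  have h2 := norm_sub_gridPoint_le y
  have h3 := (mem_offsets.1 h).2
  rw [← gridPoint_sub] at h3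
  unfold tiny at h1 h2
  calc ‖x - y‖ = ‖(x - gridPoint (gridIndex x)) + (gridPoint (gridIndex x) - gridPoint (gridIndex y)) -
        (y - gridPoint (gridIndex y))‖ := by congr 1; ring
    _ ≤ _ := (norm_sub_le _ _).trans (add_le_add_left (norm_add_le _ _) _)
    _ ≤ 3 := by linarith

theorem mem_of_gridSep {x y : ℂ} (h : gridSep x y) : y ∈ Metric.closedBall x 3 := by
  rw [mem_closedBall_iff_norm, norm_sub_rev]
  exact norm_sub_le_of_gridSep h

/-- The truncated oscillatory kernel localized to distances comparable to one. -/
def gridKer (μ : ℝ) : ℂ → ℂ → ℂ := cut gridSep (cut trunc (osc μ))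

theorem gridKer_ne_zero {μ : ℝ} {x y : ℂ} (h : gridKer μ x y ≠ 0) : gridSep x y := by
  by_contra hc
  exact h (cut_of_neg hc)

theorem norm_gridKer_le (μ : ℝ) (x y : ℂ) : ‖gridKer μ x y‖ ≤ 1 :=
  (norm_cut_le _ _ _ _).trans ((norm_cut_le _ _ _ _).trans (norm_osc μ x y).le)

/-- For a fixed offset the kernel is block diagonal in the grid squares, so the uniform bound for
pairs serves all squares at once; the number of offsets is finite. -/
theorem KerBound.gridKer {q : ℝ≥0∞} (hq : 1 ≤ q) (hqt : q ≠ ⊤) {s : ℝ} {C : ℝ≥0}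
    (h : ∀ x₀ y₀ : ℂ, ‖x₀ - y₀‖ ∈ Icc (1 / 4 : ℝ) 2 → ∀ μ : ℝ,
      KerBound (cut trunc (cut (nearPair x₀ y₀) (osc μ))) q q
        (C * ENNReal.ofReal ((1 + |μ|) ^ (-s)))) (μ : ℝ) :
    KerBound (BochnerRiesz.gridKer μ) q q
      ((offsets.card * C : ℝ≥0) * ENNReal.ofReal ((1 + |μ|) ^ (-s))) := by
  set k := cut trunc (osc μ) with hk
  have hkm : Measurable (uncurry k) := measurable_cut measurableSet_trunc (continuous_osc μ).measurable
  have hd : ∀ d ∈ offsets, KerBound (cut (fun x y => gridIndex x - d = gridIndex y) k) q q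
      (C * ENNReal.ofReal ((1 + |μ|) ^ (-s))) := by
    intro d hd
    refine KerBound.blocks (α := fun x => gridIndex x - d) (measurable_gridIndex.sub_const d)
      measurable_gridIndex (lt_of_lt_of_le one_pos hq).ne' hqt fun n => ?_
    have hR : ‖gridPoint (n + d) - gridPoint n‖ ∈ Icc (1 / 4 : ℝ) 2 := by
      rw [gridPoint_sub, add_sub_cancel_left]
      exact mem_offsets.1 hd
    refine ((h _ _ hR μ).cut_prod (E := {x | gridIndex x - d = n}) (E' := {y | gridIndex y = n})
      (measurable_gridIndex (measurableSet_singleton n))).congr fun x =>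
      Filter.Eventually.of_forall fun y => ?_
    by_cases hxy : x ∈ {x | gridIndex x - d = n} ∧ y ∈ {y | gridIndex y = n}
    · have hx : gridIndex x = n + d := sub_eq_iff_eq_add.1 hxy.1
      have hy : gridIndex y = n := hxy.2
      have hn : nearPair (gridPoint (n + d)) (gridPoint n) x y := by
        constructor
        · rw [mem_closedBall_iff_norm, ← hx]; exact norm_sub_gridPoint_le x
        · rw [mem_closedBall_iff_norm, ← hy]; exact norm_sub_gridPoint_le y
      rw [cut_of_pos (P := fun x y => x ∈ {x | gridIndex x - d = n} ∧ y ∈ {y | gridIndex y = n}) hxy,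
        cut_of_pos (P := fun x y => gridIndex x - d = n ∧ gridIndex y = n) hxy, hk]
      simp only [cut, hn, if_true]
    · rw [cut_of_neg (P := fun x y => x ∈ {x | gridIndex x - d = n} ∧ y ∈ {y | gridIndex y = n}) hxy]
      exact (cut_of_neg (P := fun x y => gridIndex x - d = n ∧ gridIndex y = n) hxy).symm
  have hadm : ∀ d ∈ offsets, Adm (cut (fun x y => gridIndex x - d = gridIndex y) k) := by
    intro d hd
    have hsub : ∀ x y, gridIndex x - d = gridIndex y → gridSep x y := fun x y h => by
      unfold gridSep
      rwa [← h, sub_sub_cancel]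
    refine ⟨measurable_cut (P := fun x y => gridIndex x - d = gridIndex y) (measurableSet_eq_fun
      ((measurable_gridIndex.sub_const d).comp measurable_fst)
      (measurable_gridIndex.comp measurable_snd)) hkm, ⟨1, fun x y => ?_⟩, fun x => ?_⟩
    · exact (norm_cut_le _ _ _ _).trans ((norm_cut_le _ _ _ _).trans (norm_osc μ x y).le)
    · refine (measure_mono (t := Metric.closedBall x 3) fun y hy => ?_).trans_lt measure_closedBall_lt_top
      by_contra hc
      exact hy (cut_of_neg fun h => hc (mem_of_gridSep (hsub x y h)))
  have h2 := KerBound.sum offsets hadm hq hq hd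
  refine (h2.congr fun x => Filter.Eventually.of_forall fun y => ?_).mono ?_
  · have e1 : ∀ d, cut (fun x y => gridIndex x - d = gridIndex y) k x y =
        if d = gridIndex x - gridIndex y then k x y else 0 := by
      intro d
      by_cases h : gridIndex x - d = gridIndex y
      · rw [cut_of_pos (P := fun x y => gridIndex x - d = gridIndex y) h, if_pos]
        rw [← h, sub_sub_cancel]
      · rw [cut_of_neg (P := fun x y => gridIndex x - d = gridIndex y) h, if_neg]
        intro hd
        exact h (by rw [hd, sub_sub_cancel])
    simp only [e1, Finset.sum_ite_eq']
    by_cases h : gridSep x y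
    · rw [BochnerRiesz.gridKer, cut_of_pos h]
      exact if_pos h
    · rw [BochnerRiesz.gridKer, cut_of_neg h]
      exact if_neg h
  · rw [Finset.sum_const, nsmul_eq_mul]
    push_cast
    rw [mul_assoc]

end Cells

/-! ### Frequency decay at unit scale. -/

section Frequency

/-- Decay in the frequency of the truncated kernels, for `q > 4`. -/
theorem exists_kerBound_gridKer {q : ℝ≥0∞} (hq : 4 < q) (hqt : q ≠ ⊤) : ∃ C : ℝ≥0, ∀ μ : ℝ,
    KerBound (gridKer μ) q q (C * ENNReal.ofReal ((1 + |μ|) ^ (-(2 / q.toReal)))) := by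
  have hq1 : 1 ≤ q := le_trans (by norm_num) hq.le
  obtain ⟨C, hC⟩ := exists_kerBound_pair hq hqt
  obtain ⟨C', hC'⟩ := exists_kerBound_wrap hq hqt
  -- On a ball of area at most one the `L⁴` norm is at most the `L^q` norm, so the smoothing bound
  -- gives one from `L^q` to itself.
  have hpair : ∀ x₀ y₀ : ℂ, ‖x₀ - y₀‖ ∈ Icc (1 / 4 : ℝ) 2 → ∀ μ > 0,
      KerBound (cut (nearPair x₀ y₀) (osc μ)) q q
        ((C : ℝ≥0) * ENNReal.ofReal (μ ^ (-(2 / q.toReal)))) := by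
    intro x₀ y₀ hR μ hμ
    have h := (hC x₀ y₀ hR μ hμ).cut_prod_of_le (E := Metric.closedBall x₀ tiny)
      (E' := Metric.closedBall y₀ tiny) Metric.isClosed_closedBall.measurableSet
      measure_closedBall_lt_top.ne hq.le
    refine (h.congr fun x => Filter.Eventually.of_forall fun y => ?_).mono ?_
    · by_cases hn : nearPair x₀ y₀ x y
      · exact cut_of_pos (P := fun x y => x ∈ Metric.closedBall x₀ tiny ∧
          y ∈ Metric.closedBall y₀ tiny) hn
      · rw [cut_of_neg hn]
        exact cut_of_neg (P := fun x y => x ∈ Metric.closedBall x₀ tiny ∧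
          y ∈ Metric.closedBall y₀ tiny) hn
    · refine (mul_le_mul' ?_ (ENNReal.rpow_le_one (volume_closedBall_tiny_le y₀) ?_)).trans_eq
        (mul_one _)
      · exact le_rfl
      · have h4 : (4 : ℝ) ≤ q.toReal := by
          have := ENNReal.toReal_mono hqt hq.le
          simpa using this
        have : 1 / q.toReal ≤ 1 / (4 : ℝ) := one_div_le_one_div_of_le (by norm_num) h4
        simpa using this
  obtain ⟨D, hD⟩ := KerBound.trunc_pair_all hq1 (s := 2 / q.toReal) (by positivity)
    fun x₀ y₀ hR μ hμ => KerBound.trunc_pair hq1 hpair (fun x₀ y₀ hR μ hμ => hC' x₀ y₀ hR μ hμ) hR hμ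
  exact ⟨_, fun μ => KerBound.gridKer hq1 hqt hD μ⟩

theorem exists_kerBound_gridKer_two : ∃ C : ℝ≥0, ∀ μ : ℝ,
    KerBound (gridKer μ) 2 2 (C * ENNReal.ofReal ((1 + |μ|) ^ (-(1 / 2 : ℝ)))) := by
  obtain ⟨C', hC'⟩ := exists_kerBound_wrap_two
  have hpair : ∀ x₀ y₀ : ℂ, ‖x₀ - y₀‖ ∈ Icc (1 / 4 : ℝ) 2 → ∀ μ > 0,
      KerBound (cut (nearPair x₀ y₀) (osc μ)) 2 2
        ((80 : ℝ≥0) * ENNReal.ofReal (μ ^ (-(1 / 2 : ℝ)))) := by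
    intro x₀ y₀ hR μ hμ
    refine (kerBound_pair_two hR hμ).mono ?_
    have hs2 : √2 ≤ 2 := by rw [Real.sqrt_le_left (by norm_num)]; norm_num
    have e : ((80 : ℝ≥0) : ℝ≥0∞) = ENNReal.ofReal 80 := by simp
    rw [e, ← ENNReal.ofReal_mul (by norm_num), Real.rpow_neg hμ.le, ← Real.sqrt_eq_rpow,
      ← div_eq_mul_inv]
    refine ENNReal.ofReal_le_ofReal ?_
    rw [div_mul_eq_mul_div]
    gcongr
    linarith
  obtain ⟨D, hD⟩ := KerBound.trunc_pair_all one_le_two (s := 1 / 2) (by positivity)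
    fun x₀ y₀ hR μ hμ => KerBound.trunc_pair one_le_two hpair hC' hR hμ
  exact ⟨_, fun μ => KerBound.gridKer one_le_two ENNReal.ofNat_ne_top hD μ⟩

end Frequency

/-! ### Amplitudes as superpositions of exponentials. -/

section Amplitude

open scoped FourierTransform

/-- Twice differentiable functions supported in `[3/8, 4/3]`, with quantitative bounds. -/
structure Amplitude (A : ℝ) (b : ℝ → ℂ) : Prop where
  support : support b ⊆ Icc (3 / 8) (4 / 3)
  norm_le : ∀ r, ‖b r‖ ≤ A
  differentiable : Differentiable ℝ b
  differentiable_deriv : Differentiable ℝ (deriv b)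
  norm_deriv_deriv_le : ∀ r, ‖deriv (deriv b) r‖ ≤ A

theorem support_deriv_subset_Icc {b : ℝ → ℂ} (h : support b ⊆ Icc (3 / 8) (4 / 3)) :
    support (deriv b) ⊆ Icc (3 / 8) (4 / 3) :=
  support_deriv_subset.trans (closure_minimal h isClosed_Icc)

theorem integral_norm_le_of_support {f : ℝ → ℂ} {A : ℝ} (hA : ∀ r, ‖f r‖ ≤ A)
    (hs : support f ⊆ Icc (3 / 8) (4 / 3)) : ∫ r, ‖f r‖ ≤ A := by
  have hA0 : 0 ≤ A := (norm_nonneg _).trans (hA 0)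
  have h1 : ∫ r, ‖f r‖ = ∫ r in Icc (3 / 8 : ℝ) (4 / 3), ‖f r‖ := by
    rw [setIntegral_eq_integral_of_forall_compl_eq_zero]
    intro r hr
    rw [norm_eq_zero]
    by_contra hc
    exact hr (hs hc)
  rw [h1]
  refine (le_abs_self _).trans ?_
  rw [← Real.norm_eq_abs]
  refine (norm_setIntegral_le_of_norm_le_const (C := A) measure_Icc_lt_top fun r _ => ?_).trans ?_
  · rw [norm_norm]; exact hA r
  · rw [Real.volume_real_Icc_of_le (by norm_num)]
    nlinarith

theorem integrable_of_support {f : ℝ → ℂ} {A : ℝ} (hf : AEStronglyMeasurable f volume)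
    (hA : ∀ r, ‖f r‖ ≤ A) (hs : support f ⊆ Icc (3 / 8) (4 / 3)) : Integrable f := by
  rw [← integrableOn_iff_integrable_of_support_subset hs]
  exact Measure.integrableOn_of_bounded measure_Icc_lt_top.ne hf (Filter.Eventually.of_forall hA)

variable {A : ℝ} {b : ℝ → ℂ}

theorem Amplitude.continuous (hb : Amplitude A b) : Continuous b := hb.differentiable.continuous

theorem Amplitude.integrable (hb : Amplitude A b) : Integrable b :=
  integrable_of_support hb.continuous.aestronglyMeasurable hb.norm_le hb.support

/-- Two integrations by parts bound `(1 + u²) |𝓕 b|` by `2A` with `u = |2πτ|`, and `(1 + u)² ≤ 2 (1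
+ u²)`. -/
theorem Amplitude.norm_fourier_le (hb : Amplitude A b) (τ : ℝ) :
    ‖𝓕 b τ‖ ≤ 4 * A * (1 + |2 * Real.pi * τ|) ^ (-(2 : ℝ)) := by
  have hs1 := support_deriv_subset_Icc hb.support
  have hs2 := support_deriv_subset_Icc hs1
  have hi1 : Integrable (deriv b) :=
    hb.differentiable_deriv.continuous.integrable_of_hasCompactSupport
      (HasCompactSupport.of_support_subset_isCompact isCompact_Icc hs1)
  have hi2 : Integrable (deriv (deriv b)) :=
    integrable_of_support (measurable_deriv _).aestronglyMeasurable hb.norm_deriv_deriv_le hs2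
  have e1 := Real.fourier_deriv hb.integrable hb.differentiable hi1
  have e2 := Real.fourier_deriv hi1 hb.differentiable_deriv hi2
  have h0 : ‖𝓕 b τ‖ ≤ A :=
    (VectorFourier.norm_fourierIntegral_le_integral_norm _ _ _ _ _).trans
      (integral_norm_le_of_support hb.norm_le hb.support)
  have h2 : ‖𝓕 (deriv (deriv b)) τ‖ ≤ A :=
    (VectorFourier.norm_fourierIntegral_le_integral_norm _ _ _ _ _).trans
      (integral_norm_le_of_support hb.norm_deriv_deriv_le hs2)
  rw [e2, e1] at h2
  have hn : ‖(2 * Real.pi * Complex.I * τ : ℂ)‖ = |2 * Real.pi * τ| := by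
    simp [abs_mul]
  simp only [smul_eq_mul, norm_mul (2 * Real.pi * Complex.I * τ : ℂ), hn] at h2
  set u := |2 * Real.pi * τ| with hu
  have hu0 : 0 ≤ u := abs_nonneg _
  rw [Real.rpow_neg (by positivity), ← div_eq_mul_inv, le_div_iff₀ (by positivity), Real.rpow_two]
  nlinarith [sq_nonneg (1 - u), norm_nonneg (𝓕 b τ)]

theorem measurable_fourier (hb : Integrable b) : Measurable (𝓕 b) :=
  (VectorFourier.fourierIntegral_continuous Real.continuous_fourierChar
    (by exact continuous_inner) hb).measurable

/-- The truncated oscillatory kernel with amplitude. -/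
def ampKer (b : ℝ → ℂ) (μ : ℝ) (x y : ℂ) : ℂ := b ‖x - y‖ * cut trunc (osc μ) x y

/-- Peetre's inequality `1 + |μ| ≤ (1 + |μ + u|)(1 + |u|)` restores the decay at `μ`. It consumes `s
≤ 1/2` of the two available powers of `1 + |u|`, leaving the integrable power `3/2`. -/
theorem rpow_shift_le {s : ℝ} (hs : 0 ≤ s) (hs2 : s ≤ 1 / 2) (μ τ : ℝ) :
    (1 + |2 * Real.pi * τ|) ^ (-(2 : ℝ)) * (1 + |μ + 2 * Real.pi * τ|) ^ (-s) ≤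
      (1 + |μ|) ^ (-s) * (1 + ‖τ‖) ^ (-(3 / 2 : ℝ)) := by
  set u := 2 * Real.pi * τ with hu
  have hτ : ‖τ‖ ≤ |u| := by
    have hπ := Real.pi_gt_three
    rw [hu, abs_mul, Real.norm_eq_abs, abs_of_pos (by linarith : 0 < 2 * Real.pi)]
    nlinarith [abs_nonneg τ]
  have h1 : 1 + |μ| ≤ (1 + |μ + u|) * (1 + |u|) := by
    have := abs_sub (μ + u) u
    rw [add_sub_cancel_right] at this
    nlinarith [abs_nonneg (μ + u), abs_nonneg u]
  have h2 : (1 + |μ + u|) ^ (-s) * (1 + |u|) ^ (-s) ≤ (1 + |μ|) ^ (-s) := by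
    rw [← Real.mul_rpow (by positivity) (by positivity)]
    exact Real.rpow_le_rpow_of_nonpos (by positivity) h1 (by linarith)
  have e : (1 + |u|) ^ (-(2 : ℝ)) = (1 + |u|) ^ (-s) * (1 + |u|) ^ (s - 2) := by
    rw [← Real.rpow_add (by positivity)]; ring_nf
  have h3 : (1 + |u|) ^ (s - 2) ≤ (1 + ‖τ‖) ^ (-(3 / 2 : ℝ)) :=
    (Real.rpow_le_rpow_of_exponent_le (by linarith [abs_nonneg u]) (by linarith)).trans
      (Real.rpow_le_rpow_of_nonpos (by positivity) (by linarith) (by norm_num))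
  rw [e]
  calc _ = (1 + |μ + u|) ^ (-s) * (1 + |u|) ^ (-s) * (1 + |u|) ^ (s - 2) := by ring
    _ ≤ _ := by gcongr

theorem Amplitude.integrable_fourier (hb : Amplitude A b) : Integrable (𝓕 b) := by
  have hi : Integrable fun τ : ℝ => (1 + ‖τ‖) ^ (-(3 / 2 : ℝ)) :=
    integrable_one_add_norm (by simp; norm_num)
  refine (hi.const_mul (4 * A)).mono' (measurable_fourier hb.integrable).aestronglyMeasurable
    (Filter.Eventually.of_forall fun τ => ?_)
  have h := rpow_shift_le (le_refl 0) (by norm_num) 0 τ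
  simp only [neg_zero, Real.rpow_zero, mul_one, one_mul] at h
  have hA0 : 0 ≤ A := (norm_nonneg _).trans (hb.norm_le 0)
  exact (hb.norm_fourier_le τ).trans (mul_le_mul_of_nonneg_left h (by positivity))

/-- By Fourier inversion `b(|x - y|)` is a superposition of exponentials in `|x - y|`, each of which
only shifts the frequency. The grid restriction holds automatically on the support of the amplitude.
-/
theorem Amplitude.ampKer_eq (hb : Amplitude A b) (μ : ℝ) (x y : ℂ) :
    ampKer b μ x y = ∫ τ, 𝓕 b τ * gridKer (μ + 2 * Real.pi * τ) x y := by
  unfold ampKer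
  by_cases hg : gridSep x y
  · by_cases ht : trunc x y
    · have e := congrFun (hb.continuous.fourierInv_fourier_eq hb.integrable hb.integrable_fourier)
        ‖x - y‖
      rw [Real.fourierInv_eq'] at e
      rw [← e, cut_of_pos ht, ← integral_mul_const]
      refine integral_congr_ae (Filter.Eventually.of_forall fun τ => ?_)
      simp only [gridKer, cut_of_pos hg, cut_of_pos ht, osc, smul_eq_mul]
      rw [mul_comm (Complex.exp _) (𝓕 b τ), mul_assoc, ← Complex.exp_add]
      congr 2
      simp
      ring
    · simp [gridKer, cut_of_neg ht, cut_of_pos hg]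
  · have : b ‖x - y‖ = 0 := by
      by_contra hc
      exact hg (mem_offsets_of_norm (hb.support hc))
    simp [gridKer, cut_of_neg hg, this]

theorem measurable_gridKer_shift (μ : ℝ) :
    Measurable fun z : ℝ × ℂ × ℂ => gridKer (μ + 2 * Real.pi * z.1) z.2.1 z.2.2 := by
  unfold gridKer cut osc
  refine Measurable.ite (measurable_snd measurableSet_gridSep)
    (Measurable.ite (measurable_snd measurableSet_trunc) ?_ measurable_const) measurable_const
  exact Continuous.measurable (by fun_prop)

/-- Amplitudes preserve the decay in the frequency. -/
theorem exists_kerBound_ampKer {q : ℝ≥0∞} (hq : 1 ≤ q) (hqt : q ≠ ⊤) {s : ℝ} (hs : 0 ≤ s)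
    (hs2 : s ≤ 1 / 2) {C : ℝ≥0}
    (h : ∀ μ : ℝ, KerBound (gridKer μ) q q (C * ENNReal.ofReal ((1 + |μ|) ^ (-s)))) (A : ℝ) :
    ∃ C' : ℝ≥0, ∀ b, Amplitude A b → ∀ μ : ℝ,
      KerBound (ampKer b μ) q q (C' * ENNReal.ofReal ((1 + |μ|) ^ (-s))) := by
  have hi : Integrable fun τ : ℝ => (1 + ‖τ‖) ^ (-(3 / 2 : ℝ)) :=
    integrable_one_add_norm (by simp; norm_num)
  set G := ∫⁻ τ : ℝ, ENNReal.ofReal ((1 + ‖τ‖) ^ (-(3 / 2 : ℝ))) with hG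
  have hGt : G ≠ ⊤ := hi.lintegral_lt_top.ne
  refine ⟨(4 * A).toNNReal * C * G.toNNReal, fun b hb μ => ?_⟩
  have hA0 : 0 ≤ A := (norm_nonneg _).trans (hb.norm_le 0)
  have hk := KerBound.superpose (ν := volume) (κ := fun τ => gridKer (μ + 2 * Real.pi * τ))
    (measurable_gridKer_shift μ) (fun τ x y => norm_gridKer_le _ x y)
    (S := fun x => Metric.closedBall x 3) (fun x => measure_closedBall_lt_top)
    (fun τ x y hne => mem_of_gridSep (gridKer_ne_zero hne)) (measurable_fourier hb.integrable)
    hb.integrable_fourier hq hq hqt (fun τ => h _)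
  refine (hk.congr fun x => Filter.Eventually.of_forall fun y => (hb.ampKer_eq μ x y).symm).mono ?_
  calc ∫⁻ τ, ‖𝓕 b τ‖ₑ * (C * ENNReal.ofReal ((1 + |μ + 2 * Real.pi * τ|) ^ (-s)))
      ≤ ∫⁻ τ : ℝ, ENNReal.ofReal (4 * A) * C * ENNReal.ofReal ((1 + |μ|) ^ (-s)) *
          ENNReal.ofReal ((1 + ‖τ‖) ^ (-(3 / 2 : ℝ))) := by
        refine lintegral_mono fun τ => ?_
        have e1 : ‖𝓕 b τ‖ₑ ≤ ENNReal.ofReal (4 * A) *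
            ENNReal.ofReal ((1 + |2 * Real.pi * τ|) ^ (-(2 : ℝ))) := by
          rw [← ofReal_norm, ← ENNReal.ofReal_mul (by positivity)]
          exact ENNReal.ofReal_le_ofReal (hb.norm_fourier_le τ)
        calc _ ≤ ENNReal.ofReal (4 * A) * ENNReal.ofReal ((1 + |2 * Real.pi * τ|) ^ (-(2 : ℝ))) *
              (C * ENNReal.ofReal ((1 + |μ + 2 * Real.pi * τ|) ^ (-s))) := mul_le_mul' e1 le_rfl
          _ = ENNReal.ofReal (4 * A) * C * ENNReal.ofReal
              ((1 + |2 * Real.pi * τ|) ^ (-(2 : ℝ)) * (1 + |μ + 2 * Real.pi * τ|) ^ (-s)) := by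
              rw [ENNReal.ofReal_mul (p := (1 + |2 * Real.pi * τ|) ^ (-(2 : ℝ))) (by positivity)]
              ring
          _ ≤ ENNReal.ofReal (4 * A) * C * ENNReal.ofReal
              ((1 + |μ|) ^ (-s) * (1 + ‖τ‖) ^ (-(3 / 2 : ℝ))) := by
              exact mul_le_mul' le_rfl (ENNReal.ofReal_le_ofReal (rpow_shift_le hs hs2 μ τ))
          _ = _ := by
              rw [ENNReal.ofReal_mul (p := (1 + |μ|) ^ (-s)) (by positivity)]
              ring
    _ = _ := by
        rw [lintegral_const_mul' _ _ (by finiteness), ← hG]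
        push_cast
        rw [ENNReal.coe_toNNReal hGt]
        change ENNReal.ofReal (4 * A) * C * _ * G = ENNReal.ofReal (4 * A) * C * G * _
        ring

end Amplitude

/-! ### Uniform amplitude bounds after rescaling. -/

section RescaledAmplitude

/-- `v` is differentiable on the positive half-line only; elsewhere `u` vanishes in a neighbourhood.
-/
theorem hasDerivAt_mul_of_support {u u' v v' : ℝ → ℂ} (hs : support u ⊆ Icc (3 / 8) (4 / 3))
    (hu : ∀ r, HasDerivAt u (u' r) r) (hv : ∀ r, 0 < r → HasDerivAt v (v' r) r) (r : ℝ) :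
    HasDerivAt (fun r => u r * v r) (u' r * v r + u r * v' r) r := by
  rcases lt_or_ge 0 r with hr | hr
  · exact (hu r).mul (hv r hr)
  · have h0 : u =ᶠ[nhds r] fun _ => 0 := by
      filter_upwards [Iio_mem_nhds (show r < 3 / 8 by linarith)] with z hz
      by_contra hc
      exact absurd (hs hc).1 (not_le.2 hz)
    have h1 : u' r = 0 := (hu r).unique ((hasDerivAt_const r (0 : ℂ)).congr_of_eventuallyEq h0)
    rw [h1, h0.eq_of_nhds, zero_mul, zero_mul, add_zero]
    refine (hasDerivAt_const r (0 : ℂ)).congr_of_eventuallyEq ?_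
    filter_upwards [h0] with z hz
    rw [hz, zero_mul]

theorem exists_norm_le_of_support {f : ℝ → ℂ} (hf : Continuous f)
    (hs : support f ⊆ Icc (3 / 8) (4 / 3)) : ∃ D : ℝ, ∀ r, ‖f r‖ ≤ D :=
  hf.bounded_above_of_compact_support
    (HasCompactSupport.of_support_subset_isCompact isCompact_Icc hs)

/-- Products of a cutoff with a twice differentiable function are amplitudes. -/
theorem exists_amplitude_mul {β : ℝ → ℝ} (hβ : ContDiff ℝ ∞ β)
    (hs : support β ⊆ Icc (3 / 8) (4 / 3)) : ∃ D : ℝ, 0 ≤ D ∧ ∀ (M : ℝ) (h h' h'' : ℝ → ℂ),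
      (∀ r, 0 < r → HasDerivAt h (h' r) r) → (∀ r, 0 < r → HasDerivAt h' (h'' r) r) →
      (∀ r ∈ Icc (3 / 8 : ℝ) (4 / 3), ‖h r‖ ≤ M ∧ ‖h' r‖ ≤ M ∧ ‖h'' r‖ ≤ M) →
      Amplitude (4 * D * M) (fun r => (β r : ℂ) * h r) := by
  set B : ℝ → ℂ := fun r => (β r : ℂ) with hB
  have hBc : ContDiff ℝ ∞ B := Complex.ofRealCLM.contDiff.comp hβ
  have hBs : support B ⊆ Icc (3 / 8) (4 / 3) := fun r hr => hs fun h0 => hr (by simp [hB, h0])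
  have hBs1 := support_deriv_subset_Icc hBs
  have hBs2 := support_deriv_subset_Icc hBs1
  have hc1 : ContDiff ℝ ∞ (deriv B) := (contDiff_infty_iff_deriv.1 hBc).2
  have hc2 : ContDiff ℝ ∞ (deriv (deriv B)) := (contDiff_infty_iff_deriv.1 hc1).2
  obtain ⟨D0, hD0⟩ := exists_norm_le_of_support hBc.continuous hBs
  obtain ⟨D1, hD1⟩ := exists_norm_le_of_support hc1.continuous hBs1
  obtain ⟨D2, hD2⟩ := exists_norm_le_of_support hc2.continuous hBs2
  have p0 := (norm_nonneg _).trans (hD0 0)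
  have p1 := (norm_nonneg _).trans (hD1 0)
  have p2 := (norm_nonneg _).trans (hD2 0)
  refine ⟨D0 + D1 + D2, by positivity, fun M h h' h'' hh hh' hM => ?_⟩
  set D := D0 + D1 + D2 with hD
  have d0 : ∀ r, ‖B r‖ ≤ D := fun r => (hD0 r).trans (by linarith)
  have d1 : ∀ r, ‖deriv B r‖ ≤ D := fun r => (hD1 r).trans (by linarith)
  have d2 : ∀ r, ‖deriv (deriv B) r‖ ≤ D := fun r => (hD2 r).trans (by linarith)
  have hM0 : 0 ≤ M := (norm_nonneg _).trans (hM 1 ⟨by norm_num, by norm_num⟩).1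
  have hDp : 0 ≤ D := (norm_nonneg _).trans (d0 0)
  have prod : ∀ (u v : ℝ → ℂ), support u ⊆ Icc (3 / 8) (4 / 3) → (∀ r, ‖u r‖ ≤ D) →
      (∀ r ∈ Icc (3 / 8 : ℝ) (4 / 3), ‖v r‖ ≤ M) → ∀ r, ‖u r * v r‖ ≤ D * M := by
    intro u v hus hu hv r
    by_cases hr : u r = 0
    · rw [hr, zero_mul, norm_zero]; positivity
    · rw [norm_mul]
      exact mul_le_mul (hu r) (hv r (hus hr)) (norm_nonneg _) hDp
  have hB1 : ∀ r, HasDerivAt B (deriv B r) r := fun r =>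
    (hBc.differentiable (by simp) r).hasDerivAt
  have hB2 : ∀ r, HasDerivAt (deriv B) (deriv (deriv B) r) r := fun r =>
    (hc1.differentiable (by simp) r).hasDerivAt
  have e1 := hasDerivAt_mul_of_support hBs hB1 hh
  have e2 : ∀ r, HasDerivAt (fun r => deriv B r * h r + B r * h' r)
      (deriv (deriv B) r * h r + deriv B r * h' r + (deriv B r * h' r + B r * h'' r)) r := fun r =>
    (hasDerivAt_mul_of_support hBs1 hB2 hh r).add (hasDerivAt_mul_of_support hBs hB1 hh' r)
  have f1 : deriv (fun r => B r * h r) = fun r => deriv B r * h r + B r * h' r :=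
    funext fun r => (e1 r).deriv
  have hDM : 0 ≤ D * M := by positivity
  refine ⟨fun r hr => hBs (left_ne_zero_of_mul hr), fun r => ?_, fun r => (e1 r).differentiableAt, ?_,
    fun r => ?_⟩
  · have := prod B h hBs d0 (fun r hr => (hM r hr).1) r
    linarith
  · rw [f1]
    exact fun r => (e2 r).differentiableAt
  · rw [f1, (e2 r).deriv]
    have b1 := prod _ h hBs2 d2 (fun r hr => (hM r hr).1) r
    have b2 := prod _ h' hBs1 d1 (fun r hr => (hM r hr).2.1) r
    have b3 := prod B h'' hBs d0 (fun r hr => (hM r hr).2.2) r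
    refine (norm_add_le _ _).trans ?_
    have := norm_add_le (deriv (deriv B) r * h r) (deriv B r * h' r)
    have := norm_add_le (deriv B r * h' r) (B r * h'' r)
    linarith

theorem hasDerivAt_ofReal_rpow (c t : ℝ) {r : ℝ} (hr : 0 < c + r) :
    HasDerivAt (fun r : ℝ => (((c + r) ^ t : ℝ) : ℂ)) ((t * (c + r) ^ (t - 1) : ℝ) : ℂ) r := by
  have h := ((hasDerivAt_id r).const_add c).rpow_const (p := t) (Or.inl hr.ne')
  simpa only [id, one_mul] using h.ofReal_comp

theorem IsSymbol.hasDerivAt {a : ℝ → ℂ} (ha : IsSymbol a) {r : ℝ} (hr : 0 < r) :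
    HasDerivAt a (deriv a r) r :=
  ((ha.1.differentiableOn (by simp) r hr).differentiableAt (Ioi_mem_nhds hr)).hasDerivAt

theorem IsSymbol.hasDerivAt_deriv {a : ℝ → ℂ} (ha : IsSymbol a) {r : ℝ} (hr : 0 < r) :
    HasDerivAt (deriv a) (deriv (deriv a) r) r := by
  have h := ((contDiffOn_infty_iff_deriv_of_isOpen isOpen_Ioi).1 ha.1).2
  exact ((h.differentiableOn (by simp) r hr).differentiableAt (Ioi_mem_nhds hr)).hasDerivAt

theorem IsSymbol.exists_norm_deriv_le {a : ℝ → ℂ} (ha : IsSymbol a) : ∃ C : ℝ, 0 ≤ C ∧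
    ∀ r, 0 < r → ‖a r‖ ≤ C ∧ ‖deriv a r‖ ≤ C / r ∧ ‖deriv (deriv a) r‖ ≤ C / r ^ 2 := by
  obtain ⟨C0, h0⟩ := ha.2 0
  obtain ⟨C1, h1⟩ := ha.2 1
  obtain ⟨C2, h2⟩ := ha.2 2
  simp only [iteratedDeriv_succ, iteratedDeriv_zero, pow_zero, div_one, pow_one] at h0 h1 h2
  have p0 := (norm_nonneg _).trans (h0 1 one_pos)
  have p1 := (norm_nonneg _).trans (h1 1 one_pos)
  have p2 := (norm_nonneg _).trans (h2 1 one_pos)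
  simp only [div_one, one_pow] at p1 p2
  refine ⟨C0 + C1 + C2, by positivity, fun r hr => ⟨(h0 r hr).trans (by linarith),
    (h1 r hr).trans ?_, (h2 r hr).trans ?_⟩⟩ <;> gcongr <;> linarith

/-- The amplitude of the piece at scale `l`, after rescaling to unit scale. -/
def scaledAmp (a : ℝ → ℂ) (β : ℝ → ℝ) (t l r : ℝ) : ℂ :=
  β r * (a (l * r) * ((l⁻¹ + r) ^ t : ℝ))

/-- Symbol estimates are invariant under dilation: the `N`-th derivative of `a(l r)` is `O(r^(-N))`
uniformly in `l`. On the support `r ≥ 3/8`, so these derivatives and those of `(l⁻¹ + r)^t` are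
bounded independently of the scale. -/
theorem exists_amplitude_scaledAmp {a : ℝ → ℂ} (ha : IsSymbol a) {β : ℝ → ℝ} (hβ : ContDiff ℝ ∞ β)
    (hs : support β ⊆ Icc (3 / 8) (4 / 3)) {t : ℝ} (ht : t ≤ 0) :
    ∃ A : ℝ, ∀ l : ℝ, 1 ≤ l → Amplitude A (scaledAmp a β t l) := by
  obtain ⟨D, hD, hprod⟩ := exists_amplitude_mul hβ hs
  obtain ⟨C, hC, haC⟩ := ha.exists_norm_deriv_le
  have hw : ∀ c : ℝ, 0 ≤ c → ∀ r ∈ Icc (3 / 8 : ℝ) (4 / 3), ∀ u ≤ (0 : ℝ),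
      (c + r) ^ u ≤ (3 / 8 : ℝ) ^ u := fun c hc r hr u hu =>
    Real.rpow_le_rpow_of_nonpos (by norm_num) (by linarith [hr.1]) hu
  set W := (3 / 8 : ℝ) ^ t + |t| * (3 / 8 : ℝ) ^ (t - 1) + |t * (t - 1)| * (3 / 8 : ℝ) ^ (t - 1 - 1)
    with hW
  have q0 : 0 ≤ (3 / 8 : ℝ) ^ t := by positivity
  have q1 : 0 ≤ |t| * (3 / 8 : ℝ) ^ (t - 1) := by positivity
  have q2 : 0 ≤ |t * (t - 1)| * (3 / 8 : ℝ) ^ (t - 1 - 1) := by positivity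
  have hW0 : 0 ≤ W := by positivity
  -- The 9 bounds `r⁻¹` and `r⁻²` for `r ≥ 3/8`; the inner 4 counts the terms in the second
  -- derivative of a product.
  refine ⟨4 * D * (4 * (9 * C * W)), fun l hl => ?_⟩
  have hl0 : 0 < l := by linarith
  have hli : 0 < l⁻¹ := by positivity
  have hmul : ∀ r : ℝ, HasDerivAt (fun r : ℝ => l * r) l r := fun r => by
    simpa using (hasDerivAt_id r).const_mul l
  have a1 : ∀ r, 0 < r → HasDerivAt (fun r : ℝ => a (l * r)) (l * deriv a (l * r)) r := by
    intro r hr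
    have := (ha.hasDerivAt (mul_pos hl0 hr)).scomp r (hmul r)
    simpa [Function.comp_def] using this
  have a2 : ∀ r, 0 < r → HasDerivAt (fun r : ℝ => (l : ℂ) * deriv a (l * r))
      (l * (l * deriv (deriv a) (l * r))) r := by
    intro r hr
    have := ((ha.hasDerivAt_deriv (mul_pos hl0 hr)).scomp r (hmul r)).const_mul (l : ℂ)
    simpa [Function.comp_def] using this
  have w1 : ∀ r, 0 < r → HasDerivAt (fun r : ℝ => (((l⁻¹ + r) ^ t : ℝ) : ℂ))
      ((t * (l⁻¹ + r) ^ (t - 1) : ℝ) : ℂ) r := fun r hr =>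
    hasDerivAt_ofReal_rpow _ _ (by positivity)
  have w2 : ∀ r, 0 < r → HasDerivAt (fun r : ℝ => ((t * (l⁻¹ + r) ^ (t - 1) : ℝ) : ℂ))
      ((t * (t - 1) * (l⁻¹ + r) ^ (t - 1 - 1) : ℝ) : ℂ) r := by
    intro r hr
    have := (hasDerivAt_ofReal_rpow l⁻¹ (t - 1) (r := r) (by positivity)).const_mul (t : ℂ)
    push_cast at this ⊢
    rw [mul_assoc]
    exact this
  refine hprod (4 * (9 * C * W)) _ _ _ (fun r hr => (a1 r hr).mul (w1 r hr))
    (fun r hr => ((a2 r hr).mul (w1 r hr)).add ((a1 r hr).mul (w2 r hr))) fun r hr => ?_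
  have hr0 : 0 < r := by linarith [hr.1]
  obtain ⟨b0, b1, b2⟩ := haC (l * r) (mul_pos hl0 hr0)
  have n0 : ‖a (l * r)‖ ≤ 9 * C := by linarith
  have n1 : ‖(l : ℂ) * deriv a (l * r)‖ ≤ 9 * C := by
    rw [norm_mul, Complex.norm_real, Real.norm_of_nonneg hl0.le]
    calc l * ‖deriv a (l * r)‖ ≤ l * (C / (l * r)) := by gcongr
      _ = C / r := by field_simp
      _ ≤ 9 * C := by rw [div_le_iff₀ hr0]; nlinarith [hr.1]
  have n2 : ‖(l : ℂ) * (l * deriv (deriv a) (l * r))‖ ≤ 9 * C := by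
    rw [norm_mul, norm_mul, Complex.norm_real, Real.norm_of_nonneg hl0.le]
    calc l * (l * ‖deriv (deriv a) (l * r)‖) ≤ l * (l * (C / (l * r) ^ 2)) := by gcongr
      _ = C / r ^ 2 := by field_simp
      _ ≤ 9 * C := by
          rw [div_le_iff₀ (by positivity)]
          have : 1 ≤ 9 * r ^ 2 := by nlinarith [hr.1]
          nlinarith
  have m0 : ‖(((l⁻¹ + r) ^ t : ℝ) : ℂ)‖ ≤ W := by
    rw [Complex.norm_real, Real.norm_of_nonneg (by positivity)]
    have := hw l⁻¹ hli.le r hr t ht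
    linarith
  have m1 : ‖((t * (l⁻¹ + r) ^ (t - 1) : ℝ) : ℂ)‖ ≤ W := by
    rw [Complex.norm_real, norm_mul, Real.norm_eq_abs, Real.norm_of_nonneg (by positivity)]
    have := mul_le_mul_of_nonneg_left (hw l⁻¹ hli.le r hr (t - 1) (by linarith)) (abs_nonneg t)
    linarith
  have m2 : ‖((t * (t - 1) * (l⁻¹ + r) ^ (t - 1 - 1) : ℝ) : ℂ)‖ ≤ W := by
    rw [Complex.norm_real, norm_mul, Real.norm_eq_abs, Real.norm_of_nonneg (by positivity)]
    have := mul_le_mul_of_nonneg_left (hw l⁻¹ hli.le r hr (t - 1 - 1) (by linarith))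
      (abs_nonneg (t * (t - 1)))
    linarith
  have key : ∀ z w : ℂ, ‖z‖ ≤ 9 * C → ‖w‖ ≤ W → ‖z * w‖ ≤ 9 * C * W := fun z w hz hw' => by
    rw [norm_mul]
    exact mul_le_mul hz hw' (norm_nonneg _) (by positivity)
  have hp : 0 ≤ 9 * C * W := by positivity
  refine ⟨(key _ _ n0 m0).trans (by linarith), ?_, ?_⟩
  · refine (norm_add_le _ _).trans ?_
    linarith [key _ _ n1 m0, key _ _ n0 m1]
  · refine (norm_add_le _ _).trans ?_
    have s1 := norm_add_le ((l : ℂ) * (l * deriv (deriv a) (l * r)) * (((l⁻¹ + r) ^ t : ℝ) : ℂ))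
      ((l : ℂ) * deriv a (l * r) * ((t * (l⁻¹ + r) ^ (t - 1) : ℝ) : ℂ))
    have s2 := norm_add_le ((l : ℂ) * deriv a (l * r) * ((t * (l⁻¹ + r) ^ (t - 1) : ℝ) : ℂ))
      (a (l * r) * ((t * (t - 1) * (l⁻¹ + r) ^ (t - 1 - 1) : ℝ) : ℂ))
    linarith [key _ _ n2 m0, key _ _ n1 m1, key _ _ n0 m2]

end RescaledAmplitude

/-! ### Scaling of operator norms. -/

section Dilation

variable {l : ℝ} {q : ℝ≥0∞}

theorem eLpNorm_comp_inv_smul (hl : 0 < l) (g : Plane → ℂ) :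
    eLpNorm (fun x => g (l⁻¹ • x)) q volume =
      ENNReal.ofReal (l ^ 2) ^ (1 / q).toReal * eLpNorm g q volume := by
  have he : MeasurableEmbedding fun x : Plane => l⁻¹ • x :=
    (Homeomorph.smulOfNeZero l⁻¹ (inv_ne_zero hl.ne')).measurableEmbedding
  have h := he.eLpNorm_map_measure (μ := volume) (g := g) (p := q)
  rw [Measure.map_addHaar_smul volume (inv_ne_zero hl.ne'), finrank_euclideanSpace_fin,
    inv_pow, inv_inv, abs_of_nonneg (by positivity)] at h
  rw [← smul_eq_mul, ← eLpNorm_smul_measure_of_ne_zero, h]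
  · rfl
  · simpa using hl.ne'

theorem memLp_comp_smul (hl : 0 < l) {f : Plane → ℂ} (hf : MemLp f q volume) :
    MemLp (fun x => f (l • x)) q volume := by
  have he : Measurable fun x : Plane => l • x := measurable_const_smul l
  refine MemLp.comp_of_map ?_ he.aemeasurable
  rw [Measure.map_addHaar_smul volume hl.ne']
  exact hf.smul_measure ENNReal.ofReal_ne_top

/-- Dilating a kernel on the plane. -/
theorem KerBound.dilate {k : Plane → Plane → ℂ} {B : ℝ≥0∞} (h : KerBound k q q B) (hl : 0 < l) :
    KerBound (fun x y => k (l⁻¹ • x) (l⁻¹ • y)) q q (ENNReal.ofReal (l ^ 2) * B) := by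
  intro f hf
  -- Substitution in the integral produces the Jacobian `l²`; the scaling factors of the input and
  -- output norms will cancel.
  have e1 : kop (fun x y => k (l⁻¹ • x) (l⁻¹ • y)) f =
      (l ^ 2 : ℝ) • fun x => kop k (fun y => f (l • y)) (l⁻¹ • x) := by
    ext x
    have h := Measure.integral_comp_inv_smul volume (fun y : Plane => k (l⁻¹ • x) y * f (l • y)) l
    rw [finrank_euclideanSpace_fin, abs_of_nonneg (by positivity)] at h
    simp only [kop, Pi.smul_apply]
    rw [← h]
    refine integral_congr_ae (Filter.Eventually.of_forall fun y => ?_)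
    simp only [smul_inv_smul₀ hl.ne']
  have e2 := eLpNorm_comp_inv_smul (q := q) hl fun y => f (l • y)
  simp only [smul_inv_smul₀ hl.ne'] at e2
  rw [e1, eLpNorm_const_smul, eLpNorm_comp_inv_smul hl, e2]
  have h2 : ‖(l ^ 2 : ℝ)‖ₑ = ENNReal.ofReal (l ^ 2) := by
    rw [Real.enorm_eq_ofReal (by positivity)]
  rw [h2]
  calc _ ≤ ENNReal.ofReal (l ^ 2) * (ENNReal.ofReal (l ^ 2) ^ (1 / q).toReal *
        (B * eLpNorm (fun y => f (l • y)) q volume)) := by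
        gcongr
        exact h _ (memLp_comp_smul hl hf)
    _ = _ := by ring

end Dilation

/-! ### Bounds for the pieces of the geometric kernel. -/

section Plane

/-- The identification of the plane with `ℂ`. -/
def toComplex : Plane ≃ₗᵢ[ℝ] ℂ := Complex.orthonormalBasisOneI.repr.symm

theorem toComplex_apply (x : Plane) : toComplex x = ⟨x 0, x 1⟩ := by
  rw [toComplex, ← OrthonormalBasis.sum_repr_symm]
  apply Complex.ext <;> simp [Fin.sum_univ_two]

theorem polarAngle_eq_angle (x : Plane) : polarAngle x = angle (toComplex x) := by
  rw [toComplex_apply]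
  rfl

theorem angle_smul {l : ℝ} (hl : 0 < l) (z : ℂ) : angle (l • z) = angle z := by
  rw [angle, Complex.real_smul, Complex.arg_real_mul _ hl, angle]

theorem norm_smul_sub_smul {l : ℝ} (hl : 0 < l) (x y : Plane) :
    ‖toComplex (l • x) - toComplex (l • y)‖ = l * ‖x - y‖ := by
  rw [← map_sub, LinearIsometryEquiv.norm_map, ← smul_sub, norm_smul, Real.norm_of_nonneg hl.le]

theorem trunc_smul {l : ℝ} (hl : 0 < l) (x y : Plane) :
    trunc (toComplex (l • x)) (toComplex (l • y)) ↔
      |polarAngle x - polarAngle y| ∈ Icc 0 Real.pi := by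
  rw [trunc, map_smul, map_smul, angle_smul hl, angle_smul hl, polarAngle_eq_angle,
    polarAngle_eq_angle]
  exact ⟨fun h => ⟨abs_nonneg _, h⟩, fun h => h.2⟩

variable {a : ℝ → ℂ} {β : ℝ → ℝ} {σ δ : ℝ}

/-- The pieces of the geometric kernel are dilates of truncated oscillatory kernels. -/
theorem geometricPiece_eq (σ δ : ℝ) (a : ℝ → ℂ) (β : ℝ → ℝ) {j : ℕ} (hj : j ≠ 0) (x y : Plane) :
    geometricPiece σ δ a β j x y = ((((2 : ℝ) ^ j) ^ (-(3 / 2) - δ) : ℝ) : ℂ) *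
      ampKer (scaledAmp a β (-(3 / 2) - δ) (2 ^ j)) (σ * 2 ^ j)
        (toComplex (((2 : ℝ) ^ j)⁻¹ • x)) (toComplex (((2 : ℝ) ^ j)⁻¹ • y)) := by
  set l : ℝ := 2 ^ j with hl
  have hl0 : 0 < l := by positivity
  have hli : 0 < l⁻¹ := by positivity
  set r := ‖x - y‖ with hr
  have hr0 : 0 ≤ r := norm_nonneg _
  have ha : l * (l⁻¹ * r) = r := by field_simp
  -- Extracting the scale from the weight leaves `l⁻¹ + r/l`, which is bounded below on the support
  -- of the rescaled cutoff.
  have hw : l ^ (-(3 / 2) - δ) * (l⁻¹ + l⁻¹ * r) ^ (-(3 / 2) - δ) = (1 + r) ^ (-(3 / 2) - δ) := by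
    rw [← Real.mul_rpow hl0.le (by positivity)]
    congr 1
    field_simp
  unfold geometricPiece geometricKernel dyadicCutoff ampKer scaledAmp
  rw [if_neg hj, norm_smul_sub_smul hli, ha, ← hl, ← hr, ← hw, div_eq_inv_mul]
  by_cases ht : |polarAngle x - polarAngle y| ∈ Icc 0 Real.pi
  · rw [indicator_of_mem ht, cut_of_pos ((trunc_smul hli x y).2 ht), osc, norm_smul_sub_smul hli,
      mul_assoc σ, ← hr, ha]
    push_cast
    rw [show (Complex.I * (σ * r) : ℂ) = σ * Complex.I * r by ring]
    ring
  · rw [indicator_of_notMem ht, cut_of_neg fun h => ht ((trunc_smul hli x y).1 h)]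
    simp

theorem IsDyadicPartition.exists_abs_le (hβ : IsDyadicPartition β) :
    ∃ D : ℝ, 0 ≤ D ∧ ∀ r, |β r| ≤ D := by
  obtain ⟨D, hD⟩ := hβ.smooth.continuous.bounded_above_of_compact_support
    (HasCompactSupport.of_support_subset_isCompact isCompact_Icc hβ.support_subset)
  exact ⟨D, (norm_nonneg _).trans (hD 0), hD⟩

theorem IsDyadicPartition.betaZero_eq (hβ : IsDyadicPartition β) (r : ℝ) :
    betaZero β r = if r ≤ 1 then 1 - β (r / 2) else 0 := by
  split_ifs with h
  -- For `r ≤ 1` only the first term can be nonzero: the argument of every later one is at most `1/4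
  -- < 3/8`.
  · rw [betaZero, tsum_eq_single 0]
    · simp
    · intro j hj
      by_contra hc
      have h1 := (hβ.support_subset hc).1
      have h2 : (4 : ℝ) ≤ 2 ^ (j + 1) := by
        calc (4 : ℝ) = 2 ^ 2 := by norm_num
          _ ≤ 2 ^ (j + 1) := pow_le_pow_right₀ (by norm_num) (by omega)
      rw [le_div_iff₀ (by positivity)] at h1
      linarith
  · exact hβ.betaZero_eq_zero r (not_le.1 h)

theorem IsDyadicPartition.exists_abs_dyadicCutoff_le (hβ : IsDyadicPartition β) :
    ∃ D : ℝ, 0 ≤ D ∧ ∀ (j : ℕ) (r : ℝ), |dyadicCutoff β j r| ≤ D := by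
  obtain ⟨D, hD, h⟩ := hβ.exists_abs_le
  refine ⟨1 + D, by positivity, fun j r => ?_⟩
  unfold dyadicCutoff
  split_ifs
  · rw [hβ.betaZero_eq]
    split_ifs
    · refine (abs_sub _ _).trans ?_
      rw [abs_one]
      linarith [h (r / 2)]
    · rw [abs_zero]; positivity
  · linarith [h (r / 2 ^ j)]

/-- A form of `r ~ 2^j` that also covers `j = 0`, where `r` may vanish. -/
theorem IsDyadicPartition.of_dyadicCutoff_ne_zero (hβ : IsDyadicPartition β) {j : ℕ} {r : ℝ}
    (hr : 0 ≤ r) (h : dyadicCutoff β j r ≠ 0) : r ≤ 2 * 2 ^ j ∧ 2 ^ j ≤ 4 * (1 + r) := by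
  unfold dyadicCutoff at h
  split_ifs at h with hj
  · have h1 : r ≤ 1 := by
      by_contra hc
      exact h (hβ.betaZero_eq_zero r (not_le.1 hc))
    subst hj
    constructor <;> norm_num <;> linarith
  · have hp : (0 : ℝ) < 2 ^ j := by positivity
    obtain ⟨h1, h2⟩ := hβ.support_subset h
    rw [le_div_iff₀ hp] at h1
    rw [div_le_iff₀ hp] at h2
    constructor <;> linarith

theorem IsDyadicPartition.measurable_dyadicCutoff (hβ : IsDyadicPartition β) (j : ℕ) :
    Measurable (dyadicCutoff β j) := by
  have hm := hβ.smooth.continuous.measurable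
  rcases eq_or_ne j 0 with rfl | hj
  · have : dyadicCutoff β 0 = fun r => if r ≤ 1 then 1 - β (r / 2) else 0 := by
      ext r
      rw [← hβ.betaZero_eq, dyadicCutoff, if_pos rfl]
    rw [this]
    exact Measurable.ite measurableSet_Iic (measurable_const.sub (hm.comp (measurable_id.div_const _)))
      measurable_const
  · have : dyadicCutoff β j = fun r => β (r / 2 ^ j) := by
      ext r
      rw [dyadicCutoff, if_neg hj]
    rw [this]
    exact hm.comp (measurable_id.div_const _)

/-- Regularity of the symbol is known on `(0, ∞)` only, but a single value at the origin cannot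
spoil measurability. -/
theorem IsSymbol.measurable_comp_norm (ha : IsSymbol a) : Measurable fun x : Plane => a ‖x‖ := by
  have h : Measurable ((Ioi (0 : ℝ)).piecewise a fun _ => a 0) :=
    ContinuousOn.measurable_piecewise ha.1.continuousOn continuousOn_const measurableSet_Ioi
  have e : (fun x : Plane => a ‖x‖) = fun x => (Ioi (0 : ℝ)).piecewise a (fun _ => a 0) ‖x‖ := by
    ext x
    rcases eq_or_ne x 0 with rfl | hx
    · simp
    · simp [hx]
  rw [e]
  exact h.comp measurable_norm

theorem measurable_geometricPiece (σ δ : ℝ) (ha : IsSymbol a) (hβ : IsDyadicPartition β) (j : ℕ) :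
    Measurable (uncurry (geometricPiece σ δ a β j)) := by
  have hm : Measurable fun z : Plane × Plane => z.1 - z.2 := measurable_fst.sub measurable_snd
  have ht : MeasurableSet {z : Plane × Plane | |polarAngle z.1 - polarAngle z.2| ∈ Icc 0 Real.pi} := by
    have hc : Measurable fun z : Plane × Plane => (toComplex z.1, toComplex z.2) :=
      ((toComplex.continuous.measurable.comp measurable_fst).prodMk
        (toComplex.continuous.measurable.comp measurable_snd))
    convert hc measurableSet_trunc using 1
    ext z
    have := trunc_smul one_pos z.1 z.2
    rw [one_smul, one_smul] at this
    exact this.symm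
  unfold geometricPiece geometricKernel uncurry
  refine (Complex.measurable_ofReal.comp ((hβ.measurable_dyadicCutoff j).comp hm.norm)).mul
    (((Measurable.mul ?_ ?_).mul (ha.measurable_comp_norm.comp hm)).mul ?_)
  · exact Continuous.measurable (by fun_prop)
  · exact Complex.measurable_ofReal.comp ((measurable_const.add hm.norm).pow_const _)
  · exact measurable_const.indicator ht

theorem measurableSet_norm_sub_le (R : ℝ) :
    MeasurableSet {z : Plane × Plane | ‖z.1 - z.2‖ ≤ R} :=
  measurableSet_le (measurable_fst.sub measurable_snd).norm measurable_const

theorem volume_plane_closedBall (x : Plane) {R : ℝ} (hR : 0 ≤ R) :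
    volume (Metric.closedBall x R) = ENNReal.ofReal (R ^ 2) * volume (Metric.ball (0 : Plane) 1) := by
  rw [Measure.addHaar_closedBall volume x hR, finrank_euclideanSpace_fin]

/-- The size and the support of the pieces. -/
theorem exists_norm_geometricPiece_le (hδ : 0 ≤ δ) (ha : IsSymbol a) (hβ : IsDyadicPartition β) :
    ∃ C : ℝ, 0 ≤ C ∧ ∀ σ j x y, ‖geometricPiece σ δ a β j x y‖ ≤ C * ((2 : ℝ) ^ j) ^ (-(3 / 2) - δ) ∧
      (geometricPiece σ δ a β j x y ≠ 0 → ‖x - y‖ ≤ 2 * 2 ^ j) := by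
  obtain ⟨D, hD, hDb⟩ := hβ.exists_abs_dyadicCutoff_le
  obtain ⟨A, hA, hAb⟩ := ha.exists_norm_deriv_le
  refine ⟨D * (((1 / 4 : ℝ) ^ (-(3 / 2) - δ)) * (A + ‖a 0‖)), by positivity, fun σ j x y => ?_⟩
  by_cases h0 : dyadicCutoff β j ‖x - y‖ = 0
  · have : geometricPiece σ δ a β j x y = 0 := by rw [geometricPiece, h0]; simp
    rw [this, norm_zero]
    exact ⟨by positivity, fun h => absurd rfl h⟩
  obtain ⟨h1, h2⟩ := hβ.of_dyadicCutoff_ne_zero (norm_nonneg _) h0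
  refine ⟨?_, fun _ => h1⟩
  set r := ‖x - y‖ with hr
  have hr0 : 0 ≤ r := norm_nonneg _
  -- The symbol bounds say nothing at `r = 0`, hence the extra `‖a 0‖`.
  have ha' : ‖a r‖ ≤ A + ‖a 0‖ := by
    rcases hr0.eq_or_lt with h | h
    · rw [← h]; linarith
    · linarith [(hAb r h).1, norm_nonneg (a 0)]
  have hw : (1 + r) ^ (-(3 / 2) - δ) ≤ (1 / 4 : ℝ) ^ (-(3 / 2) - δ) * ((2 : ℝ) ^ j) ^ (-(3 / 2) - δ) := by
    rw [← Real.mul_rpow (by norm_num) (by positivity)]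
    exact Real.rpow_le_rpow_of_nonpos (by positivity) (by linarith) (by linarith)
  have he : ‖Complex.exp (σ * Complex.I * r)‖ = 1 := by
    rw [show (σ * Complex.I * r : ℂ) = ((σ * r : ℝ) : ℂ) * Complex.I by push_cast; ring,
      Complex.norm_exp_ofReal_mul_I]
  have hi : ‖(Icc 0 Real.pi).indicator (fun _ => (1 : ℂ)) |polarAngle x - polarAngle y|‖ ≤ 1 := by
    refine (norm_indicator_le_norm_self _ _).trans ?_
    simp
  unfold geometricPiece geometricKernel
  rw [← hr, norm_mul, norm_mul, norm_mul, norm_mul, he, one_mul, Complex.norm_real, Complex.norm_real,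
    Real.norm_of_nonneg (by positivity : 0 ≤ (1 + r) ^ (-(3 / 2) - δ)), Real.norm_eq_abs]
  calc |dyadicCutoff β j r| * ((1 + r) ^ (-(3 / 2) - δ) * ‖a r‖ *
        ‖(Icc 0 Real.pi).indicator (fun _ => (1 : ℂ)) |polarAngle x - polarAngle y|‖)
      ≤ D * (((1 / 4 : ℝ) ^ (-(3 / 2) - δ) * ((2 : ℝ) ^ j) ^ (-(3 / 2) - δ)) * (A + ‖a 0‖) * 1) := by
        gcongr
        exact hDb j r
    _ = _ := by ring

theorem adm_geometricPiece (σ : ℝ) (hδ : 0 ≤ δ) (ha : IsSymbol a) (hβ : IsDyadicPartition β) (j : ℕ) :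
    Adm (geometricPiece σ δ a β j) := by
  obtain ⟨C, -, hC⟩ := exists_norm_geometricPiece_le hδ ha hβ
  refine ⟨measurable_geometricPiece σ δ ha hβ j, ⟨_, fun x y => (hC σ j x y).1⟩, fun x => ?_⟩
  refine (measure_mono (t := Metric.closedBall x (2 * 2 ^ j)) fun y hy => ?_).trans_lt
    measure_closedBall_lt_top
  rw [mem_closedBall_iff_norm, norm_sub_rev]
  exact (hC σ j x y).2 hy

/-- Schur's test for the pieces. -/
theorem exists_kerBound_geometricPiece_schur (hδ : 0 ≤ δ) (ha : IsSymbol a)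
    (hβ : IsDyadicPartition β) : ∃ C : ℝ≥0, ∀ σ j, ∀ q : ℝ≥0∞, 1 ≤ q →
      KerBound (geometricPiece σ δ a β j) q q
        (C * ENNReal.ofReal (((2 : ℝ) ^ j) ^ (1 / 2 - δ))) := by
  obtain ⟨C, hC0, hC⟩ := exists_norm_geometricPiece_le hδ ha hβ
  set V := volume (Metric.ball (0 : Plane) 1) with hV
  have hVt : V ≠ ⊤ := measure_ball_lt_top.ne
  refine ⟨(4 * C).toNNReal * V.toNNReal, fun σ j q hq => ?_⟩
  have hb := KerBound.of_bounded (k := geometricPiece σ δ a β j)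
    (M := ENNReal.ofReal (C * ((2 : ℝ) ^ j) ^ (-(3 / 2) - δ)))
    (A := ENNReal.ofReal ((2 * 2 ^ j) ^ 2) * V) (S := fun x y => ‖x - y‖ ≤ 2 * 2 ^ j)
    (measurableSet_norm_sub_le _) (fun x y => ?_) (fun x y => (hC σ j x y).2) (fun x => ?_)
    (fun y => ?_) hq (by finiteness) (by finiteness)
  · refine hb.mono (le_of_eq ?_)
    -- The size of the kernel times the area of its sections, of order `2^(2j)`.
    have e : ((2 : ℝ) ^ j) ^ (1 / 2 - δ) = ((2 : ℝ) ^ j) ^ (-(3 / 2) - δ) * (2 ^ j) ^ 2 := by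
      rw [← Real.rpow_natCast ((2 : ℝ) ^ j) 2, ← Real.rpow_add (by positivity)]
      congr 1
      push_cast
      ring
    push_cast
    rw [ENNReal.coe_toNNReal hVt, ← mul_assoc, ← ENNReal.ofReal_mul (by positivity)]
    change _ = ENNReal.ofReal (4 * C) * V * _
    rw [mul_right_comm (ENNReal.ofReal (4 * C)), ← ENNReal.ofReal_mul (by positivity), e]
    congr 2
    ring
  · rw [← ofReal_norm]
    exact ENNReal.ofReal_le_ofReal (hC σ j x y).1
  · rw [← volume_plane_closedBall x (by positivity)]
    refine measure_mono fun y hy => ?_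
    rw [mem_closedBall_iff_norm, norm_sub_rev]
    exact hy
  · rw [← volume_plane_closedBall y (by positivity)]
    exact measure_mono fun x hx => mem_closedBall_iff_norm.2 hx

theorem Amplitude.adm_ampKer {A : ℝ} {b : ℝ → ℂ} (hb : Amplitude A b) (μ : ℝ) : Adm (ampKer b μ) := by
  have hn : Measurable fun z : ℂ × ℂ => ‖z.1 - z.2‖ := (measurable_fst.sub measurable_snd).norm
  refine ⟨(hb.continuous.measurable.comp hn).mul
    (measurable_cut measurableSet_trunc (continuous_osc μ).measurable), ⟨A * 1, fun x y => ?_⟩,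
    fun x => ?_⟩
  · rw [ampKer, norm_mul]
    exact mul_le_mul (hb.norm_le _) ((norm_cut_le _ _ _ _).trans (norm_osc μ x y).le) (norm_nonneg _)
      ((norm_nonneg _).trans (hb.norm_le 0))
  · refine (measure_mono (t := Metric.closedBall x 2) fun y hy => ?_).trans_lt
      measure_closedBall_lt_top
    rw [mem_closedBall_iff_norm, norm_sub_rev]
    linarith [(hb.support (left_ne_zero_of_mul hy)).2]

/-- Frequency decay at unit scale gives bounds for the pieces at all scales. -/
theorem exists_kerBound_geometricPiece {σ : ℝ} (hσ : σ = 1 ∨ σ = -1) (hδ : 0 ≤ δ) (ha : IsSymbol a)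
    (hβ : IsDyadicPartition β) {q : ℝ≥0∞} (hq : 1 ≤ q) (hqt : q ≠ ⊤) {s : ℝ} (hs : 0 ≤ s)
    (hs2 : s ≤ 1 / 2)
    (h : ∃ C : ℝ≥0, ∀ μ : ℝ, KerBound (gridKer μ) q q (C * ENNReal.ofReal ((1 + |μ|) ^ (-s)))) :
    ∃ C : ℝ≥0, ∀ j, KerBound (geometricPiece σ δ a β j) q q
      (C * ENNReal.ofReal (((2 : ℝ) ^ j) ^ (1 / 2 - δ - s))) := by
  obtain ⟨C₀, hC₀⟩ := exists_kerBound_geometricPiece_schur hδ ha hβ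
  obtain ⟨C₁, hC₁⟩ := h
  obtain ⟨A, hA⟩ := exists_amplitude_scaledAmp ha hβ.smooth hβ.support_subset
    (t := -(3 / 2) - δ) (by linarith)
  obtain ⟨C, hC⟩ := exists_kerBound_ampKer hq hqt hs hs2 hC₁ A
  refine ⟨C₀ + C, fun j => ?_⟩
  -- At `j = 0` there is nothing to gain and Schur's test suffices.
  rcases eq_or_ne j 0 with rfl | hj
  · refine (hC₀ σ 0 q hq).mono ?_
    simp only [pow_zero, Real.one_rpow, ENNReal.ofReal_one, mul_one]
    exact_mod_cast le_self_add
  have hl1 : (1 : ℝ) ≤ 2 ^ j := one_le_pow₀ (by norm_num)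
  have hk := geometricPiece_eq σ δ a β hj
  set l : ℝ := 2 ^ j with hl
  have hl0 : 0 < l := by positivity
  have hb := hA l hl1
  have h1 := ((((hC _ hb (σ * l)).comp (hb.adm_ampKer _) toComplex.measurePreserving
    toComplex.toHomeomorph.toMeasurableEquiv toComplex.measurePreserving).dilate hl0).const_mul
    ((l ^ (-(3 / 2) - δ) : ℝ) : ℂ))
  refine (h1.congr fun x => Filter.Eventually.of_forall fun y => (hk x y).symm).mono ?_
  have hσl : |σ * l| = l := by
    rcases hσ with rfl | rfl <;> simp [abs_of_pos hl0]
  have hdec : (1 + |σ * l|) ^ (-s) ≤ l ^ (-s) := by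
    rw [hσl]
    exact Real.rpow_le_rpow_of_nonpos hl0 (by linarith) (by linarith)
  -- The three factors are the prefactor of the kernel, the Jacobian of the dilation and the decay
  -- at frequency `|σ l| = l`.
  have e : l ^ (1 / 2 - δ - s) = l ^ (-(3 / 2) - δ) * (l ^ 2 * l ^ (-s)) := by
    rw [← Real.rpow_natCast l 2, ← Real.rpow_add hl0, ← Real.rpow_add hl0]
    congr 1
    push_cast
    ring
  rw [← ofReal_norm, Complex.norm_real, Real.norm_of_nonneg (by positivity), e,
    ENNReal.ofReal_mul (by positivity), ENNReal.ofReal_mul (p := l ^ 2) (by positivity)]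
  calc _ ≤ ENNReal.ofReal (l ^ (-(3 / 2) - δ)) * (ENNReal.ofReal (l ^ 2) *
        (((C₀ + C : ℝ≥0) : ℝ≥0∞) * ENNReal.ofReal (l ^ (-s)))) := by
        gcongr
        exact le_add_self
    _ = _ := by ring

theorem operatorNormLE_of_kerBound {K : Plane → Plane → ℂ} (hK : Adm K) {q : ℝ≥0∞} (hq : 1 ≤ q)
    {B : ℝ≥0∞} (hB : B ≠ ⊤) (h : KerBound K q q B) : OperatorNormLE K q B := fun f hf =>
  ⟨fun x => hK.integrable hq hf x,
    ⟨hK.aestronglyMeasurable hf.1, (h f hf).trans_lt (ENNReal.mul_lt_top hB.lt_top hf.2)⟩, h f hf⟩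

/-- Since `1/p ≤ 1/4`, the second entry of the maximum is nonnegative. -/
theorem criticalIndex_eq {p : ℝ≥0∞} (hp : 4 < p) :
    criticalIndex p 2 = 1 / 2 - 2 * (p⁻¹).toReal := by
  have h : (p⁻¹).toReal ≤ 1 / 4 := by
    have h4 : p⁻¹ ≤ (4 : ℝ≥0∞)⁻¹ := ENNReal.inv_le_inv.2 hp.le
    have := ENNReal.toReal_mono (by simp) h4
    simpa using this
  have h0 : 0 ≤ (p⁻¹).toReal := ENNReal.toReal_nonneg
  rw [criticalIndex, one_div 2, abs_of_nonneg (by linarith), max_eq_right] <;> push_cast <;> linarith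

theorem two_pow_rpow (j : ℕ) (u : ℝ) : ((2 : ℝ) ^ j) ^ u = (2 : ℝ) ^ ((j : ℝ) * u) := by
  rw [← Real.rpow_natCast, ← Real.rpow_mul (by norm_num)]

/-- For finite `p` the decay exponent `2/p` turns `1/2 - δ` into the critical exponent. At `p = ∞`
the critical index is `1/2`, and Schur's test already gives the bound. -/
theorem exists_kerBound_geometricPiece_criticalIndex {σ : ℝ} (hσ : σ = 1 ∨ σ = -1) (hδ : 0 ≤ δ)
    (ha : IsSymbol a) (hβ : IsDyadicPartition β) {p : ℝ≥0∞} (hp : 4 < p) :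
    ∃ C : ℝ≥0, ∀ j : ℕ, KerBound (geometricPiece σ δ a β j) p p
      (C * ENNReal.ofReal ((2 : ℝ) ^ ((j : ℝ) * (criticalIndex p 2 - δ)))) := by
  have hp1 : 1 ≤ p := le_trans (by norm_num) hp.le
  simp only [← two_pow_rpow, criticalIndex_eq hp]
  rcases eq_or_ne p ⊤ with rfl | hpt
  · obtain ⟨C, hC⟩ := exists_kerBound_geometricPiece_schur hδ ha hβ
    refine ⟨C, fun j => ?_⟩
    simpa using hC σ j ⊤ hp1
  · have h4 : (4 : ℝ) ≤ p.toReal := by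
      have := ENNReal.toReal_mono hpt hp.le
      simpa using this
    obtain ⟨C, hC⟩ := exists_kerBound_geometricPiece hσ hδ ha hβ hp1 hpt (s := 2 / p.toReal)
      (by positivity) (by rw [div_le_iff₀ (by linarith)]; linarith) (exists_kerBound_gridKer hp hpt)
    refine ⟨C, fun j => ?_⟩
    have e : 1 / 2 - 2 * (p⁻¹).toReal - δ = 1 / 2 - δ - 2 / p.toReal := by
      rw [ENNReal.toReal_inv]
      ring
    rw [e]
    exact hC j

end Plane

end BochnerRiesz

end

theorem proposition3p1
    (δ : ℝ) (hδ : 0 ≤ δ) (p : ℝ≥0∞) (hp : 4 < p)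
    (σ : ℝ) (hσ : σ = 1 ∨ σ = -1)
    (a : ℝ → ℂ) (ha : BochnerRiesz.IsSymbol a)
    (β : ℝ → ℝ) (hβ : BochnerRiesz.IsDyadicPartition β) :
    ∃ C : ℝ≥0, ∀ j : ℕ,
      BochnerRiesz.OperatorNormLE (BochnerRiesz.geometricPiece σ δ a β j) p
        (C * ENNReal.ofReal ((2 : ℝ) ^ ((j : ℝ) * (BochnerRiesz.criticalIndex p 2 - δ)))) ∧
      BochnerRiesz.OperatorNormLE (BochnerRiesz.geometricPiece σ δ a β j) 2
        (C * ENNReal.ofReal ((2 : ℝ) ^ (-((j : ℝ) * δ)))) := by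
  have h2 : ∃ C : ℝ≥0, ∀ j : ℕ, BochnerRiesz.KerBound (BochnerRiesz.geometricPiece σ δ a β j) 2 2
      (C * ENNReal.ofReal ((2 : ℝ) ^ (-((j : ℝ) * δ)))) := by
    -- On `L²` the frequency decay of order `1/2` removes the whole loss `2^(j/2)` of Schur's test.
    obtain ⟨C, hC⟩ := BochnerRiesz.exists_kerBound_geometricPiece hσ hδ ha hβ one_le_two
      ENNReal.ofNat_ne_top (s := 1 / 2) (by norm_num) le_rfl BochnerRiesz.exists_kerBound_gridKer_two
    refine ⟨C, fun j => ?_⟩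
    have e : (2 : ℝ) ^ (-((j : ℝ) * δ)) = ((2 : ℝ) ^ j) ^ (1 / 2 - δ - 1 / 2) := by
      rw [BochnerRiesz.two_pow_rpow]
      ring_nf
    rw [e]
    exact hC j
  obtain ⟨C₁, h₁⟩ := BochnerRiesz.exists_kerBound_geometricPiece_criticalIndex hσ hδ ha hβ hp
  obtain ⟨C₂, h₂⟩ := h2
  refine ⟨C₁ + C₂, fun j => ⟨?_, ?_⟩⟩
  · refine BochnerRiesz.operatorNormLE_of_kerBound (BochnerRiesz.adm_geometricPiece σ hδ ha hβ j)
      (le_trans (by norm_num) hp.le) (by finiteness) ((h₁ j).mono ?_)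
    gcongr
    exact le_self_add
  · refine BochnerRiesz.operatorNormLE_of_kerBound (BochnerRiesz.adm_geometricPiece σ hδ ha hβ j)
      one_le_two (by finiteness) ((h₂ j).mono ?_)
    gcongr
    exact le_add_self
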